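/- Let $K=U_2$, $G=U_2\ltimes\mathbb C^2$ with product $(k,z)(k',z')=(kk',z+kz')$, and let $\mathbb D(G)^{\mathrm{Int}(K)}$ be the algebra of left-invariant differential operators on $G$ that commute with conjugation by elements of $K$. A *bounded spherical function* is a bounded smooth $\varphi:G\to\mathbb C$ which is $K$-central ($\varphi(hgh^{-1})=\varphi(g)$ for $h\in K$), is an eigenfunction of every operator in $\mathbb D(G)^{\mathrm{Int}(K)}$, and satisfies $\varphi(e)=1$. Let $$X_1=\begin{pmatrix} i&0\\0&-i\end{pmatrix},\quad X_2=\begin{pmatrix}0&1\\-1&0\end{pmatrix},\quad X_3=\begin{pmatrix}0&i\\i&0\end{pmatrix},\quad X_4=iI,\qquad \Delta_{z_j}=-4\,\partial_{z_j}\partial_{\bar z_j},$$ and consider the operators on $G$ (all fields being left-invariant) $$D_1=\Delta_z=\Delta_{z_1}+\Delta_{z_2},\qquad D_3=-X_1^2-X_2^2-X_3^2,\qquad D_4=iX_4,$$ $$D_2=i(\Delta_{z_2}-\Delta_{z_1})X_1-4(\partial_{\bar z_1}\partial_{z_2}-\partial_{z_1}\partial_{\bar z_2})X_2+4i(\partial_{z_1}\partial_{\bar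 z_2}+\partial_{\bar z_1}\partial_{z_2})X_3 .$$ Let $\Sigma_{\mathcal D}\subset\mathbb C^4$ be the set of quadruples of eigenvalues with respect to $(D_1,D_2,D_3,D_4)$ of the bounded spherical functions. Let $n\ge 0$ and $m\in n+2\mathbb Z$, and put $\Sigma^n_{\mathcal D}=\{(\xi_1,\xi_2):(\xi_1,\xi_2,n^2+2n,m)\in\Sigma_{\mathcal D}\}$. Let $V_n$ be the space of homogeneous polynomials of degree $n$ on $\mathbb C^2$, with $[\tau_n(k)p](z)=p(k^{-1}z)$ and $\tau_{m,n}(k)=(\det k)^{(n-m)/2}\tau_n(k)$ for $k\in U_2$, and identify $\mathrm{End}(V_n)$ with matrices by means of the basis $e_n^j=\binom nj^{1/2}z_1^jz_2^{n-j}$, $j=0,\dots,n$. A *bounded $\mathrm{End}(V_n)$-valued spherical function* is a function $\Phi(z)=(n+1)^2\int_K\varphi(k,z)\,\tau_{m,n}(k)\,dk$ on $\mathbb C^2$, where $dk$ is the normalized Haar measure and $\varphi$ is a bounded spherical function of $K$-type $\tau_{m,n}$, i.e. $\varphi(g)=(n+1)\int_K\varphi(gh^{-1})\,\overline{\mathrm{tr}\,\tau_{m,n}(h)}\,dh$.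 Its eigenvalues are taken with respect to $\Delta_z$ and $$\mathbf D_n=i(\Delta_{z_2}-\Delta_{z_1})\otimes d\tau_n(X_1)-4(\partial_{\bar z_1}\partial_{z_2}-\partial_{z_1}\partial_{\bar z_2})\otimes d\tau_n(X_2)+4i(\partial_{z_1}\partial_{\bar z_2}+\partial_{\bar z_1}\partial_{z_2})\otimes d\tau_n(X_3).$$ Let $\langle z,\zeta\rangle=\mathrm{Re}\sum_l z_l\bar\zeta_l$, let $\sigma$ be the normalized surface measure of $S^3\subset\mathbb C^2$, and for $\xi\geq0$ let $\varphi_\xi(z)=\varphi_1(\sqrt\xi z)$ with $\varphi_1(z)=\int_{S^3}e^{-i\langle z,\zeta\rangle}\,d\sigma(\zeta)$. For $B\in\mathrm{End}(V_n)$ and $z\ne0$ put, with $z'=z/|z|$, $$Q^n_B(z)=|z|^{2n}\,\tau_n(k_{z'})\,B\,\tau_n(k_{z'})^*,\qquad k_z=\begin{pmatrix}\bar z_2&z_1\\-\bar z_1&z_2\end{pmatrix}.$$ For a polynomial $P$ in $z,\bar z$, the operator $P(\partial)$ is obtained by replacing $z_l$ by $-2i\partial_{\bar z_l}$ and $\bar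 z_l$ by $-2i\partial_{z_l}$. Let $E_{jj}$ be the matrix with $jj$-entry $1$ and all other entries $0$. **Proposition.** For every $n\ge 0$ and every $m\in n+2\mathbb Z$: 1. $\Sigma^n_{\mathcal D}$ is the union of $n+1$ half-lines, $$\Sigma^n_{\mathcal D}=\big\{\big(\xi,(-n+2j)\xi\big):\xi\ge0,\ j=0,\dots,n\big\},$$ and this is also the set of pairs of eigenvalues, with respect to $\Delta_z$ and $\mathbf D_n$, of the bounded $\mathrm{End}(V_n)$-valued spherical functions. 2. The constant $I$ is a bounded $\mathrm{End}(V_n)$-valued spherical function, with pair of eigenvalues $(0,0)$, and it is the only one whose $\Delta_z$-eigenvalue is $0$. 3. For each $j$, $Q^n_{E_{jj}}$ has a unique continuation to an $\mathrm{End}(V_n)$-valued polynomial in $z,\bar z$. For $\xi>0$ there is exactly one bounded $\mathrm{End}(V_n)$-valued spherical function with pair of eigenvalues $(\xi,(-n+2j)\xi)$, namely $$\Phi_{\xi,j}(z)=(n+1)\int_{S^3}e^{-i\sqrt\xi\langle z,\zeta\rangle}Q^n_{E_{jj}}(\zeta)\,d\sigma(\zeta)=\xi^{-n}(n+1)\,\big(Q^n_{E_{jj}}(\partial)\varphi_\xi\big)(z)=(n+1)\big(Q^n_{E_{jj}}(\partial)\varphi_1\big)(\sqrt\xi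 z).$$ -/

import Mathlib

open MeasureTheory Matrix
open scoped ContDiff ComplexConjugate

noncomputable section

namespace MotionM2

/-! ### The groups `U₂` and `M₂(ℂ) = U₂ ⋉ ℂ²` -/

/-- `ℂ²` with its Hermitian norm. -/
abbrev C2 := EuclideanSpace ℂ (Fin 2)

/-- The compact group `K = U₂`. -/
abbrev U2 := Matrix.unitaryGroup (Fin 2) ℂ

instance : MeasurableSpace U2 := borel U2

instance : BorelSpace U2 := ⟨rfl⟩

instance : CompactSpace U2 := by
  suffices h : IsCompact (Matrix.unitaryGroup (Fin 2) ℂ : Set (Matrix (Fin 2) (Fin 2) ℂ)) from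
    isCompact_iff_compactSpace.1 h
  have hK : IsCompact (Set.univ.pi fun _ : Fin 2 => Set.univ.pi fun _ : Fin 2 =>
      Metric.closedBall (0 : ℂ) 1) :=
    isCompact_univ_pi fun _ => isCompact_univ_pi fun _ => isCompact_closedBall _ _
  refine hK.of_isClosed_subset ?_ ?_
  · have : ((Matrix.unitaryGroup (Fin 2) ℂ : Set (Matrix (Fin 2) (Fin 2) ℂ))) =
        {A | A * star A = 1} := by
      ext A
      exact Matrix.mem_unitaryGroup_iff
    rw [this]
    exact isClosed_eq (by fun_prop) continuous_const
  · intro A hA i _ j _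
    simpa using entry_norm_bound_of_unitary hA i j

/-- Normalized Haar measure on `U₂`. -/
def haarU2 : Measure U2 := Measure.haarMeasure ⊤

/-- The natural action of a `2 × 2` matrix on `ℂ²`. -/
def act (k : Matrix (Fin 2) (Fin 2) ℂ) (z : C2) : C2 := WithLp.toLp 2 (k *ᵥ z.ofLp)

lemma act_one (z : C2) : act 1 z = z := by simp [act]

lemma act_mul (k k' : Matrix (Fin 2) (Fin 2) ℂ) (z : C2) :
    act (k * k') z = act k (act k' z) := by
  simp only [act, Matrix.mulVec_mulVec]

lemma act_add (k : Matrix (Fin 2) (Fin 2) ℂ) (z w : C2) :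
    act k (z + w) = act k z + act k w := by
  simp only [act, WithLp.ofLp_add, Matrix.mulVec_add, WithLp.toLp_add]

lemma act_neg (k : Matrix (Fin 2) (Fin 2) ℂ) (z : C2) : act k (-z) = -act k z := by
  simp only [act, WithLp.ofLp_neg, Matrix.mulVec_neg, WithLp.toLp_neg]

/-- The complex motion group `G = M₂(ℂ) = U₂ ⋉ ℂ²`. -/
@[ext]
structure G where
  k : U2
  z : C2

/-- `(k, z) (k', z') = (k k', z + k z')`. -/
instance : Mul G := ⟨fun g h => ⟨g.k * h.k, g.z + act g.k h.z⟩⟩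

instance : One G := ⟨⟨1, 0⟩⟩

instance : Inv G := ⟨fun g => ⟨g.k⁻¹, -act (g.k⁻¹ : U2) g.z⟩⟩

@[simp] lemma mul_k (g h : G) : (g * h).k = g.k * h.k := rfl
@[simp] lemma mul_z (g h : G) : (g * h).z = g.z + act g.k h.z := rfl
@[simp] lemma one_k : (1 : G).k = 1 := rfl
@[simp] lemma one_z : (1 : G).z = 0 := rfl
@[simp] lemma inv_k (g : G) : (g⁻¹).k = g.k⁻¹ := rfl
@[simp] lemma inv_z (g : G) : (g⁻¹).z = -act (g.k⁻¹ : U2) g.z := rfl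

instance : Group G :=
  Group.ofLeftAxioms
    (fun a b c => by
      ext1
      · simp [mul_assoc]
      · simp [act_add, act_mul, add_assoc])
    (fun a => by
      ext1
      · simp
      · simp [act_one])
    (fun a => by
      ext1
      · simp
      · simp)

/-- The embedding of `K` in `G`. -/
def ofK (k : U2) : G := ⟨k, 0⟩

/-- The embedding of `ℂ²` in `G`. -/
def ofC (w : C2) : G := ⟨1, w⟩

/-- The basis `X₁, X₂, X₃, X₄` (indexed by `0, 1, 2, 3`) of the Lie algebra `𝔲₂`;
the first three matrices are a basis of `𝔰𝔲₂`. -/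
def basisU : Fin 4 → Matrix (Fin 2) (Fin 2) ℂ :=
  ![!![Complex.I, 0; 0, -Complex.I], !![0, 1; -1, 0], !![0, Complex.I; Complex.I, 0],
    !![Complex.I, 0; 0, Complex.I]]

/-- The element of `𝔲₂` with coordinates `x`. -/
def lieU (x : Fin 4 → ℝ) : Matrix (Fin 2) (Fin 2) ℂ := ∑ l, ((x l : ℝ) : ℂ) • basisU l

lemma star_lieU (x : Fin 4 → ℝ) : (lieU x)ᴴ = -lieU x := by
  ext i j
  fin_cases i <;> fin_cases j <;>
    simp [lieU, basisU, Fin.sum_univ_four, Matrix.conjTranspose_apply] <;> ring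

lemma exp_lieU_mem (x : Fin 4 → ℝ) :
    NormedSpace.exp (lieU x) ∈ Matrix.unitaryGroup (Fin 2) ℂ := by
  rw [Matrix.mem_unitaryGroup_iff, Matrix.star_eq_conjTranspose, ← Matrix.exp_conjTranspose,
    star_lieU, ← Matrix.exp_add_of_commute _ _ (Commute.refl (lieU x)).neg_right]
  simp [NormedSpace.exp_zero]

/-- The exponential map of `U₂` in the coordinates `x`. -/
def expU (x : Fin 4 → ℝ) : U2 := ⟨NormedSpace.exp (lieU x), exp_lieU_mem x⟩

/-! ### Left-invariant differential operators on `G` -/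

/-- `f` is of class `C^∞` on `G`, tested in the charts
`(x, w) ↦ g (exp x, w)` of `G` (local diffeomorphisms at `0`). -/
def IsSmooth (f : G → ℂ) : Prop :=
  ∀ g : G, ContDiff ℝ ∞ fun p : (Fin 4 → ℝ) × C2 => f (g * ⟨expU p.1, p.2⟩)

/-- The left-invariant vector field of the element of `𝔲₂` with coordinates `x`. -/
def fieldU (x : Fin 4 → ℝ) (f : G → ℂ) : G → ℂ :=
  fun g => deriv (fun t : ℝ => f (g * ofK (expU (t • x)))) 0

/-- The left-invariant vector field of the element `v` of the Lie algebra `ℂ²`. -/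
def fieldC (v : C2) (f : G → ℂ) : G → ℂ :=
  fun g => deriv (fun t : ℝ => f (g * ofC (t • v))) 0

/-- The algebra `𝔻(G)` generated by the left-invariant vector fields. -/
inductive IsLeftInvDiffOp : ((G → ℂ) → (G → ℂ)) → Prop
  | one : IsLeftInvDiffOp (fun f => f)
  | smul (c : ℂ) {D : (G → ℂ) → (G → ℂ)} :
      IsLeftInvDiffOp D → IsLeftInvDiffOp (fun f => c • D f)
  | add {D D' : (G → ℂ) → (G → ℂ)} :
      IsLeftInvDiffOp D → IsLeftInvDiffOp D' → IsLeftInvDiffOp (fun f => D f + D' f)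
  | compU (x : Fin 4 → ℝ) {D : (G → ℂ) → (G → ℂ)} :
      IsLeftInvDiffOp D → IsLeftInvDiffOp (fun f => D (fieldU x f))
  | compC (v : C2) {D : (G → ℂ) → (G → ℂ)} :
      IsLeftInvDiffOp D → IsLeftInvDiffOp (fun f => D (fieldC v f))

/-- Invariance of an operator under the conjugations by the elements of `K`. -/
def IsIntKInvariant (D : (G → ℂ) → (G → ℂ)) : Prop :=
  ∀ f, IsSmooth f → ∀ (h : U2) (g : G),
    D (fun x => f (ofK h * x * (ofK h)⁻¹)) g = D f (ofK h * g * (ofK h)⁻¹)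

/-- The left-invariant field `X_l` for the `l`-th basis element. -/
def X (l : Fin 4) : (G → ℂ) → (G → ℂ) := fieldU (Pi.single l 1)

/-- The left-invariant version of `∂/∂z_j` on `G`. -/
def Zd (j : Fin 2) (f : G → ℂ) : G → ℂ :=
  (1 / 2 : ℂ) • (fieldC (EuclideanSpace.single j 1) f
    - Complex.I • fieldC (EuclideanSpace.single j Complex.I) f)

/-- The left-invariant version of `∂/∂z̄_j` on `G`. -/
def Zb (j : Fin 2) (f : G → ℂ) : G → ℂ :=
  (1 / 2 : ℂ) • (fieldC (EuclideanSpace.single j 1) f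
    + Complex.I • fieldC (EuclideanSpace.single j Complex.I) f)

/-- `Δ_{z_j} = -4 ∂_{z_j} ∂_{z̄_j}` on `G`. -/
def lapG (j : Fin 2) (f : G → ℂ) : G → ℂ := (-4 : ℂ) • Zd j (Zb j f)

/-- `D₁ = Δ_z`. -/
def D1 (f : G → ℂ) : G → ℂ := lapG 0 f + lapG 1 f

/-- `D₂ = i(Δ_{z₂} - Δ_{z₁})X₁ - 4(∂_{z̄₁}∂_{z₂} - ∂_{z₁}∂_{z̄₂})X₂
+ 4i(∂_{z₁}∂_{z̄₂} + ∂_{z̄₁}∂_{z₂})X₃`. -/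
def D2 (f : G → ℂ) : G → ℂ :=
  Complex.I • (lapG 1 (X 0 f) - lapG 0 (X 0 f))
    - (4 : ℂ) • (Zb 0 (Zd 1 (X 1 f)) - Zd 0 (Zb 1 (X 1 f)))
    + (4 * Complex.I) • (Zd 0 (Zb 1 (X 2 f)) + Zb 0 (Zd 1 (X 2 f)))

/-- `D₃ = -X₁² - X₂² - X₃²`, the Casimir operator of `SU₂`. -/
def D3 (f : G → ℂ) : G → ℂ := -X 0 (X 0 f) - X 1 (X 1 f) - X 2 (X 2 f)

/-- `D₄ = i X₄`. -/
def D4 (f : G → ℂ) : G → ℂ := Complex.I • X 3 f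

/-! ### Spherical functions of the strong Gelfand pair `(G, K)` and the embedded spectrum -/

/-- `φ` is a spherical function of the strong Gelfand pair `(G, K)`: a smooth `K`-central
joint eigenfunction of all operators in `𝔻(G)^{Int K}`, with value `1` at the identity. -/
structure IsSpherical (φ : G → ℂ) : Prop where
  smooth : IsSmooth φ
  central : ∀ (h : U2) (g : G), φ (ofK h * g * (ofK h)⁻¹) = φ g
  eigen : ∀ D, IsLeftInvDiffOp D → IsIntKInvariant D → ∃ c : ℂ, D φ = c • φ
  map_one : φ 1 = 1

/-- `φ` is a bounded spherical function, i.e. a point of the Gelfand spectrum `Σ`. -/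
def IsBoundedSpherical (φ : G → ℂ) : Prop :=
  IsSpherical φ ∧ ∃ C : ℝ, ∀ g, ‖φ g‖ ≤ C

/-- The embedded spectrum `Σ_𝒟` for `𝒟 = {D₁, D₂, D₃, D₄}`. -/
def embeddedSpectrum : Set (ℂ × ℂ × ℂ × ℂ) :=
  {ξ | ∃ φ, IsBoundedSpherical φ ∧ D1 φ = ξ.1 • φ ∧ D2 φ = ξ.2.1 • φ ∧
    D3 φ = ξ.2.2.1 • φ ∧ D4 φ = ξ.2.2.2 • φ}

/-- The section `{(ξ₁, ξ₂) : (ξ₁, ξ₂, n² + 2n, m) ∈ Σ_𝒟}`, which is `Σ^n_𝒟` for each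
`m ∈ n + 2ℤ`. -/
def spectrumSection (m : ℤ) (n : ℕ) : Set (ℂ × ℂ) :=
  {ξ | (ξ.1, ξ.2, (n : ℂ) ^ 2 + 2 * n, (m : ℂ)) ∈ embeddedSpectrum}

/-- The union of the `n + 1` half-lines `{(ξ, (-n + 2j)ξ) : ξ ≥ 0}`. -/
def halfLines (n : ℕ) : Set (ℂ × ℂ) :=
  {p | ∃ (ξ : ℝ) (j : Fin (n + 1)), 0 ≤ ξ ∧
    p = ((ξ : ℂ), (-(n : ℂ) + 2 * ((j : ℕ) : ℂ)) * (ξ : ℂ))}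

/-! ### The representations `τ_n`, `τ_{m,n}` -/

/-- `End(V_n)`, as matrices with respect to the orthonormal basis
`e_n^j = binom(n, j)^{1/2} z₁^j z₂^{n-j}`, `j = 0, …, n`. -/
abbrev EndV (n : ℕ) := Matrix (Fin (n + 1)) (Fin (n + 1)) ℂ

/-- The polynomial `e_n^j(z) = binom(n, j)^{1/2} z₁^j z₂^{n-j}`. -/
def basisV (n : ℕ) (j : Fin (n + 1)) : MvPolynomial (Fin 2) ℂ :=
  MvPolynomial.C ((Real.sqrt (n.choose j) : ℝ) : ℂ) *
    (MvPolynomial.X 0 ^ (j : ℕ) * MvPolynomial.X 1 ^ (n - (j : ℕ)))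

/-- `p ↦ p(k⁻¹ ·)` on polynomials on `ℂ²`. -/
def pullInv (k : Matrix (Fin 2) (Fin 2) ℂ) (p : MvPolynomial (Fin 2) ℂ) :
    MvPolynomial (Fin 2) ℂ :=
  MvPolynomial.aeval (fun a => ∑ b, MvPolynomial.C (k⁻¹ a b) * MvPolynomial.X b) p

/-- The matrix of `[τ_n(k) p](z) = p(k⁻¹ z)` in the basis `e_n^j`: its `(i, j)` entry is the
coordinate of `τ_n(k) e_n^j` along `e_n^i`. -/
def tau (n : ℕ) (k : Matrix (Fin 2) (Fin 2) ℂ) : EndV n :=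
  Matrix.of fun i j =>
    MvPolynomial.coeff (Finsupp.single 0 (i : ℕ) + Finsupp.single 1 (n - (i : ℕ)))
        (pullInv k (basisV n j)) / ((Real.sqrt (n.choose i) : ℝ) : ℂ)

/-- `τ_{m,n}(k) = (det k)^{(n-m)/2} τ_n(k)` for `k ∈ U₂`, where `m ∈ n + 2ℤ`. -/
def tauU (m : ℤ) (n : ℕ) (k : U2) : EndV n :=
  (k : Matrix (Fin 2) (Fin 2) ℂ).det ^ (((n : ℤ) - m) / 2) • tau n k

/-- The differential `dτ_n(Y)`, `Y ∈ 𝔰𝔲₂`. -/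
def dtau (n : ℕ) (Y : Matrix (Fin 2) (Fin 2) ℂ) : EndV n :=
  Matrix.of fun i j => deriv (fun t : ℝ => tau n (NormedSpace.exp ((t : ℂ) • Y)) i j) 0

/-! ### `End(V_n)`-valued spherical functions -/

/-- `f` is of `K`-type `τ_{m,n}`: `f = f *_K (d \overline{χ})`, with `d = n + 1` and `χ` the
dimension and the character of `τ_{m,n}`. -/
def HasKType (m : ℤ) (n : ℕ) (f : G → ℂ) : Prop :=
  ∀ g : G, f g =
    ∫ h : U2, f (g * (ofK h)⁻¹) * (((n : ℂ) + 1) * conj (tauU m n h).trace) ∂haarU2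

/-- `(A_{m,n} f)(z) = ∫_K f(k, z) τ_{m,n}(k) dk`. -/
def A (m : ℤ) (n : ℕ) (f : G → ℂ) (z : C2) : EndV n :=
  Matrix.of fun i j => ∫ k : U2, f ⟨k, z⟩ * tauU m n k i j ∂haarU2

/-- `Φ` is a bounded `End(V_n)`-valued spherical function: `Φ = (n+1)² A_{m,n} φ` for a
bounded spherical function `φ` of `(G, K)` of `K`-type `τ_{m,n}`. -/
def IsBoundedEndSpherical (m : ℤ) (n : ℕ) (Φ : C2 → EndV n) : Prop :=
  ∃ φ, IsBoundedSpherical φ ∧ HasKType m n φ ∧ ∀ z, Φ z = ((n : ℂ) + 1) ^ 2 • A m n φ z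

/-- `∂/∂z_j` on functions on `ℂ²`. -/
def dz (j : Fin 2) (f : C2 → ℂ) (z : C2) : ℂ :=
  (1 / 2 : ℂ) * (lineDeriv ℝ f z (EuclideanSpace.single j 1)
    - Complex.I * lineDeriv ℝ f z (EuclideanSpace.single j Complex.I))

/-- `∂/∂z̄_j` on functions on `ℂ²`. -/
def dzb (j : Fin 2) (f : C2 → ℂ) (z : C2) : ℂ :=
  (1 / 2 : ℂ) * (lineDeriv ℝ f z (EuclideanSpace.single j 1)
    + Complex.I * lineDeriv ℝ f z (EuclideanSpace.single j Complex.I))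

/-- A scalar operator acting on matrix-valued functions entry by entry. -/
def entrywise {n : ℕ} (T : (C2 → ℂ) → C2 → ℂ) (F : C2 → EndV n) (z : C2) : EndV n :=
  Matrix.of fun a b => T (fun w => F w a b) z

/-- `Δ_{z_j} = -4 ∂_{z_j} ∂_{z̄_j}` on functions on `ℂ²`. -/
def lap (j : Fin 2) (f : C2 → ℂ) (z : C2) : ℂ := -4 * dz j (dzb j f) z

/-- `Δ_z = Δ_{z₁} + Δ_{z₂}`, on `End(V_n)`-valued functions. -/
def lapEnd {n : ℕ} (F : C2 → EndV n) (z : C2) : EndV n :=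
  entrywise (lap 0) F z + entrywise (lap 1) F z

/-- `𝐃_n = i(Δ_{z₂} - Δ_{z₁}) ⊗ dτ_n(X₁) - 4(∂_{z̄₁}∂_{z₂} - ∂_{z₁}∂_{z̄₂}) ⊗ dτ_n(X₂)
+ 4i(∂_{z₁}∂_{z̄₂} + ∂_{z̄₁}∂_{z₂}) ⊗ dτ_n(X₃)`. -/
def Dn {n : ℕ} (F : C2 → EndV n) (z : C2) : EndV n :=
  Complex.I • (dtau n (basisU 0) * (entrywise (lap 1) F z - entrywise (lap 0) F z))
    - (4 : ℂ) • (dtau n (basisU 1) *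
        (entrywise (fun f => dzb 0 (dz 1 f)) F z - entrywise (fun f => dz 0 (dzb 1 f)) F z))
    + (4 * Complex.I) • (dtau n (basisU 2) *
        (entrywise (fun f => dz 0 (dzb 1 f)) F z + entrywise (fun f => dzb 0 (dz 1 f)) F z))

/-- `Φ` has the pair of eigenvalues `(p.1, p.2)` with respect to `(Δ_z, 𝐃_n)`. -/
def HasEigenvalues {n : ℕ} (Φ : C2 → EndV n) (p : ℂ × ℂ) : Prop :=
  (∀ z, lapEnd Φ z = p.1 • Φ z) ∧ ∀ z, Dn Φ z = p.2 • Φ z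

/-! ### The explicit spherical functions -/

/-- The real inner product of `ℂ² ≅ ℝ⁴`. -/
def rInner (z w : C2) : ℝ := (∑ i, z i * conj (w i)).re

/-- The unit sphere `S³` of `ℂ²`. -/
abbrev S3 := Metric.sphere (0 : C2) 1

/-- The normalized surface measure of `S³`. -/
def sigma : Measure S3 :=
  ((volume : Measure C2).toSphere Set.univ)⁻¹ • (volume : Measure C2).toSphere

/-- The scalar spherical function
`φ_ξ(z) = φ₁(√ξ z)`, `φ₁(z) = ∫_{S³} e^{-i⟨z,ζ⟩} dσ(ζ)`. -/
def phi (ξ : ℝ) (z : C2) : ℂ :=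
  ∫ ζ : S3, Complex.exp (-Complex.I * (rInner (Real.sqrt ξ • z) ζ : ℝ)) ∂sigma

/-- The matrix `k_z`, in `SU₂` when `|z| = 1`, which maps `(0, 1)` to `z`. -/
def kMat (z : C2) : Matrix (Fin 2) (Fin 2) ℂ := !![conj (z 1), z 0; -conj (z 0), z 1]

/-- `Q^d_B(z) = |z|^{2d} τ_n(k_{z'}) B τ_n(k_{z'})^*`, where `z' = z / |z|` (`z ≠ 0`). -/
def Q {n : ℕ} (d : ℕ) (B : EndV n) (z : C2) : EndV n :=
  ((‖z‖ ^ (2 * d) : ℝ) : ℂ) •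
    (tau n (kMat (‖z‖⁻¹ • z)) * B * (tau n (kMat (‖z‖⁻¹ • z)))ᴴ)

/-- `E_{jj}`. -/
def E (n : ℕ) (j : Fin (n + 1)) : EndV n := Matrix.single j j 1

/-- Polynomials in `z₁, z₂` (variables `inl 0, inl 1`) and `z̄₁, z̄₂` (variables
`inr 0, inr 1`). -/
abbrev Poly := MvPolynomial (Fin 2 ⊕ Fin 2) ℂ

/-- The function `z ↦ p(z, z̄)`. -/
def polyFun (p : Poly) (z : C2) : ℂ :=
  MvPolynomial.eval (Sum.elim (fun i => z i) (fun i => conj (z i))) p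

/-- The constant coefficient operator `p(∂)`, with
`(z^α z̄^β)(∂) = (-2i ∂_{z̄})^α (-2i ∂_z)^β`. -/
def polyOp (p : Poly) (f : C2 → ℂ) (z : C2) : ℂ :=
  ∑ s ∈ p.support, p.coeff s *
    ((fun g w => -2 * Complex.I * dzb 0 g w)^[s (Sum.inl 0)]
      ((fun g w => -2 * Complex.I * dzb 1 g w)^[s (Sum.inl 1)]
        ((fun g w => -2 * Complex.I * dz 0 g w)^[s (Sum.inr 0)]
          ((fun g w => -2 * Complex.I * dz 1 g w)^[s (Sum.inr 1)] f)))) z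

/-- The operator `P(∂)` of an `End(V_n)`-valued polynomial `P`, applied to a scalar function. -/
def polyOpEnd {n : ℕ} (P : Matrix (Fin (n + 1)) (Fin (n + 1)) Poly) (f : C2 → ℂ) (z : C2) :
    EndV n :=
  Matrix.of fun a b => polyOp (P a b) f z

/-- The `End(V_n)`-valued polynomial `P` continues the function `F` on `ℂ² \ {0}`. -/
def Continues {n : ℕ} (P : Matrix (Fin (n + 1)) (Fin (n + 1)) Poly) (F : C2 → EndV n) : Prop :=
  ∀ z : C2, z ≠ 0 → ∀ a b, polyFun (P a b) z = F z a b

/-- `Φ_{ξ,j}(z) = (n + 1) ∫_{S³} e^{-i√ξ⟨z,ζ⟩} Q^n_{E_{jj}}(ζ) dσ(ζ)`. -/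
def PhiSph (n : ℕ) (j : Fin (n + 1)) (ξ : ℝ) (z : C2) : EndV n :=
  ((n : ℂ) + 1) • Matrix.of fun a b =>
    ∫ ζ : S3, Complex.exp (-Complex.I * (Real.sqrt ξ * rInner z ζ : ℝ)) *
      Q n (E n j) (ζ : C2) a b ∂sigma

end MotionM2

end

/-!
# Bounded spherical functions of the motion group `U₂ ⋉ ℂ²`

A function on `G` of `K`-type `τ_{m,n}` is `(k, z) ↦ tr(τ_{m,n}(k)^* Φ(z))` (`trFn`) for a unique
`End(V_n)`-valued function `Φ`. In terms of `Φ` being `K`-central means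
`Φ(kz) = τ_n(k) Φ(z) τ_n(k)^*` (`Equivariant`), `D₁` becomes `Δ_z` and `D₂` becomes `-𝐃_n`, while
`D₃` and `D₄` have the eigenvalues `n² + 2n` and `-m` (`D1_trFn`, …, `D4_trFn`). The theorem
therefore reduces to the classification of the bounded equivariant joint eigenfunctions `Φ` of the
constant coefficient operators `Δ_z` and `𝐃_n` with `Φ(0) = I`.

*The lines.* The symbol of `𝐃_n` at `z = |z| ζ` is the conjugate by `τ_n(k_ζ)` of the diagonal matrix
with entries `(2l - n)|z|²`. So `Q^n_{E_{jj}}` is a polynomial in this symbol, by Lagrange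
interpolation (`lagrangeQ`, `evalM_lagrangeQ`), and the Cayley–Hamilton identity (`prod_factor`)
confines the pairs of eigenvalues to `n + 1` lines (`exists_line`).

*Existence.* A differential operator which commutes with left translations and with conjugation by
`K` has `tr(τ(k)^* Q_{E_{jj}}(ζ)) e^{-is⟨z,ζ⟩}` as an eigenfunction, with an eigenvalue which does not
depend on `ζ` (`eigen_wave_e2`, `eigen_wave`). The integral over the sphere is `Φ_{ξ,j}`, and gives a
bounded spherical function (`isBoundedSpherical_PhiSph`). Differentiation under the integral yields
the formulas in terms of the scalar spherical functions (`PhiSph_eq_polyOpEnd`).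

*Uniqueness.* Bounded eigenfunctions of `Δ_z` are multiplied by `e^{-ξr²/(4c)}` under averaging with
Gaussians `e^{-c|w|²}` dilated by `r`, for `Re c > 0` (`gauss_average`). Boundedness in `r` forces
`ξ ≥ 0` (`eigenvalue_nonneg`), and for the derivatives it gives Bernstein's inequality
(`exists_bernstein`) and Liouville's theorem (`liouville`), the latter for `ξ = 0`. If `ξ > 0`, two
normalized eigenfunctions differ by an equivariant `H` with `H(0) = 0`. The degree `d` part of the
Taylor series of `H` has a Fischer dual polynomial `P`, which is equivariant, hence up to powers of
`|z|²` a combination of the `Q_{E_{ii}}`. Then `P(∂)H` is a multiple of `H`, so `P(∂)H(0) = 0`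
(`actM_fischerM`). As the trace of `P(∂)H(0)` is a weighted sum of squares of the derivatives of `H`
of order `d`, all these vanish, and by Bernstein's inequality `H = 0` (`eq_PhiSph`).

*The `K`-type.* For the set `Σ^n_𝒟` only the eigenvalues with respect to `D₃` and `D₄` are given. On
each coset `U₂ × {z}` they leave a single nonzero Fourier coefficient (`coeffU_eq_zero`), and the
functions on `U₂` are determined by their Fourier coefficients (`eq_zero_of_coeffU`), so the spherical
function is of `K`-type `τ_{-m,n}` (`eq_trFn_of_eigen`).
-/

open MeasureTheory Matrix
open scoped ContDiff ComplexConjugate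

noncomputable section

namespace MotionM2

section
/-! ### The symmetric powers of a `2 × 2` matrix -/

/-- The vector of the values at `z` of the orthonormal basis `e_n^j`. -/
def basisVal (n : ℕ) (z : Fin 2 → ℂ) (j : Fin (n + 1)) : ℂ :=
  ((Real.sqrt (n.choose j) : ℝ) : ℂ) * (z 0 ^ (j : ℕ) * z 1 ^ (n - (j : ℕ)))

lemma sqrt_choose_ne (n : ℕ) (j : Fin (n + 1)) : ((Real.sqrt (n.choose j) : ℝ) : ℂ) ≠ 0 := by
  have : 0 < n.choose j := Nat.choose_pos (Nat.lt_succ_iff.1 j.2)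
  exact_mod_cast (Real.sqrt_pos.2 (by exact_mod_cast this)).ne'

lemma sqrt_choose_sq (n : ℕ) (j : ℕ) :
    ((Real.sqrt (n.choose j) : ℝ) : ℂ) * ((Real.sqrt (n.choose j) : ℝ) : ℂ) = n.choose j := by
  rw [← Complex.ofReal_mul, Real.mul_self_sqrt (by positivity)]; simp

/-- The matrix of `p ↦ p(A ·)` in the basis `e_n^j`, with its entries written out as
polynomials in the entries of `A`. -/
def symPow (n : ℕ) (A : Matrix (Fin 2) (Fin 2) ℂ) : EndV n :=
  Matrix.of fun i j =>
    ((Real.sqrt (n.choose j) : ℝ) : ℂ) / ((Real.sqrt (n.choose i) : ℝ) : ℂ) *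
      ∑ r ∈ Finset.range (j + 1), ∑ s ∈ Finset.range (n - j + 1),
        if r + s = (i : ℕ) then
          ((j : ℕ).choose r : ℂ) * ((n - j).choose s : ℂ) *
            (A 0 0 ^ r * A 0 1 ^ ((j : ℕ) - r) * (A 1 0 ^ s * A 1 1 ^ (n - j - s)))
        else 0

lemma tau_eq_symPow (n : ℕ) (k : Matrix (Fin 2) (Fin 2) ℂ) : tau n k = symPow n k⁻¹ := by
  ext i j
  have hi := Nat.lt_succ_iff.1 i.2
  have hj := Nat.lt_succ_iff.1 j.2
  have hc : ∀ a b : ℕ, a + b = n → MvPolynomial.coeff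
      (Finsupp.single 0 (i : ℕ) + Finsupp.single 1 (n - (i : ℕ)))
      (MvPolynomial.X 0 ^ a * MvPolynomial.X 1 ^ b : MvPolynomial (Fin 2) ℂ) =
      if a = i then 1 else 0 := by
    intro a b hab
    rw [MvPolynomial.X_pow_eq_monomial, MvPolynomial.X_pow_eq_monomial,
      MvPolynomial.monomial_mul, MvPolynomial.coeff_monomial, mul_one]
    refine if_congr ⟨fun h => ?_, fun h => ?_⟩ rfl rfl
    · simpa using DFunLike.congr_fun h 0
    · subst h; congr 2; omega
  simp only [tau, symPow, Matrix.of_apply, pullInv, basisV, map_mul, map_pow,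
    MvPolynomial.aeval_X, Fin.sum_univ_two, MvPolynomial.algHom_C]
  rw [MvPolynomial.algebraMap_eq, MvPolynomial.coeff_C_mul, mul_div_assoc, div_mul_eq_mul_div,
    mul_div_assoc]
  congr 2
  rw [add_pow, add_pow, Finset.sum_mul_sum, MvPolynomial.coeff_sum]
  refine Finset.sum_congr rfl fun r hr => ?_
  rw [MvPolynomial.coeff_sum]
  refine Finset.sum_congr rfl fun s hs => ?_
  have hr' := Finset.mem_range.1 hr
  have hs' := Finset.mem_range.1 hs
  have key : (MvPolynomial.C (k⁻¹ 0 0) * MvPolynomial.X 0) ^ r *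
        (MvPolynomial.C (k⁻¹ 0 1) * MvPolynomial.X 1) ^ ((j : ℕ) - r) *
        (((j : ℕ).choose r : ℕ) : MvPolynomial (Fin 2) ℂ) *
      ((MvPolynomial.C (k⁻¹ 1 0) * MvPolynomial.X 0) ^ s *
        (MvPolynomial.C (k⁻¹ 1 1) * MvPolynomial.X 1) ^ (n - (j : ℕ) - s) *
        (((n - (j : ℕ)).choose s : ℕ) : MvPolynomial (Fin 2) ℂ)) =
      MvPolynomial.C (((j : ℕ).choose r : ℂ) * ((n - (j : ℕ)).choose s : ℂ) *
        (k⁻¹ 0 0 ^ r * k⁻¹ 0 1 ^ ((j : ℕ) - r) *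
          (k⁻¹ 1 0 ^ s * k⁻¹ 1 1 ^ (n - (j : ℕ) - s)))) *
        (MvPolynomial.X 0 ^ (r + s) * MvPolynomial.X 1 ^ (((j : ℕ) - r) + (n - (j : ℕ) - s))) := by
    simp only [map_mul, map_pow, map_natCast, mul_pow, pow_add]
    ring
  rw [key, MvPolynomial.coeff_C_mul, hc _ _ (by omega)]
  split_ifs <;> simp

lemma basisVal_mulVec (n : ℕ) (A : Matrix (Fin 2) (Fin 2) ℂ) (z : Fin 2 → ℂ) (j : Fin (n + 1)) :
    basisVal n (A *ᵥ z) j = ∑ i, symPow n A i j * basisVal n z i := by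
  have hj := Nat.lt_succ_iff.1 j.2
  simp only [basisVal, symPow, Matrix.of_apply, Matrix.mulVec, dotProduct, Fin.sum_univ_two]
  rw [add_pow, add_pow, Finset.sum_mul_sum]
  have h : ∀ i : Fin (n + 1), ∀ (x y : ℂ), ((Real.sqrt (n.choose j) : ℝ) : ℂ) /
      ((Real.sqrt (n.choose i) : ℝ) : ℂ) * x * (((Real.sqrt (n.choose i) : ℝ) : ℂ) * y) =
      ((Real.sqrt (n.choose j) : ℝ) : ℂ) * (x * y) := by
    intro i x y
    have := sqrt_choose_ne n i
    field_simp
  simp_rw [h]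
  rw [← Finset.mul_sum]
  congr 1
  simp_rw [Finset.sum_mul]
  symm
  rw [Finset.sum_comm]
  refine Finset.sum_congr rfl fun r hr => ?_
  rw [Finset.sum_comm]
  refine Finset.sum_congr rfl fun s hs => ?_
  have hr' := Finset.mem_range.1 hr
  have hs' := Finset.mem_range.1 hs
  rw [Finset.sum_eq_single (⟨r + s, by omega⟩ : Fin (n + 1))]
  · have e : n - (r + s) = ((j : ℕ) - r) + (n - (j : ℕ) - s) := by omega
    simp only [if_true, e, pow_add, mul_pow]
    ring
  · intro b _ hb
    rw [if_neg, zero_mul]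
    intro h'
    exact hb (Fin.ext h'.symm)
  · simp

lemma basisVal_independent (n : ℕ) (c : Fin (n + 1) → ℂ)
    (h : ∀ z : Fin 2 → ℂ, ∑ i, c i * basisVal n z i = 0) : c = 0 := by
  have hp : (∑ i : Fin (n + 1), Polynomial.C (c i * ((Real.sqrt (n.choose i) : ℝ) : ℂ)) *
      Polynomial.X ^ (i : ℕ)) = 0 := by
    refine Polynomial.funext fun x => ?_
    have := h ![x, 1]
    simp only [basisVal, Matrix.cons_val_zero, Matrix.cons_val_one, one_pow, mul_one] at this
    simp only [Polynomial.eval_finsetSum, Polynomial.eval_mul, Polynomial.eval_C,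
      Polynomial.eval_pow, Polynomial.eval_X, Polynomial.eval_zero]
    rw [← this]
    exact Finset.sum_congr rfl fun i _ => by ring
  funext i
  have := congrArg (fun p => Polynomial.coeff p (i : ℕ)) hp
  simp only [Polynomial.finsetSum_coeff, Polynomial.coeff_C_mul, Polynomial.coeff_X_pow,
    Polynomial.coeff_zero] at this
  rw [Finset.sum_eq_single i] at this
  · simpa [sqrt_choose_ne n i] using this
  · intro b _ hb
    rw [if_neg (fun h' => hb (Fin.ext h'.symm)), mul_zero]
  · simp

lemma symPow_mul (n : ℕ) (A B : Matrix (Fin 2) (Fin 2) ℂ) :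
    symPow n (A * B) = symPow n B * symPow n A := by
  ext i j
  have := basisVal_independent n (fun i => symPow n (A * B) i j - (symPow n B * symPow n A) i j) ?_
  · exact sub_eq_zero.1 (congrFun this i)
  intro z
  simp only [sub_mul, Finset.sum_sub_distrib, Matrix.mul_apply, Finset.sum_mul]
  rw [← basisVal_mulVec, ← Matrix.mulVec_mulVec, basisVal_mulVec, Finset.sum_comm, sub_eq_zero]
  refine Finset.sum_congr rfl fun l _ => ?_
  rw [basisVal_mulVec, Finset.mul_sum]
  exact Finset.sum_congr rfl fun i _ => by ring

lemma symPow_eq_of_basisVal {n : ℕ} {A : Matrix (Fin 2) (Fin 2) ℂ} {T : EndV n}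
    (h : ∀ z j, basisVal n (A *ᵥ z) j = ∑ i, T i j * basisVal n z i) : symPow n A = T := by
  ext i j
  have := basisVal_independent n (fun i => symPow n A i j - T i j) ?_
  · exact sub_eq_zero.1 (congrFun this i)
  intro z
  simp only [sub_mul, Finset.sum_sub_distrib]
  rw [← basisVal_mulVec, h, sub_self]

lemma symPow_one (n : ℕ) : symPow n 1 = 1 :=
  symPow_eq_of_basisVal fun z j => by simp [Matrix.one_apply]

/-- The reproducing kernel of `V_n`. -/
lemma sum_basisVal_conj (n : ℕ) (z w : Fin 2 → ℂ) :
    ∑ j, basisVal n z j * conj (basisVal n w j) = (z 0 * conj (w 0) + z 1 * conj (w 1)) ^ n := by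
  rw [add_pow, ← Fin.sum_univ_eq_sum_range (fun m => (z 0 * conj (w 0)) ^ m *
    (z 1 * conj (w 1)) ^ (n - m) * (n.choose m : ℂ)) (n + 1)]
  refine Finset.sum_congr rfl fun j _ => ?_
  simp only [basisVal, map_mul, map_pow, Complex.conj_ofReal, mul_pow]
  rw [← sqrt_choose_sq n j]
  ring

lemma symPow_conjTranspose (n : ℕ) (A : Matrix (Fin 2) (Fin 2) ℂ) :
    symPow n Aᴴ = (symPow n A)ᴴ := by
  refine symPow_eq_of_basisVal fun z j => ?_
  have key : ∀ w : Fin 2 → ℂ, ∑ j, conj (basisVal n (Aᴴ *ᵥ z) j) * basisVal n w j =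
      ∑ j, conj (∑ i, (symPow n A)ᴴ i j * basisVal n z i) * basisVal n w j := by
    intro w
    have h1 := sum_basisVal_conj n w (Aᴴ *ᵥ z)
    have h2 := sum_basisVal_conj n (A *ᵥ w) z
    have h3 : (w 0 * conj ((Aᴴ *ᵥ z) 0) + w 1 * conj ((Aᴴ *ᵥ z) 1)) =
        ((A *ᵥ w) 0 * conj (z 0) + (A *ᵥ w) 1 * conj (z 1)) := by
      simp [Matrix.mulVec, dotProduct, Fin.sum_univ_two, Matrix.conjTranspose_apply]
      ring
    rw [h3, ← h2] at h1
    calc _ = ∑ j, basisVal n w j * conj (basisVal n (Aᴴ *ᵥ z) j) :=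
          Finset.sum_congr rfl fun i _ => mul_comm _ _
      _ = _ := by
        rw [h1]
        simp_rw [basisVal_mulVec, map_sum, Finset.sum_mul]
        rw [Finset.sum_comm]
        refine Finset.sum_congr rfl fun i _ => Finset.sum_congr rfl fun l _ => ?_
        simp [Matrix.conjTranspose_apply]
        ring
  have := basisVal_independent n (fun j => conj (basisVal n (Aᴴ *ᵥ z) j) -
    conj (∑ i, (symPow n A)ᴴ i j * basisVal n z i)) fun w => by
      simp only [sub_mul, Finset.sum_sub_distrib, key w, sub_self]
  have h4 := sub_eq_zero.1 (congrFun this j)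
  exact (starRingEnd ℂ).injective h4

lemma symPow_diagonal (n : ℕ) (a b : ℂ) : symPow n !![a, 0; 0, b] =
    Matrix.diagonal fun j : Fin (n + 1) => a ^ (j : ℕ) * b ^ (n - (j : ℕ)) := by
  refine symPow_eq_of_basisVal fun z j => ?_
  simp [basisVal, Matrix.mulVec, dotProduct, Fin.sum_univ_two, Matrix.diagonal_apply, mul_pow]
  ring

lemma symPow_smul (n : ℕ) (c : ℂ) (A : Matrix (Fin 2) (Fin 2) ℂ) :
    symPow n (c • A) = c ^ n • symPow n A := by
  refine symPow_eq_of_basisVal fun z j => ?_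
  have hj := Nat.lt_succ_iff.1 j.2
  have : basisVal n ((c • A) *ᵥ z) j = c ^ n * basisVal n (A *ᵥ z) j := by
    simp only [basisVal, Matrix.smul_mulVec, Pi.smul_apply, smul_eq_mul, mul_pow]
    rw [show c ^ n = c ^ (j : ℕ) * c ^ (n - (j : ℕ)) by rw [← pow_add]; congr 1; omega]
    ring
  rw [this, basisVal_mulVec, Finset.mul_sum]
  simp [mul_assoc]

/-- The column of index `0` is the expansion of `(A z)₂ ^ n`. -/
lemma symPow_zero_col (n : ℕ) (A : Matrix (Fin 2) (Fin 2) ℂ) (i : Fin (n + 1)) :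
    symPow n A i 0 = ((Real.sqrt (n.choose i) : ℝ) : ℂ) *
      (A 1 0 ^ (i : ℕ) * A 1 1 ^ (n - (i : ℕ))) := by
  have hi := Nat.lt_succ_iff.1 i.2
  have h0 := sqrt_choose_ne n i
  simp only [symPow, Matrix.of_apply, Fin.val_zero, zero_add, Finset.sum_range_one, Nat.sub_zero,
    Nat.choose_zero_right]
  rw [Finset.sum_eq_single (i : ℕ)]
  · simp only [if_true, pow_zero, Nat.cast_one, one_mul]
    rw [← sqrt_choose_sq n i]
    field_simp
    simp
  · intro b _ hb
    exact if_neg hb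
  · intro h
    exact absurd (Finset.mem_range.2 (by omega)) h

lemma tau_eq_star (n : ℕ) (k : U2) :
    tau n k = symPow n (k : Matrix (Fin 2) (Fin 2) ℂ)ᴴ := by
  rw [tau_eq_symPow]
  congr 1
  exact Matrix.inv_eq_right_inv (Matrix.mem_unitaryGroup_iff.1 k.2)

end

section
/-! ### Haar measure on `U₂` -/

instance : haarU2.IsHaarMeasure := by unfold haarU2; infer_instance

instance : IsProbabilityMeasure haarU2 :=
  ⟨by
    have := Measure.haarMeasure_self (K₀ := (⊤ : TopologicalSpace.PositiveCompacts U2))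
    simpa [haarU2] using this⟩

instance : haarU2.IsMulRightInvariant := by
  refine ⟨fun g => ?_⟩
  have hm : Measurable fun x : U2 => x * g := (continuous_mul_const g).measurable
  have : (Measure.map (fun x => x * g) haarU2).IsMulLeftInvariant :=
    isMulLeftInvariant_map_mul_right g
  have : IsProbabilityMeasure (Measure.map (fun x => x * g) haarU2) :=
    Measure.isProbabilityMeasure_map hm.aemeasurable
  have h := Measure.isMulInvariant_eq_smul_of_compactSpace
    (Measure.map (fun x => x * g) haarU2) haarU2
  have h1 := congrArg (fun ν : Measure U2 => ν Set.univ) h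
  simp only [measure_univ, Measure.smul_apply] at h1
  rw [h]
  ext s _
  simp only [Measure.smul_apply]
  rw [ENNReal.smul_def] at h1 ⊢
  rw [smul_eq_mul, mul_one] at h1
  rw [← h1]; simp

instance : haarU2.IsInvInvariant := by
  refine ⟨?_⟩
  have : IsProbabilityMeasure haarU2.inv :=
    Measure.isProbabilityMeasure_map measurable_inv.aemeasurable
  have h := Measure.isMulInvariant_eq_smul_of_compactSpace haarU2.inv haarU2
  have h1 := congrArg (fun ν : Measure U2 => ν Set.univ) h
  simp only [measure_univ, Measure.smul_apply] at h1
  rw [h]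
  ext s _
  simp only [Measure.smul_apply]
  rw [ENNReal.smul_def] at h1 ⊢
  rw [smul_eq_mul, mul_one] at h1
  rw [← h1]; simp

lemma integrable_haarU2 {f : U2 → ℂ} (hf : Continuous f) : Integrable f haarU2 :=
  hf.integrable_of_hasCompactSupport (HasCompactSupport.of_compactSpace f)

/-! ### The representations `τ_{m,n}` of `U₂` -/

lemma det_U2_mul_conj (k : U2) :
    (k : Matrix (Fin 2) (Fin 2) ℂ).det * conj (k : Matrix (Fin 2) (Fin 2) ℂ).det = 1 := by
  have h := congrArg Matrix.det (Matrix.mem_unitaryGroup_iff.1 k.2)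
  rw [Matrix.det_mul, Matrix.star_eq_conjTranspose, Matrix.det_conjTranspose, Matrix.det_one] at h
  exact h

lemma det_U2_ne (k : U2) : (k : Matrix (Fin 2) (Fin 2) ℂ).det ≠ 0 := fun h => by
  simpa [h] using det_U2_mul_conj k

lemma coe_inv_U2 (k : U2) :
    ((k⁻¹ : U2) : Matrix (Fin 2) (Fin 2) ℂ) = (k : Matrix (Fin 2) (Fin 2) ℂ)ᴴ := rfl

lemma tau_mul (n : ℕ) (k k' : U2) : tau n (k * k' : U2) = tau n k * tau n k' := by
  rw [tau_eq_star, tau_eq_star, tau_eq_star, ← symPow_mul, ← Matrix.conjTranspose_mul]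
  rfl

lemma tau_one (n : ℕ) : tau n (1 : U2) = 1 := by
  rw [tau_eq_star, Submonoid.coe_one, Matrix.conjTranspose_one, symPow_one]

lemma tau_inv (n : ℕ) (k : U2) : tau n (k⁻¹ : U2) = (tau n k)ᴴ := by
  rw [tau_eq_star, tau_eq_star, coe_inv_U2, symPow_conjTranspose]

lemma tauU_mul (m : ℤ) (n : ℕ) (k k' : U2) : tauU m n (k * k') = tauU m n k * tauU m n k' := by
  rw [tauU, tau_mul, Submonoid.coe_mul, Matrix.det_mul, mul_zpow, tauU, tauU, smul_mul_smul_comm]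

lemma tauU_one (m : ℤ) (n : ℕ) : tauU m n 1 = 1 := by
  rw [tauU, tau_one, Submonoid.coe_one, Matrix.det_one, _root_.one_zpow, one_smul]

lemma tauU_inv (m : ℤ) (n : ℕ) (k : U2) : tauU m n k⁻¹ = (tauU m n k)ᴴ := by
  rw [tauU, tau_inv, coe_inv_U2, Matrix.det_conjTranspose, tauU, Matrix.conjTranspose_smul,
    star_zpow₀]

lemma tauU_mul_conjTranspose (m : ℤ) (n : ℕ) (k : U2) : tauU m n k * (tauU m n k)ᴴ = 1 := by
  rw [← tauU_inv, ← tauU_mul, mul_inv_cancel, tauU_one]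

lemma tauU_conjTranspose_mul (m : ℤ) (n : ℕ) (k : U2) : (tauU m n k)ᴴ * tauU m n k = 1 := by
  rw [← tauU_inv, ← tauU_mul, inv_mul_cancel, tauU_one]

lemma tau_conj_eq_tauU (m : ℤ) (n : ℕ) (k : U2) (B : EndV n) :
    tau n k * B * (tau n k)ᴴ = tauU m n k * B * (tauU m n k)ᴴ := by
  simp only [tauU, Matrix.conjTranspose_smul, Matrix.smul_mul, Matrix.mul_smul, smul_smul]
  have := det_U2_mul_conj k
  rw [starRingEnd_apply, mul_comm] at this
  rw [star_zpow₀, ← mul_zpow, this, _root_.one_zpow, one_smul]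

lemma continuous_symPow (n : ℕ) : Continuous (symPow n) := by
  refine continuous_matrix fun i j => ?_
  simp only [symPow, Matrix.of_apply]
  refine Continuous.mul continuous_const ?_
  refine continuous_finsetSum _ fun r _ => ?_
  refine continuous_finsetSum _ fun s _ => ?_
  split_ifs
  · fun_prop
  · fun_prop

lemma continuous_tauU (m : ℤ) (n : ℕ) : Continuous (tauU m n) := by
  have h : tauU m n = fun k : U2 => (k : Matrix (Fin 2) (Fin 2) ℂ).det ^ (((n : ℤ) - m) / 2) •
      symPow n (k : Matrix (Fin 2) (Fin 2) ℂ)ᴴ := by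
    funext k
    rw [tauU, tau_eq_star]
  rw [h]
  have hc : Continuous fun k : U2 => (k : Matrix (Fin 2) (Fin 2) ℂ) := continuous_subtype_val
  have hd : Continuous fun k : U2 => (k : Matrix (Fin 2) (Fin 2) ℂ).det := hc.matrix_det
  exact (hd.zpow₀ _ fun k => Or.inl (det_U2_ne k)).smul
    ((continuous_symPow n).comp hc.matrix_conjTranspose)

lemma continuous_tauU_apply (m : ℤ) (n : ℕ) (i j : Fin (n + 1)) :
    Continuous fun k => tauU m n k i j := (continuous_tauU m n).matrix_elem i j

/-- The element `diag(a, 1)` of `U₂`. -/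
def torus (a : ℂ) (ha : a * conj a = 1) : U2 :=
  ⟨!![a, 0; 0, 1], by
    rw [Matrix.mem_unitaryGroup_iff]
    ext i j
    fin_cases i <;> fin_cases j <;> simp [Matrix.mul_apply, Fin.sum_univ_two, ha]⟩

lemma tau_torus (n : ℕ) (a : ℂ) (ha : a * conj a = 1) : tau n (torus a ha) =
    Matrix.diagonal fun j : Fin (n + 1) => (conj a) ^ (j : ℕ) := by
  rw [tau_eq_star]
  have : ((torus a ha : U2) : Matrix (Fin 2) (Fin 2) ℂ)ᴴ = !![conj a, 0; 0, 1] := by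
    ext i j
    fin_cases i <;> fin_cases j <;> simp [torus]
  rw [this, symPow_diagonal]
  simp

/-- `exp(i / (n + 1))`, whose powers of exponent `0, …, n` are distinct. -/
def torusAngle (n : ℕ) : ℂ := Complex.exp (Complex.I * ((1 / ((n : ℝ) + 1) : ℝ) : ℂ))

lemma torusAngle_unit (n : ℕ) : torusAngle n * conj (torusAngle n) = 1 := by
  rw [torusAngle, ← Complex.exp_conj, ← Complex.exp_add]
  simp

lemma torusAngle_injective (n : ℕ) :
    Function.Injective fun j : Fin (n + 1) => (conj (torusAngle n)) ^ (j : ℕ) := by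
  intro i j h
  have hn : (0 : ℝ) < (n : ℝ) + 1 := by positivity
  have h1 : torusAngle n ^ (i : ℕ) = torusAngle n ^ (j : ℕ) := by
    have := congrArg (starRingEnd ℂ) h
    simpa using this
  rw [torusAngle, ← Complex.exp_nat_mul, ← Complex.exp_nat_mul, Complex.exp_eq_exp_iff_exists_int]
    at h1
  obtain ⟨N, hN⟩ := h1
  have h2 : ((i : ℕ) : ℝ) * (1 / ((n : ℝ) + 1)) =
      ((j : ℕ) : ℝ) * (1 / ((n : ℝ) + 1)) + N * (2 * Real.pi) := by
    have : Complex.I * ((((i : ℕ) : ℝ) * (1 / ((n : ℝ) + 1)) : ℝ) : ℂ) =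
        Complex.I * ((((j : ℕ) : ℝ) * (1 / ((n : ℝ) + 1)) + N * (2 * Real.pi) : ℝ) : ℂ) := by
      push_cast at hN ⊢
      linear_combination hN
    exact_mod_cast mul_left_cancel₀ Complex.I_ne_zero this
  have hi : (i : ℝ) < n + 1 := by exact_mod_cast i.2
  have hj : (j : ℝ) < n + 1 := by exact_mod_cast j.2
  have h3 : ((i : ℕ) : ℝ) - ((j : ℕ) : ℝ) = N * (2 * Real.pi) * ((n : ℝ) + 1) := by
    field_simp at h2
    linarith
  have hpi := Real.pi_gt_three
  have hN0 : N = 0 := by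
    by_contra hne
    have h4 : (1 : ℝ) ≤ |(N : ℝ)| := by exact_mod_cast Int.one_le_abs hne
    have h5 : |((i : ℕ) : ℝ) - ((j : ℕ) : ℝ)| < n + 1 := by
      rw [abs_lt]
      constructor <;> linarith [(Nat.cast_nonneg (i : ℕ) : (0 : ℝ) ≤ (i : ℕ)),
        (Nat.cast_nonneg (j : ℕ) : (0 : ℝ) ≤ (j : ℕ))]
    rw [h3, abs_mul, abs_mul, abs_of_pos hn, abs_of_pos (by positivity : (0 : ℝ) < 2 * Real.pi)] at h5
    nlinarith [mul_le_mul_of_nonneg_right h4 (by positivity : (0 : ℝ) ≤ 2 * Real.pi * (n + 1))]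
  rw [hN0] at h3
  simp only [Int.cast_zero, zero_mul, sub_eq_zero] at h3
  exact Fin.ext (by exact_mod_cast h3)

/-- The rotation by `π / 4`, an element of `U₂` without vanishing entries. -/
def rot : U2 :=
  ⟨((Real.sqrt 2 : ℝ) : ℂ)⁻¹ • !![1, 1; -1, 1], by
    have h : ((Real.sqrt 2 : ℝ) : ℂ) * ((Real.sqrt 2 : ℝ) : ℂ) = 2 := by
      rw [← Complex.ofReal_mul, Real.mul_self_sqrt (by norm_num)]; simp
    have h0 : ((Real.sqrt 2 : ℝ) : ℂ) ≠ 0 := fun h' => by simp [h'] at h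
    rw [Matrix.mem_unitaryGroup_iff]
    ext i j
    fin_cases i <;> fin_cases j <;> simp [Matrix.mul_apply, Fin.sum_univ_two] <;>
      field_simp <;> rw [sq, h] <;> norm_num⟩

/-- Schur's lemma for `τ_n`, tested on one generator of the torus and one rotation. -/
lemma schur {n : ℕ} {B : EndV n}
    (ht : tau n (torus (torusAngle n) (torusAngle_unit n)) * B =
      B * tau n (torus (torusAngle n) (torusAngle_unit n)))
    (hr : tau n rot * B = B * tau n rot) : B = (B.trace / ((n : ℂ) + 1)) • 1 := by
  -- `B` is diagonal, since the generator of the torus acts with distinct weights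
  have hd : ∀ i j, i ≠ j → B i j = 0 := by
    intro i j hij
    rw [tau_torus] at ht
    have := congrFun (congrFun ht i) j
    rw [Matrix.diagonal_mul, Matrix.mul_diagonal, mul_comm, ← sub_eq_zero, ← mul_sub] at this
    rcases mul_eq_zero.1 this with h | h
    · exact h
    · exact absurd (torusAngle_injective n (sub_eq_zero.1 h)) hij
  -- the entries of `B` agree, since the column of index `0` of the rotation has no zero entry
  have hc : ∀ i, B i i = B 0 0 := by
    intro i
    have := congrFun (congrFun hr i) 0
    rw [Matrix.mul_apply, Matrix.mul_apply, Finset.sum_eq_single 0, Finset.sum_eq_single i] at this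
    · rw [mul_comm] at this
      refine (mul_right_cancel₀ ?_ this).symm
      rw [tau_eq_star, symPow_zero_col]
      refine mul_ne_zero (sqrt_choose_ne n i) (mul_ne_zero (pow_ne_zero _ ?_) (pow_ne_zero _ ?_)) <;>
        simp [rot]
    · intro b _ hb; rw [hd i b hb.symm, zero_mul]
    · simp
    · intro b _ hb; rw [hd b 0 hb, mul_zero]
    · simp
  have htr : B.trace = ((n : ℂ) + 1) * B 0 0 := by
    simp [Matrix.trace, hc]
  have hn : (n : ℂ) + 1 ≠ 0 := by exact_mod_cast Nat.succ_ne_zero n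
  rw [htr, mul_div_cancel_left₀ _ hn]
  ext i j
  by_cases h : i = j
  · subst h; simp [hc i]
  · simp [hd i j h, Matrix.one_apply_ne h]

lemma schur_of_conj {n : ℕ} {B : EndV n} (h : ∀ k : U2, tau n k * B * (tau n k)ᴴ = B) :
    B = (B.trace / ((n : ℂ) + 1)) • 1 := by
  have h' : ∀ k : U2, tau n k * B = B * tau n k := by
    intro k
    conv_rhs => rw [← h k]
    rw [mul_assoc, ← tau_inv, ← tau_mul, inv_mul_cancel, tau_one, mul_one]
  exact schur (h' _) (h' _)

lemma integral_matrix_mul {X : Type*} [MeasurableSpace X] {μ : Measure X} {n : ℕ}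
    {F : X → EndV n} (hF : ∀ i j, Integrable (fun x => F x i j) μ) (S T : EndV n) :
    (Matrix.of fun i j => ∫ x, (S * F x * T) i j ∂μ) =
      S * (Matrix.of fun i j => ∫ x, F x i j ∂μ) * T := by
  ext i j
  simp only [Matrix.of_apply, Matrix.mul_apply]
  rw [integral_finsetSum]
  · refine Finset.sum_congr rfl fun a _ => ?_
    rw [integral_mul_const, integral_finsetSum]
    · congr 1
      exact Finset.sum_congr rfl fun b _ => integral_const_mul _ _
    · exact fun b _ => (hF b a).const_mul _
  · exact fun a _ => (integrable_finsetSum _ fun b _ => (hF b a).const_mul _).mul_const _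

lemma integral_trace {X : Type*} [MeasurableSpace X] {μ : Measure X} {n : ℕ}
    {F : X → EndV n} (hF : ∀ i j, Integrable (fun x => F x i j) μ) (B : EndV n) :
    ∫ x, (B * F x).trace ∂μ = (B * Matrix.of fun i j => ∫ x, F x i j ∂μ).trace := by
  simp only [Matrix.trace, Matrix.diag_apply, Matrix.mul_apply, Matrix.of_apply]
  rw [integral_finsetSum]
  · refine Finset.sum_congr rfl fun i _ => ?_
    rw [integral_finsetSum]
    · exact Finset.sum_congr rfl fun j _ => integral_const_mul _ _
    · exact fun j _ => (hF j i).const_mul _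
  · exact fun i _ => integrable_finsetSum _ fun j _ => (hF j i).const_mul _

/-- The average of `τ(k) B τ(k)^*` over `K` is scalar. -/
lemma integral_tauU_conj (m : ℤ) (n : ℕ) (B : EndV n) :
    (Matrix.of fun i j => ∫ k, (tauU m n k * B * (tauU m n k)ᴴ) i j ∂haarU2) =
      (B.trace / ((n : ℂ) + 1)) • (1 : EndV n) := by
  have hc : ∀ i j, Continuous fun k => (tauU m n k * B * (tauU m n k)ᴴ) i j := fun i j =>
    (((continuous_tauU m n).mul continuous_const).mul
      (continuous_tauU m n).matrix_conjTranspose).matrix_elem i j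
  have hint : ∀ i j, Integrable (fun k => (tauU m n k * B * (tauU m n k)ᴴ) i j) haarU2 :=
    fun i j => integrable_haarU2 (hc i j)
  set T : EndV n := Matrix.of fun i j => ∫ k, (tauU m n k * B * (tauU m n k)ᴴ) i j ∂haarU2 with hT
  have hinv : ∀ h : U2, tau n h * T * (tau n h)ᴴ = T := by
    intro h
    rw [tau_conj_eq_tauU m, hT, ← integral_matrix_mul hint]
    ext i j
    simp only [Matrix.of_apply]
    rw [← integral_mul_left_eq_self (fun k => (tauU m n k * B * (tauU m n k)ᴴ) i j) h]
    refine integral_congr_ae (Filter.Eventually.of_forall fun k => ?_)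
    simp only [tauU_mul, Matrix.conjTranspose_mul, Matrix.mul_assoc]
  rw [schur_of_conj hinv]
  congr 2
  have := integral_trace hint 1
  rw [one_mul] at this
  rw [hT, ← this]
  have h2 : ∀ k, (1 * (tauU m n k * B * (tauU m n k)ᴴ)).trace = B.trace := fun k => by
    rw [one_mul, Matrix.trace_mul_cycle, tauU_conjTranspose_mul, one_mul]
  simp_rw [h2]
  simp

/-- Schur orthogonality. -/
lemma integral_tauU_mul_conj (m : ℤ) (n : ℕ) (i j a b : Fin (n + 1)) :
    ∫ k, tauU m n k i j * conj (tauU m n k a b) ∂haarU2 =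
      if i = a ∧ j = b then ((n : ℂ) + 1)⁻¹ else 0 := by
  have h := congrFun (congrFun (integral_tauU_conj m n (Matrix.single j b 1)) i) a
  simp only [Matrix.of_apply, Matrix.smul_apply, smul_eq_mul] at h
  have h2 : ∀ k : U2, (tauU m n k * Matrix.single j b (1 : ℂ) * (tauU m n k)ᴴ) i a =
      tauU m n k i j * conj (tauU m n k a b) := by
    intro k
    rw [Matrix.mul_apply, Finset.sum_eq_single b]
    · simp [Matrix.conjTranspose_apply]
    · intro c _ hc
      rw [Matrix.mul_single_apply_of_ne (hbj := hc), zero_mul]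
    · simp
  simp_rw [h2] at h
  rw [h]
  by_cases h1 : i = a <;> by_cases h3 : j = b
  · subst h1; subst h3; simp
  · subst h1; simp [h3, Matrix.trace_single_eq_of_ne _ _ _ h3]
  · simp [h1]
  · simp [h1]

/-- The matrices `τ(k)` span `End(V_n)`. -/
lemma span_tauU (m : ℤ) (n : ℕ) : Submodule.span ℂ (Set.range fun k : U2 => (tauU m n k)ᴴ) = ⊤ := by
  by_contra hne
  obtain ⟨f, hf0, hf⟩ := Submodule.exists_le_ker_of_lt_top _ (lt_top_iff_ne_top.2 hne)
  apply hf0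
  have hfk : ∀ k : U2, f (tauU m n k)ᴴ = 0 := fun k =>
    LinearMap.mem_ker.1 (hf (Submodule.subset_span ⟨k, rfl⟩))
  -- a functional vanishing on all `τ(k)^*` is `M ↦ tr(C M)`; orthogonality gives `C = 0`
  set C : EndV n := Matrix.of fun b a => f (Matrix.single a b 1) with hC
  have hexp : ∀ M : EndV n, f M = (C * M).trace := by
    intro M
    conv_lhs => rw [Matrix.matrix_eq_sum_single M]
    simp only [map_sum, Matrix.trace, Matrix.diag_apply, Matrix.mul_apply]
    rw [Finset.sum_comm]
    refine Finset.sum_congr rfl fun a _ => Finset.sum_congr rfl fun b _ => ?_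
    rw [hC, Matrix.of_apply, mul_comm, ← smul_eq_mul, ← map_smul, Matrix.smul_single, smul_eq_mul,
      mul_one]
  have hs : ∀ i j, C i j = 0 := by
    intro i j
    have hint : ∀ a b, Integrable (fun k => (tauU m n k i j • (tauU m n k)ᴴ) a b) haarU2 := by
      intro a b
      refine integrable_haarU2 ?_
      exact (continuous_tauU_apply m n i j).mul
        ((continuous_tauU m n).matrix_conjTranspose.matrix_elem a b)
    have h0 := integral_trace hint C
    have h1 : (Matrix.of fun a b => ∫ k, (tauU m n k i j • (tauU m n k)ᴴ) a b ∂haarU2) =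
        ((n : ℂ) + 1)⁻¹ • Matrix.single j i 1 := by
      ext a b
      simp only [Matrix.of_apply, Matrix.smul_apply, smul_eq_mul, Matrix.conjTranspose_apply]
      have := integral_tauU_mul_conj m n i j b a
      refine this.trans ?_
      rw [Matrix.single_apply]
      by_cases h1 : i = b <;> by_cases h2 : j = a <;> simp [h1, h2]
    have h2 : ∀ k : U2, (C * (tauU m n k i j • (tauU m n k)ᴴ)).trace = 0 := fun k => by
      rw [← hexp, map_smul, hfk, smul_zero]
    simp_rw [h2] at h0
    rw [h1, ← hexp, map_smul] at h0
    have hn : (n : ℂ) + 1 ≠ 0 := by exact_mod_cast Nat.succ_ne_zero n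
    have h3 : f (Matrix.single j i 1) = 0 := by simpa [hn] using h0.symm
    rw [hC, Matrix.of_apply, h3]
  have hC0 : C = 0 := Matrix.ext hs
  refine LinearMap.ext fun M => ?_
  rw [hexp M, hC0]
  simp

end

section
/-! ### The differential of `τ_n` -/

section Differential

open scoped Matrix.Norms.Operator

lemma hasDerivAt_exp_entry (Y : Matrix (Fin 2) (Fin 2) ℂ) (a b : Fin 2) :
    HasDerivAt (fun t : ℝ => NormedSpace.exp ((t : ℂ) • Y) a b) (Y a b) 0 := by
  have h := hasDerivAt_exp_smul_const (𝕂 := ℝ) Y 0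
  simp only [zero_smul, NormedSpace.exp_zero, one_mul] at h
  have h2 := (LinearMap.toContinuousLinearMap
    (Matrix.entryLinearMap ℝ ℂ a b : Matrix (Fin 2) (Fin 2) ℂ →ₗ[ℝ] ℂ)).hasFDerivAt.comp_hasDerivAt
      (0 : ℝ) h
  have h3 : HasDerivAt (fun t : ℝ => NormedSpace.exp (t • Y) a b) (Y a b) 0 := h2
  simpa using h3

lemma exp_smul_inv (Y : Matrix (Fin 2) (Fin 2) ℂ) (t : ℝ) :
    (NormedSpace.exp ((t : ℂ) • Y))⁻¹ = NormedSpace.exp ((t : ℂ) • -Y) := by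
  rw [smul_neg, Matrix.exp_neg]

end Differential

/-- The linear form `Y ↦ d/dt symPow (1 + t Y)_{ij}` at `t = 0`. -/
def dsymPow (n : ℕ) (i j : Fin (n + 1)) : (Fin 2 → Fin 2 → ℂ) →L[ℝ] ℂ :=
  fderiv ℝ (fun a : Fin 2 → Fin 2 → ℂ => symPow n (Matrix.of a) i j)
    (fun a b => (1 : Matrix (Fin 2) (Fin 2) ℂ) a b)

lemma contDiff_symPow {E : Type*} [NormedAddCommGroup E] [NormedSpace ℝ E] (n : ℕ)
    {A : E → Matrix (Fin 2) (Fin 2) ℂ} {N : WithTop ℕ∞}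
    (hA : ∀ a b, ContDiff ℝ N fun x => A x a b)
    (i j : Fin (n + 1)) : ContDiff ℝ N fun x => symPow n (A x) i j := by
  simp only [symPow, Matrix.of_apply]
  refine contDiff_const.mul (ContDiff.sum fun r _ => ContDiff.sum fun s _ => ?_)
  have h00 := hA 0 0
  have h01 := hA 0 1
  have h10 := hA 1 0
  have h11 := hA 1 1
  split_ifs
  · fun_prop
  · fun_prop

lemma hasDerivAt_symPow (n : ℕ) (i j : Fin (n + 1)) {A : ℝ → Matrix (Fin 2) (Fin 2) ℂ}
    {Y : Matrix (Fin 2) (Fin 2) ℂ} (h0 : A 0 = 1)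
    (hA : ∀ a b, HasDerivAt (fun t => A t a b) (Y a b) 0) :
    HasDerivAt (fun t => symPow n (A t) i j) (dsymPow n i j fun a b => Y a b) 0 := by
  have h1 : HasDerivAt (fun t => (fun a b => A t a b : Fin 2 → Fin 2 → ℂ)) (fun a b => Y a b) 0 :=
    hasDerivAt_pi.2 fun a => hasDerivAt_pi.2 fun b => hA a b
  have h2 : DifferentiableAt ℝ (fun a : Fin 2 → Fin 2 → ℂ => symPow n (Matrix.of a) i j)
      (fun a b => A 0 a b) :=
    ((contDiff_symPow n (N := 1) (A := fun a : Fin 2 → Fin 2 → ℂ => Matrix.of a)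
      (fun a b => by simp only [Matrix.of_apply]; fun_prop) i j).differentiable
        (by norm_num)).differentiableAt
  have h3 := h2.hasFDerivAt.comp_hasDerivAt (0 : ℝ) h1
  rw [h0] at h3
  exact h3

lemma hasDerivAt_tau_exp (n : ℕ) (Y : Matrix (Fin 2) (Fin 2) ℂ) (i j : Fin (n + 1)) :
    HasDerivAt (fun t : ℝ => tau n (NormedSpace.exp ((t : ℂ) • Y)) i j)
      (dsymPow n i j fun a b => (-Y) a b) 0 := by
  simp_rw [tau_eq_symPow, exp_smul_inv]
  exact hasDerivAt_symPow n i j (by simp) fun a b => hasDerivAt_exp_entry (-Y) a b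

lemma dtau_apply (n : ℕ) (Y : Matrix (Fin 2) (Fin 2) ℂ) (i j : Fin (n + 1)) :
    dtau n Y i j = dsymPow n i j fun a b => (-Y) a b := by
  simpa [dtau] using (hasDerivAt_tau_exp n Y i j).deriv

lemma hasDerivAt_tau (n : ℕ) (Y : Matrix (Fin 2) (Fin 2) ℂ) (i j : Fin (n + 1)) :
    HasDerivAt (fun t : ℝ => tau n (NormedSpace.exp ((t : ℂ) • Y)) i j) (dtau n Y i j) 0 := by
  rw [dtau_apply]
  exact hasDerivAt_tau_exp n Y i j

lemma dtau_add (n : ℕ) (Y Z : Matrix (Fin 2) (Fin 2) ℂ) :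
    dtau n (Y + Z) = dtau n Y + dtau n Z := by
  ext i j
  rw [Matrix.add_apply, dtau_apply, dtau_apply, dtau_apply, ← map_add]
  congr 1
  funext a b
  simp
  ring

lemma dtau_smul_real (n : ℕ) (c : ℝ) (Y : Matrix (Fin 2) (Fin 2) ℂ) :
    dtau n ((c : ℂ) • Y) = (c : ℂ) • dtau n Y := by
  ext i j
  rw [Matrix.smul_apply, dtau_apply, dtau_apply, smul_eq_mul, ← Complex.real_smul, ← map_smul]
  congr 1
  funext a b
  simp

lemma tau_mul' (n : ℕ) (A B : Matrix (Fin 2) (Fin 2) ℂ) : tau n (A * B) = tau n A * tau n B := by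
  rw [tau_eq_symPow, tau_eq_symPow, tau_eq_symPow, Matrix.mul_inv_rev, symPow_mul]

lemma dtau_conj (n : ℕ) (k : U2) (Y : Matrix (Fin 2) (Fin 2) ℂ) :
    tau n k * dtau n Y * (tau n k)ᴴ =
      dtau n ((k : Matrix (Fin 2) (Fin 2) ℂ) * Y * (k : Matrix (Fin 2) (Fin 2) ℂ)ᴴ) := by
  have hinv : (k : Matrix (Fin 2) (Fin 2) ℂ)⁻¹ = (k : Matrix (Fin 2) (Fin 2) ℂ)ᴴ :=
    Matrix.inv_eq_right_inv (Matrix.mem_unitaryGroup_iff.1 k.2)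
  have hu : IsUnit (k : Matrix (Fin 2) (Fin 2) ℂ) :=
    (Matrix.isUnit_iff_isUnit_det _).2 (isUnit_iff_ne_zero.2 (det_U2_ne k))
  have h1 : ∀ t : ℝ, tau n (NormedSpace.exp ((t : ℂ) • ((k : Matrix (Fin 2) (Fin 2) ℂ) * Y *
      (k : Matrix (Fin 2) (Fin 2) ℂ)ᴴ))) =
        tau n k * tau n (NormedSpace.exp ((t : ℂ) • Y)) * (tau n k)ᴴ := by
    intro t
    rw [← hinv, ← Matrix.smul_mul, ← Matrix.mul_smul, Matrix.exp_conj _ _ hu, tau_mul', tau_mul',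
      hinv, ← coe_inv_U2, tau_inv]
  ext i j
  refine HasDerivAt.unique ?_ (hasDerivAt_tau n _ i j)
  simp_rw [h1, Matrix.mul_apply]
  refine HasDerivAt.fun_sum fun a _ => HasDerivAt.mul_const ?_ _
  exact HasDerivAt.fun_sum fun b _ => (hasDerivAt_tau n Y b a).const_mul _

lemma dtau_conjTranspose (n : ℕ) (Y : Matrix (Fin 2) (Fin 2) ℂ) :
    (dtau n Y)ᴴ = dtau n Yᴴ := by
  have h1 : ∀ t : ℝ, tau n (NormedSpace.exp ((t : ℂ) • Yᴴ)) =
      (tau n (NormedSpace.exp ((t : ℂ) • Y)))ᴴ := by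
    intro t
    have : (t : ℂ) • Yᴴ = ((t : ℂ) • Y)ᴴ := by simp [Matrix.conjTranspose_smul]
    rw [this, Matrix.exp_conjTranspose, tau_eq_symPow, tau_eq_symPow, ← symPow_conjTranspose,
      Matrix.conjTranspose_nonsing_inv]
  ext i j
  refine HasDerivAt.unique ?_ (hasDerivAt_tau n _ i j)
  simp_rw [h1, Matrix.conjTranspose_apply]
  exact (hasDerivAt_tau n Y j i).star

lemma dtau_diagonal (n : ℕ) (a b : ℂ) : dtau n !![a, 0; 0, b] =
    Matrix.diagonal fun j : Fin (n + 1) => -(a * (j : ℕ) + b * ((n - (j : ℕ) : ℕ) : ℂ)) := by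
  have h1 : ∀ t : ℝ, tau n (NormedSpace.exp ((t : ℂ) • !![a, 0; 0, b])) =
      Matrix.diagonal fun j : Fin (n + 1) => Complex.exp ((t : ℂ) * -a) ^ (j : ℕ) *
        Complex.exp ((t : ℂ) * -b) ^ (n - (j : ℕ)) := by
    intro t
    have : (t : ℂ) • -!![a, 0; 0, b] = Matrix.diagonal ![(t : ℂ) * -a, (t : ℂ) * -b] := by
      ext i j
      fin_cases i <;> fin_cases j <;> simp
    rw [tau_eq_symPow, exp_smul_inv, this, Matrix.exp_diagonal, ← symPow_diagonal]
    congr 1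
    ext i j
    fin_cases i <;> fin_cases j <;> simp [Complex.exp_eq_exp_ℂ, Pi.coe_exp]
  ext i j
  refine HasDerivAt.unique (hasDerivAt_tau n _ i j) ?_
  simp_rw [h1]
  by_cases h : i = j
  · subst h
    simp only [Matrix.diagonal_apply_eq, ← Complex.exp_nat_mul, ← Complex.exp_add]
    have h2 : HasDerivAt (fun t : ℝ => ((i : ℕ) : ℂ) * ((t : ℂ) * -a) +
        ((n - (i : ℕ) : ℕ) : ℂ) * ((t : ℂ) * -b))
        (-(a * (i : ℕ) + b * ((n - (i : ℕ) : ℕ) : ℂ))) 0 := by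
      have h3 := (hasDerivAt_id (0 : ℝ)).ofReal_comp
      have := ((h3.mul_const (-a)).const_mul ((i : ℕ) : ℂ)).add
        ((h3.mul_const (-b)).const_mul ((n - (i : ℕ) : ℕ) : ℂ))
      refine this.congr_deriv ?_
      simp
      ring
    have := h2.cexp
    simpa using this
  · simp only [Matrix.diagonal_apply_ne _ h]
    exact hasDerivAt_const _ _

lemma dtau_zero_col (n : ℕ) (Y : Matrix (Fin 2) (Fin 2) ℂ) (i : Fin (n + 1)) :
    dtau n Y i 0 = if (i : ℕ) = 0 then -(n * Y 1 1) else
      if (i : ℕ) = 1 then -(((Real.sqrt n : ℝ) : ℂ) * Y 1 0) else 0 := by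
  refine HasDerivAt.unique (hasDerivAt_tau n _ i 0) ?_
  simp_rw [tau_eq_symPow, exp_smul_inv, symPow_zero_col]
  have h10 := hasDerivAt_exp_entry (-Y) 1 0
  have h11 := hasDerivAt_exp_entry (-Y) 1 1
  have := ((h10.fun_pow (i : ℕ)).mul (h11.fun_pow (n - (i : ℕ)))).const_mul
    ((Real.sqrt (n.choose i) : ℝ) : ℂ)
  refine this.congr_deriv ?_
  split_ifs with h0 h1
  · simp [h0]
  · simp [h1]
  · have : (0 : ℂ) ^ ((i : ℕ) - 1) = 0 := zero_pow (by omega)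
    simp [h0, this]

/-! ### The Casimir element -/

lemma dtau_neg (n : ℕ) (Y : Matrix (Fin 2) (Fin 2) ℂ) : dtau n (-Y) = -dtau n Y := by
  have := dtau_smul_real n (-1) Y
  simpa using this

/-- `dτ_n(X₁)² + dτ_n(X₂)² + dτ_n(X₃)²`. -/
def casimir (n : ℕ) : EndV n :=
  dtau n (basisU 0) * dtau n (basisU 0) + dtau n (basisU 1) * dtau n (basisU 1) +
    dtau n (basisU 2) * dtau n (basisU 2)

lemma casimir_conj (n : ℕ) (k : U2) : tau n k * casimir n * (tau n k)ᴴ =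
    ∑ l : Fin 3, (dtau n ((k : Matrix (Fin 2) (Fin 2) ℂ) * basisU l.castSucc *
      (k : Matrix (Fin 2) (Fin 2) ℂ)ᴴ)) * (dtau n ((k : Matrix (Fin 2) (Fin 2) ℂ) *
        basisU l.castSucc * (k : Matrix (Fin 2) (Fin 2) ℂ)ᴴ)) := by
  have h1 : (tau n k)ᴴ * tau n k = 1 := by
    rw [← tau_inv, ← tau_mul, inv_mul_cancel, tau_one]
  have h : ∀ S : EndV n, tau n k * (S * S) * (tau n k)ᴴ =
      (tau n k * S * (tau n k)ᴴ) * (tau n k * S * (tau n k)ᴴ) := by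
    intro S
    calc _ = tau n k * S * 1 * S * (tau n k)ᴴ := by simp only [Matrix.mul_assoc, Matrix.one_mul]
      _ = _ := by rw [← h1]; simp only [Matrix.mul_assoc]
  simp only [← dtau_conj, casimir, Fin.sum_univ_three, Matrix.mul_add, Matrix.add_mul, h]
  rfl

lemma tau_commute_of_conj {n : ℕ} {k : U2} {B : EndV n} (h : tau n k * B * (tau n k)ᴴ = B) :
    tau n k * B = B * tau n k := by
  conv_rhs => rw [← h]
  rw [mul_assoc, ← tau_inv, ← tau_mul, inv_mul_cancel, tau_one, mul_one]

/-- Conjugation by the torus rotates the plane of `X₂, X₃`, which leaves the sum of squares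
invariant. -/
lemma casimir_torus (n : ℕ) (a : ℂ) (ha : a * conj a = 1) :
    tau n (torus a ha) * casimir n * (tau n (torus a ha))ᴴ = casimir n := by
  have hre : a.re * a.re + a.im * a.im = 1 := by
    have := congrArg Complex.re ha
    simpa using this
  have h0 : ((torus a ha : U2) : Matrix (Fin 2) (Fin 2) ℂ) * basisU 0 *
      ((torus a ha : U2) : Matrix (Fin 2) (Fin 2) ℂ)ᴴ = basisU 0 := by
    ext i j
    fin_cases i <;> fin_cases j <;>
      simp [torus, basisU, Matrix.mul_apply, Fin.sum_univ_two, Matrix.conjTranspose_apply]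
    linear_combination Complex.I * ha
  have h1 : ((torus a ha : U2) : Matrix (Fin 2) (Fin 2) ℂ) * basisU 1 *
      ((torus a ha : U2) : Matrix (Fin 2) (Fin 2) ℂ)ᴴ =
        (a.re : ℂ) • basisU 1 + (a.im : ℂ) • basisU 2 := by
    ext i j
    fin_cases i <;> fin_cases j <;>
      simp [torus, basisU, Matrix.mul_apply, Fin.sum_univ_two, Matrix.conjTranspose_apply,
        Complex.ext_iff]
  have h2 : ((torus a ha : U2) : Matrix (Fin 2) (Fin 2) ℂ) * basisU 2 *
      ((torus a ha : U2) : Matrix (Fin 2) (Fin 2) ℂ)ᴴ =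
        ((-a.im : ℝ) : ℂ) • basisU 1 + (a.re : ℂ) • basisU 2 := by
    ext i j
    fin_cases i <;> fin_cases j <;>
      simp [torus, basisU, Matrix.mul_apply, Fin.sum_univ_two, Matrix.conjTranspose_apply,
        Complex.ext_iff]
  rw [casimir_conj, Fin.sum_univ_three]
  simp only [Fin.castSucc_zero, Fin.isValue, show Fin.castSucc (1 : Fin 3) = 1 from rfl,
    show Fin.castSucc (2 : Fin 3) = 2 from rfl, h0, h1, h2, dtau_add, dtau_smul_real, casimir]
  have hre' : (a.re : ℂ) * a.re + (a.im : ℂ) * a.im = 1 := by exact_mod_cast hre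
  simp only [Matrix.add_mul, Matrix.mul_add, Matrix.smul_mul, Matrix.mul_smul]
  ext i j
  simp only [Matrix.add_apply, Matrix.smul_apply, smul_eq_mul, Complex.ofReal_neg]
  linear_combination ((dtau n (basisU 1) * dtau n (basisU 1)) i j +
    (dtau n (basisU 2) * dtau n (basisU 2)) i j) * hre'

/-- Conjugation by the rotation permutes `X₁, X₂, X₃` up to signs. -/
lemma casimir_rot (n : ℕ) : tau n rot * casimir n * (tau n rot)ᴴ = casimir n := by
  have h : ((Real.sqrt 2 : ℝ) : ℂ) * ((Real.sqrt 2 : ℝ) : ℂ) = 2 := by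
    rw [← Complex.ofReal_mul, Real.mul_self_sqrt (by norm_num)]; simp
  have hs : ((Real.sqrt 2 : ℝ) : ℂ)⁻¹ * ((Real.sqrt 2 : ℝ) : ℂ)⁻¹ = 1 / 2 := by
    rw [← mul_inv, h]; norm_num
  have hk : ∀ Y : Matrix (Fin 2) (Fin 2) ℂ, ((rot : U2) : Matrix (Fin 2) (Fin 2) ℂ) * Y *
      ((rot : U2) : Matrix (Fin 2) (Fin 2) ℂ)ᴴ =
      (1 / 2 : ℂ) • (!![1, 1; -1, 1] * Y * !![1, -1; 1, 1]) := by
    intro Y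
    have e1 : ((rot : U2) : Matrix (Fin 2) (Fin 2) ℂ) =
      ((Real.sqrt 2 : ℝ) : ℂ)⁻¹ • !![1, 1; -1, 1] := rfl
    have e2 : ((rot : U2) : Matrix (Fin 2) (Fin 2) ℂ)ᴴ =
        ((Real.sqrt 2 : ℝ) : ℂ)⁻¹ • !![1, -1; 1, 1] := by
      rw [e1]
      ext i j
      fin_cases i <;> fin_cases j <;> simp
    rw [e2, e1, Matrix.smul_mul, Matrix.smul_mul, Matrix.mul_smul, smul_smul, hs]
  have h0 : ((rot : U2) : Matrix (Fin 2) (Fin 2) ℂ) * basisU 0 *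
      ((rot : U2) : Matrix (Fin 2) (Fin 2) ℂ)ᴴ = -basisU 2 := by
    rw [hk]
    ext i j
    fin_cases i <;> fin_cases j <;>
      simp [basisU] <;> ring
  have h1 : ((rot : U2) : Matrix (Fin 2) (Fin 2) ℂ) * basisU 1 *
      ((rot : U2) : Matrix (Fin 2) (Fin 2) ℂ)ᴴ = basisU 1 := by
    rw [hk]
    ext i j
    fin_cases i <;> fin_cases j <;>
      simp [basisU] <;> ring
  have h2 : ((rot : U2) : Matrix (Fin 2) (Fin 2) ℂ) * basisU 2 *
      ((rot : U2) : Matrix (Fin 2) (Fin 2) ℂ)ᴴ = basisU 0 := by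
    rw [hk]
    ext i j
    fin_cases i <;> fin_cases j <;>
      simp [basisU] <;> ring
  rw [casimir_conj, Fin.sum_univ_three]
  simp only [Fin.castSucc_zero, Fin.isValue, show Fin.castSucc (1 : Fin 3) = 1 from rfl,
    show Fin.castSucc (2 : Fin 3) = 2 from rfl, h0, h1, h2, dtau_neg, casimir, neg_mul_neg]
  abel

lemma casimir_zero_zero (n : ℕ) : casimir n 0 0 = -((n : ℂ) ^ 2 + 2 * n) := by
  have hrow : ∀ (l : Fin 3) (i : Fin (n + 1)), dtau n (basisU l.castSucc) 0 i =
      -conj (dtau n (basisU l.castSucc) i 0) := by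
    intro l i
    have h1 : (basisU l.castSucc)ᴴ = -basisU l.castSucc := by
      ext a b
      fin_cases l <;> fin_cases a <;> fin_cases b <;> simp [basisU, Matrix.conjTranspose_apply]
    have h2 := congrFun (congrFun (dtau_conjTranspose n (basisU l.castSucc)) 0) i
    rw [h1, dtau_neg, Matrix.conjTranspose_apply, Matrix.neg_apply] at h2
    rw [starRingEnd_apply, h2, neg_neg]
  have h0 := hrow 0
  have h1 := hrow 1
  have h2 := hrow 2
  simp only [Fin.castSucc_zero, show Fin.castSucc (1 : Fin 3) = 1 from rfl,
    show Fin.castSucc (2 : Fin 3) = 2 from rfl] at h0 h1 h2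
  simp only [casimir, Matrix.add_apply, Matrix.mul_apply, h0, h1, h2, dtau_zero_col]
  rcases n with _ | n
  · simp
  · have hs : ((Real.sqrt ((n + 1 : ℕ) : ℝ) : ℝ) : ℂ) * ((Real.sqrt ((n + 1 : ℕ) : ℝ) : ℝ) : ℂ) =
        (n + 1 : ℕ) := by
      rw [← Complex.ofReal_mul, Real.mul_self_sqrt (by positivity)]; simp
    rw [Fin.sum_univ_succ, Fin.sum_univ_succ, Fin.sum_univ_succ, Fin.sum_univ_succ,
      Fin.sum_univ_succ, Fin.sum_univ_succ]
    push_cast at hs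
    simp [basisU]
    linear_combination (-2 : ℂ) * hs +
      (((n : ℂ) + 1) ^ 2 + ((Real.sqrt ((n : ℝ) + 1) : ℝ) : ℂ) ^ 2) * Complex.I_mul_I

/-- The Casimir element commutes with the two elements in Schur's lemma, and one of its entries gives
the scalar. -/
lemma casimir_eq (n : ℕ) : casimir n = (-((n : ℂ) ^ 2 + 2 * n)) • (1 : EndV n) := by
  have h := schur (tau_commute_of_conj (casimir_torus n _ (torusAngle_unit n)))
    (tau_commute_of_conj (casimir_rot n))
  have h0 := casimir_zero_zero n
  rw [h] at h0
  simp only [Matrix.smul_apply, Matrix.one_apply_eq, smul_eq_mul, mul_one] at h0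
  rw [h, h0]

end

section
/-! ### Constant coefficient differential operators -/

/-- The space `C^∞(ℂ²)`. -/
def SmoothFn : Submodule ℂ (C2 → ℂ) where
  carrier := {f | ContDiff ℝ ∞ f}
  add_mem' {f g} (hf : ContDiff ℝ ∞ f) (hg : ContDiff ℝ ∞ g) := hf.add hg
  zero_mem' := (contDiff_const : ContDiff ℝ ∞ fun _ : C2 => (0 : ℂ))
  smul_mem' _ f (hf : ContDiff ℝ ∞ f) := contDiff_const.smul hf

lemma contDiff_coe (f : SmoothFn) : ContDiff ℝ ∞ (f : C2 → ℂ) := f.2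

lemma differentiable_coe (f : SmoothFn) : Differentiable ℝ (f : C2 → ℂ) :=
  (contDiff_coe f).differentiable (by simp)

lemma contDiff_fderiv_apply {f : C2 → ℂ} (hf : ContDiff ℝ ∞ f) (v : C2) :
    ContDiff ℝ ∞ fun z => fderiv ℝ f z v :=
  (hf.fderiv_right (m := ∞) (by simp)).clm_apply contDiff_const

/-- The directional derivative on smooth functions. -/
def dirD (v : C2) : Module.End ℂ SmoothFn where
  toFun f := ⟨fun z => fderiv ℝ (f : C2 → ℂ) z v, contDiff_fderiv_apply (contDiff_coe f) v⟩
  map_add' f g := by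
    ext z
    change fderiv ℝ ((f : C2 → ℂ) + (g : C2 → ℂ)) z v = _
    rw [fderiv_add (differentiable_coe f z) (differentiable_coe g z)]
    rfl
  map_smul' c f := by
    ext z
    change fderiv ℝ (c • (f : C2 → ℂ)) z v = _
    rw [fderiv_const_smul (differentiable_coe f z) c]
    rfl

lemma dirD_apply (v : C2) (f : SmoothFn) (z : C2) :
    (dirD v f : C2 → ℂ) z = fderiv ℝ (f : C2 → ℂ) z v := rfl

lemma dirD_add (v w : C2) : dirD (v + w) = dirD v + dirD w := by
  ext f z
  simp [dirD_apply]

lemma dirD_smul (c : ℝ) (v : C2) : dirD (c • v) = (c : ℂ) • dirD v := by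
  ext f z
  simp [dirD_apply]

lemma dirD_comm (v w : C2) : dirD v * dirD w = dirD w * dirD v := by
  ext f z
  have h2 : ContDiff ℝ ∞ (fderiv ℝ (f : C2 → ℂ)) := (contDiff_coe f).fderiv_right (m := ∞) (by simp)
  have h : ∀ a b : C2, ((dirD a * dirD b) f : C2 → ℂ) z =
      fderiv ℝ (fderiv ℝ (f : C2 → ℂ)) z a b := by
    intro a b
    rw [Module.End.mul_apply, dirD_apply]
    have h3 := ((h2.differentiable (by simp)) z).hasFDerivAt.clm_apply (hasFDerivAt_const b z)
    have h4 : (dirD b f : C2 → ℂ) = fun y => fderiv ℝ (f : C2 → ℂ) y b := rfl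
    rw [h4, h3.fderiv]
    simp
  rw [h, h]
  exact ((contDiff_coe f).contDiffAt.isSymmSndFDerivAt
    (by simpa using WithTop.coe_le_coe.2 (le_top : (2 : ℕ∞) ≤ ⊤))).eq v w

/-- The operators `-2i ∂_{z̄_l}` and `-2i ∂_{z_l}`, substituted for `z_l` and `z̄_l`. -/
def gen (i : Fin 2 ⊕ Fin 2) : Module.End ℂ SmoothFn :=
  (-Complex.I) • (dirD (EuclideanSpace.single (Sum.elim id id i) 1) +
    Sum.elim (fun _ => Complex.I) (fun _ => -Complex.I) i •
      dirD (EuclideanSpace.single (Sum.elim id id i) Complex.I))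

lemma gen_comm (a b : Fin 2 ⊕ Fin 2) : gen a * gen b = gen b * gen a := by
  have h : ∀ v w : C2, Commute (dirD v) (dirD w) := dirD_comm
  have h1 : ∀ (v w w' : C2) (c : ℂ), Commute (dirD v) (dirD w + c • dirD w') := fun v w w' c =>
    (h v w).add_right ((h v w').smul_right c)
  exact (((h1 _ _ _ _).add_left ((h1 _ _ _ _).smul_left _)).smul_left _).smul_right _

/-- The commutative algebra of the constant coefficient differential operators. -/
def opAlg : Subalgebra ℂ (Module.End ℂ SmoothFn) := Algebra.adjoin ℂ (Set.range gen)

instance : IsMulCommutative opAlg := Algebra.isMulCommutative_adjoin ℂ (by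
  rintro _ ⟨a, rfl⟩ _ ⟨b, rfl⟩
  exact gen_comm a b)

open scoped IsMulCommutative in
/-- The homomorphism `p ↦ p(∂)`. -/
def symb : Poly →ₐ[ℂ] Module.End ℂ SmoothFn :=
  opAlg.val.comp (MvPolynomial.aeval fun i => (⟨gen i, Algebra.subset_adjoin ⟨i, rfl⟩⟩ : opAlg))

@[simp] lemma symb_X (i : Fin 2 ⊕ Fin 2) : symb (MvPolynomial.X i) = gen i := by
  simp [symb]

@[simp] lemma symb_C (c : ℂ) : symb (MvPolynomial.C c) = c • 1 := by
  rw [← MvPolynomial.algebraMap_eq, AlgHom.commutes, Algebra.algebraMap_eq_smul_one]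

lemma lineDeriv_eq {f : C2 → ℂ} (hf : ContDiff ℝ ∞ f) (z v : C2) :
    lineDeriv ℝ f z v = fderiv ℝ f z v :=
  (hf.differentiable (by simp) z).lineDeriv_eq_fderiv

lemma dzb_eq (l : Fin 2) (f : SmoothFn) :
    (fun w => -2 * Complex.I * dzb l (f : C2 → ℂ) w) = (gen (Sum.inl l) f : C2 → ℂ) := by
  funext z
  simp only [dzb, lineDeriv_eq (contDiff_coe f), gen, LinearMap.smul_apply, LinearMap.add_apply,
    Submodule.coe_smul, Submodule.coe_add, Pi.smul_apply, Pi.add_apply, dirD_apply, smul_eq_mul,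
    Sum.elim_inl, id]
  ring

lemma dz_eq (l : Fin 2) (f : SmoothFn) :
    (fun w => -2 * Complex.I * dz l (f : C2 → ℂ) w) = (gen (Sum.inr l) f : C2 → ℂ) := by
  funext z
  simp only [dz, lineDeriv_eq (contDiff_coe f), gen, LinearMap.smul_apply, LinearMap.add_apply,
    Submodule.coe_smul, Submodule.coe_add, Pi.smul_apply, Pi.add_apply, dirD_apply, smul_eq_mul,
    Sum.elim_inr, id]
  ring

lemma iterate_eq {T : (C2 → ℂ) → C2 → ℂ} {S : Module.End ℂ SmoothFn}
    (h : ∀ f : SmoothFn, T f = (S f : C2 → ℂ)) (N : ℕ) (f : SmoothFn) :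
    T^[N] f = ((S ^ N) f : SmoothFn) := by
  induction N with
  | zero => rfl
  | succ N ih => rw [Function.iterate_succ_apply', ih, h, pow_succ', Module.End.mul_apply]

lemma polyOp_eq (p : Poly) (f : SmoothFn) : polyOp p f = (symb p f : C2 → ℂ) := by
  funext z
  conv_rhs => rw [p.as_sum]
  rw [map_sum, LinearMap.sum_apply, Submodule.coe_sum, Finset.sum_apply, polyOp]
  refine Finset.sum_congr rfl fun s _ => ?_
  have h1 : (MvPolynomial.monomial s (p.coeff s) : Poly) = MvPolynomial.C (p.coeff s) *
      (MvPolynomial.X (Sum.inl 0) ^ s (Sum.inl 0) * (MvPolynomial.X (Sum.inl 1) ^ s (Sum.inl 1) *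
      (MvPolynomial.X (Sum.inr 0) ^ s (Sum.inr 0) * MvPolynomial.X (Sum.inr 1) ^ s (Sum.inr 1)))) := by
    rw [MvPolynomial.monomial_eq, Finsupp.prod_fintype _ _ (by simp), Fintype.prod_sum_type,
      Fin.prod_univ_two, Fin.prod_univ_two]
    ring
  rw [h1]
  simp only [map_mul, map_pow, symb_X, symb_C, Module.End.mul_apply, LinearMap.smul_apply,
    Module.End.one_apply, Submodule.coe_smul, Pi.smul_apply, smul_eq_mul]
  rw [iterate_eq (dz_eq 1), iterate_eq (dz_eq 0), iterate_eq (dzb_eq 1), iterate_eq (dzb_eq 0)]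

lemma dz_coe (l : Fin 2) (f : SmoothFn) :
    dz l (f : C2 → ℂ) = (((Complex.I / 2) • gen (Sum.inr l)) f : SmoothFn) := by
  rw [LinearMap.smul_apply, Submodule.coe_smul, ← dz_eq]
  funext z
  simp only [Pi.smul_apply, smul_eq_mul]
  linear_combination (dz l (f : C2 → ℂ) z) * Complex.I_mul_I

lemma dzb_coe (l : Fin 2) (f : SmoothFn) :
    dzb l (f : C2 → ℂ) = (((Complex.I / 2) • gen (Sum.inl l)) f : SmoothFn) := by
  rw [LinearMap.smul_apply, Submodule.coe_smul, ← dzb_eq]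
  funext z
  simp only [Pi.smul_apply, smul_eq_mul]
  linear_combination (dzb l (f : C2 → ℂ) z) * Complex.I_mul_I

lemma neg_four_dz_dzb (l p : Fin 2) (f : SmoothFn) :
    (-4 : ℂ) • dz l (dzb p (f : C2 → ℂ)) =
      (symb (MvPolynomial.X (Sum.inl p) * MvPolynomial.X (Sum.inr l)) f : C2 → ℂ) := by
  rw [dzb_coe, dz_coe, map_mul, symb_X, symb_X, gen_comm]
  funext z
  simp only [LinearMap.smul_apply, Submodule.coe_smul, Pi.smul_apply, smul_eq_mul, map_smul,
    Module.End.mul_apply]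
  linear_combination -((gen (Sum.inr l) (gen (Sum.inl p) f) : SmoothFn) : C2 → ℂ) z *
    Complex.I_mul_I

lemma neg_four_dzb_dz (l p : Fin 2) (f : SmoothFn) :
    (-4 : ℂ) • dzb l (dz p (f : C2 → ℂ)) =
      (symb (MvPolynomial.X (Sum.inl l) * MvPolynomial.X (Sum.inr p)) f : C2 → ℂ) := by
  rw [dz_coe, dzb_coe, map_mul, symb_X, symb_X]
  funext z
  simp only [LinearMap.smul_apply, Submodule.coe_smul, Pi.smul_apply, smul_eq_mul, map_smul,
    Module.End.mul_apply]
  linear_combination -((gen (Sum.inl l) (gen (Sum.inr p) f) : SmoothFn) : C2 → ℂ) z *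
    Complex.I_mul_I

/-! ### Polynomials in `z, z̄` as functions -/

/-- Evaluation of polynomials at `(z, z̄)`, as a ring homomorphism. -/
def evalP (z : C2) : Poly →+* ℂ :=
  MvPolynomial.eval (Sum.elim (fun i => z i) (fun i => conj (z i)))

lemma polyFun_eq (p : Poly) (z : C2) : polyFun p z = evalP z p := rfl

@[simp] lemma evalP_inl (z : C2) (l : Fin 2) : evalP z (MvPolynomial.X (Sum.inl l)) = z l := by
  simp [evalP]

@[simp] lemma evalP_inr (z : C2) (l : Fin 2) :
    evalP z (MvPolynomial.X (Sum.inr l)) = conj (z l) := by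
  simp [evalP]

@[simp] lemma evalP_C (z : C2) (c : ℂ) : evalP z (MvPolynomial.C c) = c := by
  simp [evalP]

/-- A polynomial in `z, z̄` which vanishes on `ℂ²` is zero: the substitution
`z = x + i y`, `z̄ = x - i y` is invertible. -/
lemma poly_eq_zero {p : Poly} (h : ∀ z : C2, evalP z p = 0) : p = 0 := by
  set T : Poly →ₐ[ℂ] Poly := MvPolynomial.aeval (Sum.elim
    (fun l => MvPolynomial.X (Sum.inl l) + MvPolynomial.C Complex.I * MvPolynomial.X (Sum.inr l))
    (fun l => MvPolynomial.X (Sum.inl l) - MvPolynomial.C Complex.I * MvPolynomial.X (Sum.inr l)))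
    with hT
  set S : Poly →ₐ[ℂ] Poly := MvPolynomial.aeval (Sum.elim
    (fun l => MvPolynomial.C (1 / 2) * (MvPolynomial.X (Sum.inl l) + MvPolynomial.X (Sum.inr l)))
    (fun l => MvPolynomial.C (-Complex.I / 2) *
      (MvPolynomial.X (Sum.inl l) - MvPolynomial.X (Sum.inr l)))) with hS
  have hCI : (MvPolynomial.C Complex.I * MvPolynomial.C (-Complex.I / 2) : Poly) =
      MvPolynomial.C (1 / 2) := by
    rw [← map_mul]; congr 1; linear_combination (-1 / 2 : ℂ) * Complex.I_mul_I
  have hC2 : (MvPolynomial.C (1 / 2) : Poly) + MvPolynomial.C (1 / 2) = 1 := by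
    rw [← map_add]; norm_num
  have hST : ∀ q, S (T q) = q := by
    intro q
    have : S.comp T = AlgHom.id ℂ Poly := by
      refine MvPolynomial.algHom_ext fun i => ?_
      rcases i with l | l
      · simp only [hS, hT, AlgHom.comp_apply, MvPolynomial.aeval_X, Sum.elim_inl, map_add, map_mul,
          MvPolynomial.algHom_C, MvPolynomial.algebraMap_eq, Sum.elim_inr, AlgHom.id_apply]
        linear_combination ((MvPolynomial.X (Sum.inl l) : Poly) - MvPolynomial.X (Sum.inr l)) * hCI +
          (MvPolynomial.X (Sum.inl l) : Poly) * hC2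
      · simp only [hS, hT, AlgHom.comp_apply, MvPolynomial.aeval_X, Sum.elim_inl, map_sub, map_mul,
          MvPolynomial.algHom_C, MvPolynomial.algebraMap_eq, Sum.elim_inr, AlgHom.id_apply]
        linear_combination (-(MvPolynomial.X (Sum.inl l) : Poly) + MvPolynomial.X (Sum.inr l)) * hCI +
          (MvPolynomial.X (Sum.inr l) : Poly) * hC2
    exact DFunLike.congr_fun this q
  have hT0 : T p = 0 := by
    refine MvPolynomial.funext_set (fun _ => Set.range ((↑) : ℝ → ℂ))
      (fun _ => Set.infinite_range_of_injective Complex.ofReal_injective) fun x hx => ?_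
    rw [map_zero]
    have hx' : ∀ i, ∃ r : ℝ, (r : ℂ) = x i := fun i => hx i trivial
    choose r hr using hx'
    have := h (WithLp.toLp 2 fun l => x (Sum.inl l) + Complex.I * x (Sum.inr l))
    rw [← this, hT, MvPolynomial.aeval_def, MvPolynomial.algebraMap_eq, evalP]
    rw [MvPolynomial.eval_eval₂]
    have he : (MvPolynomial.eval x).comp (MvPolynomial.C : ℂ →+* Poly) = RingHom.id ℂ := by
      ext; simp
    rw [he, MvPolynomial.eval, MvPolynomial.coe_eval₂Hom]
    congr 1
    funext i
    rcases i with l | l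
    · simp
    · simp [← hr, sub_eq_add_neg]
  rw [← hST p, hT0, map_zero]

/-- The polynomial `|z|²`. -/
def normP : Poly := MvPolynomial.X (Sum.inl 0) * MvPolynomial.X (Sum.inr 0) +
  MvPolynomial.X (Sum.inl 1) * MvPolynomial.X (Sum.inr 1)

lemma norm_sq_eq (z : C2) : ((‖z‖ ^ 2 : ℝ) : ℂ) = z 0 * conj (z 0) + z 1 * conj (z 1) := by
  rw [EuclideanSpace.norm_sq_eq, Fin.sum_univ_two, Complex.mul_conj, Complex.mul_conj,
    Complex.normSq_eq_norm_sq, Complex.normSq_eq_norm_sq]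
  push_cast
  ring

lemma evalP_normP (z : C2) : evalP z normP = ((‖z‖ ^ 2 : ℝ) : ℂ) := by
  rw [norm_sq_eq]
  simp [normP]

lemma poly_eq_of_ne_zero {p q : Poly} (h : ∀ z : C2, z ≠ 0 → evalP z p = evalP z q) : p = q := by
  have h1 : (p - q) * normP = 0 := by
    refine poly_eq_zero fun z => ?_
    rw [map_mul, map_sub]
    by_cases hz : z = 0
    · rw [evalP_normP, hz]; simp
    · rw [h z hz, sub_self, zero_mul]
  have h2 : normP ≠ 0 := by
    intro h0
    have := evalP_normP (EuclideanSpace.single 0 1)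
    rw [h0] at this
    simp at this
  rcases mul_eq_zero.1 h1 with h3 | h3
  · exact sub_eq_zero.1 h3
  · exact absurd h3 h2

end

section
variable {n : ℕ}
/-! ### Matrix-valued operators -/

/-- `End(V_n)`-valued polynomials in `z, z̄`. -/
abbrev PolyMat (n : ℕ) := Matrix (Fin (n + 1)) (Fin (n + 1)) Poly

/-- `End(V_n)`-valued smooth functions, as matrices of smooth functions. -/
abbrev SmoothMat (n : ℕ) := Matrix (Fin (n + 1)) (Fin (n + 1)) SmoothFn

/-- The value at `z` of an `End(V_n)`-valued smooth function. -/
def valM {n : ℕ} (F : SmoothMat n) (z : C2) : EndV n := Matrix.of fun a b => (F a b : C2 → ℂ) z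

/-- The operator `P(∂)` acting from the left on `End(V_n)`-valued functions. -/
def actM {n : ℕ} (P : PolyMat n) (F : SmoothMat n) : SmoothMat n :=
  Matrix.of fun a b => ∑ c, symb (P a c) (F c b)

/-- An `End(V_n)`-valued function with smooth entries, as a matrix of smooth functions. -/
def liftM {n : ℕ} (Φ : C2 → EndV n) (h : ∀ a b, ContDiff ℝ ∞ fun z => Φ z a b) : SmoothMat n :=
  Matrix.of fun a b => ⟨fun z => Φ z a b, h a b⟩

lemma valM_liftM {n : ℕ} (Φ : C2 → EndV n) (h : ∀ a b, ContDiff ℝ ∞ fun z => Φ z a b) :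
    valM (liftM Φ h) = Φ := rfl

lemma valM_injective {n : ℕ} : Function.Injective (valM (n := n)) := by
  intro F G h
  ext a b z
  exact congrFun (congrFun (congrFun h z) a) b


lemma actM_mul (P R : PolyMat n) (F : SmoothMat n) : actM (P * R) F = actM P (actM R F) := by
  ext1 a b
  simp only [actM, Matrix.of_apply, Matrix.mul_apply, map_sum, LinearMap.sum_apply, map_mul,
    Module.End.mul_apply]
  rw [Finset.sum_comm]

lemma actM_one (F : SmoothMat n) : actM 1 F = F := by
  ext1 a b
  simp [actM, Matrix.one_apply, apply_ite (symb : Poly → Module.End ℂ SmoothFn),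
    DFunLike.ite_apply]

lemma actM_add (P R : PolyMat n) (F : SmoothMat n) : actM (P + R) F = actM P F + actM R F := by
  ext1 a b
  simp only [actM, Matrix.of_apply, Matrix.add_apply, map_add, LinearMap.add_apply,
    Finset.sum_add_distrib]

lemma actM_sub (P R : PolyMat n) (F : SmoothMat n) : actM (P - R) F = actM P F - actM R F := by
  ext1 a b
  simp only [actM, Matrix.of_apply, Matrix.sub_apply, map_sub, LinearMap.sub_apply,
    Finset.sum_sub_distrib]

lemma actM_C_smul (c : ℂ) (P : PolyMat n) (F : SmoothMat n) :
    actM ((MvPolynomial.C c : Poly) • P) F = c • actM P F := by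
  ext1 a b
  simp only [actM, Matrix.of_apply, Matrix.smul_apply, smul_eq_mul, map_mul, symb_C,
    Module.End.mul_apply, LinearMap.smul_apply, Module.End.one_apply, Finset.smul_sum]

lemma actM_smul_right (P : PolyMat n) (c : ℂ) (F : SmoothMat n) :
    actM P (c • F) = c • actM P F := by
  ext1 a b
  simp only [actM, Matrix.of_apply, Matrix.smul_apply, map_smul, Finset.smul_sum]

lemma actM_sub_right (P : PolyMat n) (F H : SmoothMat n) :
    actM P (F - H) = actM P F - actM P H := by
  ext1 a b
  simp only [actM, Matrix.of_apply, Matrix.sub_apply, map_sub, Finset.sum_sub_distrib]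

lemma actM_smul_one (p : Poly) (F : SmoothMat n) (a b : Fin (n + 1)) :
    actM (p • (1 : PolyMat n)) F a b = symb p (F a b) := by
  rw [actM, Matrix.of_apply, Finset.sum_eq_single a]
  · simp
  · intro c _ hc
    simp [Matrix.one_apply_ne hc.symm]
  · simp

lemma actM_list_prod {ι : Type*} (L : List ι) (f : ι → PolyMat n) (c : ι → ℂ) (F : SmoothMat n)
    (h : ∀ l, actM (f l) F = c l • F) : actM (L.map f).prod F = (L.map c).prod • F := by
  induction L with
  | nil => simp [actM_one]
  | cons l L ih =>
    rw [List.map_cons, List.prod_cons, actM_mul, ih, actM_smul_right, h, List.map_cons,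
      List.prod_cons, smul_smul, mul_comm]

/-! ### The symbol of `𝐃_n` -/

/-- The symbol of `𝐃_n`. -/
def symbolM (n : ℕ) : PolyMat n := Matrix.of fun a b =>
  MvPolynomial.C (Complex.I * dtau n (basisU 0) a b) *
      (MvPolynomial.X (Sum.inl 1) * MvPolynomial.X (Sum.inr 1) -
        MvPolynomial.X (Sum.inl 0) * MvPolynomial.X (Sum.inr 0)) +
    MvPolynomial.C (dtau n (basisU 1) a b) *
      (MvPolynomial.X (Sum.inl 0) * MvPolynomial.X (Sum.inr 1) -
        MvPolynomial.X (Sum.inl 1) * MvPolynomial.X (Sum.inr 0)) -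
    MvPolynomial.C (Complex.I * dtau n (basisU 2) a b) *
      (MvPolynomial.X (Sum.inl 1) * MvPolynomial.X (Sum.inr 0) +
        MvPolynomial.X (Sum.inl 0) * MvPolynomial.X (Sum.inr 1))

lemma lapEnd_valM (F : SmoothMat n) (z : C2) :
    lapEnd (valM F) z = valM (actM (normP • (1 : PolyMat n)) F) z := by
  ext a b
  have h := fun l : Fin 2 => congrFun (neg_four_dz_dzb l l (F a b)) z
  simp only [Pi.smul_apply, smul_eq_mul] at h
  simp only [lapEnd, entrywise, valM, Matrix.of_apply, Matrix.add_apply, lap, actM_smul_one, normP,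
    map_add, LinearMap.add_apply, Submodule.coe_add, Pi.add_apply]
  rw [h 0, h 1]

lemma Dn_valM (F : SmoothMat n) (z : C2) :
    Dn (valM F) z = valM (actM (symbolM n) F) z := by
  ext a b
  have h1 := fun (l : Fin 2) c => congrFun (neg_four_dz_dzb l l (F c b)) z
  have h2 := fun c => congrFun (neg_four_dzb_dz 0 1 (F c b)) z
  have h3 := fun c => congrFun (neg_four_dz_dzb 0 1 (F c b)) z
  simp only [Pi.smul_apply, smul_eq_mul] at h1 h2 h3
  simp only [Dn, entrywise, valM, Matrix.of_apply, Matrix.add_apply, Matrix.sub_apply,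
    Matrix.smul_apply, smul_eq_mul, Matrix.mul_apply, lap, actM, Submodule.coe_sum,
    Finset.sum_apply, Finset.mul_sum]
  rw [← Finset.sum_sub_distrib, ← Finset.sum_add_distrib]
  refine Finset.sum_congr rfl fun c _ => ?_
  rw [h1, h1]
  simp only [symbolM, Matrix.of_apply, map_add, map_sub, map_mul, symb_C, symb_X, LinearMap.add_apply,
    LinearMap.sub_apply, Module.End.mul_apply, LinearMap.smul_apply, Module.End.one_apply,
    Submodule.coe_add, Submodule.coe_sub, Submodule.coe_smul, Pi.add_apply, Pi.sub_apply,
    Pi.smul_apply, smul_eq_mul] at h1 h2 h3 ⊢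
  linear_combination (dtau n (basisU 1) a c - Complex.I * dtau n (basisU 2) a c) * h2 c +
    (-dtau n (basisU 1) a c - Complex.I * dtau n (basisU 2) a c) * h3 c

lemma hasEigenvalues_valM (F : SmoothMat n) (p : ℂ × ℂ) : HasEigenvalues (valM F) p ↔
    actM (normP • (1 : PolyMat n)) F = p.1 • F ∧ actM (symbolM n) F = p.2 • F := by
  have h : ∀ (H : SmoothMat n) (c : ℂ), (∀ z, valM H z = c • valM F z) ↔ H = c • F := by
    intro H c
    constructor
    · intro hz
      refine valM_injective (funext fun z => ?_)
      rw [hz]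
      rfl
    · rintro rfl z
      rfl
  rw [HasEigenvalues]
  simp only [lapEnd_valM, Dn_valM]
  exact and_congr (h _ _) (h _ _)

/-- Evaluation of `End(V_n)`-valued polynomials at `(z, z̄)`. -/
def evalM (z : C2) : PolyMat n →+* EndV n := (evalP z).mapMatrix

lemma evalM_apply (z : C2) (P : PolyMat n) (a b : Fin (n + 1)) :
    evalM z P a b = evalP z (P a b) := rfl

lemma evalM_smul (z : C2) (p : Poly) (P : PolyMat n) :
    evalM z (p • P) = evalP z p • evalM z P := by
  ext a b
  simp [evalM_apply]

lemma polyMat_eq {P R : PolyMat n} (h : ∀ z : C2, z ≠ 0 → evalM z P = evalM z R) : P = R := by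
  ext1 a b
  exact poly_eq_of_ne_zero fun z hz => congrFun (congrFun (h z hz) a) b

/-- The matrix `k_z` as an element of `U₂`, for `|z| = 1`. -/
def kU (z : C2) (hz : ‖z‖ = 1) : U2 :=
  ⟨kMat z, by
    have h := norm_sq_eq z
    rw [hz] at h
    rw [Matrix.mem_unitaryGroup_iff]
    ext i j
    fin_cases i <;> fin_cases j <;>
      simp [kMat, Matrix.mul_apply, Fin.sum_univ_two, Matrix.star_eq_conjTranspose] at h ⊢ <;>
      first | ring1 | linear_combination -h⟩

lemma coe_kU (z : C2) (hz : ‖z‖ = 1) : ((kU z hz : U2) : Matrix (Fin 2) (Fin 2) ℂ) = kMat z := rfl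

/-- The element of `𝔰𝔲₂` whose image under `i dτ_n` is the symbol of `𝐃_n`. -/
def symbolY (z : C2) : Matrix (Fin 2) (Fin 2) ℂ :=
  ((‖z 1‖ ^ 2 - ‖z 0‖ ^ 2 : ℝ) : ℂ) • basisU 0 + ((2 * (z 0 * conj (z 1)).im : ℝ) : ℂ) • basisU 1 +
    ((-2 * (z 0 * conj (z 1)).re : ℝ) : ℂ) • basisU 2

lemma coe_norm_sq (w : ℂ) : ((‖w‖ ^ 2 : ℝ) : ℂ) = w * conj w := by
  rw [Complex.mul_conj, Complex.normSq_eq_norm_sq]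

lemma two_im_mul_I (w v : ℂ) :
    ((2 * (w * conj v).im : ℝ) : ℂ) * Complex.I = w * conj v - v * conj w := by
  have := Complex.sub_conj (w * conj v)
  rw [map_mul, Complex.conj_conj] at this
  push_cast at this ⊢
  linear_combination -this

lemma coe_neg_two_re (w v : ℂ) :
    ((-2 * (w * conj v).re : ℝ) : ℂ) = -(v * conj w + w * conj v) := by
  have := Complex.add_conj (w * conj v)
  rw [map_mul, Complex.conj_conj] at this
  push_cast at this ⊢
  linear_combination this

lemma evalM_symbolM_eq (n : ℕ) (z : C2) :
    evalM z (symbolM n) = Complex.I • dtau n (symbolY z) := by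
  have h2 := two_im_mul_I (z 0) (z 1)
  ext a b
  simp only [symbolY, dtau_add, dtau_smul_real, evalM_apply, symbolM, Matrix.of_apply,
    Matrix.smul_apply, Matrix.add_apply, smul_eq_mul, map_add, map_sub, map_mul, evalP_C, evalP_inl,
    evalP_inr]
  rw [Complex.ofReal_sub, coe_norm_sq, coe_norm_sq, coe_neg_two_re]
  linear_combination (-dtau n (basisU 1) a b) * h2

lemma symbolY_eq (z : C2) : symbolY z = kMat z * basisU 0 * (kMat z)ᴴ := by
  have h2 := two_im_mul_I (z 0) (z 1)
  have h3 : ((2 * (z 0 * conj (z 1)).im : ℝ) : ℂ) =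
      -Complex.I * (z 0 * conj (z 1) - z 1 * conj (z 0)) := by
    linear_combination (-Complex.I) * h2 + ((2 * (z 0 * conj (z 1)).im : ℝ) : ℂ) * Complex.I_mul_I
  rw [symbolY, coe_neg_two_re, h3, Complex.ofReal_sub, coe_norm_sq, coe_norm_sq]
  ext i j
  fin_cases i <;> fin_cases j <;>
    simp [kMat, basisU, Matrix.mul_apply, Fin.sum_univ_two, Matrix.conjTranspose_apply] <;> ring

lemma kMat_smul (r : ℝ) (z : C2) : kMat (r • z) = (r : ℂ) • kMat z := by
  ext i j
  fin_cases i <;> fin_cases j <;> simp [kMat]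

lemma symbolY_smul (r : ℝ) (z : C2) : symbolY (r • z) = ((r ^ 2 : ℝ) : ℂ) • symbolY z := by
  rw [symbolY_eq, symbolY_eq, kMat_smul, Matrix.conjTranspose_smul]
  simp only [Matrix.smul_mul, Matrix.mul_smul, smul_smul]
  congr 1
  simp
  ring

lemma dtau_basisU_zero (n : ℕ) : Complex.I • dtau n (basisU 0) =
    Matrix.diagonal fun i : Fin (n + 1) => (2 * (i : ℕ) - n : ℂ) := by
  have : basisU 0 = !![Complex.I, 0; 0, -Complex.I] := rfl
  rw [this, dtau_diagonal]
  ext i j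
  by_cases h : i = j
  · subst h
    have hi := Nat.lt_succ_iff.1 i.2
    simp only [Matrix.smul_apply, Matrix.diagonal_apply_eq, smul_eq_mul, Nat.cast_sub hi]
    linear_combination (-(2 * (i : ℕ) - n : ℂ)) * Complex.I_mul_I
  · simp [Matrix.diagonal_apply_ne _ h]

lemma norm_unit {z : C2} (hz : z ≠ 0) : ‖‖z‖⁻¹ • z‖ = 1 := by
  rw [norm_smul, norm_inv, norm_norm, inv_mul_cancel₀ (norm_ne_zero_iff.2 hz)]

lemma tau_kMat_conj {z : C2} (hz : ‖z‖ = 1) (n : ℕ) :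
    (tau n (kMat z))ᴴ * tau n (kMat z) = 1 ∧ tau n (kMat z) * (tau n (kMat z))ᴴ = 1 := by
  rw [← coe_kU z hz, ← tau_inv, ← tau_mul, ← tau_mul, inv_mul_cancel, mul_inv_cancel, tau_one]
  exact ⟨rfl, rfl⟩

lemma evalM_symbolM (n : ℕ) {z : C2} (hz : z ≠ 0) : evalM z (symbolM n) =
    tau n (kMat (‖z‖⁻¹ • z)) * Matrix.diagonal (fun i : Fin (n + 1) =>
      ((‖z‖ ^ 2 : ℝ) : ℂ) * (2 * (i : ℕ) - n : ℂ)) * (tau n (kMat (‖z‖⁻¹ • z)))ᴴ := by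
  have hn : ‖z‖ ≠ 0 := norm_ne_zero_iff.2 hz
  have h1 : z = ‖z‖ • (‖z‖⁻¹ • z) := by rw [smul_smul, mul_inv_cancel₀ hn, one_smul]
  have h2 : symbolY z = ((‖z‖ ^ 2 : ℝ) : ℂ) • symbolY (‖z‖⁻¹ • z) := by
    conv_lhs => rw [h1]
    exact symbolY_smul _ _
  have h3 : Matrix.diagonal (fun i : Fin (n + 1) => ((‖z‖ ^ 2 : ℝ) : ℂ) * (2 * (i : ℕ) - n : ℂ)) =
      ((‖z‖ ^ 2 : ℝ) : ℂ) • Complex.I • dtau n (basisU 0) := by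
    rw [dtau_basisU_zero, ← Matrix.diagonal_smul]
    rfl
  rw [evalM_symbolM_eq, h2, symbolY_eq, dtau_smul_real, h3,
    ← coe_kU _ (norm_unit hz), ← dtau_conj]
  simp only [Matrix.mul_smul, Matrix.smul_mul]
  rw [smul_comm]

/-! ### The polynomials `Q^n_{E_{jj}}` -/

/-- The indices different from `j`. -/
def others (n : ℕ) (j : Fin (n + 1)) : List (Fin (n + 1)) :=
  (List.finRange (n + 1)).filter fun l => l ≠ j

lemma mem_others {j l : Fin (n + 1)} : l ∈ others n j ↔ l ≠ j := by
  simp [others]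

lemma length_others (j : Fin (n + 1)) : (others n j).length = n := by
  have h1 : (others n j).Nodup := (List.nodup_finRange _).filter _
  have h2 : (others n j).toFinset = Finset.univ.erase j := by
    ext l
    simp [mem_others]
  rw [← List.toFinset_card_of_nodup h1, h2, Finset.card_erase_of_mem (Finset.mem_univ _)]
  simp

lemma prod_others (i j : Fin (n + 1)) : ((others n i).map fun l : Fin (n + 1) =>
    (((j : ℕ) : ℂ) - (l : ℕ)) / (((i : ℕ) : ℂ) - (l : ℕ))).prod = if i = j then 1 else 0 := by
  split_ifs with h
  · subst h
    refine List.prod_eq_one fun x hx => ?_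
    obtain ⟨l, hl, rfl⟩ := List.mem_map.1 hx
    refine div_self (sub_ne_zero.2 fun h => mem_others.1 hl ?_)
    exact Fin.ext (by exact_mod_cast h.symm)
  · refine List.prod_eq_zero (List.mem_map.2 ⟨j, mem_others.2 (fun h' => h h'.symm), ?_⟩)
    simp

/-- The factor `𝐌 - (2l - n)|z|²`, where `𝐌` is the symbol of `𝐃_n`. -/
def factor (n : ℕ) (l : Fin (n + 1)) : PolyMat n :=
  symbolM n - (MvPolynomial.C (2 * (l : ℕ) - n : ℂ) : Poly) • (normP • (1 : PolyMat n))

/-- The polynomial continuing `Q^n_{E_{jj}}`, by Lagrange interpolation: `E_{jj}` is a polynomial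
in the diagonal matrix with the distinct entries `2l - n`. -/
def lagrangeQ (n : ℕ) (j : Fin (n + 1)) : PolyMat n :=
  ((others n j).map fun l : Fin (n + 1) => (MvPolynomial.C (1 / (2 * (((j : ℕ) : ℂ) - (l : ℕ)))) : Poly) •
    factor n l).prod

lemma conj_list_prod {ι : Type*} {S T : EndV n} (h : T * S = 1) (h' : S * T = 1) (L : List ι)
    (f : ι → EndV n) : (L.map fun l => S * f l * T).prod = S * (L.map f).prod * T := by
  induction L with
  | nil => simp [h']
  | cons l L ih =>
    rw [List.map_cons, List.prod_cons, ih, List.map_cons, List.prod_cons]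
    calc _ = S * f l * (T * S) * (L.map f).prod * T := by simp only [mul_assoc]
      _ = _ := by rw [h, mul_one, mul_assoc S]

lemma evalM_factor {z : C2} (hz : z ≠ 0) (l : Fin (n + 1)) : evalM z (factor n l) =
    tau n (kMat (‖z‖⁻¹ • z)) * Matrix.diagonal (fun i : Fin (n + 1) =>
      ((‖z‖ ^ 2 : ℝ) : ℂ) * (2 * (((i : ℕ) : ℂ) - (l : ℕ)))) * (tau n (kMat (‖z‖⁻¹ • z)))ᴴ := by
  have h1 : evalM z ((MvPolynomial.C (2 * (l : ℕ) - n : ℂ) : Poly) • (normP • (1 : PolyMat n))) =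
      tau n (kMat (‖z‖⁻¹ • z)) * Matrix.diagonal (fun _ : Fin (n + 1) =>
        ((‖z‖ ^ 2 : ℝ) : ℂ) * (2 * (l : ℕ) - n : ℂ)) * (tau n (kMat (‖z‖⁻¹ • z)))ᴴ := by
    have h2 : Matrix.diagonal (fun _ : Fin (n + 1) =>
        ((‖z‖ ^ 2 : ℝ) : ℂ) * (2 * (l : ℕ) - n : ℂ)) =
        (((‖z‖ ^ 2 : ℝ) : ℂ) * (2 * (l : ℕ) - n : ℂ)) • (1 : EndV n) := by
      rw [← Matrix.diagonal_one, ← Matrix.diagonal_smul]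
      congr 1
      funext i
      simp
    rw [h2, Matrix.mul_smul, Matrix.smul_mul, Matrix.mul_one, (tau_kMat_conj (norm_unit hz) n).2,
      evalM_smul, evalM_smul, evalP_C, evalP_normP, map_one, smul_smul, mul_comm]
  rw [factor, map_sub, evalM_symbolM n hz, h1, ← Matrix.sub_mul, ← Matrix.mul_sub,
    Matrix.diagonal_sub]
  congr 3
  funext i
  ring

lemma evalM_lagrangeQ (j : Fin (n + 1)) {z : C2} (hz : z ≠ 0) :
    evalM z (lagrangeQ n j) = Q n (E n j) z := by
  have h1 : ∀ l : Fin (n + 1), evalM z ((MvPolynomial.C (1 / (2 * (((j : ℕ) : ℂ) - (l : ℕ)))) : Poly) •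
      factor n l) = tau n (kMat (‖z‖⁻¹ • z)) * Matrix.diagonalRingHom (Fin (n + 1)) ℂ
        (fun i : Fin (n + 1) => ((‖z‖ ^ 2 : ℝ) : ℂ) *
          ((((i : ℕ) : ℂ) - (l : ℕ)) / (((j : ℕ) : ℂ) - (l : ℕ)))) *
            (tau n (kMat (‖z‖⁻¹ • z)))ᴴ := by
    intro l
    rw [evalM_smul, evalP_C, evalM_factor hz, ← Matrix.smul_mul, ← Matrix.mul_smul,
      ← Matrix.diagonal_smul]
    simp only [Matrix.diagonalRingHom_apply]
    congr 3
    funext i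
    simp only [Pi.smul_apply, smul_eq_mul]
    rw [one_div, mul_inv, div_eq_mul_inv]
    ring
  rw [lagrangeQ, map_list_prod, List.map_map]
  simp only [Function.comp_def, h1]
  rw [conj_list_prod (tau_kMat_conj (norm_unit hz) n).1 (tau_kMat_conj (norm_unit hz) n).2]
  have h2 : ((others n j).map fun l : Fin (n + 1) => Matrix.diagonalRingHom (Fin (n + 1)) ℂ
        (fun i : Fin (n + 1) => ((‖z‖ ^ 2 : ℝ) : ℂ) *
          ((((i : ℕ) : ℂ) - (l : ℕ)) / (((j : ℕ) : ℂ) - (l : ℕ))))).prod =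
      ((‖z‖ ^ (2 * n) : ℝ) : ℂ) • E n j := by
    have h3 := map_list_prod (Matrix.diagonalRingHom (Fin (n + 1)) ℂ) ((others n j).map
      fun l : Fin (n + 1) => (fun i : Fin (n + 1) => ((‖z‖ ^ 2 : ℝ) : ℂ) *
          ((((i : ℕ) : ℂ) - (l : ℕ)) / (((j : ℕ) : ℂ) - (l : ℕ)))))
    rw [List.map_map] at h3
    refine h3.symm.trans ?_
    rw [Matrix.diagonalRingHom_apply]
    ext a b
    have h4 : ((others n j).map fun l : Fin (n + 1) => (fun i : Fin (n + 1) =>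
        ((‖z‖ ^ 2 : ℝ) : ℂ) * ((((i : ℕ) : ℂ) - (l : ℕ)) / (((j : ℕ) : ℂ) - (l : ℕ))))).prod a =
        if j = a then ((‖z‖ ^ (2 * n) : ℝ) : ℂ) else 0 := by
      have h5 := map_list_prod (Pi.evalRingHom (fun _ : Fin (n + 1) => ℂ) a) ((others n j).map
        fun l : Fin (n + 1) => (fun i : Fin (n + 1) => ((‖z‖ ^ 2 : ℝ) : ℂ) *
          ((((i : ℕ) : ℂ) - (l : ℕ)) / (((j : ℕ) : ℂ) - (l : ℕ)))))
      rw [List.map_map] at h5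
      refine h5.trans ?_
      simp only [Function.comp_def, Pi.evalRingHom_apply]
      rw [List.prod_map_mul, prod_others, List.map_const', List.prod_replicate, length_others,
        mul_ite, mul_one, mul_zero, pow_mul]
      push_cast
      rfl
    by_cases hab : a = b
    · subst hab
      rw [Matrix.diagonal_apply_eq, h4]
      by_cases hj : j = a
      · subst hj; simp [E]
      · simp [E, hj]
    · rw [Matrix.diagonal_apply_ne _ hab]
      simp only [E, Matrix.smul_apply, Matrix.single_apply]
      rw [if_neg (fun h => hab (h.1.symm.trans h.2)), smul_zero]
  rw [h2, Q, Matrix.mul_smul, Matrix.smul_mul]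

/-- The Cayley–Hamilton identity for the symbol of `𝐃_n`, whose eigenvalues at `z` are
`(2l - n)|z|²`. -/
lemma prod_factor : ((List.finRange (n + 1)).map (factor n)).prod = 0 := by
  refine polyMat_eq fun z hz => ?_
  rw [map_list_prod, List.map_map, map_zero]
  have h1 : ∀ l : Fin (n + 1), evalM z (factor n l) = tau n (kMat (‖z‖⁻¹ • z)) *
      Matrix.diagonalRingHom (Fin (n + 1)) ℂ (fun i : Fin (n + 1) =>
        ((‖z‖ ^ 2 : ℝ) : ℂ) * (2 * (((i : ℕ) : ℂ) - (l : ℕ)))) * (tau n (kMat (‖z‖⁻¹ • z)))ᴴ :=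
    fun l => evalM_factor hz l
  simp only [Function.comp_def, h1]
  rw [conj_list_prod (tau_kMat_conj (norm_unit hz) n).1 (tau_kMat_conj (norm_unit hz) n).2]
  have h3 := map_list_prod (Matrix.diagonalRingHom (Fin (n + 1)) ℂ) ((List.finRange (n + 1)).map
    fun l : Fin (n + 1) => (fun i : Fin (n + 1) =>
      ((‖z‖ ^ 2 : ℝ) : ℂ) * (2 * (((i : ℕ) : ℂ) - (l : ℕ)))))
  rw [List.map_map] at h3
  have h4 : ((List.finRange (n + 1)).map fun l : Fin (n + 1) => (fun i : Fin (n + 1) =>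
      ((‖z‖ ^ 2 : ℝ) : ℂ) * (2 * (((i : ℕ) : ℂ) - (l : ℕ))))).prod = 0 := by
    funext a
    have h5 := map_list_prod (Pi.evalRingHom (fun _ : Fin (n + 1) => ℂ) a)
      ((List.finRange (n + 1)).map fun l : Fin (n + 1) => (fun i : Fin (n + 1) =>
        ((‖z‖ ^ 2 : ℝ) : ℂ) * (2 * (((i : ℕ) : ℂ) - (l : ℕ)))))
    rw [List.map_map] at h5
    refine h5.trans ?_
    refine List.prod_eq_zero (List.mem_map.2 ⟨a, List.mem_finRange a, ?_⟩)
    simp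
  rw [h4, map_zero] at h3
  have h6 := h3.symm
  simp only [Function.comp_def] at h6
  rw [h6, mul_zero, zero_mul]

lemma actM_factor {F : SmoothMat n} {ξ η : ℂ} (h1 : actM (normP • (1 : PolyMat n)) F = ξ • F)
    (h2 : actM (symbolM n) F = η • F) (l : Fin (n + 1)) :
    actM (factor n l) F = (η - (2 * (l : ℕ) - n : ℂ) * ξ) • F := by
  rw [factor, actM_sub, actM_C_smul, h1, h2, smul_smul]
  exact (sub_smul η ((2 * (l : ℕ) - n : ℂ) * ξ) F).symm

/-- A pair of eigenvalues with a nonzero eigenfunction lies on one of the `n + 1` lines. -/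
lemma exists_line {F : SmoothMat n} (hF : F ≠ 0) {ξ η : ℂ}
    (h1 : actM (normP • (1 : PolyMat n)) F = ξ • F) (h2 : actM (symbolM n) F = η • F) :
    ∃ j : Fin (n + 1), η = (-(n : ℂ) + 2 * ((j : ℕ) : ℂ)) * ξ := by
  have h3 := actM_list_prod (List.finRange (n + 1)) (factor n) _ F (actM_factor h1 h2)
  rw [prod_factor] at h3
  have h4 : actM (0 : PolyMat n) F = 0 := by
    ext1 a b
    simp [actM]
  rw [h4] at h3
  have h5 := (smul_eq_zero.1 h3.symm).resolve_right hF
  rw [List.prod_eq_zero_iff] at h5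
  obtain ⟨j, _, hj⟩ := List.mem_map.1 h5
  exact ⟨j, by linear_combination hj⟩

lemma actM_lagrangeQ {F : SmoothMat n} {ξ : ℂ} {j : Fin (n + 1)}
    (h1 : actM (normP • (1 : PolyMat n)) F = ξ • F)
    (h2 : actM (symbolM n) F = ((-(n : ℂ) + 2 * ((j : ℕ) : ℂ)) * ξ) • F) (i : Fin (n + 1)) :
    actM (lagrangeQ n i) F = (if i = j then ξ ^ n else 0) • F := by
  rw [lagrangeQ, actM_list_prod _ _ (fun l : Fin (n + 1) => ξ *
    ((((j : ℕ) : ℂ) - (l : ℕ)) / (((i : ℕ) : ℂ) - (l : ℕ)))) F]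
  · rw [List.prod_map_mul, prod_others, List.map_const', List.prod_replicate, length_others,
      mul_ite, mul_one, mul_zero]
  · intro l
    rw [actM_C_smul, actM_factor h1 h2, smul_smul]
    congr 1
    rw [one_div, mul_inv, div_eq_mul_inv]
    ring

end

section
/-! ### The action of `U₂` on the sphere -/

lemma rInner_eq_inner (z w : C2) : rInner z w = inner ℝ w z := by
  simp [rInner, PiLp.inner_apply, Complex.inner]

lemma rInner_add (z z' w : C2) : rInner (z + z') w = rInner z w + rInner z' w := by
  simp only [rInner_eq_inner, inner_add_right]

lemma rInner_smul (r : ℝ) (z w : C2) : rInner (r • z) w = r * rInner z w := by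
  simp only [rInner_eq_inner, inner_smul_right]

lemma rInner_zero (w : C2) : rInner 0 w = 0 := by
  simp only [rInner_eq_inner, inner_zero_right]

lemma continuous_rInner : Continuous fun p : C2 × C2 => rInner p.1 p.2 := by
  simp only [rInner_eq_inner]
  fun_prop

lemma rInner_act (k : U2) (z w : C2) : rInner (act k z) (act k w) = rInner z w := by
  have h := Matrix.mem_unitaryGroup_iff'.1 k.2
  have h' : ∀ i j, ∑ l, conj ((k : Matrix (Fin 2) (Fin 2) ℂ) l i) *
      (k : Matrix (Fin 2) (Fin 2) ℂ) l j = if i = j then 1 else 0 := by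
    intro i j
    have := congrFun (congrFun h i) j
    simpa [Matrix.mul_apply, Matrix.star_eq_conjTranspose, Matrix.one_apply] using this
  have h00 := h' 0 0
  have h01 := h' 0 1
  have h10 := h' 1 0
  have h11 := h' 1 1
  simp [Fin.sum_univ_two] at h00 h01 h10 h11
  simp only [rInner, act, Matrix.mulVec, dotProduct, Fin.sum_univ_two, map_add, map_mul]
  congr 1
  linear_combination (z 0 * conj (w 0)) * h00 + (z 1 * conj (w 0)) * h01 +
    (z 0 * conj (w 1)) * h10 + (z 1 * conj (w 1)) * h11

lemma norm_act (k : U2) (z : C2) : ‖act k z‖ = ‖z‖ := by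
  have h := rInner_act k z z
  rw [rInner_eq_inner, rInner_eq_inner, real_inner_self_eq_norm_sq,
    real_inner_self_eq_norm_sq] at h
  exact (sq_eq_sq₀ (norm_nonneg _) (norm_nonneg _)).1 h

lemma act_smul_real (k : Matrix (Fin 2) (Fin 2) ℂ) (r : ℝ) (z : C2) :
    act k (r • z) = r • act k z := by
  ext i
  simp only [act, WithLp.ofLp_smul, Matrix.mulVec_smul, WithLp.toLp_smul]

/-- The action of `k ∈ U₂` as a real linear isometry of `ℂ²`. -/
def actL (k : U2) : C2 ≃ₗᵢ[ℝ] C2 where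
  toFun := act k
  invFun := act (k⁻¹ : U2)
  map_add' := act_add k
  map_smul' r z := act_smul_real k r z
  left_inv z := by
    rw [← act_mul, ← Submonoid.coe_mul, inv_mul_cancel, Submonoid.coe_one, act_one]
  right_inv z := by
    rw [← act_mul, ← Submonoid.coe_mul, mul_inv_cancel, Submonoid.coe_one, act_one]
  norm_map' := norm_act k

lemma actL_apply (k : U2) (z : C2) : actL k z = act k z := rfl

/-- The action of `U₂` on the unit sphere. -/
def sphAct (k : U2) (ζ : S3) : S3 :=
  ⟨act k ζ, by rw [mem_sphere_zero_iff_norm, norm_act]; exact mem_sphere_zero_iff_norm.1 ζ.2⟩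

lemma coe_sphAct (k : U2) (ζ : S3) : (sphAct k ζ : C2) = act k ζ := rfl

lemma continuous_sphAct (k : U2) : Continuous (sphAct k) :=
  Continuous.subtype_mk ((actL k).continuous.comp continuous_subtype_val) _

instance : IsProbabilityMeasure sigma := by
  refine ⟨?_⟩
  rw [sigma, Measure.smul_apply, smul_eq_mul]
  refine ENNReal.inv_mul_cancel ?_ (measure_ne_top _ _)
  rw [Ne, Measure.measure_univ_eq_zero]
  exact Measure.toSphere_ne_zero _

open scoped Pointwise in
lemma measurePreserving_sphAct (k : U2) : MeasurePreserving (sphAct k) sigma sigma := by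
  refine ⟨(continuous_sphAct k).measurable, ?_⟩
  ext s hs
  rw [Measure.map_apply (continuous_sphAct k).measurable hs, sigma, Measure.smul_apply,
    Measure.smul_apply, Measure.toSphere_apply' _ hs,
    Measure.toSphere_apply' _ ((continuous_sphAct k).measurable hs)]
  congr 2
  have h1 : (fun ζ : S3 => (ζ : C2)) '' (sphAct k ⁻¹' s) =
      actL k ⁻¹' ((fun ζ : S3 => (ζ : C2)) '' s) := by
    ext z
    constructor
    · rintro ⟨ζ, hζ, rfl⟩
      exact ⟨sphAct k ζ, hζ, rfl⟩
    · rintro ⟨ζ, hζ, h⟩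
      have hz : ‖z‖ = 1 := by
        rw [← norm_act k z, ← actL_apply, ← h]
        exact mem_sphere_zero_iff_norm.1 ζ.2
      refine ⟨⟨z, mem_sphere_zero_iff_norm.2 hz⟩, ?_, rfl⟩
      have : sphAct k ⟨z, mem_sphere_zero_iff_norm.2 hz⟩ = ζ := Subtype.ext h.symm
      rwa [Set.mem_preimage, this]
  have h2 : Set.Ioo (0 : ℝ) 1 • ((fun ζ : S3 => (ζ : C2)) '' (sphAct k ⁻¹' s)) =
      actL k ⁻¹' (Set.Ioo (0 : ℝ) 1 • ((fun ζ : S3 => (ζ : C2)) '' s)) := by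
    rw [h1]
    ext z
    simp only [Set.mem_smul, Set.mem_preimage]
    constructor
    · rintro ⟨r, hr, y, hy, rfl⟩
      exact ⟨r, hr, actL k y, hy, (map_smul (actL k) r y).symm⟩
    · rintro ⟨r, hr, y, hy, h⟩
      refine ⟨r, hr, (actL k).symm y, by simpa using hy, ?_⟩
      rw [← map_smul, h, LinearIsometryEquiv.symm_apply_apply]
  rw [h2]
  exact (actL k).measurePreserving.measure_preimage_equiv (f := (actL k).toMeasurableEquiv) _

lemma integral_sphAct (k : U2) {f : S3 → ℂ} (hf : Continuous f) :
    ∫ ζ, f (sphAct k ζ) ∂sigma = ∫ ζ, f ζ ∂sigma := by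
  conv_rhs => rw [← (measurePreserving_sphAct k).map_eq]
  rw [integral_map (continuous_sphAct k).measurable.aemeasurable hf.aestronglyMeasurable]

lemma integrable_sigma {f : S3 → ℂ} (hf : Continuous f) : Integrable f sigma :=
  hf.integrable_of_hasCompactSupport (HasCompactSupport.of_compactSpace f)

/-! ### Fourier integrals over the sphere -/

/-- `∫_{S³} e^{-is⟨z,ζ⟩} a(ζ) dσ(ζ)`, as a function of `z`. -/
def expInt (s : ℝ) (a : S3 → ℂ) (z : C2) : ℂ :=
  ∫ ζ : S3, Complex.exp (-Complex.I * (s * rInner z ζ : ℝ)) * a ζ ∂sigma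

lemma continuous_expInt_integrand (s : ℝ) {a : S3 → ℂ} (ha : Continuous a) (z : C2) :
    Continuous fun ζ : S3 => Complex.exp (-Complex.I * (s * rInner z ζ : ℝ)) * a ζ := by
  have h : Continuous fun ζ : S3 => rInner z ζ :=
    continuous_rInner.comp (continuous_const.prodMk continuous_subtype_val)
  fun_prop

lemma norm_exp_neg_I_mul (t : ℝ) : ‖Complex.exp (-Complex.I * (t : ℂ))‖ = 1 := by
  rw [show -Complex.I * (t : ℂ) = ((-t : ℝ) : ℂ) * Complex.I by push_cast; ring]
  exact Complex.norm_exp_ofReal_mul_I _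

/-- The factor produced by the differentiation of `e^{-is⟨z,ζ⟩}` in the direction `v`. -/
def dirFactor (s : ℝ) (v : C2) (a : S3 → ℂ) (ζ : S3) : ℂ :=
  (-Complex.I * (s * rInner v ζ : ℝ)) * a ζ

lemma continuous_dirFactor (s : ℝ) (v : C2) {a : S3 → ℂ} (ha : Continuous a) :
    Continuous (dirFactor s v a) := by
  have h : Continuous fun ζ : S3 => rInner v ζ :=
    continuous_rInner.comp (continuous_const.prodMk continuous_subtype_val)
  unfold dirFactor
  fun_prop

lemma continuous_derivForm (s : ℝ) : Continuous fun ζ : S3 =>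
    (-Complex.I * (s : ℂ)) • Complex.ofRealCLM.comp (innerSL ℝ (ζ : C2)) := by
  have h : Continuous fun ζ : S3 => Complex.ofRealCLM.comp (innerSL ℝ (ζ : C2)) :=
    (ContinuousLinearMap.compL ℝ C2 ℝ ℂ Complex.ofRealCLM).continuous.comp
      ((innerSL ℝ).continuous.comp continuous_subtype_val)
  exact h.const_smul (-Complex.I * (s : ℂ))

lemma hasFDerivAt_expInt (s : ℝ) {a : S3 → ℂ} (ha : Continuous a) (z : C2) :
    HasFDerivAt (expInt s a) (∫ ζ : S3, (Complex.exp (-Complex.I * (s * rInner z ζ : ℝ)) * a ζ) •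
      ((-Complex.I * (s : ℂ)) • Complex.ofRealCLM.comp (innerSL ℝ (ζ : C2))) ∂sigma) z := by
  obtain ⟨M, hM⟩ := IsCompact.exists_bound_of_continuousOn isCompact_univ ha.continuousOn
  have hc : ∀ ζ : S3, ‖(-Complex.I * (s : ℂ)) • Complex.ofRealCLM.comp (innerSL ℝ (ζ : C2))‖ ≤
      |s| := by
    intro ζ
    refine ContinuousLinearMap.opNorm_le_bound _ (abs_nonneg s) fun v => ?_
    have h2 := abs_real_inner_le_norm (ζ : C2) v
    rw [mem_sphere_zero_iff_norm.1 ζ.2, one_mul] at h2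
    have h3 : ‖((-Complex.I * (s : ℂ)) • Complex.ofRealCLM.comp (innerSL ℝ (ζ : C2))) v‖ =
        |s| * |inner ℝ (ζ : C2) v| := by
      simp
    rw [h3]
    gcongr
  refine hasFDerivAt_integral_of_dominated_of_fderiv_le (s := Set.univ) (bound := fun _ => M * |s|)
    (F := fun (z : C2) (ζ : S3) => Complex.exp (-Complex.I * (s * rInner z ζ : ℝ)) * a ζ)
    (F' := fun (z : C2) (ζ : S3) => (Complex.exp (-Complex.I * (s * rInner z ζ : ℝ)) * a ζ) •
      ((-Complex.I * (s : ℂ)) • Complex.ofRealCLM.comp (innerSL ℝ (ζ : C2)))) Filter.univ_mem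
    (Filter.Eventually.of_forall fun y =>
      (continuous_expInt_integrand s ha y).aestronglyMeasurable)
    (integrable_sigma (continuous_expInt_integrand s ha z)) ?_ ?_ (integrable_const _) ?_
  · refine Continuous.aestronglyMeasurable ?_
    refine (continuous_expInt_integrand s ha z).smul (continuous_derivForm s)
  · refine Filter.Eventually.of_forall fun ζ y _ => ?_
    rw [norm_smul, norm_mul, norm_exp_neg_I_mul, one_mul]
    exact mul_le_mul (hM ζ trivial) (hc ζ) (norm_nonneg _) ((norm_nonneg _).trans (hM ζ trivial))
  · refine Filter.Eventually.of_forall fun ζ y _ => ?_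
    have h1 : HasFDerivAt (fun y : C2 => ((rInner y ζ : ℝ) : ℂ))
        (Complex.ofRealCLM.comp (innerSL ℝ (ζ : C2))) y := by
      have := (Complex.ofRealCLM.comp (innerSL ℝ (ζ : C2))).hasFDerivAt (x := y)
      refine this.congr_of_eventuallyEq (Filter.Eventually.of_forall fun w => ?_)
      simp [rInner_eq_inner]
    have h2 := ((h1.const_mul (-Complex.I * (s : ℂ))).cexp).mul_const (a ζ)
    have h3 : (fun y : C2 => Complex.exp (-Complex.I * ((s * rInner y ζ : ℝ) : ℂ)) * a ζ) =
        fun y : C2 => Complex.exp (-Complex.I * (s : ℂ) * ((rInner y ζ : ℝ) : ℂ)) * a ζ := by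
      funext w
      push_cast
      rw [mul_assoc]
    rw [h3]
    refine h2.congr_fderiv ?_
    ext v
    simp
    ring_nf

lemma fderiv_expInt (s : ℝ) {a : S3 → ℂ} (ha : Continuous a) (z v : C2) :
    fderiv ℝ (expInt s a) z v = expInt s (dirFactor s v a) z := by
  rw [(hasFDerivAt_expInt s ha z).fderiv, ContinuousLinearMap.integral_apply, expInt]
  · refine integral_congr_ae (Filter.Eventually.of_forall fun ζ => ?_)
    simp [dirFactor, rInner_eq_inner]
    ring
  · refine Continuous.integrable_of_hasCompactSupport ?_ (HasCompactSupport.of_compactSpace _)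
    refine (continuous_expInt_integrand s ha z).smul (continuous_derivForm s)

lemma contDiff_expInt (s : ℝ) {a : S3 → ℂ} (ha : Continuous a) : ContDiff ℝ ∞ (expInt s a) := by
  rw [contDiff_infty]
  intro N
  induction N generalizing a with
  | zero =>
    exact contDiff_zero.2
      (continuous_iff_continuousAt.2 fun z => (hasFDerivAt_expInt s ha z).continuousAt)
  | succ N ih =>
    push_cast
    rw [contDiff_succ_iff_fderiv_apply]
    refine ⟨fun z => (hasFDerivAt_expInt s ha z).differentiableAt, by simp, fun v => ?_⟩
    simp only [fderiv_expInt s ha]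
    exact ih (continuous_dirFactor s v ha)

/-- `expInt` as an element of `C^∞(ℂ²)`. -/
def expIntS (s : ℝ) {a : S3 → ℂ} (ha : Continuous a) : SmoothFn :=
  ⟨expInt s a, contDiff_expInt s ha⟩

lemma continuous_evalP (p : Poly) : Continuous fun z : C2 => evalP z p := by
  unfold evalP
  refine MvPolynomial.continuous_eval p |>.comp (continuous_pi fun i => ?_)
  rcases i with i | i <;> simp <;> fun_prop

lemma continuous_polySph (s : ℝ) (p : Poly) {a : S3 → ℂ} (ha : Continuous a) :
    Continuous fun ζ : S3 => evalP (-(s • (ζ : C2))) p * a ζ :=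
  ((continuous_evalP p).comp (by fun_prop)).mul ha

lemma expInt_add (s : ℝ) {a b : S3 → ℂ} (ha : Continuous a) (hb : Continuous b) (z : C2) :
    expInt s (fun ζ => a ζ + b ζ) z = expInt s a z + expInt s b z := by
  simp only [expInt, mul_add]
  exact integral_add (integrable_sigma (continuous_expInt_integrand s ha z))
    (integrable_sigma (continuous_expInt_integrand s hb z))

lemma expInt_smul (s : ℝ) (c : ℂ) (a : S3 → ℂ) (z : C2) :
    expInt s (fun ζ => c * a ζ) z = c * expInt s a z := by
  simp only [expInt]
  rw [← integral_const_mul]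
  congr 1
  funext ζ
  ring

/-- The factors produced by the operators `-2i ∂_{z̄_l}` and `-2i ∂_{z_l}` are the coordinates
of `-sζ` and their conjugates. -/
lemma gen_factor (s : ℝ) (i : Fin 2 ⊕ Fin 2) (ζ : C2) :
    -Complex.I * (-Complex.I * (s * rInner (EuclideanSpace.single (Sum.elim id id i) 1) ζ : ℝ) +
      Sum.elim (fun _ => Complex.I) (fun _ => -Complex.I) i *
        (-Complex.I * (s * rInner (EuclideanSpace.single (Sum.elim id id i) Complex.I) ζ : ℝ))) =
      evalP (-(s • ζ)) (MvPolynomial.X i) := by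
  have h2 : ∀ l : Fin 2, rInner (EuclideanSpace.single l 1) ζ = (ζ l).re := by
    intro l
    fin_cases l <;> simp [rInner]
  have h3 : ∀ l : Fin 2, rInner (EuclideanSpace.single l Complex.I) ζ = (ζ l).im := by
    intro l
    fin_cases l <;> simp [rInner]
  rcases i with l | l
  · simp only [evalP_inl, Sum.elim_inl, id]
    rw [h2, h3]
    have h4 := Complex.re_add_im (ζ l)
    simp only [PiLp.neg_apply, PiLp.smul_apply, Complex.real_smul]
    push_cast
    linear_combination (s * ((ζ l).re + Complex.I * (ζ l).im)) * Complex.I_mul_I - s * h4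
  · simp only [evalP_inr, Sum.elim_inr, id]
    rw [h2, h3]
    have h4 := Complex.re_add_im (ζ l)
    have h6 := congrArg conj h4
    simp only [map_add, map_mul, Complex.conj_ofReal, Complex.conj_I] at h6
    simp only [PiLp.neg_apply, PiLp.smul_apply, Complex.real_smul, map_neg, map_mul,
      Complex.conj_ofReal]
    push_cast
    linear_combination (s * ((ζ l).re - Complex.I * (ζ l).im)) * Complex.I_mul_I - s * h6

/-- `p(∂)` acts on the Fourier integrals by multiplication of the density by `p(-sζ)`. -/
lemma symb_expInt (s : ℝ) (p : Poly) {a : S3 → ℂ} (ha : Continuous a) :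
    symb p (expIntS s ha) = expIntS s (continuous_polySph s p ha) := by
  induction p using MvPolynomial.induction_on generalizing a with
  | C c =>
    ext z
    rw [symb_C]
    simp only [expIntS, LinearMap.smul_apply, Module.End.one_apply, Submodule.coe_smul,
      Pi.smul_apply, smul_eq_mul, evalP_C]
    rw [expInt_smul]
  | add p q hp hq =>
    ext z
    rw [map_add, LinearMap.add_apply, hp, hq]
    simp only [expIntS, Submodule.coe_add, Pi.add_apply, map_add, add_mul]
    rw [expInt_add s (continuous_polySph s p ha) (continuous_polySph s q ha)]
  | mul_X p i hp =>
    have hX : symb (MvPolynomial.X i) (expIntS s ha) =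
        expIntS s (continuous_polySph s (MvPolynomial.X i) ha) := by
      ext z
      have h1 : ∀ v, (dirD v (expIntS s ha) : C2 → ℂ) z = expInt s (dirFactor s v a) z :=
        fun v => fderiv_expInt s ha z v
      rw [symb_X]
      simp only [gen, LinearMap.smul_apply, LinearMap.add_apply, Submodule.coe_smul,
        Submodule.coe_add, Pi.smul_apply, Pi.add_apply, smul_eq_mul, h1]
      rw [← expInt_smul]
      have h5 := fun (c : ℂ) (v w : C2) => expInt_add s (continuous_dirFactor s v ha)
        (b := fun ζ => c * dirFactor s w a ζ)
        (continuous_const.mul (continuous_dirFactor s w ha)) z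
      rw [← h5, ← expInt_smul]
      simp only [expIntS]
      congr 1
      funext ζ
      rw [← gen_factor]
      simp only [dirFactor]
      ring
    rw [map_mul, Module.End.mul_apply, hX, hp]
    ext z
    simp only [expIntS, map_mul, mul_assoc]

lemma norm_expInt_le (s : ℝ) {a : S3 → ℂ} {M : ℝ} (hM : ∀ ζ, ‖a ζ‖ ≤ M) (z : C2) :
    ‖expInt s a z‖ ≤ M := by
  refine (norm_integral_le_of_norm_le_const (C := M) (Filter.Eventually.of_forall fun ζ => ?_)).trans
    (by simp)
  rw [norm_mul, norm_exp_neg_I_mul, one_mul]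
  exact hM ζ

end

section
variable {n : ℕ}
/-! ### The functions `Φ_{ξ,j}` -/

lemma Q_unit (B : EndV n) (d : ℕ) {z : C2} (hz : ‖z‖ = 1) :
    Q d B z = tau n (kMat z) * B * (tau n (kMat z))ᴴ := by
  simp [Q, hz]

/-- `k_{kζ} = k k_ζ d` with `d` in the stabilizer of `(0, 1)`, which consists of diagonal matrices,
so `Q^n_{E_{jj}}` is equivariant. -/
lemma Q_act (j : Fin (n + 1)) (k : U2) {z : C2} (hz : ‖z‖ = 1) :
    Q n (E n j) (act k z) = tau n k * Q n (E n j) z * (tau n k)ᴴ := by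
  have hkz : ‖act k z‖ = 1 := by rw [norm_act, hz]
  rw [Q_unit _ _ hz, Q_unit _ _ hkz]
  set d : U2 := (kU (act k z) hkz)⁻¹ * k * kU z hz with hd
  have hkd : k * kU z hz = kU (act k z) hkz * d := by rw [hd]; group
  have hnz := norm_sq_eq (act k z)
  rw [hkz] at hnz
  have h01 : (d : Matrix (Fin 2) (Fin 2) ℂ) 0 1 = 0 ∧ (d : Matrix (Fin 2) (Fin 2) ℂ) 1 1 = 1 := by
    have h1 : ∀ i, ((k : Matrix (Fin 2) (Fin 2) ℂ) * kMat z) i 1 = (act k z) i := by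
      intro i
      fin_cases i <;>
        simp [act, kMat, Matrix.mul_apply, Fin.sum_univ_two]
    have h2 : (d : Matrix (Fin 2) (Fin 2) ℂ) =
        (kMat (act k z))ᴴ * ((k : Matrix (Fin 2) (Fin 2) ℂ) * kMat z) := by
      rw [← mul_assoc]; rfl
    rw [h2, Matrix.mul_apply, Matrix.mul_apply, Fin.sum_univ_two, Fin.sum_univ_two, h1, h1]
    simp [kMat, Matrix.conjTranspose_apply] at hnz ⊢
    exact ⟨by ring, by linear_combination -hnz⟩
  have hu := Matrix.mem_unitaryGroup_iff.1 d.2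
  have h11 := congrFun (congrFun hu 1) 1
  have h00 := congrFun (congrFun hu 0) 0
  simp [Matrix.mul_apply, Fin.sum_univ_two, Matrix.star_eq_conjTranspose, h01.1, h01.2,
    Complex.mul_conj] at h11 h00
  have hdt : d = torus ((d : Matrix (Fin 2) (Fin 2) ℂ) 0 0) (by
      rw [Complex.mul_conj, h00, Complex.ofReal_one]) := by
    apply Subtype.ext
    ext a b
    fin_cases a <;> fin_cases b <;> simp [torus, h01.1, h01.2, h11]
  have htau : tau n k * tau n (kMat z) = tau n (kMat (act k z)) * tau n d := by
    rw [← coe_kU z hz, ← coe_kU _ hkz, ← tau_mul, ← tau_mul, hkd]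
  have hcomm : tau n d * E n j * (tau n d)ᴴ = E n j := by
    have h1 : tau n d * (tau n d)ᴴ = 1 := by rw [← tau_inv, ← tau_mul, mul_inv_cancel, tau_one]
    have h2 : tau n d * E n j = E n j * tau n d := by
      rw [hdt, tau_torus]
      ext a b
      simp only [Matrix.diagonal_mul, Matrix.mul_diagonal, E, Matrix.single_apply]
      by_cases h : j = a ∧ j = b
      · rw [← h.1, ← h.2, mul_comm]
      · simp [h]
    rw [h2, mul_assoc, h1, mul_one]
  calc _ = tau n (kMat (act k z)) * (tau n d * E n j * (tau n d)ᴴ) * (tau n (kMat (act k z)))ᴴ := by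
        rw [hcomm]
    _ = (tau n (kMat (act k z)) * tau n d) * E n j *
        (tau n (kMat (act k z)) * tau n d)ᴴ := by
        rw [Matrix.conjTranspose_mul]; simp only [mul_assoc]
    _ = _ := by rw [← htau, Matrix.conjTranspose_mul]; simp only [mul_assoc]

lemma norm_S3 (ζ : S3) : ‖(ζ : C2)‖ = 1 := mem_sphere_zero_iff_norm.1 ζ.2

lemma S3_ne_zero (ζ : S3) : (ζ : C2) ≠ 0 := by
  rw [← norm_ne_zero_iff, norm_S3]; exact one_ne_zero

lemma continuous_Q (j : Fin (n + 1)) (a b : Fin (n + 1)) :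
    Continuous fun ζ : S3 => Q n (E n j) (ζ : C2) a b := by
  have h : (fun ζ : S3 => Q n (E n j) (ζ : C2) a b) =
      fun ζ : S3 => evalP (ζ : C2) (lagrangeQ n j a b) := by
    funext ζ
    rw [← evalM_lagrangeQ j (S3_ne_zero ζ), evalM_apply]
  rw [h]
  exact (continuous_evalP _).comp continuous_subtype_val

lemma PhiSph_apply (j : Fin (n + 1)) (ξ : ℝ) (z : C2) (a b : Fin (n + 1)) :
    PhiSph n j ξ z a b =
      ((n : ℂ) + 1) * expInt (Real.sqrt ξ) (fun ζ => Q n (E n j) (ζ : C2) a b) z := rfl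

/-- `Φ_{ξ,j}` as a matrix of smooth functions. -/
def PhiS (n : ℕ) (j : Fin (n + 1)) (ξ : ℝ) : SmoothMat n :=
  Matrix.of fun a b => ((n : ℂ) + 1) • expIntS (Real.sqrt ξ) (continuous_Q j a b)

lemma valM_PhiS (j : Fin (n + 1)) (ξ : ℝ) : valM (PhiS n j ξ) = PhiSph n j ξ := rfl

lemma expInt_sum {ι : Type*} (S : Finset ι) (s : ℝ) {a : ι → S3 → ℂ} (ha : ∀ i, Continuous (a i))
    (z : C2) : expInt s (fun ζ => ∑ i ∈ S, a i ζ) z = ∑ i ∈ S, expInt s (a i) z := by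
  simp only [expInt, Finset.mul_sum]
  exact integral_finsetSum _ fun i _ => integrable_sigma (continuous_expInt_integrand s (ha i) z)

lemma valM_actM_PhiS (P : PolyMat n) (j : Fin (n + 1)) (ξ : ℝ) (z : C2) (a b : Fin (n + 1)) :
    valM (actM P (PhiS n j ξ)) z a b = ((n : ℂ) + 1) * expInt (Real.sqrt ξ)
      (fun ζ => (evalM (-(Real.sqrt ξ • (ζ : C2))) P * Q n (E n j) (ζ : C2)) a b) z := by
  simp only [valM, actM, PhiS, Matrix.of_apply, map_smul, symb_expInt, Matrix.mul_apply]
  have h := expInt_sum Finset.univ (Real.sqrt ξ) (a := fun c (ζ : S3) =>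
    evalP (-(Real.sqrt ξ • (ζ : C2))) (P a c) * Q n (E n j) (ζ : C2) c b)
    (fun c => continuous_polySph _ _ (continuous_Q j c b)) z
  refine Eq.trans ?_ (congrArg (((n : ℂ) + 1) * ·) h.symm)
  simp only [Submodule.coe_sum, Finset.sum_apply, Submodule.coe_smul, Pi.smul_apply, smul_eq_mul,
    Finset.mul_sum]
  rfl

lemma evalM_symbolM_mul_Q (j : Fin (n + 1)) (ζ : S3) :
    evalM (ζ : C2) (symbolM n) * Q n (E n j) (ζ : C2) =
      (-(n : ℂ) + 2 * ((j : ℕ) : ℂ)) • Q n (E n j) (ζ : C2) := by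
  have h := norm_S3 ζ
  rw [evalM_symbolM n (S3_ne_zero ζ), Q_unit _ _ h, h]
  simp only [inv_one, one_smul, one_pow, Complex.ofReal_one, one_mul]
  have h1 := (tau_kMat_conj h n).1
  have h2 : Matrix.diagonal (fun i : Fin (n + 1) => (2 * (i : ℕ) - n : ℂ)) * E n j =
      (-(n : ℂ) + 2 * ((j : ℕ) : ℂ)) • E n j := by
    ext a b
    simp only [Matrix.diagonal_mul, E, Matrix.smul_apply, Matrix.single_apply, smul_eq_mul]
    by_cases h : j = a ∧ j = b
    · rw [← h.1]; ring
    · simp [h]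
  calc _ = tau n (kMat ζ) * Matrix.diagonal (fun i : Fin (n + 1) => (2 * (i : ℕ) - n : ℂ)) *
        ((tau n (kMat ζ))ᴴ * tau n (kMat ζ)) * E n j * (tau n (kMat ζ))ᴴ := by
        simp only [mul_assoc]
    _ = tau n (kMat ζ) * (Matrix.diagonal (fun i : Fin (n + 1) => (2 * (i : ℕ) - n : ℂ)) *
        E n j) * (tau n (kMat ζ))ᴴ := by rw [h1, mul_one]; simp only [mul_assoc]
    _ = _ := by rw [h2, Matrix.mul_smul, Matrix.smul_mul]

lemma evalM_symbolM_smul (r : ℝ) (z : C2) :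
    evalM (r • z) (symbolM n) = ((r ^ 2 : ℝ) : ℂ) • evalM z (symbolM n) := by
  rw [evalM_symbolM_eq, evalM_symbolM_eq, symbolY_smul, dtau_smul_real, smul_comm]

lemma evalP_normP_smul (r : ℝ) (z : C2) :
    evalP (r • z) normP = ((r ^ 2 : ℝ) : ℂ) * evalP z normP := by
  rw [evalP_normP, evalP_normP, norm_smul, mul_pow, Real.norm_eq_abs, sq_abs]
  push_cast
  rfl

lemma evalM_lagrangeQ_smul (j : Fin (n + 1)) (r : ℝ) (z : C2) :
    evalM (r • z) (lagrangeQ n j) = ((r ^ (2 * n) : ℝ) : ℂ) • evalM z (lagrangeQ n j) := by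
  have h1 : ∀ l : Fin (n + 1), evalM (r • z) ((MvPolynomial.C (1 / (2 * (((j : ℕ) : ℂ) - (l : ℕ)))) :
      Poly) • factor n l) = ((r ^ 2 : ℝ) : ℂ) • evalM z ((MvPolynomial.C
        (1 / (2 * (((j : ℕ) : ℂ) - (l : ℕ)))) : Poly) • factor n l) := by
    intro l
    rw [evalM_smul, evalM_smul, evalP_C, evalP_C, smul_comm]
    congr 1
    rw [factor, map_sub (evalM (r • z)), map_sub (evalM z), evalM_symbolM_smul, smul_sub, evalM_smul, evalM_smul, evalM_smul,
      evalM_smul, evalP_normP_smul, evalP_C, evalP_C, map_one, map_one, smul_smul, smul_smul,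
      smul_smul, mul_left_comm, mul_assoc]
  have h2 : ∀ L : List (Fin (n + 1)), evalM (r • z) (L.map fun l : Fin (n + 1) =>
      (MvPolynomial.C (1 / (2 * (((j : ℕ) : ℂ) - (l : ℕ)))) : Poly) • factor n l).prod =
      ((r ^ (2 * L.length) : ℝ) : ℂ) • evalM z (L.map fun l : Fin (n + 1) =>
      (MvPolynomial.C (1 / (2 * (((j : ℕ) : ℂ) - (l : ℕ)))) : Poly) • factor n l).prod := by
    intro L
    induction L with
    | nil => simp
    | cons l L ih =>
      rw [List.map_cons, List.prod_cons, map_mul, map_mul, ih, h1, Matrix.smul_mul, Matrix.mul_smul,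
        smul_smul, List.length_cons]
      congr 1
      push_cast
      ring
  have h3 := h2 (others n j)
  rw [length_others] at h3
  exact h3

lemma PhiS_eigen (j : Fin (n + 1)) {ξ : ℝ} (hξ : 0 ≤ ξ) :
    actM (normP • (1 : PolyMat n)) (PhiS n j ξ) = (ξ : ℂ) • PhiS n j ξ ∧
    actM (symbolM n) (PhiS n j ξ) = ((-(n : ℂ) + 2 * ((j : ℕ) : ℂ)) * ξ) • PhiS n j ξ := by
  constructor <;> refine valM_injective (funext fun z => ?_) <;> ext a b <;>
    rw [valM_actM_PhiS]
  · have h : ∀ ζ : S3, (evalM (-(Real.sqrt ξ • (ζ : C2))) (normP • (1 : PolyMat n)) *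
        Q n (E n j) (ζ : C2)) a b = (ξ : ℂ) * Q n (E n j) (ζ : C2) a b := by
      intro ζ
      rw [evalM_smul, map_one, ← neg_smul, evalP_normP_smul, evalP_normP, norm_S3, neg_sq,
        Real.sq_sqrt hξ]
      simp
    simp only [h, expInt_smul]
    rw [mul_left_comm]
    rfl
  · have h : ∀ ζ : S3, (evalM (-(Real.sqrt ξ • (ζ : C2))) (symbolM n) *
        Q n (E n j) (ζ : C2)) a b =
        ((-(n : ℂ) + 2 * ((j : ℕ) : ℂ)) * ξ) * Q n (E n j) (ζ : C2) a b := by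
      intro ζ
      rw [← neg_smul, evalM_symbolM_smul, Matrix.smul_mul, evalM_symbolM_mul_Q, neg_sq,
        Real.sq_sqrt hξ, Matrix.smul_apply, Matrix.smul_apply, smul_eq_mul, smul_eq_mul]
      ring
    simp only [h, expInt_smul]
    rw [mul_left_comm]
    rfl

lemma PhiSph_hasEigenvalues (j : Fin (n + 1)) {ξ : ℝ} (hξ : 0 ≤ ξ) :
    HasEigenvalues (PhiSph n j ξ) ((ξ : ℂ), (-(n : ℂ) + 2 * ((j : ℕ) : ℂ)) * (ξ : ℂ)) := by
  rw [← valM_PhiS, hasEigenvalues_valM]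
  exact PhiS_eigen j hξ

lemma PhiSph_act (j : Fin (n + 1)) (ξ : ℝ) (k : U2) (z : C2) :
    PhiSph n j ξ (act k z) = tau n k * PhiSph n j ξ z * (tau n k)ᴴ := by
  have hc := fun a b => integrable_sigma
    (continuous_expInt_integrand (Real.sqrt ξ) (continuous_Q j a b) z)
  have h1 := integral_matrix_mul (μ := sigma) (F := fun ζ : S3 => Matrix.of fun a b =>
    Complex.exp (-Complex.I * (Real.sqrt ξ * rInner z ζ : ℝ)) * Q n (E n j) (ζ : C2) a b) hc
    (tau n k) (tau n k)ᴴ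
  have h2 : ∀ a b, ∫ ζ : S3, Complex.exp (-Complex.I * (Real.sqrt ξ * rInner (act k z) ζ : ℝ)) *
      Q n (E n j) (ζ : C2) a b ∂sigma = ∫ ζ : S3, (tau n k * (Matrix.of fun a b =>
        Complex.exp (-Complex.I * (Real.sqrt ξ * rInner z ζ : ℝ)) * Q n (E n j) (ζ : C2) a b) *
          (tau n k)ᴴ) a b ∂sigma := by
    intro a b
    rw [← integral_sphAct k (continuous_expInt_integrand (Real.sqrt ξ) (continuous_Q j a b) _)]
    refine integral_congr_ae (Filter.Eventually.of_forall fun ζ => ?_)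
    have h3 : (Matrix.of fun a b => Complex.exp (-Complex.I * (Real.sqrt ξ * rInner z ζ : ℝ)) *
        Q n (E n j) (ζ : C2) a b) = Complex.exp (-Complex.I * (Real.sqrt ξ * rInner z ζ : ℝ)) •
          Q n (E n j) (ζ : C2) := rfl
    simp only [coe_sphAct, rInner_act, Q_act j k (norm_S3 ζ), h3, Matrix.mul_smul, Matrix.smul_mul,
      Matrix.smul_apply, smul_eq_mul]
  have h4 : (Matrix.of fun a b => ∫ ζ : S3, Complex.exp (-Complex.I *
      (Real.sqrt ξ * rInner (act k z) ζ : ℝ)) * Q n (E n j) (ζ : C2) a b ∂sigma) =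
      tau n k * (Matrix.of fun a b => ∫ ζ : S3, Complex.exp (-Complex.I *
      (Real.sqrt ξ * rInner z ζ : ℝ)) * Q n (E n j) (ζ : C2) a b ∂sigma) * (tau n k)ᴴ := by
    simp only [h2]
    exact h1
  rw [PhiSph, h4, PhiSph, Matrix.mul_smul, Matrix.smul_mul]

lemma trace_Q (j : Fin (n + 1)) (ζ : S3) : (Q n (E n j) (ζ : C2)).trace = 1 := by
  rw [Q_unit _ _ (norm_S3 ζ), Matrix.trace_mul_comm, ← mul_assoc, (tau_kMat_conj (norm_S3 ζ) n).1,
    one_mul, E, Matrix.trace_single_eq_same]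

lemma PhiSph_zero (j : Fin (n + 1)) (ξ : ℝ) : PhiSph n j ξ 0 = 1 := by
  have h0 : ∀ k : U2, act k 0 = 0 := fun k => by simp [act]
  have h1 : ∀ k : U2, tau n k * PhiSph n j ξ 0 * (tau n k)ᴴ = PhiSph n j ξ 0 := by
    intro k
    rw [← PhiSph_act, h0]
  have h2 := schur_of_conj h1
  have h3 : (PhiSph n j ξ 0).trace = (n : ℂ) + 1 := by
    have h4 := integral_trace (μ := sigma) (F := fun ζ : S3 => Q n (E n j) (ζ : C2))
      (fun a b => integrable_sigma (continuous_Q j a b)) 1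
    simp only [one_mul, trace_Q, integral_const, probReal_univ, one_smul] at h4
    rw [PhiSph, Matrix.trace_smul]
    simp only [rInner_zero, mul_zero, Complex.ofReal_zero, Complex.exp_zero, one_mul]
    rw [← h4, smul_eq_mul, mul_one]
  rw [h2, h3, div_self, one_smul]
  exact_mod_cast Nat.succ_ne_zero n

lemma PhiSph_param_zero (j : Fin (n + 1)) : PhiSph n j 0 = fun _ => 1 := by
  funext z
  rw [← PhiSph_zero j 0]
  simp [PhiSph]

lemma PhiSph_bounded (j : Fin (n + 1)) (ξ : ℝ) (a b : Fin (n + 1)) :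
    ∃ C : ℝ, ∀ z, ‖PhiSph n j ξ z a b‖ ≤ C := by
  obtain ⟨M, hM⟩ := IsCompact.exists_bound_of_continuousOn isCompact_univ
    (continuous_Q j a b).continuousOn
  refine ⟨((n : ℝ) + 1) * M, fun z => ?_⟩
  rw [PhiSph_apply, norm_mul]
  have h1 : ‖(n : ℂ) + 1‖ = (n : ℝ) + 1 := by
    rw [show (n : ℂ) + 1 = ((n + 1 : ℕ) : ℂ) by push_cast; rfl, Complex.norm_natCast]
    push_cast; rfl
  rw [h1]
  gcongr
  exact norm_expInt_le _ (fun ζ => hM ζ trivial) z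

/-! ### The formulas for `Φ_{ξ,j}` in terms of the scalar spherical functions -/

lemma continues_lagrangeQ (j : Fin (n + 1)) : Continues (lagrangeQ n j) (Q n (E n j)) := by
  intro z hz a b
  rw [polyFun_eq, ← evalM_lagrangeQ j hz, evalM_apply]

lemma eq_lagrangeQ {j : Fin (n + 1)} {P : PolyMat n} (h : Continues P (Q n (E n j))) :
    P = lagrangeQ n j := by
  refine polyMat_eq fun z hz => ?_
  rw [evalM_lagrangeQ j hz]
  ext a b
  exact h z hz a b

lemma phi_eq_expInt (ξ : ℝ) : phi ξ = expInt (Real.sqrt ξ) fun _ => 1 := by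
  funext z
  simp only [phi, expInt, rInner_smul, mul_one]

lemma polyOpEnd_phi (j : Fin (n + 1)) (ξ : ℝ) (z : C2) (a b : Fin (n + 1)) :
    polyOpEnd (lagrangeQ n j) (phi ξ) z a b = ((Real.sqrt ξ ^ (2 * n) : ℝ) : ℂ) *
      expInt (Real.sqrt ξ) (fun ζ => Q n (E n j) (ζ : C2) a b) z := by
  have h : phi ξ = (expIntS (Real.sqrt ξ) (continuous_const (y := (1 : ℂ))) : C2 → ℂ) :=
    phi_eq_expInt ξ
  rw [polyOpEnd, Matrix.of_apply, h, polyOp_eq, symb_expInt, ← expInt_smul]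
  simp only [expIntS]
  congr 1
  funext ζ
  rw [mul_one, ← neg_smul, ← evalM_apply, evalM_lagrangeQ_smul, evalM_lagrangeQ j (S3_ne_zero ζ),
    Matrix.smul_apply, smul_eq_mul, Even.neg_pow ⟨n, by ring⟩]

lemma PhiSph_eq_polyOpEnd (j : Fin (n + 1)) {ξ : ℝ} (hξ : 0 < ξ) (z : C2) :
    PhiSph n j ξ z = (((ξ : ℂ) ^ n)⁻¹ * ((n : ℂ) + 1)) • polyOpEnd (lagrangeQ n j) (phi ξ) z := by
  ext a b
  have h0 : (ξ : ℂ) ^ n ≠ 0 := pow_ne_zero _ (by exact_mod_cast hξ.ne')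
  rw [Matrix.smul_apply, smul_eq_mul, polyOpEnd_phi, PhiSph_apply, pow_mul, Real.sq_sqrt hξ.le]
  push_cast
  field_simp

lemma PhiSph_eq_polyOpEnd_one (j : Fin (n + 1)) (ξ : ℝ) (z : C2) :
    PhiSph n j ξ z = ((n : ℂ) + 1) • polyOpEnd (lagrangeQ n j) (phi 1) (Real.sqrt ξ • z) := by
  ext a b
  rw [Matrix.smul_apply, smul_eq_mul, polyOpEnd_phi, PhiSph_apply]
  simp [expInt, rInner_smul]

end

section
/-! ### One-parameter subgroups and the algebra of polynomial functions on `U₂` -/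

lemma lieU_smul (t : ℝ) (x : Fin 4 → ℝ) : lieU (t • x) = (t : ℂ) • lieU x := by
  simp only [lieU, Pi.smul_apply, smul_eq_mul, Finset.smul_sum, smul_smul, Complex.ofReal_mul]

lemma lieU_single (l : Fin 4) : lieU (Pi.single l 1) = basisU l := by
  rw [lieU, Finset.sum_eq_single l]
  · simp
  · intro b _ hb
    simp [Pi.single_eq_of_ne hb]
  · simp

lemma coe_expU (x : Fin 4 → ℝ) :
    ((expU x : U2) : Matrix (Fin 2) (Fin 2) ℂ) = NormedSpace.exp (lieU x) := rfl

lemma coe_expU_smul (t : ℝ) (x : Fin 4 → ℝ) :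
    ((expU (t • x) : U2) : Matrix (Fin 2) (Fin 2) ℂ) = NormedSpace.exp ((t : ℂ) • lieU x) := by
  rw [coe_expU, lieU_smul]

lemma expU_zero : expU 0 = 1 := by
  apply Subtype.ext
  rw [coe_expU]
  simp [lieU, NormedSpace.exp_zero]

lemma expU_add_smul (s t : ℝ) (x : Fin 4 → ℝ) :
    expU ((s + t) • x) = expU (s • x) * expU (t • x) := by
  apply Subtype.ext
  rw [Submonoid.coe_mul, coe_expU_smul, coe_expU_smul, coe_expU_smul,
    ← Matrix.exp_add_of_commute _ _ (((Commute.refl (lieU x)).smul_left _).smul_right _)]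
  congr 1
  push_cast
  rw [add_smul]

open scoped Matrix.Norms.Operator in
lemma contDiff_exp_lieU (a b : Fin 2) :
    ContDiff ℝ ∞ fun x : Fin 4 → ℝ => (NormedSpace.exp (lieU x) : Matrix (Fin 2) (Fin 2) ℂ) a b := by
  have h1 : ContDiff ℝ ∞ fun x : Fin 4 → ℝ => lieU x := by
    unfold lieU
    exact ContDiff.sum fun l _ =>
      (Complex.ofRealCLM.contDiff.comp (contDiff_apply ℝ ℝ l)).smul contDiff_const
  have h2 : ContDiff ℝ ∞ (NormedSpace.exp : Matrix (Fin 2) (Fin 2) ℂ → _) :=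
    contDiff_iff_contDiffAt.2 fun A => (NormedSpace.exp_analytic (𝕂 := ℝ) A).contDiffAt
  exact (LinearMap.toContinuousLinearMap
    (Matrix.entryLinearMap ℝ ℂ a b : Matrix (Fin 2) (Fin 2) ℂ →ₗ[ℝ] ℂ)).contDiff.comp (h2.comp h1)

/-- The algebra of the polynomial functions on `U₂` (in the entries and their conjugates). -/
def PolK : Subalgebra ℂ (U2 → ℂ) :=
  Algebra.adjoin ℂ (Set.range (fun (p : Fin 2 × Fin 2) (k : U2) =>
      (k : Matrix (Fin 2) (Fin 2) ℂ) p.1 p.2) ∪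
    Set.range (fun (p : Fin 2 × Fin 2) (k : U2) => conj ((k : Matrix (Fin 2) (Fin 2) ℂ) p.1 p.2)))

lemma entry_mem_PolK (a b : Fin 2) : (fun k : U2 => (k : Matrix (Fin 2) (Fin 2) ℂ) a b) ∈ PolK :=
  Algebra.subset_adjoin (Or.inl ⟨(a, b), rfl⟩)

lemma conj_entry_mem_PolK (a b : Fin 2) :
    (fun k : U2 => conj ((k : Matrix (Fin 2) (Fin 2) ℂ) a b)) ∈ PolK :=
  Algebra.subset_adjoin (Or.inr ⟨(a, b), rfl⟩)

lemma const_mem_PolK (c : ℂ) : (fun _ : U2 => c) ∈ PolK := PolK.algebraMap_mem c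

lemma conj_mem_PolK {c : U2 → ℂ} (hc : c ∈ PolK) : (fun k => conj (c k)) ∈ PolK := by
  induction hc using Algebra.adjoin_induction with
  | mem c hc =>
    rcases hc with ⟨p, rfl⟩ | ⟨p, rfl⟩
    · exact conj_entry_mem_PolK _ _
    · simpa using entry_mem_PolK p.1 p.2
  | algebraMap r => exact const_mem_PolK (conj r)
  | add f g _ _ hf hg =>
    have e : (fun k => conj ((f + g) k)) = (fun k => conj (f k)) + fun k => conj (g k) := by
      funext k
      simp
    exact e ▸ PolK.add_mem hf hg
  | mul f g _ _ hf hg =>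
    have e : (fun k => conj ((f * g) k)) = (fun k => conj (f k)) * fun k => conj (g k) := by
      funext k
      simp
    exact e ▸ PolK.mul_mem hf hg

lemma symPow_mem_PolK (n : ℕ) {A : U2 → Matrix (Fin 2) (Fin 2) ℂ}
    (hA : ∀ a b, (fun k => A k a b) ∈ PolK) (i j : Fin (n + 1)) :
    (fun k => symPow n (A k) i j) ∈ PolK := by
  set M : Fin 2 → Fin 2 → U2 → ℂ := fun a b k => A k a b with hM
  have e : (fun k => symPow n (A k) i j) =
      (fun _ => ((Real.sqrt (n.choose j) : ℝ) : ℂ) / ((Real.sqrt (n.choose i) : ℝ) : ℂ)) *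
        ∑ r ∈ Finset.range ((j : ℕ) + 1), ∑ s ∈ Finset.range (n - (j : ℕ) + 1),
          if r + s = (i : ℕ) then
            (fun _ => ((j : ℕ).choose r : ℂ) * ((n - (j : ℕ)).choose s : ℂ)) *
              (M 0 0 ^ r * M 0 1 ^ ((j : ℕ) - r) * (M 1 0 ^ s * M 1 1 ^ (n - (j : ℕ) - s)))
          else 0 := by
    funext k
    simp only [symPow, Matrix.of_apply, Pi.mul_apply, Finset.sum_apply]
    congr 1
    refine Finset.sum_congr rfl fun r _ => Finset.sum_congr rfl fun s _ => ?_
    split_ifs <;> rfl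
  rw [e]
  refine PolK.mul_mem (const_mem_PolK _) (PolK.sum_mem fun r _ => PolK.sum_mem fun s _ => ?_)
  split_ifs
  · exact PolK.mul_mem (const_mem_PolK _) (PolK.mul_mem
      (PolK.mul_mem (PolK.pow_mem (hA 0 0) _) (PolK.pow_mem (hA 0 1) _))
      (PolK.mul_mem (PolK.pow_mem (hA 1 0) _) (PolK.pow_mem (hA 1 1) _)))
  · exact PolK.zero_mem

lemma tauU_mem_PolK (m : ℤ) (n : ℕ) (i j : Fin (n + 1)) : (fun k => tauU m n k i j) ∈ PolK := by
  have h1 : (fun k : U2 => (k : Matrix (Fin 2) (Fin 2) ℂ).det) ∈ PolK := by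
    have : (fun k : U2 => (k : Matrix (Fin 2) (Fin 2) ℂ).det) =
        (fun k : U2 => (k : Matrix (Fin 2) (Fin 2) ℂ) 0 0) *
          (fun k : U2 => (k : Matrix (Fin 2) (Fin 2) ℂ) 1 1) -
        (fun k : U2 => (k : Matrix (Fin 2) (Fin 2) ℂ) 0 1) *
          (fun k : U2 => (k : Matrix (Fin 2) (Fin 2) ℂ) 1 0) := by
      funext k
      simp [Matrix.det_fin_two]
    rw [this]
    exact PolK.sub_mem (PolK.mul_mem (entry_mem_PolK _ _) (entry_mem_PolK _ _))
      (PolK.mul_mem (entry_mem_PolK _ _) (entry_mem_PolK _ _))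
  have h2 : ∀ N : ℤ, (fun k : U2 => (k : Matrix (Fin 2) (Fin 2) ℂ).det ^ N) ∈ PolK := by
    intro N
    obtain ⟨d, rfl | rfl⟩ := N.eq_nat_or_neg
    · simp only [zpow_natCast]
      exact PolK.pow_mem h1 d
    · have : (fun k : U2 => (k : Matrix (Fin 2) (Fin 2) ℂ).det ^ (-(d : ℤ))) =
          (fun k : U2 => conj (k : Matrix (Fin 2) (Fin 2) ℂ).det) ^ d := by
        funext k
        rw [_root_.zpow_neg, zpow_natCast, ← inv_pow, Pi.pow_apply]
        congr 1
        exact inv_eq_of_mul_eq_one_right (det_U2_mul_conj k)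
      rw [this]
      exact PolK.pow_mem (conj_mem_PolK h1) d
  have h3 : (fun k => tauU m n k i j) = (fun k : U2 => (k : Matrix (Fin 2) (Fin 2) ℂ).det ^
      (((n : ℤ) - m) / 2)) * fun k : U2 => symPow n (k : Matrix (Fin 2) (Fin 2) ℂ)ᴴ i j := by
    funext k
    rw [tauU, tau_eq_star]
    rfl
  rw [h3]
  exact PolK.mul_mem (h2 _) (symPow_mem_PolK n (fun a b => conj_entry_mem_PolK b a) i j)

lemma continuous_PolK {c : U2 → ℂ} (hc : c ∈ PolK) : Continuous c := by
  induction hc using Algebra.adjoin_induction with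
  | mem c hc =>
    rcases hc with ⟨p, rfl⟩ | ⟨p, rfl⟩
    · exact continuous_subtype_val.matrix_elem _ _
    · exact Complex.continuous_conj.comp (continuous_subtype_val.matrix_elem _ _)
  | algebraMap r => exact continuous_const
  | add f g _ _ hf hg => exact hf.add hg
  | mul f g _ _ hf hg => exact hf.mul hg

lemma contDiff_PolK {c : U2 → ℂ} (hc : c ∈ PolK) (k : U2) :
    ContDiff ℝ ∞ fun x : Fin 4 → ℝ => c (k * expU x) := by
  have he : ∀ a b : Fin 2, ContDiff ℝ ∞ fun x : Fin 4 → ℝ =>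
      ((k * expU x : U2) : Matrix (Fin 2) (Fin 2) ℂ) a b := by
    intro a b
    simp only [Submonoid.coe_mul, Matrix.mul_apply, coe_expU]
    exact ContDiff.sum fun i _ => contDiff_const.mul (contDiff_exp_lieU i b)
  induction hc using Algebra.adjoin_induction with
  | mem c hc =>
    rcases hc with ⟨p, rfl⟩ | ⟨p, rfl⟩
    · exact he _ _
    · exact Complex.conjCLE.contDiff.comp (he _ _)
  | algebraMap r => exact contDiff_const
  | add f g _ _ hf hg => exact hf.add hg
  | mul f g _ _ hf hg => exact hf.mul hg

lemma hasDerivAt_mul_expU (k : U2) (x : Fin 4 → ℝ) (a b : Fin 2) :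
    HasDerivAt (fun t : ℝ => ((k * expU (t • x) : U2) : Matrix (Fin 2) (Fin 2) ℂ) a b)
      (((k : Matrix (Fin 2) (Fin 2) ℂ) * lieU x) a b) 0 := by
  simp only [Submonoid.coe_mul, Matrix.mul_apply, coe_expU_smul]
  exact HasDerivAt.fun_sum fun i _ => (hasDerivAt_exp_entry (lieU x) i b).const_mul _

lemma exists_deriv_PolK {c : U2 → ℂ} (hc : c ∈ PolK) (x : Fin 4 → ℝ) :
    ∃ c' ∈ PolK, ∀ k, HasDerivAt (fun t : ℝ => c (k * expU (t • x))) (c' k) 0 := by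
  have hm : ∀ a b, (fun k : U2 => ((k : Matrix (Fin 2) (Fin 2) ℂ) * lieU x) a b) ∈ PolK := by
    intro a b
    have : (fun k : U2 => ((k : Matrix (Fin 2) (Fin 2) ℂ) * lieU x) a b) =
        ∑ i, (fun k : U2 => (k : Matrix (Fin 2) (Fin 2) ℂ) a i) * fun _ => lieU x i b := by
      funext k
      simp [Matrix.mul_apply]
    rw [this]
    exact PolK.sum_mem fun i _ => PolK.mul_mem (entry_mem_PolK _ _) (const_mem_PolK _)
  have h0 : ∀ k : U2, k * expU ((0 : ℝ) • x) = k := fun k => by rw [zero_smul, expU_zero, mul_one]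
  induction hc using Algebra.adjoin_induction with
  | mem c hc =>
    rcases hc with ⟨p, rfl⟩ | ⟨p, rfl⟩
    · exact ⟨_, hm p.1 p.2, fun k => hasDerivAt_mul_expU k x _ _⟩
    · exact ⟨_, conj_mem_PolK (hm p.1 p.2), fun k =>
        Complex.conjCLE.hasFDerivAt.comp_hasDerivAt _ (hasDerivAt_mul_expU k x _ _)⟩
  | algebraMap r => exact ⟨0, PolK.zero_mem, fun k => hasDerivAt_const _ _⟩
  | add f g _ _ hf hg =>
    obtain ⟨f', hf', hfd⟩ := hf
    obtain ⟨g', hg', hgd⟩ := hg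
    exact ⟨f' + g', PolK.add_mem hf' hg', fun k => (hfd k).add (hgd k)⟩
  | mul f g hfm hgm hf hg =>
    obtain ⟨f', hf', hfd⟩ := hf
    obtain ⟨g', hg', hgd⟩ := hg
    refine ⟨f' * g + f * g', PolK.add_mem (PolK.mul_mem hf' hgm) (PolK.mul_mem hfm hg'), fun k => ?_⟩
    have := (hfd k).mul (hgd k)
    rw [h0] at this
    exact this

/-! ### Left-invariant operators on tensor products -/

/-- The function `(k, z) ↦ f(k)(z)` on `G`. -/
def ofFam (f : U2 → SmoothFn) (g : G) : ℂ := (f g.k : C2 → ℂ) g.z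

/-- The symbol of the directional derivative. -/
def linP (v : C2) : Poly :=
  ∑ l : Fin 2, (MvPolynomial.C (Complex.I / 2 * v l) * MvPolynomial.X (Sum.inr l) +
    MvPolynomial.C (Complex.I / 2 * conj (v l)) * MvPolynomial.X (Sum.inl l))

lemma dirD_eq_symb (v : C2) : dirD v = symb (linP v) := by
  have h1 : v = ∑ l : Fin 2, ((v l).re • (EuclideanSpace.single l 1 : C2) +
      (v l).im • (EuclideanSpace.single l Complex.I : C2)) := by
    ext i
    fin_cases i <;> simp [Fin.sum_univ_two]
  have h2 : ∀ l : Fin 2, dirD ((v l).re • (EuclideanSpace.single l 1 : C2) +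
      (v l).im • (EuclideanSpace.single l Complex.I : C2)) =
      symb (MvPolynomial.C (Complex.I / 2 * v l) * MvPolynomial.X (Sum.inr l) +
    MvPolynomial.C (Complex.I / 2 * conj (v l)) * MvPolynomial.X (Sum.inl l)) := by
    intro l
    have h4 := Complex.re_add_im (v l)
    have h6 := congrArg conj h4
    simp only [map_add, map_mul, Complex.conj_ofReal, Complex.conj_I] at h6
    rw [dirD_add, dirD_smul, dirD_smul, map_add, map_mul symb, map_mul symb, symb_C, symb_C, symb_X,
      symb_X]
    simp only [smul_mul_assoc, one_mul, gen, Sum.elim_inl, Sum.elim_inr, id, smul_add, smul_smul]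
    rw [← h6, ← h4]
    generalize dirD (EuclideanSpace.single l 1 : C2) = A
    generalize dirD (EuclideanSpace.single l Complex.I : C2) = B
    simp only [Complex.add_re, Complex.ofReal_re, Complex.mul_re, Complex.I_re, mul_zero,
      Complex.ofReal_im, Complex.I_im, mul_one, sub_self, add_zero, Complex.add_im, Complex.mul_im,
      zero_add]
    match_scalars
    · linear_combination (((v l).re : ℝ) : ℂ) * Complex.I_mul_I
    · linear_combination (-(((v l).im : ℝ) : ℂ) * (Complex.I * Complex.I - 1)) * Complex.I_mul_I
  have h3 : dirD v = ∑ l : Fin 2, dirD ((v l).re • (EuclideanSpace.single l 1 : C2) +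
      (v l).im • (EuclideanSpace.single l Complex.I : C2)) := by
    conv_lhs => rw [h1]
    simp only [Fin.sum_univ_two, dirD_add]
  rw [h3, linP, map_sum]
  exact Finset.sum_congr rfl fun l _ => h2 l

lemma hasDerivAt_dir (F : SmoothFn) (z v : C2) :
    HasDerivAt (fun t : ℝ => (F : C2 → ℂ) (z + t • v)) ((dirD v F : C2 → ℂ) z) 0 := by
  have h1 : HasDerivAt (fun t : ℝ => z + t • v) v 0 := by
    simpa using ((hasDerivAt_id (0 : ℝ)).smul_const v).const_add z
  have h2 : HasFDerivAt (F : C2 → ℂ) (fderiv ℝ (F : C2 → ℂ) z) (z + (0 : ℝ) • v) := by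
    rw [zero_smul, add_zero]
    exact (differentiable_coe F z).hasFDerivAt
  exact h2.comp_hasDerivAt (0 : ℝ) h1

lemma fieldC_ofFam (v : C2) (f : U2 → SmoothFn) :
    fieldC v (ofFam f) = ofFam fun k => dirD (act k v) (f k) := by
  funext g
  have h : ∀ t : ℝ, ofFam f (g * ofC (t • v)) = (f g.k : C2 → ℂ) (g.z + t • act g.k v) := by
    intro t
    simp only [ofFam, mul_k, mul_z, ofC, mul_one, act_smul_real]
  simp only [fieldC, h]
  exact (hasDerivAt_dir (f g.k) g.z (act g.k v)).deriv

/-- The functions `k ↦ Σ_i c_i(k) p_i`, with `c_i` polynomial on `U₂` and polynomials `p_i` in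
`z, z̄`. -/
def SymK : Submodule ℂ (U2 → Poly) :=
  Submodule.span ℂ {q | ∃ c ∈ PolK, ∃ p : Poly, q = fun k => MvPolynomial.C (c k) * p}

lemma mem_SymK {c : U2 → ℂ} (hc : c ∈ PolK) (p : Poly) :
    (fun k => MvPolynomial.C (c k) * p) ∈ SymK := Submodule.subset_span ⟨c, hc, p, rfl⟩

lemma mul_mem_SymK {q : U2 → Poly} (hq : q ∈ SymK) {c : U2 → ℂ} (hc : c ∈ PolK) (p : Poly) :
    (fun k => (MvPolynomial.C (c k) * p) * q k) ∈ SymK := by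
  induction hq using Submodule.span_induction with
  | mem q hq =>
    obtain ⟨d, hd, r, rfl⟩ := hq
    have := mem_SymK (PolK.mul_mem hc hd) (p * r)
    convert this using 2
    rw [Pi.mul_apply, map_mul]
    ring
  | zero =>
    have e : (fun k : U2 => (MvPolynomial.C (c k) * p) * (0 : U2 → Poly) k) = 0 := by
      funext k
      simp
    rw [e]
    exact SymK.zero_mem
  | add q r _ _ hq hr =>
    have := SymK.add_mem hq hr
    convert this using 2
    simp [mul_add]
  | smul a q _ hq =>
    have := SymK.smul_mem a hq
    convert this using 2
    simp

lemma linP_mul_mem_SymK {q : U2 → Poly} (hq : q ∈ SymK) (v : C2) :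
    (fun k : U2 => linP (act k v) * q k) ∈ SymK := by
  have h1 : ∀ l : Fin 2, (fun k : U2 => (act k v) l) ∈ PolK := by
    intro l
    have : (fun k : U2 => (act k v) l) =
        ∑ i, (fun k : U2 => (k : Matrix (Fin 2) (Fin 2) ℂ) l i) * fun _ => v i := by
      funext k
      fin_cases l <;> simp [act]
    rw [this]
    exact PolK.sum_mem fun i _ => PolK.mul_mem (entry_mem_PolK _ _) (const_mem_PolK _)
  have h2 : (fun k : U2 => linP (act k v) * q k) = ∑ l : Fin 2,
      ((fun k : U2 => (MvPolynomial.C (Complex.I / 2 * (act k v) l) *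
        MvPolynomial.X (Sum.inr l)) * q k) +
      fun k : U2 => (MvPolynomial.C (Complex.I / 2 * conj ((act k v) l)) *
        MvPolynomial.X (Sum.inl l)) * q k) := by
    funext k
    simp only [linP, Finset.sum_mul, Finset.sum_apply, Pi.add_apply, add_mul]
  rw [h2]
  refine SymK.sum_mem fun l _ => SymK.add_mem ?_ ?_
  · exact mul_mem_SymK hq (PolK.mul_mem (const_mem_PolK _) (h1 l)) _
  · exact mul_mem_SymK hq (PolK.mul_mem (const_mem_PolK _) (conj_mem_PolK (h1 l))) _

lemma exists_deriv_SymK {q : U2 → Poly} (hq : q ∈ SymK) (x : Fin 4 → ℝ) :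
    ∃ q' ∈ SymK, ∀ (k : U2) (F : SmoothFn) (z : C2), HasDerivAt
      (fun t : ℝ => (symb (q (k * expU (t • x))) F : C2 → ℂ) z) ((symb (q' k) F : C2 → ℂ) z) 0 := by
  induction hq using Submodule.span_induction with
  | mem q hq =>
    obtain ⟨c, hc, p, rfl⟩ := hq
    obtain ⟨c', hc', hd⟩ := exists_deriv_PolK hc x
    refine ⟨_, mem_SymK hc' p, fun k F z => ?_⟩
    simp only [map_mul, symb_C, Module.End.mul_apply, LinearMap.smul_apply, Module.End.one_apply,
      Submodule.coe_smul, Pi.smul_apply, smul_eq_mul]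
    exact (hd k).mul_const _
  | zero => exact ⟨0, SymK.zero_mem, fun k F z => by simpa using hasDerivAt_const (0 : ℝ) (0 : ℂ)⟩
  | add q r _ _ hq hr =>
    obtain ⟨q', hq', hqd⟩ := hq
    obtain ⟨r', hr', hrd⟩ := hr
    refine ⟨_, SymK.add_mem hq' hr', fun k F z => ?_⟩
    simp only [Pi.add_apply, map_add, LinearMap.add_apply, Submodule.coe_add]
    exact (hqd k F z).add (hrd k F z)
  | smul a q _ hq =>
    obtain ⟨q', hq', hqd⟩ := hq
    refine ⟨_, SymK.smul_mem a hq', fun k F z => ?_⟩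
    simp only [Pi.smul_apply, map_smul, LinearMap.smul_apply, Submodule.coe_smul]
    exact (hqd k F z).const_smul a

/-- A left-invariant operator transforms `Σ_i q_i(k)(∂) F_i` into `Σ_i q_i'(k)(∂) F_i`, where the
symbols `q_i'` do not depend on the functions `F_i`. -/
lemma exists_symbol {D : (G → ℂ) → G → ℂ} (hD : IsLeftInvDiffOp D) {ι : Type*} [Fintype ι]
    (q : ι → U2 → Poly) (hq : ∀ i, q i ∈ SymK) :
    ∃ q' : ι → U2 → Poly, (∀ i, q' i ∈ SymK) ∧ ∀ F : ι → SmoothFn,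
      D (ofFam fun k => ∑ i, symb (q i k) (F i)) = ofFam fun k => ∑ i, symb (q' i k) (F i) := by
  induction hD generalizing q with
  | one => exact ⟨q, hq, fun F => rfl⟩
  | smul c _ ih =>
    obtain ⟨q', hq', h⟩ := ih q hq
    refine ⟨fun i => c • q' i, fun i => SymK.smul_mem c (hq' i), fun F => ?_⟩
    simp only [h]
    funext g
    simp [ofFam, Finset.mul_sum]
  | add _ _ ih1 ih2 =>
    obtain ⟨q', hq', h'⟩ := ih1 q hq
    obtain ⟨r', hr', h''⟩ := ih2 q hq
    refine ⟨fun i => q' i + r' i, fun i => SymK.add_mem (hq' i) (hr' i), fun F => ?_⟩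
    simp only [h', h'']
    funext g
    simp [ofFam, Finset.sum_add_distrib]
  | compU x _ ih =>
    choose q1 hq1 hd using fun i => exists_deriv_SymK (hq i) x
    obtain ⟨q', hq', h⟩ := ih q1 hq1
    refine ⟨q', hq', fun F => ?_⟩
    have e : fieldU x (ofFam fun k => ∑ i, symb (q i k) (F i)) =
        ofFam fun k => ∑ i, symb (q1 i k) (F i) := by
      funext g
      simp only [fieldU, ofFam, mul_k, mul_z, ofK, Submodule.coe_sum, Finset.sum_apply]
      have h0 : act g.k 0 = 0 := by simp [act]
      rw [h0, add_zero]
      exact (HasDerivAt.fun_sum fun i _ => hd i g.k (F i) g.z).deriv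
    simp only [e, h]
  | compC v _ ih =>
    obtain ⟨q', hq', h⟩ := ih (fun i k => linP (act k v) * q i k)
      (fun i => linP_mul_mem_SymK (hq i) v)
    refine ⟨q', hq', fun F => ?_⟩
    have e : fieldC v (ofFam fun k => ∑ i, symb (q i k) (F i)) =
        ofFam fun k => ∑ i, symb (linP (act k v) * q i k) (F i) := by
      rw [fieldC_ofFam]
      simp only [map_sum, dirD_eq_symb, map_mul, Module.End.mul_apply]
    simp only [e, h]

/-- Left-invariance. -/
lemma leftInv {D : (G → ℂ) → G → ℂ} (hD : IsLeftInvDiffOp D) (h : G) (f : G → ℂ) (g : G) :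
    D (fun x => f (h * x)) g = D f (h * g) := by
  induction hD generalizing f with
  | one => rfl
  | smul c _ ih => simp only [Pi.smul_apply, ih]
  | add _ _ ih1 ih2 => simp only [Pi.add_apply, ih1, ih2]
  | compU x _ ih =>
    have e : fieldU x (fun y => f (h * y)) = fun y => fieldU x f (h * y) := by
      funext y
      simp only [fieldU, mul_assoc]
    simp only [e, ih]
  | compC v _ ih =>
    have e : fieldC v (fun y => f (h * y)) = fun y => fieldC v f (h * y) := by
      funext y
      simp only [fieldC, mul_assoc]
    simp only [e, ih]

lemma IsSmooth.comp_left {f : G → ℂ} (hf : IsSmooth f) (h : G) : IsSmooth fun x => f (h * x) := by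
  intro g
  simpa only [mul_assoc] using hf (h * g)

lemma isSmooth_ofFam {q : U2 → Poly} (hq : q ∈ SymK) (F : SmoothFn) :
    IsSmooth (ofFam fun k => symb (q k) F) := by
  intro g
  simp only [ofFam, mul_k, mul_z]
  induction hq using Submodule.span_induction with
  | mem q hq =>
    obtain ⟨c, hc, p, rfl⟩ := hq
    simp only [map_mul, symb_C, Module.End.mul_apply, LinearMap.smul_apply, Module.End.one_apply,
      Submodule.coe_smul, Pi.smul_apply, smul_eq_mul]
    have h1 : ContDiff ℝ ∞ fun w : C2 => g.z + act g.k w :=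
      contDiff_const.add (actL g.k).contDiff
    exact ((contDiff_PolK hc g.k).comp contDiff_fst).mul
      ((contDiff_coe (symb p F)).comp (h1.comp contDiff_snd))
  | zero => simpa using contDiff_const
  | add q r _ _ hq hr =>
    simp only [Pi.add_apply, map_add, LinearMap.add_apply, Submodule.coe_add]
    exact hq.add hr
  | smul a q _ hq =>
    simp only [Pi.smul_apply, map_smul, LinearMap.smul_apply, Submodule.coe_smul, smul_eq_mul]
    exact contDiff_const.mul hq

lemma isSmooth_ofFam_sum {ι : Type*} [Fintype ι] {q : ι → U2 → Poly} (hq : ∀ i, q i ∈ SymK)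
    (F : ι → SmoothFn) : IsSmooth (ofFam fun k => ∑ i, symb (q i k) (F i)) := by
  intro g
  simp only [ofFam, Submodule.coe_sum, Finset.sum_apply]
  exact ContDiff.sum fun i _ => isSmooth_ofFam (hq i) (F i) g

end

section
variable {n : ℕ}
/-! ### Plane waves -/

/-- The plane wave `e^{-is⟨z,ζ⟩}`. -/
def wave (s : ℝ) (ζ : C2) : SmoothFn :=
  ⟨fun z => Complex.exp (-Complex.I * (s * rInner z ζ : ℝ)), by
    have h : ContDiff ℝ ∞ fun z : C2 => rInner z ζ := by
      simp only [rInner_eq_inner]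
      exact (innerSL ℝ ζ).contDiff
    exact (contDiff_const.mul (Complex.ofRealCLM.contDiff.comp (contDiff_const.mul h))).cexp⟩

lemma wave_apply (s : ℝ) (ζ z : C2) :
    (wave s ζ : C2 → ℂ) z = Complex.exp (-Complex.I * (s * rInner z ζ : ℝ)) := rfl

lemma dirD_wave (s : ℝ) (ζ v : C2) :
    dirD v (wave s ζ) = (-Complex.I * (s * rInner v ζ : ℝ)) • wave s ζ := by
  ext z
  have h1 : HasDerivAt (fun t : ℝ => ((s * rInner (z + t • v) ζ : ℝ) : ℂ))
      ((s * rInner v ζ : ℝ) : ℂ) 0 := by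
    have h2 : HasDerivAt (fun t : ℝ => s * rInner (z + t • v) ζ) (s * rInner v ζ) 0 := by
      simp only [rInner_add, rInner_smul]
      simpa using (((hasDerivAt_id (0 : ℝ)).mul_const (rInner v ζ)).const_add (rInner z ζ)).const_mul s
    exact h2.ofReal_comp
  have h3 := (h1.const_mul (-Complex.I)).cexp
  rw [← (hasDerivAt_dir (wave s ζ) z v).deriv]
  simp only [wave_apply]
  rw [h3.deriv]
  simp only [zero_smul, add_zero, Submodule.coe_smul, Pi.smul_apply, smul_eq_mul, wave_apply]
  ring

lemma symb_wave (s : ℝ) (ζ : C2) (p : Poly) :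
    symb p (wave s ζ) = evalP (-(s • ζ)) p • wave s ζ := by
  induction p using MvPolynomial.induction_on with
  | C c => simp
  | add p q hp hq => rw [map_add, LinearMap.add_apply, hp, hq, map_add, add_smul]
  | mul_X p i hp =>
    have hX : symb (MvPolynomial.X i) (wave s ζ) =
        evalP (-(s • ζ)) (MvPolynomial.X i) • wave s ζ := by
      rw [symb_X, ← gen_factor]
      simp only [gen, LinearMap.smul_apply, LinearMap.add_apply, dirD_wave, smul_smul, ← add_smul]
    rw [map_mul, Module.End.mul_apply, hX, map_smul, hp, map_mul, smul_smul, mul_comm]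

/-! ### Existence of the spherical functions -/


/-- The function `tr(τ_{m,n}(k)^* Φ(z))` on `G`. -/
def trFn (m : ℤ) (Φ : C2 → EndV n) (g : G) : ℂ := ((tauU m n g.k)ᴴ * Φ g.z).trace

/-- The symbol of multiplication by a conjugate matrix coefficient. -/
def coefSym (m : ℤ) (p : Fin (n + 1) × Fin (n + 1)) (k : U2) : Poly :=
  MvPolynomial.C (conj (tauU m n k p.1 p.2)) * 1

lemma coefSym_mem (m : ℤ) (p : Fin (n + 1) × Fin (n + 1)) : coefSym m p ∈ SymK :=
  mem_SymK (conj_mem_PolK (tauU_mem_PolK m n p.1 p.2)) 1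

lemma trace_conjTranspose_mul (T B : EndV n) :
    (Tᴴ * B).trace = ∑ p : Fin (n + 1) × Fin (n + 1), conj (T p.1 p.2) * B p.1 p.2 := by
  rw [Fintype.sum_prod_type, Finset.sum_comm]
  simp [Matrix.trace, Matrix.mul_apply, Matrix.conjTranspose_apply]

lemma trFn_eq_ofFam (m : ℤ) (Ψ : SmoothMat n) :
    trFn m (valM Ψ) = ofFam fun k => ∑ p, symb (coefSym m p k) (Ψ p.1 p.2) := by
  funext g
  rw [trFn, trace_conjTranspose_mul]
  simp only [ofFam, coefSym, mul_one, symb_C, LinearMap.smul_apply, Module.End.one_apply,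
    Submodule.coe_sum, Finset.sum_apply, Submodule.coe_smul, Pi.smul_apply, smul_eq_mul]
  rfl

lemma isSmooth_trFn (m : ℤ) (Ψ : SmoothMat n) : IsSmooth (trFn m (valM Ψ)) := by
  rw [trFn_eq_ofFam]
  exact isSmooth_ofFam_sum (fun p => coefSym_mem m p) _

/-- Operators in `𝔻(G)^{Int K}` commute with the right translations by `K`. -/
lemma rightInv {D : (G → ℂ) → G → ℂ} (hD : IsLeftInvDiffOp D) (hK : IsIntKInvariant D) {f : G → ℂ}
    (hf : IsSmooth f) (h : U2) (g : G) : D (fun x => f (x * ofK h)) g = D f (g * ofK h) := by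
  have h1 : (fun x => f (x * ofK h)) = fun x =>
      (fun y => f (ofK h * y)) (ofK h⁻¹ * x * (ofK h⁻¹)⁻¹) := by
    funext x
    have : (ofK h⁻¹ : G) = (ofK h)⁻¹ := by
      ext1 <;> simp [ofK, act]
    simp only [this]
    congr 1
    group
  rw [h1, hK _ (hf.comp_left (ofK h)) h⁻¹ g, leftInv hD]
  have : (ofK h⁻¹ : G) = (ofK h)⁻¹ := by
    ext1 <;> simp [ofK, act]
  rw [this]
  congr 1
  group

/-- The matrix-valued plane wave `e^{-is⟨z,ζ⟩} B`. -/
def waveM (s : ℝ) (ζ : C2) (B : EndV n) : SmoothMat n := Matrix.of fun a b => B a b • wave s ζ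

lemma valM_waveM (s : ℝ) (ζ : C2) (B : EndV n) (z : C2) :
    valM (waveM s ζ B) z = (wave s ζ : C2 → ℂ) z • B := by
  ext a b
  simp [valM, waveM, mul_comm]

/-- The point `(0, 1)` of the sphere. -/
def e2 : C2 := EuclideanSpace.single 1 1

lemma act_kMat_e2 (ζ : C2) : act (kMat ζ) e2 = ζ := by
  ext i
  fin_cases i <;> simp [act, e2, kMat]

lemma tau_diag (T : U2) {t : Fin (n + 1) → ℂ} (hT : tau n T = Matrix.diagonal t)
    (j : Fin (n + 1)) (M : EndV n) :
    E n j * (tau n T * M * (tau n T)ᴴ) = t j • (E n j * M * (tau n T)ᴴ) := by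
  have h1 : E n j * tau n T = t j • E n j := by
    rw [hT]
    ext a b
    simp only [Matrix.mul_diagonal, E, Matrix.single_apply, Matrix.smul_apply, smul_eq_mul]
    by_cases h : j = a ∧ j = b
    · rw [← h.2, mul_comm]
    · simp [h]
  rw [← mul_assoc, ← mul_assoc, h1, Matrix.smul_mul, Matrix.smul_mul]

lemma torus_act_e2 (a : ℂ) (ha : a * conj a = 1) : act (torus a ha : U2) e2 = e2 := by
  ext i
  fin_cases i <;> simp [act, e2, torus]

lemma coe_mul_act (k h : U2) (z : C2) : act (k * h : U2) z = act k (act h z) := by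
  rw [Submonoid.coe_mul, act_mul]

lemma tauU_conj_conjTranspose (m : ℤ) (h k : U2) : (tauU m n (h * k * h⁻¹))ᴴ =
    tau n h * (tauU m n k)ᴴ * (tau n h)ᴴ := by
  rw [tau_conj_eq_tauU m, tauU_mul, tauU_mul, tauU_inv, Matrix.conjTranspose_mul,
    Matrix.conjTranspose_mul, Matrix.conjTranspose_conjTranspose, mul_assoc]

lemma rInner_act_right (h : U2) (z ζ : C2) : rInner (act h z) ζ = rInner z (act (h⁻¹ : U2) ζ) := by
  rw [← rInner_act h z, ← coe_mul_act, mul_inv_cancel, Submonoid.coe_one, act_one]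

lemma conj_k (h : U2) (g : G) : (ofK h * g * (ofK h)⁻¹).k = h * g.k * h⁻¹ := by
  simp [ofK]

lemma conj_z (h : U2) (g : G) : (ofK h * g * (ofK h)⁻¹).z = act h g.z := by
  simp [ofK, act]

/-- An operator in `𝔻(G)^{Int K}` has `tr(τ(k)^* E_{jj}) e^{-is⟨z,e₂⟩}` as an eigenfunction:
it commutes with the right translations by `K`, and with the conjugations by the torus which fixes
`e₂` and separates the weights of `τ_n`. -/
lemma eigen_wave_e2 {D : (G → ℂ) → G → ℂ} (hK : IsIntKInvariant D)
    (hD : IsLeftInvDiffOp D) (m : ℤ) (s : ℝ) (j : Fin (n + 1)) :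
    ∃ c : ℂ, D (trFn m (valM (waveM s e2 (E n j)))) = c • trFn m (valM (waveM s e2 (E n j))) := by
  obtain ⟨q, -, hq⟩ := exists_symbol hD (coefSym (n := n) m) (coefSym_mem m)
  set d : Fin (n + 1) × Fin (n + 1) → U2 → ℂ := fun p k => evalP (-(s • e2)) (q p k) with hd
  -- `D` acts on `ψ_B(k, z) = tr(τ(k)^* B) e^{-is⟨z,e₂⟩}` through its symbol, linearly in `B`
  have h1 : ∀ (B : EndV n) (g : G), D (trFn m (valM (waveM s e2 B))) g =
      (wave s e2 : C2 → ℂ) g.z * ∑ p, B p.1 p.2 * d p g.k := by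
    intro B g
    rw [trFn_eq_ofFam, hq fun p => waveM s e2 B p.1 p.2]
    simp only [ofFam, waveM, Matrix.of_apply, map_smul, symb_wave, Submodule.coe_sum,
      Finset.sum_apply, Submodule.coe_smul, Pi.smul_apply, smul_eq_mul, Finset.mul_sum]
    refine Finset.sum_congr rfl fun p _ => ?_
    simp only [hd]
    ring
  -- the linear functional `B ↦ D ψ_B(1)`
  set L : EndV n →ₗ[ℂ] ℂ := ∑ p : Fin (n + 1) × Fin (n + 1),
    d p 1 • Matrix.entryLinearMap ℂ ℂ p.1 p.2 with hL
  have hL' : ∀ B, L B = ∑ p, B p.1 p.2 * d p 1 := by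
    intro B
    simp [hL, LinearMap.sum_apply, mul_comm]
  have hw0 : (wave s e2 : C2 → ℂ) 0 = 1 := by simp [wave_apply, rInner_zero]
  -- right translation by `k` replaces `B` by `B τ(k)^*`, so `L` determines `D ψ_B`
  have h2 : ∀ (B : EndV n) (k : U2), ∑ p, B p.1 p.2 * d p k = L (B * (tauU m n k)ᴴ) := by
    intro B k
    have h3 := rightInv hD hK (isSmooth_trFn m (waveM s e2 B)) k 1
    have h4 : (fun x : G => trFn m (valM (waveM s e2 B)) (x * ofK k)) =
        trFn m (valM (waveM s e2 (B * (tauU m n k)ᴴ))) := by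
      funext x
      have h0 : act x.k 0 = 0 := by simp [act]
      simp only [trFn, valM_waveM, mul_k, mul_z, ofK, h0, add_zero, tauU_mul,
        Matrix.conjTranspose_mul, Matrix.mul_smul, Matrix.trace_smul]
      rw [mul_assoc, Matrix.trace_mul_comm, mul_assoc]
    rw [h4, h1, h1, one_mul] at h3
    simp only [one_z, one_k, ofK, hw0, one_mul] at h3
    rw [hL', h3]
  -- the torus forces `L` to see only the diagonal entry of `E_{jj} M`
  have h5 : ∀ M : EndV n, L (E n j * M) = M j j * L (E n j) := by
    set T : U2 := torus (torusAngle n) (torusAngle_unit n) with hT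
    have htT := tau_torus n _ (torusAngle_unit n)
    set t : Fin (n + 1) → ℂ := fun i => conj (torusAngle n) ^ (i : ℕ) with ht
    have h6 : ∀ k : U2, t j * L (E n j * (tauU m n k)ᴴ * (tau n T)ᴴ) =
        L (E n j * (tauU m n k)ᴴ) := by
      intro k
      have h7 := hK _ (isSmooth_trFn m (waveM s e2 (E n j))) T (ofK k)
      have hwT : ∀ z, (wave s e2 : C2 → ℂ) (act T z) = (wave s e2 : C2 → ℂ) z := by
        intro z
        have : act (T⁻¹ : U2) e2 = e2 := by
          conv_lhs => rw [← torus_act_e2 _ (torusAngle_unit n)]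
          rw [← coe_mul_act, inv_mul_cancel, Submonoid.coe_one, act_one]
        simp only [wave_apply, rInner_act_right, this]
      have h8 : (fun x : G => trFn m (valM (waveM s e2 (E n j))) (ofK T * x * (ofK T)⁻¹)) =
          trFn m (valM (waveM s e2 (E n j))) := by
        funext x
        simp only [trFn, conj_k, conj_z, valM_waveM, hwT, tauU_conj_conjTranspose, Matrix.mul_smul,
          Matrix.trace_smul]
        congr 1
        have h9 := tau_diag T htT j (tauU m n x.k)ᴴ
        rw [Matrix.trace_mul_comm, h9, Matrix.trace_smul, Matrix.trace_mul_comm, ← mul_assoc]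
        have h10 : (tau n T)ᴴ * E n j = conj (t j) • E n j := by
          rw [htT, Matrix.diagonal_conjTranspose]
          ext a b
          simp only [Matrix.diagonal_mul, E, Matrix.single_apply, Matrix.smul_apply, smul_eq_mul]
          by_cases h : j = a ∧ j = b
          · simp [← h.1, ht]
          · simp [h]
        have h11 : t j * conj (t j) = 1 := by
          simp only [ht, map_pow, Complex.conj_conj, ← mul_pow]
          rw [mul_comm, torusAngle_unit, one_pow]
        rw [h10, Matrix.smul_mul, Matrix.trace_smul, smul_smul, h11, one_smul,
          Matrix.trace_mul_comm]
      rw [h8, h1, h1, conj_k, conj_z, h2, h2] at h7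
      have h0 : act T 0 = 0 := by simp [act]
      simp only [ofK, h0, hw0, one_mul] at h7
      rw [h7, tauU_conj_conjTranspose, tau_diag T htT, map_smul, smul_eq_mul]
    have h12 : ∀ M : EndV n, t j * L (E n j * M * (tau n T)ᴴ) = L (E n j * M) := by
      intro M
      have hM : M ∈ Submodule.span ℂ (Set.range fun k : U2 => (tauU m n k)ᴴ) := by
        rw [span_tauU]; trivial
      induction hM using Submodule.span_induction with
      | mem M hM =>
        obtain ⟨k, rfl⟩ := hM
        exact h6 k
      | zero => simp
      | add M N _ _ hM hN => simp only [mul_add, add_mul, map_add, hM, hN]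
      | smul c M _ hM =>
        simp only [Matrix.mul_smul, Matrix.smul_mul, map_smul, smul_eq_mul]
        rw [← hM]
        ring
    have h13 : ∀ b, b ≠ j → L (Matrix.single j b 1) = 0 := by
      intro b hb
      have h14 := h12 (Matrix.single j b 1)
      have h15 : E n j * Matrix.single j b 1 = Matrix.single j b 1 := by
        simp [E]
      have h16 : Matrix.single j b 1 * (tau n T)ᴴ = conj (t b) • (Matrix.single j b 1 : EndV n) := by
        rw [htT, Matrix.diagonal_conjTranspose]
        ext x y
        simp only [Matrix.mul_diagonal, Matrix.single_apply, Matrix.smul_apply, smul_eq_mul]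
        by_cases h : j = x ∧ b = y
        · simp [← h.2, ht]
        · simp [h]
      rw [h15, h16, map_smul, smul_eq_mul, ← mul_assoc] at h14
      have h17 : t j * conj (t b) ≠ 1 := by
        intro h
        apply hb
        refine torusAngle_injective n ?_
        have h18 : t b * conj (t b) = 1 := by
          simp only [ht, map_pow, Complex.conj_conj, ← mul_pow]
          rw [mul_comm, torusAngle_unit, one_pow]
        have h19 : conj (t b) ≠ 0 := fun h0 => by rw [h0, mul_zero] at h18; exact zero_ne_one h18
        exact mul_right_cancel₀ h19 (h18.trans h.symm)
      have h20 : (t j * conj (t b) - 1) * L (Matrix.single j b 1) = 0 := by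
        linear_combination h14
      exact (mul_eq_zero.1 h20).resolve_left (sub_ne_zero.2 h17)
    intro M
    have h21 : E n j * M = ∑ b, M j b • Matrix.single j b 1 := by
      ext x y
      rw [Matrix.sum_apply]
      by_cases hx : j = x
      · subst hx
        simp [E, Matrix.single_apply]
      · simp [E, hx]
        exact Matrix.single_mul_apply_of_ne _ _ _ _ _ (fun h => hx h.symm) _
    rw [h21, map_sum, Finset.sum_eq_single j]
    · rw [map_smul]; rfl
    · intro b _ hb
      rw [map_smul, h13 b hb, smul_zero]
    · simp
  refine ⟨L (E n j), ?_⟩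
  funext g
  rw [h1, h2, h5, Pi.smul_apply, smul_eq_mul, trFn, valM_waveM, Matrix.mul_smul, Matrix.trace_smul,
    smul_eq_mul]
  have h22 : ((tauU m n g.k)ᴴ * E n j).trace = (tauU m n g.k)ᴴ j j := by
    simp [E, Matrix.trace_mul_single]
  rw [h22]
  ring

/-- The plane waves in all directions are conjugate to the one in the direction `e₂`, so their
eigenvalues agree. -/
lemma eigen_wave {D : (G → ℂ) → G → ℂ} (hK : IsIntKInvariant D)
    (hD : IsLeftInvDiffOp D) (m : ℤ) (s : ℝ) (j : Fin (n + 1)) :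
    ∃ c : ℂ, ∀ ζ : S3, D (trFn m (valM (waveM s (ζ : C2) (Q n (E n j) (ζ : C2))))) =
      c • trFn m (valM (waveM s (ζ : C2) (Q n (E n j) (ζ : C2)))) := by
  obtain ⟨c, hc⟩ := eigen_wave_e2 hK hD m s j
  refine ⟨c, fun ζ => ?_⟩
  set h : U2 := (kU ζ (norm_S3 ζ)) with hh
  have h1 : trFn m (valM (waveM s (ζ : C2) (Q n (E n j) (ζ : C2)))) = fun x =>
      trFn m (valM (waveM s e2 (E n j))) (ofK h⁻¹ * x * (ofK h⁻¹)⁻¹) := by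
    funext x
    have h2 : act h e2 = ζ := act_kMat_e2 _
    simp only [trFn, conj_k, conj_z, valM_waveM, tauU_conj_conjTranspose, Matrix.mul_smul,
      Matrix.trace_smul]
    congr 1
    · simp only [wave_apply]
      rw [rInner_act_right, inv_inv, h2]
    · rw [Q_unit _ _ (norm_S3 ζ), ← coe_kU _ (norm_S3 ζ), ← hh, tau_inv,
        Matrix.conjTranspose_conjTranspose, ← mul_assoc, Matrix.trace_mul_comm, ← mul_assoc,
        ← mul_assoc, mul_assoc, Matrix.trace_mul_comm]
  rw [h1]
  funext g
  rw [hK _ (isSmooth_trFn m _), hc]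
  rfl

/-- The functions `tr(τ_{m,n}(k)^* Φ_{ξ,j}(z))` are superpositions of plane waves with the same
eigenvalue. -/
lemma eigen_PhiSph {D : (G → ℂ) → G → ℂ} (hD : IsLeftInvDiffOp D) (hK : IsIntKInvariant D)
    (m : ℤ) (j : Fin (n + 1)) (ξ : ℝ) (a : ℂ) :
    ∃ c : ℂ, D (trFn m (valM (a • PhiS n j ξ))) = c • trFn m (valM (a • PhiS n j ξ)) := by
  obtain ⟨c, hc⟩ := eigen_wave hK hD m (Real.sqrt ξ) j
  obtain ⟨q, -, hq⟩ := exists_symbol hD (coefSym (n := n) m) (coefSym_mem m)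
  refine ⟨c, ?_⟩
  funext g
  -- the eigenvalue equation of the plane waves at `z = 0`, in terms of the symbol of `D`
  have h1 : ∀ ζ : S3, ∑ p : Fin (n + 1) × Fin (n + 1),
      evalP (-(Real.sqrt ξ • (ζ : C2))) (q p g.k) * Q n (E n j) (ζ : C2) p.1 p.2 =
      c * ∑ p : Fin (n + 1) × Fin (n + 1), conj (tauU m n g.k p.1 p.2) *
        Q n (E n j) (ζ : C2) p.1 p.2 := by
    intro ζ
    have h2 := congrFun (hc ζ) ⟨g.k, 0⟩
    have hw0 : (wave (Real.sqrt ξ) ζ : C2 → ℂ) 0 = 1 := by simp [wave_apply, rInner_zero]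
    rw [Pi.smul_apply, smul_eq_mul, trFn, valM_waveM, hw0, one_smul, trace_conjTranspose_mul] at h2
    rw [← h2, trFn_eq_ofFam, hq fun p => waveM (Real.sqrt ξ) ζ (Q n (E n j) (ζ : C2)) p.1 p.2]
    simp only [ofFam, waveM, Matrix.of_apply, map_smul, symb_wave, Submodule.coe_sum,
      Finset.sum_apply, Submodule.coe_smul, Pi.smul_apply, smul_eq_mul, hw0]
    exact Finset.sum_congr rfl fun p _ => by ring
  have h3 : ∀ r : Fin (n + 1) × Fin (n + 1) → Poly, (∑ p, (symb (r p)
      (((a • PhiS n j ξ : SmoothMat n)) p.1 p.2) : C2 → ℂ) g.z) = a * (((n : ℂ) + 1) *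
      expInt (Real.sqrt ξ) (fun ζ => ∑ p : Fin (n + 1) × Fin (n + 1),
        evalP (-(Real.sqrt ξ • (ζ : C2))) (r p) * Q n (E n j) (ζ : C2) p.1 p.2) g.z) := by
    intro r
    have h4 := expInt_sum Finset.univ (Real.sqrt ξ)
      (a := fun (p : Fin (n + 1) × Fin (n + 1)) (ζ : S3) =>
      evalP (-(Real.sqrt ξ • (ζ : C2))) (r p) * Q n (E n j) (ζ : C2) p.1 p.2)
      (fun p => continuous_polySph _ _ (continuous_Q j p.1 p.2)) g.z
    rw [h4, Finset.mul_sum, Finset.mul_sum]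
    refine Finset.sum_congr rfl fun p _ => ?_
    simp only [PhiS, Matrix.smul_apply, Matrix.of_apply, map_smul, symb_expInt, Submodule.coe_smul,
      Pi.smul_apply, smul_eq_mul]
    rfl
  rw [trFn_eq_ofFam, hq fun p => (a • PhiS n j ξ : SmoothMat n) p.1 p.2]
  simp only [ofFam, Pi.smul_apply, Submodule.coe_sum, Finset.sum_apply, smul_eq_mul]
  rw [h3, h3]
  simp only [h1, coefSym, mul_one, evalP_C]
  rw [expInt_smul]
  ring

lemma trFn_central (m : ℤ) {Φ : C2 → EndV n}
    (hΦ : ∀ (k : U2) z, Φ (act k z) = tau n k * Φ z * (tau n k)ᴴ) (h : U2) (g : G) :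
    trFn m Φ (ofK h * g * (ofK h)⁻¹) = trFn m Φ g := by
  have h1 : (tau n h)ᴴ * tau n h = 1 := by rw [← tau_inv, ← tau_mul, inv_mul_cancel, tau_one]
  rw [trFn, conj_k, conj_z, hΦ, tauU_conj_conjTranspose, trFn]
  calc _ = (tau n h * (tauU m n g.k)ᴴ * ((tau n h)ᴴ * tau n h) * Φ g.z * (tau n h)ᴴ).trace := by
        simp only [mul_assoc]
    _ = (tau n h * ((tauU m n g.k)ᴴ * Φ g.z * (tau n h)ᴴ)).trace := by
        rw [h1, mul_one]; simp only [mul_assoc]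
    _ = ((tauU m n g.k)ᴴ * Φ g.z * ((tau n h)ᴴ * tau n h)).trace := by
        rw [Matrix.trace_mul_comm]; simp only [mul_assoc]
    _ = _ := by rw [h1, mul_one]

lemma trFn_bounded (m : ℤ) {Φ : C2 → EndV n} (hΦ : ∀ a b, ∃ C : ℝ, ∀ z, ‖Φ z a b‖ ≤ C) :
    ∃ C : ℝ, ∀ g, ‖trFn m Φ g‖ ≤ C := by
  choose C hC using hΦ
  have h1 : ∀ p : Fin (n + 1) × Fin (n + 1), ∃ M : ℝ, ∀ k : U2, ‖tauU m n k p.1 p.2‖ ≤ M := by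
    intro p
    obtain ⟨M, hM⟩ := IsCompact.exists_bound_of_continuousOn isCompact_univ
      (continuous_tauU_apply m n p.1 p.2).continuousOn
    exact ⟨M, fun k => hM k trivial⟩
  choose M hM using h1
  refine ⟨∑ p : Fin (n + 1) × Fin (n + 1), M p * C p.1 p.2, fun g => ?_⟩
  rw [trFn, trace_conjTranspose_mul]
  refine (norm_sum_le _ _).trans (Finset.sum_le_sum fun p _ => ?_)
  rw [norm_mul, Complex.norm_conj]
  exact mul_le_mul (hM p g.k) (hC _ _ _) (norm_nonneg _) ((norm_nonneg _).trans (hM p g.k))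

/-- The scalar spherical function attached to `Φ_{ξ,j}`. -/
lemma isBoundedSpherical_PhiSph (m : ℤ) (j : Fin (n + 1)) (ξ : ℝ) :
    IsBoundedSpherical (trFn m (valM (((n : ℂ) + 1)⁻¹ • PhiS n j ξ))) := by
  have hn : (n : ℂ) + 1 ≠ 0 := by exact_mod_cast Nat.succ_ne_zero n
  have h1 : valM (((n : ℂ) + 1)⁻¹ • PhiS n j ξ) = fun z => ((n : ℂ) + 1)⁻¹ • PhiSph n j ξ z := rfl
  refine ⟨⟨isSmooth_trFn m _, trFn_central m fun k z => ?_, fun D hD hK =>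
    eigen_PhiSph hD hK m j ξ _, ?_⟩, trFn_bounded m fun a b => ?_⟩
  · simp only [h1, PhiSph_act, Matrix.mul_smul, Matrix.smul_mul]
  · simp only [trFn, h1, one_k, one_z, tauU_one, PhiSph_zero]
    simp [hn]
  · obtain ⟨C, hC⟩ := PhiSph_bounded j ξ a b
    refine ⟨‖((n : ℂ) + 1)⁻¹‖ * C, fun z => ?_⟩
    simp only [h1]
    rw [Matrix.smul_apply, norm_smul]
    gcongr
    exact hC z

end

section
variable {n : ℕ}
/-! ### The operators `D₁, D₂, D₃, D₄` on functions of `K`-type `τ_{m,n}` -/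

/-- The symbol of the left-invariant field `-2i ∂/∂z̄_j` on `{k} × ℂ²`: the `j`-th coordinate of
`k⁻¹ z`. -/
def symU (k : U2) (j : Fin 2) : Poly :=
  ∑ l, MvPolynomial.C (conj ((k : Matrix (Fin 2) (Fin 2) ℂ) l j)) * MvPolynomial.X (Sum.inl l)

/-- The symbol of the left-invariant field `-2i ∂/∂z_j` on `{k} × ℂ²`: the conjugate of the `j`-th
coordinate of `k⁻¹ z`. -/
def symV (k : U2) (j : Fin 2) : Poly :=
  ∑ l, MvPolynomial.C ((k : Matrix (Fin 2) (Fin 2) ℂ) l j) * MvPolynomial.X (Sum.inr l)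

lemma evalP_symU (k : U2) (j : Fin 2) (z : C2) : evalP z (symU k j) = (act (k⁻¹ : U2) z) j := by
  simp only [symU, map_sum, map_mul, evalP_C, evalP_inl]
  fin_cases j <;> simp [act]

lemma evalP_symV (k : U2) (j : Fin 2) (z : C2) :
    evalP z (symV k j) = conj ((act (k⁻¹ : U2) z) j) := by
  rw [← evalP_symU]
  simp only [symU, symV, map_sum, map_mul, evalP_C, evalP_inl, evalP_inr, Complex.conj_conj]

lemma linP_act_single (k : U2) (j : Fin 2) (c : ℂ) : linP (act k (EuclideanSpace.single j c)) =
    MvPolynomial.C (Complex.I / 2 * c) * symV k j +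
      MvPolynomial.C (Complex.I / 2 * conj c) * symU k j := by
  have h : ∀ l, (act k (EuclideanSpace.single j c)) l = (k : Matrix (Fin 2) (Fin 2) ℂ) l j * c := by
    intro l
    fin_cases l <;> fin_cases j <;> simp [act, mul_comm]
  simp only [linP, h, symU, symV, Finset.mul_sum, ← Finset.sum_add_distrib]
  refine Finset.sum_congr rfl fun l _ => ?_
  simp only [map_mul]
  ring

lemma Zd_ofFam (j : Fin 2) (f : U2 → SmoothFn) : Zd j (ofFam f) =
    ofFam fun k => symb (MvPolynomial.C (Complex.I / 2) * symV k j) (f k) := by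
  funext g
  rw [Zd, fieldC_ofFam, fieldC_ofFam]
  simp only [ofFam, Pi.smul_apply, Pi.sub_apply, smul_eq_mul, dirD_eq_symb, linP_act_single,
    map_add, map_mul symb, symb_C, smul_mul_assoc, one_mul, LinearMap.add_apply,
    LinearMap.smul_apply, Submodule.coe_add, Submodule.coe_smul, Pi.add_apply, map_one,
    Complex.conj_I]
  linear_combination (-(Complex.I / 4) * ((symb (symV g.k j) (f g.k) : C2 → ℂ) g.z) +
    (Complex.I / 4) * ((symb (symU g.k j) (f g.k) : C2 → ℂ) g.z)) * Complex.I_mul_I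

lemma Zb_ofFam (j : Fin 2) (f : U2 → SmoothFn) : Zb j (ofFam f) =
    ofFam fun k => symb (MvPolynomial.C (Complex.I / 2) * symU k j) (f k) := by
  funext g
  rw [Zb, fieldC_ofFam, fieldC_ofFam]
  simp only [ofFam, Pi.smul_apply, Pi.add_apply, smul_eq_mul, dirD_eq_symb, linP_act_single,
    map_add, map_mul symb, symb_C, smul_mul_assoc, one_mul, LinearMap.add_apply,
    LinearMap.smul_apply, Submodule.coe_add, Submodule.coe_smul, map_one,
    Complex.conj_I]
  linear_combination ((Complex.I / 4) * ((symb (symV g.k j) (f g.k) : C2 → ℂ) g.z) -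
    (Complex.I / 4) * ((symb (symU g.k j) (f g.k) : C2 → ℂ) g.z)) * Complex.I_mul_I

lemma neg_four_Zd_Zb (j p : Fin 2) (f : U2 → SmoothFn) (g : G) :
    -4 * Zd j (Zb p (ofFam f)) g = ofFam (fun k => symb (symU k p * symV k j) (f k)) g := by
  rw [Zb_ofFam, Zd_ofFam]
  simp only [ofFam, ← Module.End.mul_apply, ← map_mul]
  have h : (MvPolynomial.C (Complex.I / 2) * symV g.k j) *
      (MvPolynomial.C (Complex.I / 2) * symU g.k p) =
      MvPolynomial.C (-1 / 4) * (symU g.k p * symV g.k j) := by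
    have h1 : (MvPolynomial.C (-1 / 4) : Poly) =
        MvPolynomial.C (Complex.I / 2) * MvPolynomial.C (Complex.I / 2) := by
      rw [← map_mul]
      congr 1
      linear_combination (-1 / 4 : ℂ) * Complex.I_mul_I
    rw [h1]
    ring
  rw [h, map_mul symb, symb_C, Module.End.mul_apply, LinearMap.smul_apply, Module.End.one_apply,
    Submodule.coe_smul, Pi.smul_apply, smul_eq_mul]
  ring

lemma neg_four_Zb_Zd (j p : Fin 2) (f : U2 → SmoothFn) (g : G) :
    -4 * Zb j (Zd p (ofFam f)) g = ofFam (fun k => symb (symU k j * symV k p) (f k)) g := by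
  rw [← neg_four_Zd_Zb, Zb_ofFam, Zd_ofFam, Zb_ofFam, Zd_ofFam]
  simp only [ofFam, ← Module.End.mul_apply, ← map_mul]
  rw [mul_comm (MvPolynomial.C (Complex.I / 2) * symU g.k j)]

lemma sum_symU_mul_symV (k : U2) : symU k 0 * symV k 0 + symU k 1 * symV k 1 = normP := by
  refine sub_eq_zero.1 (poly_eq_zero fun z => ?_)
  rw [map_sub, map_add, map_mul, map_mul, evalP_symU, evalP_symV, evalP_symU, evalP_symV,
    ← norm_sq_eq, evalP_normP, norm_act, sub_self]

lemma D1_ofFam (f : U2 → SmoothFn) : D1 (ofFam f) = ofFam fun k => symb normP (f k) := by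
  funext g
  simp only [D1, lapG, Pi.add_apply, Pi.smul_apply, smul_eq_mul, neg_four_Zd_Zb]
  rw [← sum_symU_mul_symV g.k]
  simp [ofFam]

lemma D1_trFn (m : ℤ) (Ψ : SmoothMat n) :
    D1 (trFn m (valM Ψ)) = trFn m (valM (actM (normP • (1 : PolyMat n)) Ψ)) := by
  rw [trFn_eq_ofFam, trFn_eq_ofFam, D1_ofFam]
  simp only [map_sum, actM_smul_one, ← Module.End.mul_apply, ← map_mul, mul_comm normP]

/-- The differential of `τ_{m,n}`. -/
def dtauU (m : ℤ) (n : ℕ) (x : Fin 4 → ℝ) : EndV n :=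
  ((((n : ℤ) - m) / 2 : ℤ) * (lieU x).trace) • (1 : EndV n) + dtau n (lieU x)

lemma hasDerivAt_tauU (m : ℤ) (n : ℕ) (x : Fin 4 → ℝ) (i j : Fin (n + 1)) :
    HasDerivAt (fun t : ℝ => tauU m n (expU (t • x)) i j) (dtauU m n x i j) 0 := by
  set Y := lieU x with hY
  have he := fun a b => hasDerivAt_exp_entry Y a b
  have h0 : NormedSpace.exp (((0 : ℝ) : ℂ) • Y) = 1 := by simp [NormedSpace.exp_zero]
  have h1 : HasDerivAt (fun t : ℝ => (NormedSpace.exp ((t : ℂ) • Y)).det) Y.trace 0 := by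
    simp only [Matrix.det_fin_two]
    have h2 := ((he 0 0).mul (he 1 1)).sub ((he 0 1).mul (he 1 0))
    refine h2.congr_deriv ?_
    rw [h0]
    simp [Matrix.trace, Fin.sum_univ_two]
  have h3 : HasDerivAt (fun t : ℝ => (NormedSpace.exp ((t : ℂ) • Y)).det ^ (((n : ℤ) - m) / 2))
      ((((n : ℤ) - m) / 2 : ℤ) * Y.trace) 0 := by
    have h4 : HasDerivAt (fun w : ℂ => w ^ (((n : ℤ) - m) / 2)) (((((n : ℤ) - m) / 2 : ℤ) : ℂ) *
        (NormedSpace.exp (((0 : ℝ) : ℂ) • Y)).det ^ (((n : ℤ) - m) / 2 - 1))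
        (NormedSpace.exp (((0 : ℝ) : ℂ) • Y)).det := by
      refine hasDerivAt_zpow _ _ (Or.inl ?_)
      rw [h0, Matrix.det_one]
      exact one_ne_zero
    have h5 := h4.comp (0 : ℝ) h1
    refine h5.congr_deriv ?_
    rw [h0, Matrix.det_one, _root_.one_zpow, mul_one]
  have h6 := h3.mul (hasDerivAt_tau n Y i j)
  have h7 : (fun t : ℝ => tauU m n (expU (t • x)) i j) = fun t : ℝ =>
      (NormedSpace.exp ((t : ℂ) • Y)).det ^ (((n : ℤ) - m) / 2) *
        tau n (NormedSpace.exp ((t : ℂ) • Y)) i j := by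
    funext t
    rw [tauU, coe_expU_smul, Matrix.smul_apply, smul_eq_mul]
  rw [h7]
  refine h6.congr_deriv ?_
  have h8 : tau n (1 : Matrix (Fin 2) (Fin 2) ℂ) = 1 := tau_one n
  rw [h0, Matrix.det_one, _root_.one_zpow, one_mul, h8, dtauU, Matrix.add_apply, Matrix.smul_apply,
    smul_eq_mul]

lemma fieldU_trFn (m : ℤ) (x : Fin 4 → ℝ) (Φ : C2 → EndV n) :
    fieldU x (trFn m Φ) = trFn m fun z => Φ z * (dtauU m n x)ᴴ := by
  funext g
  have h1 : ∀ t : ℝ, trFn m Φ (g * ofK (expU (t • x))) =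
      ∑ p : Fin (n + 1) × Fin (n + 1), conj (tauU m n (expU (t • x)) p.1 p.2) *
        ((tauU m n g.k)ᴴ * Φ g.z) p.1 p.2 := by
    intro t
    have h0 : act g.k 0 = 0 := by simp [act]
    rw [trFn, ← trace_conjTranspose_mul, mul_k, mul_z, ofK, h0, add_zero, tauU_mul,
      Matrix.conjTranspose_mul, mul_assoc]
  simp only [fieldU, h1]
  rw [(HasDerivAt.fun_sum fun p _ => (Complex.conjCLE.hasFDerivAt.comp_hasDerivAt (0 : ℝ)
    (hasDerivAt_tauU m n x p.1 p.2)).mul_const (((tauU m n g.k)ᴴ * Φ g.z) p.1 p.2)).deriv]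
  have h2 := trace_conjTranspose_mul (dtauU m n x) ((tauU m n g.k)ᴴ * Φ g.z)
  refine h2.symm.trans ?_
  rw [trFn, Matrix.trace_mul_comm, mul_assoc]

lemma dtauU_single (m : ℤ) (n : ℕ) (l : Fin 4) (hl : l ≠ 3) :
    dtauU m n (Pi.single l 1) = dtau n (basisU l) := by
  have h : (basisU l).trace = 0 := by
    fin_cases l <;> simp [basisU, Matrix.trace, Fin.sum_univ_two] at hl ⊢
  rw [dtauU, lieU_single, h, mul_zero, zero_smul, zero_add]

lemma dtauU_three {m : ℤ} {n : ℕ} (hmn : Even ((n : ℤ) - m)) :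
    dtauU m n (Pi.single 3 1) = (-(Complex.I * m)) • (1 : EndV n) := by
  have h1 : basisU 3 = !![Complex.I, 0; 0, Complex.I] := rfl
  have h2 : (((((n : ℤ) - m) / 2 : ℤ) : ℂ)) * 2 = n - m := by
    have : (((n : ℤ) - m) / 2) * 2 = n - m := Int.ediv_mul_cancel hmn.two_dvd
    exact_mod_cast this
  rw [dtauU, lieU_single, h1, dtau_diagonal]
  ext i j
  by_cases h : i = j
  · subst h
    have hi := Nat.lt_succ_iff.1 i.2
    simp [Matrix.trace, Fin.sum_univ_two, Nat.cast_sub hi]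
    linear_combination Complex.I * h2
  · simp [h, Matrix.diagonal_apply_ne]

lemma dtau_basisU_conjTranspose (n : ℕ) (l : Fin 4) :
    (dtau n (basisU l))ᴴ = -dtau n (basisU l) := by
  have h : (basisU l)ᴴ = -basisU l := by
    rw [← lieU_single]
    exact star_lieU _
  rw [dtau_conjTranspose, h, dtau_neg]

lemma X_trFn (m : ℤ) (l : Fin 4) (hl : l ≠ 3) (Φ : C2 → EndV n) :
    X l (trFn m Φ) = trFn m fun z => -(Φ z * dtau n (basisU l)) := by
  rw [X, fieldU_trFn, dtauU_single m n l hl, dtau_basisU_conjTranspose]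
  simp only [mul_neg]

lemma trFn_smul (m : ℤ) (c : ℂ) (Φ : C2 → EndV n) :
    (trFn m fun z => c • Φ z) = c • trFn m Φ := by
  funext g
  simp [trFn]

lemma D3_trFn (m : ℤ) (Φ : C2 → EndV n) :
    D3 (trFn m Φ) = ((n : ℂ) ^ 2 + 2 * n) • trFn m Φ := by
  rw [D3, X_trFn m 0 (by decide), X_trFn m 1 (by decide), X_trFn m 2 (by decide),
    X_trFn m 0 (by decide), X_trFn m 1 (by decide), X_trFn m 2 (by decide), ← trFn_smul]
  funext g
  have h := congrArg (fun B => (tauU m n g.k)ᴴ * (Φ g.z * B)) (casimir_eq n)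
  simp only [casimir, Matrix.mul_smul, mul_one, mul_add] at h
  simp only [trFn, Pi.sub_apply, Pi.neg_apply, neg_mul, neg_neg, mul_assoc,
    Matrix.mul_smul]
  rw [← Matrix.trace_neg, ← Matrix.trace_sub, ← Matrix.trace_sub]
  congr 1
  rw [neg_smul] at h
  rw [← neg_eq_iff_eq_neg.2 h]
  abel

lemma D4_trFn {m : ℤ} (hmn : Even ((n : ℤ) - m)) (Φ : C2 → EndV n) :
    D4 (trFn m Φ) = (-(m : ℂ)) • trFn m Φ := by
  have h : X 3 (trFn m Φ) = (Complex.I * m) • trFn m Φ := by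
    rw [X, fieldU_trFn, dtauU_three hmn, ← trFn_smul]
    simp
  rw [D4, h, smul_smul]
  congr 1
  linear_combination (m : ℂ) * Complex.I_mul_I

/-- The symbol of `𝐃_n`, with `z` replaced by `k⁻¹ z`. -/
def symbolK (n : ℕ) (k : U2) : PolyMat n := Matrix.of fun a b =>
  MvPolynomial.C (Complex.I * dtau n (basisU 0) a b) *
      (symU k 1 * symV k 1 - symU k 0 * symV k 0) +
    MvPolynomial.C (dtau n (basisU 1) a b) * (symU k 0 * symV k 1 - symU k 1 * symV k 0) -
    MvPolynomial.C (Complex.I * dtau n (basisU 2) a b) *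
      (symU k 1 * symV k 0 + symU k 0 * symV k 1)

lemma symbolY_act (k : U2) (z : C2) : symbolY (act k z) =
    (k : Matrix (Fin 2) (Fin 2) ℂ) * symbolY z * (k : Matrix (Fin 2) (Fin 2) ℂ)ᴴ := by
  have h1 : ∀ z : C2, symbolY z = (Complex.I * ((‖z‖ ^ 2 : ℝ) : ℂ)) • 1 -
      (2 * Complex.I) • Matrix.vecMulVec z.ofLp (star z.ofLp) := by
    intro z
    rw [symbolY_eq, norm_sq_eq]
    ext i j
    fin_cases i <;> fin_cases j <;>
      simp [kMat, basisU, Matrix.mul_apply, Fin.sum_univ_two, Matrix.conjTranspose_apply,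
        Matrix.vecMulVec] <;> ring
  have hu : (k : Matrix (Fin 2) (Fin 2) ℂ) * (k : Matrix (Fin 2) (Fin 2) ℂ)ᴴ = 1 :=
    Matrix.mem_unitaryGroup_iff.1 k.2
  have h2 : Matrix.vecMulVec (act k z).ofLp (star (act k z).ofLp) =
      (k : Matrix (Fin 2) (Fin 2) ℂ) * Matrix.vecMulVec z.ofLp (star z.ofLp) *
        (k : Matrix (Fin 2) (Fin 2) ℂ)ᴴ := by
    rw [Matrix.mul_vecMulVec, Matrix.vecMulVec_mul, ← Matrix.star_mulVec]
    rfl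
  rw [h1, h1, norm_act, h2, mul_sub, sub_mul, Matrix.mul_smul, Matrix.smul_mul, mul_one, hu,
    Matrix.mul_smul, Matrix.smul_mul]

lemma evalM_symbolM_act (k : U2) (z : C2) : evalM (act k z) (symbolM n) =
    tau n k * evalM z (symbolM n) * (tau n k)ᴴ := by
  rw [evalM_symbolM_eq, evalM_symbolM_eq, symbolY_act, ← dtau_conj, Matrix.mul_smul,
    Matrix.smul_mul]

lemma evalM_symbolK (k : U2) (z : C2) :
    evalM z (symbolK n k) = evalM (act (k⁻¹ : U2) z) (symbolM n) := by
  ext a b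
  simp only [evalM_apply, symbolK, symbolM, Matrix.of_apply, map_add, map_sub, map_mul, evalP_C,
    evalP_symU, evalP_symV, evalP_inl, evalP_inr]

/-- A constant matrix as a matrix of polynomials. -/
def constM (B : EndV n) : PolyMat n := B.map MvPolynomial.C

lemma evalM_constM (B : EndV n) (z : C2) : evalM z (constM B) = B := by
  ext a b
  simp [evalM_apply, constM]

lemma symbolK_mul (m : ℤ) (k : U2) :
    symbolK n k * constM (tauU m n k)ᴴ = constM (tauU m n k)ᴴ * symbolM n := by
  refine polyMat_eq fun z _ => ?_
  rw [map_mul, map_mul, evalM_constM, evalM_symbolK, evalM_symbolM_act, tau_conj_eq_tauU m,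
    tauU_inv, Matrix.conjTranspose_conjTranspose, mul_assoc, mul_assoc, tauU_mul_conjTranspose,
    mul_one]

/-- Multiplication of a matrix of smooth functions by a constant matrix on the right. -/
def mulR (Ψ : SmoothMat n) (B : EndV n) : SmoothMat n := Matrix.of fun a b => ∑ c, B c b • Ψ a c

lemma valM_mulR (Ψ : SmoothMat n) (B : EndV n) (z : C2) : valM (mulR Ψ B) z = valM Ψ z * B := by
  ext a b
  simp [valM, mulR, Matrix.mul_apply, mul_comm]

lemma symb_mulR (r : Poly) (Ψ : SmoothMat n) (B : EndV n) (a b : Fin (n + 1)) :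
    symb r (mulR Ψ B a b) = mulR (actM (r • (1 : PolyMat n)) Ψ) B a b := by
  simp only [mulR, Matrix.of_apply, map_sum, map_smul, actM_smul_one]

lemma valM_actM_constM (B : EndV n) (Ψ : SmoothMat n) (z : C2) :
    valM (actM (constM B) Ψ) z = B * valM Ψ z := by
  ext a b
  simp [valM, actM, constM, Matrix.mul_apply]

lemma symb_sum_coefSym (m : ℤ) (k : U2) (z : C2) (r : Poly) (Ψ : SmoothMat n) (B : EndV n) :
    (symb r (∑ p, symb (coefSym m p k) (mulR Ψ (-B) p.1 p.2)) : C2 → ℂ) z =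
      -(valM (actM (constM B * (r • (1 : PolyMat n)) * constM (tauU m n k)ᴴ) Ψ) z).trace := by
  have h1 : constM B * (r • (1 : PolyMat n)) * constM (tauU m n k)ᴴ =
      constM B * (constM (tauU m n k)ᴴ * (r • (1 : PolyMat n))) := by
    simp only [smul_mul_assoc, mul_smul_comm, mul_one]
  have h2 : symb r (∑ p, symb (coefSym m p k) (mulR Ψ (-B) p.1 p.2)) =
      ∑ p, symb (coefSym m p k) (mulR (actM (r • (1 : PolyMat n)) Ψ) (-B) p.1 p.2) := by
    rw [map_sum]
    refine Finset.sum_congr rfl fun p _ => ?_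
    rw [← symb_mulR, ← Module.End.mul_apply, ← map_mul, mul_comm, map_mul, Module.End.mul_apply]
  have h3 := congrFun (trFn_eq_ofFam m (mulR (actM (r • (1 : PolyMat n)) Ψ) (-B))) ⟨k, z⟩
  rw [h2]
  refine h3.symm.trans ?_
  rw [h1, actM_mul, actM_mul, valM_actM_constM, valM_actM_constM, trFn, valM_mulR, mul_neg, mul_neg,
    Matrix.trace_neg, ← mul_assoc, Matrix.trace_mul_comm]

lemma symbolK_eq (k : U2) : symbolK n k =
    (MvPolynomial.C Complex.I : Poly) • (constM (dtau n (basisU 0)) *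
      ((symU k 1 * symV k 1 - symU k 0 * symV k 0) • (1 : PolyMat n))) +
    constM (dtau n (basisU 1)) * ((symU k 0 * symV k 1 - symU k 1 * symV k 0) • (1 : PolyMat n)) -
    (MvPolynomial.C Complex.I : Poly) • (constM (dtau n (basisU 2)) *
      ((symU k 1 * symV k 0 + symU k 0 * symV k 1) • (1 : PolyMat n))) := by
  ext1 a b
  simp only [symbolK, constM, Matrix.of_apply, Matrix.add_apply, Matrix.sub_apply,
    Matrix.smul_apply, mul_smul_comm, mul_one, Matrix.map_apply, smul_eq_mul, map_mul]
  ring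

lemma valM_add (F H : SmoothMat n) (z : C2) : valM (F + H) z = valM F z + valM H z := rfl

lemma valM_sub (F H : SmoothMat n) (z : C2) : valM (F - H) z = valM F z - valM H z := rfl

lemma valM_smul (c : ℂ) (F : SmoothMat n) (z : C2) : valM (c • F) z = c • valM F z := rfl

lemma D2_trFn (m : ℤ) (Ψ : SmoothMat n) :
    D2 (trFn m (valM Ψ)) = -trFn m (valM (actM (symbolM n) Ψ)) := by
  have hX : ∀ l : Fin 4, l ≠ 3 → X l (trFn m (valM Ψ)) =
      ofFam fun k => ∑ p, symb (coefSym m p k) (mulR Ψ (-dtau n (basisU l)) p.1 p.2) := by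
    intro l hl
    rw [X_trFn m l hl, ← trFn_eq_ofFam]
    congr 1
    funext z
    rw [valM_mulR, mul_neg]
  funext g
  rw [D2, hX 0 (by decide), hX 1 (by decide), hX 2 (by decide)]
  have k0 := symb_sum_coefSym m g.k g.z (symU g.k 1 * symV g.k 1 - symU g.k 0 * symV g.k 0) Ψ
    (dtau n (basisU 0))
  have k1 := symb_sum_coefSym m g.k g.z (symU g.k 0 * symV g.k 1 - symU g.k 1 * symV g.k 0) Ψ
    (dtau n (basisU 1))
  have k2 := symb_sum_coefSym m g.k g.z (symU g.k 1 * symV g.k 0 + symU g.k 0 * symV g.k 1) Ψ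
    (dtau n (basisU 2))
  have hS : trFn m (valM (actM (symbolM n) Ψ)) g =
      (valM (actM (symbolK n g.k * constM (tauU m n g.k)ᴴ) Ψ) g.z).trace := by
    rw [symbolK_mul, actM_mul, valM_actM_constM]
    rfl
  rw [symbolK_eq, sub_mul, add_mul, smul_mul_assoc, smul_mul_assoc, actM_sub, actM_add,
    actM_C_smul, actM_C_smul, valM_sub, valM_add, valM_smul, valM_smul, Matrix.trace_sub,
    Matrix.trace_add, Matrix.trace_smul, Matrix.trace_smul, smul_eq_mul, smul_eq_mul] at hS
  rw [Pi.neg_apply, hS]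
  clear hS hX
  generalize (valM (actM (constM (dtau n (basisU 0)) * _ * _) Ψ) g.z).trace = t0 at k0 ⊢
  generalize (valM (actM (constM (dtau n (basisU 1)) * _ * _) Ψ) g.z).trace = t1 at k1 ⊢
  generalize (valM (actM (constM (dtau n (basisU 2)) * _ * _) Ψ) g.z).trace = t2 at k2 ⊢
  generalize hf0 : (fun k => ∑ p, symb (coefSym m p k) (mulR Ψ (-dtau n (basisU 0)) p.1 p.2)) = f0
  generalize hf1 : (fun k => ∑ p, symb (coefSym m p k) (mulR Ψ (-dtau n (basisU 1)) p.1 p.2)) = f1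
  generalize hf2 : (fun k => ∑ p, symb (coefSym m p k) (mulR Ψ (-dtau n (basisU 2)) p.1 p.2)) = f2
  rw [show (∑ p, symb (coefSym m p g.k) (mulR Ψ (-dtau n (basisU 0)) p.1 p.2)) = f0 g.k from
    congrFun hf0 g.k] at k0
  rw [show (∑ p, symb (coefSym m p g.k) (mulR Ψ (-dtau n (basisU 1)) p.1 p.2)) = f1 g.k from
    congrFun hf1 g.k] at k1
  rw [show (∑ p, symb (coefSym m p g.k) (mulR Ψ (-dtau n (basisU 2)) p.1 p.2)) = f2 g.k from
    congrFun hf2 g.k] at k2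
  have a1 := neg_four_Zd_Zb 1 1 f0 g
  have a2 := neg_four_Zd_Zb 0 0 f0 g
  have a3 := neg_four_Zb_Zd 0 1 f1 g
  have a4 := neg_four_Zd_Zb 0 1 f1 g
  have a5 := neg_four_Zd_Zb 0 1 f2 g
  have a6 := neg_four_Zb_Zd 0 1 f2 g
  simp only [ofFam] at a1 a2 a3 a4 a5 a6
  simp only [map_sub symb, map_add symb, LinearMap.sub_apply, LinearMap.add_apply,
    Submodule.coe_sub, Submodule.coe_add, Pi.sub_apply, Pi.add_apply] at k0 k1 k2
  simp only [Pi.add_apply, Pi.sub_apply, Pi.smul_apply, smul_eq_mul, lapG]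
  linear_combination (Complex.I) * a1 - Complex.I * a2 + a3 - a4 -
    Complex.I * a5 - Complex.I * a6 + Complex.I * k0 + k1 - Complex.I * k2

end

section
/-! ### Gaussian averages of bounded eigenfunctions of the Laplacian -/

/-- The standard basis of `ℂ²` over `ℝ`. -/
def bv (i : Fin 2 ⊕ Fin 2) : C2 :=
  EuclideanSpace.single (Sum.elim id id i) (Sum.elim (fun _ => 1) (fun _ => Complex.I) i)

lemma sum_inner_bv (w : C2) : ∑ i, inner ℝ (bv i) w • bv i = w := by
  ext l
  have h := Complex.re_add_im (w l)
  fin_cases l <;>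
    simp [bv, ← rInner_eq_inner, rInner, Fin.sum_univ_two] at h ⊢

lemma norm_bv (i : Fin 2 ⊕ Fin 2) : ‖bv i‖ = 1 := by
  rcases i with l | l <;> simp [bv]

lemma symb_normP : symb normP = -∑ i, dirD (bv i) * dirD (bv i) := by
  have h : ∀ l : Fin 2, symb (MvPolynomial.X (Sum.inl l) * MvPolynomial.X (Sum.inr l)) =
      -(dirD (bv (Sum.inl l)) * dirD (bv (Sum.inl l)) +
        dirD (bv (Sum.inr l)) * dirD (bv (Sum.inr l))) := by
    intro l
    have hc := dirD_comm (bv (Sum.inl l)) (bv (Sum.inr l))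
    rw [map_mul, symb_X, symb_X]
    simp only [gen, Sum.elim_inl, Sum.elim_inr, id]
    change (-Complex.I) • (dirD (bv (Sum.inl l)) + Complex.I • dirD (bv (Sum.inr l))) *
      (-Complex.I) • (dirD (bv (Sum.inl l)) + (-Complex.I) • dirD (bv (Sum.inr l))) = _
    generalize dirD (bv (Sum.inl l)) = A at *
    generalize dirD (bv (Sum.inr l)) = B at *
    simp only [smul_mul_assoc, mul_smul_comm, add_mul, mul_add, smul_add, smul_smul, hc]
    match_scalars <;> simp
  rw [normP, map_add, h, h, Fintype.sum_sum_type, Fin.sum_univ_two, Fin.sum_univ_two]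
  abel

/-- All the derivatives of `u` are bounded. -/
def AllBdd (u : SmoothFn) : Prop :=
  ∀ L : List C2, ∃ C : ℝ, ∀ z, ‖((L.map dirD).prod u : C2 → ℂ) z‖ ≤ C

lemma AllBdd.dirD {u : SmoothFn} (h : AllBdd u) (v : C2) : AllBdd (dirD v u) := by
  intro L
  obtain ⟨C, hC⟩ := h (L ++ [v])
  refine ⟨C, fun z => ?_⟩
  simpa using hC z

lemma AllBdd.bound {u : SmoothFn} (h : AllBdd u) : ∃ C : ℝ, ∀ z, ‖(u : C2 → ℂ) z‖ ≤ C := by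
  obtain ⟨C, hC⟩ := h []
  exact ⟨C, by simpa using hC⟩

/-- The Gaussian `e^{-c|w|²}`. -/
def gauss (c : ℂ) (w : C2) : ℂ := Complex.exp (-c * ((‖w‖ ^ 2 : ℝ) : ℂ))

lemma norm_gauss (c : ℂ) (w : C2) : ‖gauss c w‖ = Real.exp (-c.re * ‖w‖ ^ 2) := by
  rw [gauss, Complex.norm_exp, Complex.re_mul_ofReal, Complex.neg_re]

lemma hasFDerivAt_gauss (c : ℂ) (w : C2) : HasFDerivAt (gauss c)
    ((gauss c w * (-c)) • Complex.ofRealCLM.comp ((2 : ℝ) • innerSL ℝ w)) w := by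
  have h1 : HasFDerivAt (fun x : C2 => ‖x‖ ^ 2) ((2 : ℝ) • innerSL ℝ w) w := by
    have h0 := (hasStrictFDerivAt_norm_sq w).hasFDerivAt
    rwa [← Nat.cast_smul_eq_nsmul ℝ, Nat.cast_ofNat] at h0
  have h2 := (((Complex.ofRealCLM.hasFDerivAt (x := ‖w‖ ^ 2)).comp w h1).const_mul (-c)).cexp
  refine h2.congr_fderiv ?_
  rw [smul_smul]
  rfl

lemma fderiv_gauss (c : ℂ) (w v : C2) :
    fderiv ℝ (gauss c) w v = -2 * c * ((inner ℝ v w : ℝ) : ℂ) * gauss c w := by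
  rw [(hasFDerivAt_gauss c w).fderiv]
  simp [real_inner_comm]
  ring

lemma continuous_gauss (c : ℂ) : Continuous (gauss c) :=
  continuous_iff_continuousAt.2 fun w => (hasFDerivAt_gauss c w).continuousAt

lemma integrable_gauss {c : ℂ} (hc : 0 < c.re) : Integrable (gauss c) := by
  have h := GaussianFourier.integrable_cexp_neg_mul_sq_norm_add (V := C2) hc 0 0
  refine h.congr (Filter.Eventually.of_forall fun w => ?_)
  simp [gauss]

lemma integrable_norm_mul_gauss {c : ℂ} (hc : 0 < c.re) :
    Integrable fun w : C2 => ‖w‖ * ‖gauss c w‖ := by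
  have hc2 : 0 < (c / 2).re := by
    rw [show c / 2 = c / ((2 : ℝ) : ℂ) by push_cast; rfl, Complex.div_ofReal_re]
    linarith
  have h1 := ((integrable_gauss hc2).norm).const_mul (1 + 1 / c.re)
  refine h1.mono' ?_ (Filter.Eventually.of_forall fun w => ?_)
  · exact (continuous_norm.mul (continuous_gauss c).norm).aestronglyMeasurable
  · rw [norm_mul, norm_norm, norm_norm, norm_gauss, norm_gauss,
      show (c / 2).re = c.re / 2 by
        rw [show c / 2 = c / ((2 : ℝ) : ℂ) by push_cast; rfl, Complex.div_ofReal_re]]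
    have h2 : Real.exp (-c.re * ‖w‖ ^ 2) =
        Real.exp (-(c.re / 2) * ‖w‖ ^ 2) * Real.exp (-(c.re / 2) * ‖w‖ ^ 2) := by
      rw [← Real.exp_add]
      congr 1
      ring
    have h3 : ‖w‖ * Real.exp (-(c.re / 2) * ‖w‖ ^ 2) ≤ 1 + 1 / c.re := by
      have h4 := Real.add_one_le_exp (c.re / 2 * ‖w‖ ^ 2)
      have h5 : Real.exp (-(c.re / 2) * ‖w‖ ^ 2) * Real.exp (c.re / 2 * ‖w‖ ^ 2) = 1 := by
        rw [← Real.exp_add]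
        simp
      have h6 : ‖w‖ ≤ (1 + 1 / c.re) * (c.re / 2 * ‖w‖ ^ 2 + 1) := by
        have h7 : (1 + 1 / c.re) * (c.re / 2 * ‖w‖ ^ 2 + 1) =
            c.re / 2 * ‖w‖ ^ 2 + 1 + (‖w‖ ^ 2 / 2 + 1 / c.re) := by
          field_simp
        have h8 : 0 ≤ 1 / c.re := by positivity
        have h9 : 0 ≤ c.re / 2 * ‖w‖ ^ 2 := by positivity
        rw [h7]
        nlinarith [sq_nonneg (‖w‖ - 1)]
      have h10 : 0 < Real.exp (-(c.re / 2) * ‖w‖ ^ 2) := Real.exp_pos _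
      calc ‖w‖ * Real.exp (-(c.re / 2) * ‖w‖ ^ 2)
          ≤ ((1 + 1 / c.re) * Real.exp (c.re / 2 * ‖w‖ ^ 2)) *
            Real.exp (-(c.re / 2) * ‖w‖ ^ 2) := by
            refine mul_le_mul_of_nonneg_right (h6.trans ?_) h10.le
            exact mul_le_mul_of_nonneg_left h4 (by positivity)
        _ = 1 + 1 / c.re := by rw [mul_assoc, mul_comm (Real.exp (c.re / 2 * ‖w‖ ^ 2)), h5, mul_one]
    rw [h2, ← mul_assoc]
    exact mul_le_mul_of_nonneg_right h3 (Real.exp_pos _).le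

lemma integrable_gauss_mul {c : ℂ} (hc : 0 < c.re) {f : C2 → ℂ} (hf : Continuous f) {M : ℝ}
    (hM : ∀ w, ‖f w‖ ≤ M) : Integrable fun w => gauss c w * f w := by
  refine ((integrable_gauss hc).norm.const_mul M).mono'
    ((continuous_gauss c).mul hf).aestronglyMeasurable (Filter.Eventually.of_forall fun w => ?_)
  rw [norm_mul, mul_comm]
  exact mul_le_mul_of_nonneg_right (hM w) (norm_nonneg _)

lemma integrable_inner_gauss_mul {c : ℂ} (hc : 0 < c.re) (v : C2) {f : C2 → ℂ} (hf : Continuous f)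
    {M : ℝ} (hM : ∀ w, ‖f w‖ ≤ M) :
    Integrable fun w => ((inner ℝ v w : ℝ) : ℂ) * gauss c w * f w := by
  have hi : Continuous fun w : C2 => ((inner ℝ v w : ℝ) : ℂ) :=
    Complex.continuous_ofReal.comp (innerSL ℝ v).continuous
  refine ((integrable_norm_mul_gauss hc).const_mul (‖v‖ * M)).mono'
    ((hi.mul (continuous_gauss c)).mul hf).aestronglyMeasurable
    (Filter.Eventually.of_forall fun w => ?_)
  have h1 := abs_real_inner_le_norm v w
  rw [norm_mul, norm_mul, Complex.norm_real, Real.norm_eq_abs]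
  calc |inner ℝ v w| * ‖gauss c w‖ * ‖f w‖ ≤ (‖v‖ * ‖w‖) * ‖gauss c w‖ * M := by
        have := hM w
        gcongr
    _ = _ := by ring

/-- The dilation `w ↦ u(z + r w)` of a smooth function. -/
def dil (u : SmoothFn) (z : C2) (r : ℝ) : SmoothFn :=
  ⟨fun w => (u : C2 → ℂ) (z + r • w), (contDiff_coe u).comp
    (contDiff_const.add (contDiff_id.const_smul r))⟩

lemma fderiv_dil (u : SmoothFn) (z : C2) (r : ℝ) (w v : C2) :
    fderiv ℝ (fun w => (u : C2 → ℂ) (z + r • w)) w v = r * (dirD v u : C2 → ℂ) (z + r • w) := by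
  have h1 : HasFDerivAt (fun w : C2 => z + r • w) (r • ContinuousLinearMap.id ℝ C2) w :=
    ((ContinuousLinearMap.id ℝ C2).hasFDerivAt.const_smul r).const_add z
  have h2 := (differentiable_coe u (z + r • w)).hasFDerivAt.comp w h1
  have h3 : fderiv ℝ (fun w => (u : C2 → ℂ) (z + r • w)) w =
      (fderiv ℝ (u : C2 → ℂ) (z + r • w)).comp (r • ContinuousLinearMap.id ℝ C2) := h2.fderiv
  rw [h3, dirD_apply]
  simp

lemma continuous_dil (u : SmoothFn) (z : C2) (r : ℝ) :
    Continuous fun w => (u : C2 → ℂ) (z + r • w) := (contDiff_coe (dil u z r)).continuous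

/-- Integration by parts against a Gaussian. -/
lemma integral_inner_gauss {c : ℂ} (hc : 0 < c.re) {u : SmoothFn} (hu : AllBdd u) (z v : C2)
    (r : ℝ) : 2 * c * ∫ w, ((inner ℝ v w : ℝ) : ℂ) * gauss c w * (u : C2 → ℂ) (z + r • w) =
      r * ∫ w, gauss c w * (dirD v u : C2 → ℂ) (z + r • w) := by
  obtain ⟨M, hM⟩ := hu.bound
  obtain ⟨M', hM'⟩ := (hu.dirD v).bound
  have h1 := integrable_inner_gauss_mul hc v (continuous_dil u z r) fun w => hM _
  have h2 := integrable_gauss_mul hc (continuous_dil (dirD v u) z r) fun w => hM' _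
  have h3 := integrable_gauss_mul hc (continuous_dil u z r) fun w => hM _
  have h := integral_mul_fderiv_eq_neg_fderiv_mul_of_integrable (μ := (volume : Measure C2))
    (f := gauss c) (g := fun w => (u : C2 → ℂ) (z + r • w)) (v := v) ?_ ?_ h3
    (fun w _ => (hasFDerivAt_gauss c w).differentiableAt)
    (fun w _ => differentiable_coe (dil u z r) w)
  · simp only [fderiv_gauss, fderiv_dil] at h
    rw [← integral_const_mul, ← integral_const_mul]
    rw [← integral_neg] at h
    calc _ = ∫ w, -(-2 * c * ((inner ℝ v w : ℝ) : ℂ) * gauss c w * (u : C2 → ℂ) (z + r • w)) := by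
          congr 1; funext w; ring
      _ = _ := by
          rw [← h]
          congr 1; funext w; ring
  · simp only [fderiv_gauss]
    refine (h1.const_mul (-2 * c)).congr (Filter.Eventually.of_forall fun w => ?_)
    simp only
    ring
  · simp only [fderiv_dil]
    refine (h2.const_mul (r : ℂ)).congr (Filter.Eventually.of_forall fun w => ?_)
    simp only
    ring

/-- Gaussian averages of an eigenfunction are multiples of it. The complex parameter `c` of the
Gaussian makes it possible to exclude eigenvalues which are not real. -/
lemma gauss_average {c : ℂ} (hc : 0 < c.re) {u : SmoothFn} (hu : AllBdd u) {ξ : ℂ}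
    (h : symb normP u = ξ • u) (z : C2) (r : ℝ) :
    ∫ w, gauss c w * (u : C2 → ℂ) (z + r • w) =
      (u : C2 → ℂ) z * (∫ w, gauss c w) * Complex.exp (-(ξ * r ^ 2 / (4 * c))) := by
  have hc0 : c ≠ 0 := fun h0 => by simp [h0] at hc
  obtain ⟨M, hM⟩ := hu.bound
  choose M' hM' using fun i => (hu.dirD (bv i)).bound
  -- `d/ds ∫ e^{-c|w|²} u(z + s w) dw` is `s / (2c)` times the average of the real Laplacian of `u`,
  -- by an integration by parts; this is a linear equation in `s`
  have hd : ∀ s : ℝ, HasDerivAt (fun s : ℝ => ∫ w, gauss c w * (u : C2 → ℂ) (z + s • w))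
      (-(ξ * s / (2 * c)) * ∫ w, gauss c w * (u : C2 → ℂ) (z + s • w)) s := by
    intro s
    have h1 : ∀ w : C2, ∀ t : ℝ, HasDerivAt (fun t : ℝ => gauss c w * (u : C2 → ℂ) (z + t • w))
        (∑ i, ((inner ℝ (bv i) w : ℝ) : ℂ) * gauss c w *
          (dirD (bv i) u : C2 → ℂ) (z + t • w)) t := by
      intro w t
      have h2 : HasDerivAt (fun t : ℝ => z + t • w) w t := by
        simpa using ((hasDerivAt_id t).smul_const w).const_add z
      have h3 := ((differentiable_coe u (z + t • w)).hasFDerivAt.comp_hasDerivAt t h2).const_mul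
        (gauss c w)
      refine h3.congr_deriv ?_
      conv_lhs => rw [← sum_inner_bv w]
      rw [map_sum, Finset.mul_sum]
      refine Finset.sum_congr rfl fun i _ => ?_
      rw [map_smul, Complex.real_smul, sum_inner_bv, dirD_apply]
      ring
    have h4 := hasDerivAt_integral_of_dominated_loc_of_deriv_le (μ := (volume : Measure C2))
      (F := fun (t : ℝ) (w : C2) => gauss c w * (u : C2 → ℂ) (z + t • w))
      (F' := fun (t : ℝ) (w : C2) => ∑ i, ((inner ℝ (bv i) w : ℝ) : ℂ) * gauss c w *
          (dirD (bv i) u : C2 → ℂ) (z + t • w)) (x₀ := s) (s := Set.univ)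
      (bound := fun w => (∑ i, M' i) * (‖w‖ * ‖gauss c w‖)) Filter.univ_mem
      (Filter.Eventually.of_forall fun t =>
        ((continuous_gauss c).mul (continuous_dil u z t)).aestronglyMeasurable)
      (integrable_gauss_mul hc (continuous_dil u z s) fun w => hM _)
      (integrable_finsetSum _ fun i _ => integrable_inner_gauss_mul hc (bv i)
        (continuous_dil (dirD (bv i) u) z s) fun w => hM' i _).aestronglyMeasurable
      (Filter.Eventually.of_forall fun w t _ => by
        refine (norm_sum_le _ _).trans ?_
        rw [Finset.sum_mul]
        refine Finset.sum_le_sum fun i _ => ?_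
        have h5 := abs_real_inner_le_norm (bv i) w
        rw [norm_bv, one_mul] at h5
        rw [norm_mul, norm_mul, Complex.norm_real, Real.norm_eq_abs, mul_comm (M' i)]
        have := hM' i (z + t • w)
        gcongr)
      ((integrable_norm_mul_gauss hc).const_mul _)
      (Filter.Eventually.of_forall fun w t _ => h1 w t)
    refine h4.2.congr_deriv ?_
    rw [integral_finsetSum _ fun i _ => integrable_inner_gauss_mul hc (bv i)
        (continuous_dil (dirD (bv i) u) z s) fun w => hM' i _]
    have h6 : ∀ i, ∫ w, ((inner ℝ (bv i) w : ℝ) : ℂ) * gauss c w *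
        (dirD (bv i) u : C2 → ℂ) (z + s • w) =
        (s / (2 * c)) * ∫ w, gauss c w * ((dirD (bv i) * dirD (bv i)) u : C2 → ℂ) (z + s • w) := by
      intro i
      have h7 := integral_inner_gauss hc (hu.dirD (bv i)) z (bv i) s
      rw [Module.End.mul_apply, div_mul_eq_mul_div, ← h7]
      field_simp
    have h8 : ∀ i, Integrable fun w =>
        gauss c w * ((dirD (bv i) * dirD (bv i)) u : C2 → ℂ) (z + s • w) := by
      intro i
      obtain ⟨M2, hM2⟩ := ((hu.dirD (bv i)).dirD (bv i)).bound
      exact integrable_gauss_mul hc (continuous_dil (dirD (bv i) (dirD (bv i) u)) z s) fun w => hM2 _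
    simp only [h6]
    rw [← Finset.mul_sum, ← integral_finsetSum _ fun i _ => h8 i]
    have h9 : ∀ y : C2, ∑ i, ((dirD (bv i) * dirD (bv i)) u : C2 → ℂ) y =
        -(ξ * (u : C2 → ℂ) y) := by
      intro y
      have h10 := congrFun (congrArg Subtype.val h) y
      rw [symb_normP, LinearMap.neg_apply, LinearMap.sum_apply] at h10
      simp only [Submodule.coe_neg, Pi.neg_apply, Submodule.coe_sum, Finset.sum_apply,
        Submodule.coe_smul, Pi.smul_apply, smul_eq_mul] at h10
      rw [← h10, neg_neg]
    simp only [← Finset.mul_sum, h9]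
    rw [← integral_const_mul, ← integral_const_mul]
    congr 1
    funext w
    field_simp
  set J : ℝ → ℂ := fun s => (∫ w, gauss c w * (u : C2 → ℂ) (z + s • w)) *
    Complex.exp (ξ * s ^ 2 / (4 * c)) with hJ
  have hJd : ∀ s, HasDerivAt J 0 s := by
    intro s
    have h1 : HasDerivAt (fun s : ℝ => ξ * (s : ℂ) ^ 2 / (4 * c)) (ξ * s / (2 * c)) s := by
      have h2 := (((Complex.ofRealCLM.hasDerivAt (x := s)).pow 2).const_mul ξ).div_const (4 * c)
      refine h2.congr_deriv ?_
      simp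
      field_simp
      ring
    refine ((hd s).mul h1.cexp).congr_deriv ?_
    ring
  have hJc := is_const_of_deriv_eq_zero (fun s => (hJd s).differentiableAt)
    (fun s => (hJd s).deriv) r 0
  simp only [hJ, zero_smul, add_zero, Complex.ofReal_zero, ne_eq, OfNat.ofNat_ne_zero,
    not_false_eq_true, zero_pow, mul_zero, zero_div, Complex.exp_zero, mul_one,
    integral_mul_const] at hJc
  rw [mul_comm ((u : C2 → ℂ) z), ← hJc, mul_assoc, ← Complex.exp_add, add_neg_cancel,
    Complex.exp_zero, mul_one]

end

section
/-! ### Bounded eigenfunctions of the Laplacian -/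

/-- The convolution of a smooth function with a smooth compactly supported one. -/
def mol (η : SmoothFn) (hη : HasCompactSupport (η : C2 → ℂ)) (u : SmoothFn) : SmoothFn :=
  ⟨convolution (u : C2 → ℂ) (η : C2 → ℂ) (ContinuousLinearMap.mul ℝ ℂ) volume,
    hη.contDiff_convolution_right _ (contDiff_coe u).continuous.locallyIntegrable (contDiff_coe η)⟩

variable {η : SmoothFn} (hη : HasCompactSupport (η : C2 → ℂ)) (u : SmoothFn)

lemma mol_apply (z : C2) :
    (mol η hη u : C2 → ℂ) z = ∫ t, (u : C2 → ℂ) t * (η : C2 → ℂ) (z - t) := rfl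

lemma mol_apply' (z : C2) :
    (mol η hη u : C2 → ℂ) z = ∫ t, (η : C2 → ℂ) t * (u : C2 → ℂ) (z - t) := by
  rw [mol_apply, ← integral_sub_left_eq_self _ volume z]
  simp [mul_comm]

lemma hasCompactSupport_dirD {η : SmoothFn} (hη : HasCompactSupport (η : C2 → ℂ)) (v : C2) :
    HasCompactSupport (dirD v η : C2 → ℂ) := hη.fderiv_apply ℝ v

lemma dirD_mol (v : C2) :
    dirD v (mol η hη u) = mol (dirD v η) (hasCompactSupport_dirD hη v) u := by
  apply Subtype.ext
  funext z
  have hu := (contDiff_coe u).continuous.locallyIntegrable (μ := (volume : Measure C2))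
  have h := hη.hasFDerivAt_convolution_right (ContinuousLinearMap.mul ℝ ℂ) hu
    ((contDiff_coe η).of_le (by simp)) z
  rw [dirD_apply]
  change fderiv ℝ (convolution (u : C2 → ℂ) (η : C2 → ℂ) (ContinuousLinearMap.mul ℝ ℂ) volume) z v
    = _
  rw [h.fderiv, convolution_precompR_apply _ hu (hη.fderiv ℝ)
    ((contDiff_coe η).continuous_fderiv (by simp))]
  rfl

lemma mul_sub_integrable {f : C2 → ℂ} (hf : Continuous f) (hc : HasCompactSupport f) {g : C2 → ℂ}
    (hg : Continuous g) (z : C2) : Integrable fun t => f t * g (z - t) :=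
  (hf.mul (hg.comp (continuous_const.sub continuous_id))).integrable_of_hasCompactSupport
    hc.mul_right

lemma mol_dirD (v : C2) : mol η hη (dirD v u) = dirD v (mol η hη u) := by
  rw [dirD_mol]
  apply Subtype.ext
  funext z
  rw [mol_apply', mol_apply']
  have hd : ∀ t, fderiv ℝ (fun t => (u : C2 → ℂ) (z - t)) t v = -(dirD v u : C2 → ℂ) (z - t) := by
    intro t
    have h1 : HasFDerivAt (fun t : C2 => z - t) (-ContinuousLinearMap.id ℝ C2) t :=
      (hasFDerivAt_id t).const_sub z
    have h2 : fderiv ℝ (fun t => (u : C2 → ℂ) (z - t)) t = _ :=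
      ((differentiable_coe u (z - t)).hasFDerivAt.comp t h1).fderiv
    rw [h2, dirD_apply]
    simp
  have hi := fun (f : SmoothFn) (hf : HasCompactSupport (f : C2 → ℂ)) (g : SmoothFn) =>
    mul_sub_integrable (contDiff_coe f).continuous hf (contDiff_coe g).continuous z
  have h := integral_mul_fderiv_eq_neg_fderiv_mul_of_integrable (μ := (volume : Measure C2))
    (f := (η : C2 → ℂ)) (g := fun t => (u : C2 → ℂ) (z - t)) (v := v)
    (hi (dirD v η) (hasCompactSupport_dirD hη v) u)
    (by
      simp only [hd, mul_neg]
      exact (hi η hη (dirD v u)).neg)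
    (hi η hη u)
    (fun t _ => differentiable_coe η t)
    (fun t _ => ((differentiable_coe u).comp (differentiable_id.const_sub z)) t)
  simp only [hd, mul_neg, integral_neg, neg_inj] at h
  exact h

lemma norm_mol_le {M : ℝ} (hM : ∀ z, ‖(u : C2 → ℂ) z‖ ≤ M) (z : C2) :
    ‖(mol η hη u : C2 → ℂ) z‖ ≤ M * ∫ t, ‖(η : C2 → ℂ) t‖ := by
  rw [mol_apply', mul_comm, ← integral_mul_const]
  refine norm_integral_le_of_norm_le
    (((contDiff_coe η).continuous.integrable_of_hasCompactSupport hη).norm.mul_const M)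
    (Filter.Eventually.of_forall fun t => ?_)
  rw [norm_mul]
  exact mul_le_mul_of_nonneg_left (hM _) (norm_nonneg _)

lemma allBdd_mol {M : ℝ} (hM : ∀ z, ‖(u : C2 → ℂ) z‖ ≤ M) : AllBdd (mol η hη u) := by
  intro L
  suffices h : ∃ (η' : SmoothFn) (hη' : HasCompactSupport (η' : C2 → ℂ)),
      (L.map dirD).prod (mol η hη u) = mol η' hη' u by
    obtain ⟨η', hη', h⟩ := h
    exact ⟨_, fun z => by rw [h]; exact norm_mol_le hη' u hM z⟩
  induction L with
  | nil => exact ⟨η, hη, rfl⟩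
  | cons v L ih =>
    obtain ⟨η', hη', h⟩ := ih
    exact ⟨dirD v η', hasCompactSupport_dirD hη' v, by
      rw [List.map_cons, List.prod_cons, Module.End.mul_apply, h, dirD_mol]⟩

/-- Convolution with `η`, as a linear map. -/
def molL {η : SmoothFn} (hη : HasCompactSupport (η : C2 → ℂ)) : SmoothFn →ₗ[ℂ] SmoothFn where
  toFun := mol η hη
  map_add' u w := by
    apply Subtype.ext
    funext z
    rw [Submodule.coe_add, Pi.add_apply, mol_apply', mol_apply', mol_apply', ← integral_add
      (mul_sub_integrable (contDiff_coe η).continuous hη (contDiff_coe u).continuous z)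
      (mul_sub_integrable (contDiff_coe η).continuous hη (contDiff_coe w).continuous z)]
    simp only [Submodule.coe_add, Pi.add_apply, mul_add]
  map_smul' c u := by
    apply Subtype.ext
    funext z
    rw [Submodule.coe_smul, Pi.smul_apply, mol_apply', mol_apply', RingHom.id_apply, smul_eq_mul,
      ← integral_const_mul]
    simp only [Submodule.coe_smul, Pi.smul_apply, smul_eq_mul, mul_left_comm]

lemma mol_eigen {u : SmoothFn} {ξ : ℂ} (h : symb normP u = ξ • u) :
    symb normP (mol η hη u) = ξ • mol η hη u := by
  have h1 : symb normP (molL hη u) = molL hη (symb normP u) := by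
    have h2 : ∀ v, dirD v (molL hη u) = molL hη (dirD v u) := fun v => (mol_dirD hη u v).symm
    have h3 : ∀ v, dirD v (molL hη (dirD v u)) = molL hη (dirD v (dirD v u)) :=
      fun v => (mol_dirD hη (dirD v u) v).symm
    simp only [symb_normP, LinearMap.neg_apply, LinearMap.sum_apply, Module.End.mul_apply, h2, h3,
      map_neg, map_sum]
  change symb normP (molL hη u) = ξ • molL hη u
  rw [h1, h, map_smul]

/-- A smooth approximation of the identity. -/
lemma exists_mol : ∃ (η : ℕ → SmoothFn) (hη : ∀ k, HasCompactSupport (η k : C2 → ℂ)),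
    (∀ k, ∫ t, ‖(η k : C2 → ℂ) t‖ = 1) ∧
    ∀ (u : SmoothFn) (z : C2), Filter.Tendsto (fun k => (mol (η k) (hη k) u : C2 → ℂ) z)
      Filter.atTop (nhds ((u : C2 → ℂ) z)) := by
  let φ : ℕ → ContDiffBump (0 : C2) := fun k =>
    ⟨1 / (k + 2 : ℝ), 1 / (k + 1 : ℝ), by positivity, by gcongr; norm_num⟩
  have hs : ∀ k, ContDiff ℝ ∞ fun t => (((φ k).normed volume t : ℝ) : ℂ) := fun k =>
    Complex.ofRealCLM.contDiff.comp (φ k).contDiff_normed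
  refine ⟨fun k => ⟨_, hs k⟩, fun k => ?_, fun k => ?_, fun u z => ?_⟩
  · exact (φ k).hasCompactSupport_normed.comp_left (g := fun x : ℝ => (x : ℂ)) Complex.ofReal_zero
  · rw [← (φ k).integral_normed (μ := (volume : Measure C2))]
    congr 1
    funext t
    change ‖(((φ k).normed volume t : ℝ) : ℂ)‖ = _
    rw [Complex.norm_real, Real.norm_of_nonneg ((φ k).nonneg_normed t)]
  · have h := ContDiffBump.convolution_tendsto_right_of_continuous (μ := (volume : Measure C2))
      (φ := φ) (l := Filter.atTop) tendsto_one_div_add_atTop_nhds_zero_nat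
      (contDiff_coe u).continuous z
    refine h.congr fun k => ?_
    rw [mol_apply', convolution_def]
    rfl

lemma integral_gauss_ne_zero {c : ℂ} (hc : 0 < c.re) : ∫ w, gauss c w ≠ 0 := by
  have h := GaussianFourier.integral_cexp_neg_mul_sq_norm (V := C2) hc
  have h1 : ∫ w, gauss c w = ∫ v : C2, Complex.exp (-c * ‖v‖ ^ 2) := by
    congr 1
    funext w
    simp [gauss]
  have hc0 : c ≠ 0 := fun h0 => by simp [h0] at hc
  rw [h1, h, Complex.cpow_ne_zero_iff]
  left
  exact div_ne_zero (by exact_mod_cast Real.pi_ne_zero) hc0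

/-- The averages of a bounded function are bounded in `r`; mollification reduces to the case of
bounded derivatives. -/
lemma gauss_bound {c : ℂ} (hc : 0 < c.re) {u : SmoothFn} {M : ℝ}
    (hM : ∀ z, ‖(u : C2 → ℂ) z‖ ≤ M) {ξ : ℂ} (h : symb normP u = ξ • u) (z : C2) (r : ℝ) :
    ‖(u : C2 → ℂ) z‖ * ‖∫ w, gauss c w‖ * Real.exp (-(ξ * r ^ 2 / (4 * c)).re) ≤
      M * ∫ w, ‖gauss c w‖ := by
  obtain ⟨η, hη, h1, ht⟩ := exists_mol
  refine le_of_tendsto (((ht u z).norm.mul_const _).mul_const _)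
    (Filter.Eventually.of_forall fun k => ?_)
  have h2 := gauss_average hc (allBdd_mol (hη k) u hM) (mol_eigen (hη k) h) z r
  rw [← Complex.neg_re, ← Complex.norm_exp, ← norm_mul, ← norm_mul, ← h2, mul_comm M,
    ← integral_mul_const]
  refine norm_integral_le_of_norm_le ((integrable_gauss hc).norm.mul_const M)
    (Filter.Eventually.of_forall fun w => ?_)
  rw [norm_mul]
  refine mul_le_mul_of_nonneg_left ?_ (norm_nonneg _)
  simpa [h1] using norm_mol_le (hη k) u hM (z + r • w)

/-- The bound for derivatives which leads both to Bernstein's inequality and to Liouville's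
theorem. -/
lemma gauss_deriv_bound {u : SmoothFn} {M : ℝ} (hM : ∀ z, ‖(u : C2 → ℂ) z‖ ≤ M) {ξ : ℝ}
    (h : symb normP u = (ξ : ℂ) • u) (v z : C2) (r : ℝ) :
    ‖(dirD v u : C2 → ℂ) z‖ * (|r| * ‖∫ w, gauss 1 w‖ * Real.exp (-(ξ * r ^ 2 / 4))) ≤
      M * (2 * ‖v‖ * ∫ w : C2, ‖w‖ * ‖gauss 1 w‖) := by
  obtain ⟨η, hη, h1, ht⟩ := exists_mol
  have hc : (0 : ℝ) < (1 : ℂ).re := by simp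
  refine le_of_tendsto ((ht (dirD v u) z).norm.mul_const _)
    (Filter.Eventually.of_forall fun k => ?_)
  have hb := allBdd_mol (hη k) u hM
  have he : symb normP (dirD v u) = (ξ : ℂ) • dirD v u := by
    rw [← map_smul, ← h, dirD_eq_symb, ← Module.End.mul_apply, ← Module.End.mul_apply, ← map_mul,
      ← map_mul, mul_comm]
  have h2 := gauss_average hc (hb.dirD v) (by
    rw [← mol_dirD]; exact mol_eigen (hη k) he) z r
  rw [← mol_dirD] at h2
  have h3 := integral_inner_gauss hc hb z v r
  rw [← mol_dirD, h2] at h3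
  have h4 : ‖∫ w, ((inner ℝ v w : ℝ) : ℂ) * gauss 1 w *
      (mol (η k) (hη k) u : C2 → ℂ) (z + r • w)‖ ≤
      ‖v‖ * M * ∫ w : C2, ‖w‖ * ‖gauss 1 w‖ := by
    rw [← integral_const_mul]
    refine norm_integral_le_of_norm_le ((integrable_norm_mul_gauss hc).const_mul _)
      (Filter.Eventually.of_forall fun w => ?_)
    have h5 := abs_real_inner_le_norm v w
    have h6 : ‖(mol (η k) (hη k) u : C2 → ℂ) (z + r • w)‖ ≤ M := by
      simpa [h1] using norm_mol_le (hη k) u hM (z + r • w)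
    rw [norm_mul, norm_mul, Complex.norm_real, Real.norm_eq_abs]
    calc _ ≤ (‖v‖ * ‖w‖) * ‖gauss 1 w‖ * M := by gcongr
      _ = _ := by ring
  rw [mul_one (2 : ℂ)] at h3
  have h7 := congrArg norm h3
  have h8 : (-((ξ : ℂ) * r ^ 2 / (4 * 1))).re = -(ξ * r ^ 2 / 4) := by
    rw [show -((ξ : ℂ) * r ^ 2 / (4 * 1)) = ((-(ξ * r ^ 2 / 4) : ℝ) : ℂ) by push_cast; ring,
      Complex.ofReal_re]
  rw [norm_mul, norm_mul, norm_mul, norm_mul, Complex.norm_exp, h8, Complex.norm_real,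
    Real.norm_eq_abs, Complex.norm_ofNat] at h7
  calc _ = |r| * (‖(mol (η k) (hη k) (dirD v u) : C2 → ℂ) z‖ * ‖∫ w, gauss 1 w‖ *
        Real.exp (-(ξ * r ^ 2 / 4))) := by ring
    _ ≤ _ := by rw [← h7]; linarith

/-- The eigenvalue of a bounded eigenfunction of `Δ_z` is real and nonnegative. -/
lemma eigenvalue_nonneg {u : SmoothFn} {M : ℝ} (hM : ∀ z, ‖(u : C2 → ℂ) z‖ ≤ M) {ξ : ℂ}
    (h : symb normP u = ξ • u) (hu : u ≠ 0) : ∃ r : ℝ, 0 ≤ r ∧ ξ = r := by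
  by_contra! hξ
  apply hu
  -- for such `c` the factor `e^{-ξ r² / (4c)}` of the Gaussian averages is unbounded in `r`
  obtain ⟨c, hc, hcξ⟩ : ∃ c : ℂ, 0 < c.re ∧ (ξ / c).re < 0 := by
    have h1 : ∃ t : ℝ, ξ.re + t * ξ.im < 0 := by
      by_cases him : ξ.im = 0
      · refine ⟨0, ?_⟩
        by_contra! hre
        exact hξ ξ.re (by simpa using hre) (Complex.ext rfl (by simp [him]))
      · refine ⟨-(ξ.re + 1) / ξ.im, ?_⟩
        rw [div_mul_cancel₀ _ him]
        linarith
    obtain ⟨t, ht⟩ := h1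
    refine ⟨⟨1, t⟩, one_pos, ?_⟩
    have h2 : 0 < Complex.normSq ⟨1, t⟩ := Complex.normSq_pos.2 fun h0 => by
      simpa using congrArg Complex.re h0
    rw [Complex.div_re, ← add_div]
    exact div_neg_of_neg_of_pos (by simpa [mul_comm] using ht) h2
  apply Subtype.ext
  funext z
  by_contra hz
  have hz' : 0 < ‖(u : C2 → ℂ) z‖ * ‖∫ w, gauss c w‖ :=
    mul_pos (norm_pos_iff.2 hz) (norm_pos_iff.2 (integral_gauss_ne_zero hc))
  have ht : Filter.Tendsto (fun r : ℝ => ‖(u : C2 → ℂ) z‖ * ‖∫ w, gauss c w‖ *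
      Real.exp ((-(ξ / c).re / 4) * r ^ 2)) Filter.atTop Filter.atTop := by
    refine (Real.tendsto_exp_atTop.comp ?_).const_mul_atTop hz'
    exact (Filter.tendsto_pow_atTop two_ne_zero).const_mul_atTop (by linarith)
  obtain ⟨r, hr⟩ := (ht.eventually_gt_atTop (M * ∫ w, ‖gauss c w‖)).exists
  have h3 := gauss_bound hc hM h z r
  have h4 : -(ξ * r ^ 2 / (4 * c)).re = (-(ξ / c).re / 4) * r ^ 2 := by
    rw [show ξ * (r : ℂ) ^ 2 / (4 * c) = ((r ^ 2 / 4 : ℝ) : ℂ) * (ξ / c) by push_cast; ring,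
      Complex.re_ofReal_mul]
    ring
  rw [h4] at h3
  exact absurd hr (not_lt.2 h3)

/-- Bernstein's inequality. -/
lemma exists_bernstein (ξ : ℝ) : ∃ C : ℝ, 0 ≤ C ∧ ∀ (u : SmoothFn) (M : ℝ),
    (∀ z, ‖(u : C2 → ℂ) z‖ ≤ M) → symb normP u = (ξ : ℂ) • u →
      ∀ v z, ‖(dirD v u : C2 → ℂ) z‖ ≤ C * ‖v‖ * M := by
  set a : ℝ := ‖∫ w, gauss 1 w‖ * Real.exp (-(ξ / 4)) with ha
  have ha0 : 0 < a := mul_pos (norm_pos_iff.2 (integral_gauss_ne_zero (by simp))) (Real.exp_pos _)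
  have hb0 : 0 ≤ ∫ w : C2, ‖w‖ * ‖gauss 1 w‖ := integral_nonneg fun w => by positivity
  refine ⟨2 * (∫ w : C2, ‖w‖ * ‖gauss 1 w‖) / a, by positivity, fun u M hM h v z => ?_⟩
  have h1 := gauss_deriv_bound hM h v z 1
  rw [abs_one, one_mul, one_pow, mul_one, ← ha] at h1
  rw [div_mul_eq_mul_div, div_mul_eq_mul_div, le_div_iff₀ ha0]
  linarith

/-- Liouville's theorem. -/
lemma liouville {u : SmoothFn} {M : ℝ} (hM : ∀ z, ‖(u : C2 → ℂ) z‖ ≤ M)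
    (h : symb normP u = 0) (z : C2) : (u : C2 → ℂ) z = (u : C2 → ℂ) 0 := by
  refine is_const_of_fderiv_eq_zero (𝕜 := ℝ) (differentiable_coe u) (fun y => ?_) z 0
  ext v
  rw [← dirD_apply]
  by_contra hy
  have hy' : 0 < ‖(dirD v u : C2 → ℂ) y‖ * ‖∫ w, gauss 1 w‖ :=
    mul_pos (norm_pos_iff.2 hy) (norm_pos_iff.2 (integral_gauss_ne_zero (by simp)))
  have ht : Filter.Tendsto (fun r : ℝ => ‖(dirD v u : C2 → ℂ) y‖ * ‖∫ w, gauss 1 w‖ * r)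
      Filter.atTop Filter.atTop := Filter.tendsto_id.const_mul_atTop hy'
  obtain ⟨r, hr, hr0⟩ := ((ht.eventually_gt_atTop (M * (2 * ‖v‖ * ∫ w : C2, ‖w‖ * ‖gauss 1 w‖))).and
    (Filter.eventually_ge_atTop 0)).exists
  have h1 := gauss_deriv_bound (ξ := 0) hM (by rw [h]; simp) v y r
  rw [zero_mul, zero_div, neg_zero, Real.exp_zero, mul_one, abs_of_nonneg hr0] at h1
  linarith

end

section
variable {n : ℕ}
/-! ### Uniqueness of the matrix-valued eigenfunctions -/


/-- The coefficients of the linear form `linP z`, up to the factor `i / 2`. -/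
def formC (z : C2) : Fin 2 ⊕ Fin 2 → ℂ := Sum.elim (fun l => conj (z l)) (fun l => z l)

/-- The monomial in `z, z̄` with exponents `k`. -/
def mono (k : Fin 2 ⊕ Fin 2 → ℕ) : Poly := ∏ i, MvPolynomial.X i ^ k i

lemma linP_pow (z : C2) (d : ℕ) : linP z ^ d =
    ∑ k ∈ Finset.piAntidiag Finset.univ d, MvPolynomial.C ((Complex.I / 2) ^ d *
      ((Nat.multinomial Finset.univ k : ℂ) * ∏ i, formC z i ^ k i)) * mono k := by
  have h : linP z = MvPolynomial.C (Complex.I / 2) *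
      ∑ i, MvPolynomial.C (formC z i) * MvPolynomial.X i := by
    simp only [linP, formC, Fintype.sum_sum_type, Sum.elim_inl, Sum.elim_inr, map_mul, mul_add,
      Finset.mul_sum, ← mul_assoc, Finset.sum_add_distrib]
    rw [add_comm]
  rw [h, mul_pow, Finset.sum_pow_eq_sum_piAntidiag, Finset.mul_sum]
  refine Finset.sum_congr rfl fun k _ => ?_
  simp only [mul_pow, Finset.prod_mul_distrib, mono, map_mul, map_pow, map_prod, map_natCast]
  ring

/-- The polynomial of degree `d` dual to the Taylor polynomial of `u` at the origin with respect
to the Fischer inner product. -/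
def fischer (u : SmoothFn) (d : ℕ) : Poly :=
  ∑ k ∈ Finset.piAntidiag Finset.univ d, MvPolynomial.C ((Nat.multinomial Finset.univ k : ℂ) *
    conj ((symb (mono k) u : C2 → ℂ) 0)) * mono k

lemma evalP_mono (z : C2) (k : Fin 2 ⊕ Fin 2 → ℕ) :
    evalP z (mono k) = ∏ i, conj (formC z i) ^ k i := by
  have h : ∀ i, evalP z (MvPolynomial.X i) = conj (formC z i) := by
    rintro (l | l) <;> simp [formC]
  simp only [mono, map_prod, map_pow, h]

lemma dirD_pow_apply_zero (u : SmoothFn) (d : ℕ) (z : C2) :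
    (((dirD z ^ d) u : SmoothFn) : C2 → ℂ) 0 =
      (Complex.I / 2) ^ d * conj (evalP z (fischer u d)) := by
  rw [dirD_eq_symb, ← map_pow, linP_pow, map_sum, LinearMap.sum_apply, fischer, map_sum, map_sum,
    Submodule.coe_sum, Finset.sum_apply, Finset.mul_sum]
  refine Finset.sum_congr rfl fun k _ => ?_
  rw [map_mul, symb_C, map_mul, evalP_C, evalP_mono]
  simp only [Module.End.mul_apply, LinearMap.smul_apply, Module.End.one_apply, Submodule.coe_smul,
    Pi.smul_apply, smul_eq_mul, map_mul, map_prod, map_pow, Complex.conj_conj, map_natCast]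
  ring

lemma symb_fischer (u : SmoothFn) (d : ℕ) : (symb (fischer u d) u : C2 → ℂ) 0 =
    ((∑ k ∈ Finset.piAntidiag Finset.univ d, (Nat.multinomial Finset.univ k : ℝ) *
      ‖(symb (mono k) u : C2 → ℂ) 0‖ ^ 2 : ℝ) : ℂ) := by
  rw [fischer, map_sum, LinearMap.sum_apply, Submodule.coe_sum, Finset.sum_apply,
    Complex.ofReal_sum]
  refine Finset.sum_congr rfl fun k _ => ?_
  rw [map_mul, symb_C, Complex.ofReal_mul, coe_norm_sq]
  simp only [Module.End.mul_apply, LinearMap.smul_apply, Module.End.one_apply, Submodule.coe_smul,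
    Pi.smul_apply, smul_eq_mul, Complex.ofReal_natCast]
  ring

lemma dirD_pow_eq_zero {u : SmoothFn} {d : ℕ}
    (h : ∑ k ∈ Finset.piAntidiag Finset.univ d, (Nat.multinomial Finset.univ k : ℝ) *
      ‖(symb (mono k) u : C2 → ℂ) 0‖ ^ 2 = 0) (z : C2) :
    (((dirD z ^ d) u : SmoothFn) : C2 → ℂ) 0 = 0 := by
  rw [Finset.sum_eq_zero_iff_of_nonneg fun k _ => by positivity] at h
  rw [dirD_eq_symb, ← map_pow, linP_pow, map_sum, LinearMap.sum_apply, Submodule.coe_sum,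
    Finset.sum_apply]
  refine Finset.sum_eq_zero fun k hk => ?_
  have h1 : (symb (mono k) u : C2 → ℂ) 0 = 0 := by
    have h2 := h k hk
    have h3 : (Nat.multinomial Finset.univ k : ℝ) ≠ 0 :=
      Nat.cast_ne_zero.2 (Nat.multinomial_pos _ _).ne'
    simpa [h3] using h2
  rw [map_mul, symb_C]
  simp [h1]

/-- The matrix of the polynomials dual to the Taylor polynomials of the entries of `F*`. -/
def fischerM (F : SmoothMat n) (d : ℕ) : PolyMat n := Matrix.of fun a b => fischer (F b a) d

/-- The derivatives along a ray depend only on the restriction to the ray. -/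
lemma dirD_ray {w z : C2} {u v : SmoothFn}
    (h : ∀ t : ℝ, (u : C2 → ℂ) (t • w) = (v : C2 → ℂ) (t • z)) (d : ℕ) (t : ℝ) :
    (((dirD w ^ d) u : SmoothFn) : C2 → ℂ) (t • w) =
      (((dirD z ^ d) v : SmoothFn) : C2 → ℂ) (t • z) := by
  induction d generalizing t with
  | zero => simpa using h t
  | succ d ih =>
    have hd : ∀ (f : SmoothFn) (y : C2), HasDerivAt (fun t : ℝ => (f : C2 → ℂ) (t • y))
        ((dirD y f : C2 → ℂ) (t • y)) t := by
      intro f y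
      have h2 : HasDerivAt (fun t : ℝ => t • y) y t := by
        simpa using (hasDerivAt_id t).smul_const y
      exact (differentiable_coe f (t • y)).hasFDerivAt.comp_hasDerivAt t h2
    rw [pow_succ', pow_succ', Module.End.mul_apply, Module.End.mul_apply]
    exact (hd _ w).unique ((hd _ z).congr_of_eventuallyEq (Filter.Eventually.of_forall ih))

/-- Covariance under the conjugations by the elements of `K`. -/
def Equivariant (Φ : C2 → EndV n) : Prop :=
  ∀ (k : U2) (z : C2), Φ (act k z) = tau n k * Φ z * (tau n k)ᴴ

lemma evalM_fischerM (F : SmoothMat n) (d : ℕ) (z : C2) :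
    (Complex.I / 2) ^ d • (evalM z (fischerM F d))ᴴ =
      Matrix.of fun a b => (((dirD z ^ d) (F a b) : SmoothFn) : C2 → ℂ) 0 := by
  ext a b
  rw [Matrix.of_apply, dirD_pow_apply_zero]
  rfl

lemma fischerM_equivariant {F : SmoothMat n} (hF : Equivariant (valM F)) (d : ℕ) :
    Equivariant fun z => evalM z (fischerM F d) := by
  intro k z
  have h : (Matrix.of fun a b => (((dirD (act k z) ^ d) (F a b) : SmoothFn) : C2 → ℂ) 0 : EndV n) =
      tau n k * (Matrix.of fun a b => (((dirD z ^ d) (F a b) : SmoothFn) : C2 → ℂ) 0) *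
        (tau n k)ᴴ := by
    ext a b
    have h1 := dirD_ray (w := act k z) (z := z) (u := F a b)
      (v := ∑ e, ∑ c, (tau n k a c * (tau n k)ᴴ e b) • F c e) (fun t => by
        have h2 := congrFun (congrFun (hF k (t • z)) a) b
        rw [act_smul_real] at h2
        change valM F (t • act k z) a b = _
        rw [h2, Matrix.mul_apply, Submodule.coe_sum, Finset.sum_apply]
        refine Finset.sum_congr rfl fun e _ => ?_
        rw [Matrix.mul_apply, Submodule.coe_sum, Finset.sum_apply, Finset.sum_mul]
        refine Finset.sum_congr rfl fun c _ => ?_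
        simp only [valM, Matrix.of_apply, Submodule.coe_smul, Pi.smul_apply, smul_eq_mul]
        ring) d 0
    rw [zero_smul, zero_smul] at h1
    rw [Matrix.of_apply, h1, Matrix.mul_apply, map_sum, Submodule.coe_sum, Finset.sum_apply]
    refine Finset.sum_congr rfl fun e _ => ?_
    rw [Matrix.mul_apply, map_sum, Submodule.coe_sum, Finset.sum_apply, Finset.sum_mul]
    refine Finset.sum_congr rfl fun c _ => ?_
    rw [map_smul]
    simp only [Matrix.of_apply, Submodule.coe_smul, Pi.smul_apply, smul_eq_mul]
    ring
  rw [← evalM_fischerM, ← evalM_fischerM, Matrix.mul_smul, Matrix.smul_mul] at h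
  have h0 : (Complex.I / 2) ^ d ≠ 0 := by simp
  have h3 := congrArg Matrix.conjTranspose (smul_right_injective _ h0 h)
  simpa [Matrix.conjTranspose_mul, mul_assoc] using h3

lemma evalM_fischerM_smul (F : SmoothMat n) (d : ℕ) (r : ℝ) (z : C2) :
    evalM (r • z) (fischerM F d) = ((r ^ d : ℝ) : ℂ) • evalM z (fischerM F d) := by
  ext a b
  rw [Matrix.smul_apply, evalM_apply, evalM_apply, fischerM, Matrix.of_apply, fischer, map_sum,
    map_sum, Finset.smul_sum]
  refine Finset.sum_congr rfl fun k hk => ?_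
  have h : ∀ i, conj (formC (r • z) i) = r * conj (formC z i) := by
    rintro (l | l) <;> simp [formC]
  rw [map_mul (evalP _), map_mul (evalP _), evalP_mono, evalP_mono]
  simp only [h, mul_pow, Finset.prod_mul_distrib, Finset.prod_pow_eq_pow_sum,
    (Finset.mem_piAntidiag.1 hk).1, evalP_C, smul_eq_mul, Complex.ofReal_pow]
  ring

/-- The value at `(0, 1)` of an equivariant function commutes with the torus which fixes `(0, 1)`,
and is therefore diagonal. -/
lemma Equivariant.diagonal {Φ : C2 → EndV n} (h : Equivariant Φ) :
    ∃ c : Fin (n + 1) → ℂ, Φ e2 = ∑ i, c i • E n i := by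
  have hu := torusAngle_unit n
  have h1 := h (torus (torusAngle n) hu) e2
  rw [torus_act_e2, tau_torus] at h1
  set t : Fin (n + 1) → ℂ := fun j => (conj (torusAngle n)) ^ (j : ℕ) with ht
  have ht1 : ∀ j, t j * conj (t j) = 1 := by
    intro j
    change (conj (torusAngle n)) ^ (j : ℕ) * conj ((conj (torusAngle n)) ^ (j : ℕ)) = 1
    rw [map_pow, Complex.conj_conj, ← mul_pow, mul_comm (conj _), hu, one_pow]
  refine ⟨fun i => Φ e2 i i, ?_⟩
  ext a b
  have h2 : Φ e2 a b = t a * Φ e2 a b * conj (t b) := by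
    conv_lhs => rw [h1]
    rw [Matrix.diagonal_conjTranspose, Matrix.mul_diagonal, Matrix.diagonal_mul]
    rfl
  simp only [Matrix.sum_apply, Matrix.smul_apply, E, Matrix.single_apply, smul_eq_mul]
  by_cases hab : a = b
  · subst hab
    simp
  · have h3 : Φ e2 a b * (t b - t a) = 0 := by
      linear_combination t b * h2 + (t a * Φ e2 a b) * ht1 b
    have h4 : t b - t a ≠ 0 := fun h5 => hab (torusAngle_injective n (sub_eq_zero.1 h5)).symm
    have h6 : Φ e2 a b = 0 := (mul_eq_zero.1 h3).resolve_right h4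
    rw [h6, eq_comm]
    refine Finset.sum_eq_zero fun i _ => ?_
    rw [if_neg, mul_zero]
    rintro ⟨rfl, rfl⟩
    exact hab rfl

/-- On the unit sphere an equivariant function is a combination of the `Q_{E_{ii}}`. -/
lemma Equivariant.unit {Φ : C2 → EndV n} (h : Equivariant Φ) :
    ∃ c : Fin (n + 1) → ℂ, ∀ z : C2, ‖z‖ = 1 → Φ z = ∑ i, c i • Q n (E n i) z := by
  obtain ⟨c, hc⟩ := h.diagonal
  refine ⟨c, fun z hz => ?_⟩
  have h1 := h (kU z hz) e2
  rw [coe_kU, act_kMat_e2, hc] at h1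
  rw [h1, Finset.mul_sum, Finset.sum_mul]
  refine Finset.sum_congr rfl fun i _ => ?_
  rw [Q_unit _ _ hz, Matrix.mul_smul, Matrix.smul_mul]

lemma actM_comm_smul (p : Poly) (R : PolyMat n) (F : SmoothMat n) :
    actM (p • R) F = actM R (actM (p • (1 : PolyMat n)) F) := by
  rw [← actM_mul, Matrix.mul_smul, mul_one]

lemma normP_pow_eigen {F : SmoothMat n} {ξ : ℂ}
    (h1 : actM (normP • (1 : PolyMat n)) F = ξ • F) (R : PolyMat n) (e : ℕ) :
    actM (normP ^ e • R) F = ξ ^ e • actM R F := by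
  induction e with
  | zero => simp
  | succ e ih =>
    rw [pow_succ', mul_smul, actM_comm_smul, h1, actM_smul_right, ih, smul_smul, pow_succ']

/-- The dual polynomials of an equivariant eigenfunction which vanishes at the origin annihilate it
at the origin: up to powers of `|z|²` they are combinations of the polynomials `Q_{E_{ii}}`. -/
lemma actM_fischerM {F : SmoothMat n} (hF : Equivariant (valM F)) (h0 : valM F 0 = 0)
    {ξ : ℂ} (hξ : ξ ≠ 0) {j : Fin (n + 1)} (h1 : actM (normP • (1 : PolyMat n)) F = ξ • F)
    (h2 : actM (symbolM n) F = ((-(n : ℂ) + 2 * ((j : ℕ) : ℂ)) * ξ) • F) (d : ℕ) :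
    valM (actM (fischerM F d) F) 0 = 0 := by
  have he := fischerM_equivariant hF d
  obtain ⟨c, hc⟩ := he.unit
  -- for `d` even `|z|^{2n}` times the dual polynomial is `|z|^d` times a combination of the
  -- `Q_{E_{ii}}`; for `d` odd it vanishes, since `-1 ∈ K` acts on `V_n` by the scalar `±1`
  rcases Nat.even_or_odd' d with ⟨e, rfl | rfl⟩
  · have h3 : normP ^ n • fischerM F (2 * e) =
        normP ^ e • ∑ i, (MvPolynomial.C (c i) : Poly) • lagrangeQ n i := by
      refine polyMat_eq fun z hz => ?_
      have h4 : z = ‖z‖ • (‖z‖⁻¹ • z) := by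
        rw [smul_smul, mul_inv_cancel₀ (norm_ne_zero_iff.2 hz), one_smul]
      have h5 := norm_unit hz
      have h6 : ‖z‖⁻¹ • z ≠ 0 := fun h => by simp [h] at h5
      rw [evalM_smul, evalM_smul, map_pow, map_pow, evalP_normP, map_sum]
      simp only [evalM_smul, evalP_C]
      have h7 : evalM z (fischerM F (2 * e)) = ((‖z‖ ^ (2 * e) : ℝ) : ℂ) •
          ∑ i, c i • evalM (‖z‖⁻¹ • z) (lagrangeQ n i) := by
        conv_lhs => rw [h4, evalM_fischerM_smul, hc _ h5]
        simp only [evalM_lagrangeQ _ h6]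
      have h8 : ∀ i, evalM z (lagrangeQ n i) = ((‖z‖ ^ (2 * n) : ℝ) : ℂ) •
          evalM (‖z‖⁻¹ • z) (lagrangeQ n i) := by
        intro i
        conv_lhs => rw [h4, evalM_lagrangeQ_smul]
      simp only [h7, h8, Finset.smul_sum, smul_smul]
      refine Finset.sum_congr rfl fun i _ => ?_
      congr 1
      push_cast
      ring
    have h9 := congrArg (fun R => valM (actM R F) 0) h3
    simp only [normP_pow_eigen h1, valM_smul] at h9
    have h10 : valM (actM (∑ i, (MvPolynomial.C (c i) : Poly) • lagrangeQ n i) F) 0 = 0 := by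
      have h11 : actM (∑ i, (MvPolynomial.C (c i) : Poly) • lagrangeQ n i) F =
          (∑ i, c i * (if i = j then ξ ^ n else 0)) • F := by
        have h12 : ∀ S : Finset (Fin (n + 1)),
            actM (∑ i ∈ S, (MvPolynomial.C (c i) : Poly) • lagrangeQ n i) F =
              (∑ i ∈ S, c i * (if i = j then ξ ^ n else 0)) • F := by
          intro S
          induction S using Finset.induction_on with
          | empty =>
            ext a b
            simp [actM]
          | insert i S hi ih =>
            rw [Finset.sum_insert hi, Finset.sum_insert hi, actM_add, ih, actM_C_smul,
              actM_lagrangeQ h1 h2, smul_smul, add_smul]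
        exact h12 _
      rw [h11, valM_smul, h0, smul_zero]
    rw [h10, smul_zero] at h9
    exact (smul_eq_zero.1 h9).resolve_left (pow_ne_zero _ hξ)
  · have h3 : fischerM F (2 * e + 1) = 0 := by
      refine polyMat_eq fun z hz => ?_
      have h4 := evalM_fischerM_smul F (2 * e + 1) (-1) z
      have h5 := he (-1) z
      have h6 : act ((-1 : U2) : Matrix (Fin 2) (Fin 2) ℂ) z = (-1 : ℝ) • z := by
        have : ((-1 : U2) : Matrix (Fin 2) (Fin 2) ℂ) = -1 := rfl
        rw [this]
        ext i
        fin_cases i <;> simp [act]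
      have h7 : tau n ((-1 : U2) : Matrix (Fin 2) (Fin 2) ℂ) = (-1 : ℂ) ^ n • 1 := by
        have : ((-1 : U2) : Matrix (Fin 2) (Fin 2) ℂ)ᴴ = (-1 : ℂ) • 1 := by
          change (-1 : Matrix (Fin 2) (Fin 2) ℂ)ᴴ = _
          simp
        rw [tau_eq_star, this, symPow_smul, symPow_one]
      rw [h6, h7] at h5
      simp only [h4] at h5
      have h9 : (-1 : ℂ) ^ n * (-1) ^ n = 1 := by
        rw [← mul_pow]; simp
      have h10 : ((((-1 : ℝ) ^ (2 * e + 1) : ℝ)) : ℂ) = -1 := by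
        rw [Odd.neg_one_pow ⟨e, rfl⟩]; simp
      rw [h10] at h5
      simp only [Matrix.conjTranspose_smul, Matrix.conjTranspose_one, Matrix.smul_mul,
        Matrix.mul_smul, one_mul, mul_one, smul_smul, star_pow, star_neg, star_one, h9,
        one_smul] at h5
      rw [map_zero]
      have h11 : (2 : ℂ) • evalM z (fischerM F (2 * e + 1)) = 0 := by
        rw [two_smul]
        nth_rw 1 [← h5]
        simp
      exact (smul_eq_zero.1 h11).resolve_left two_ne_zero
    rw [h3]
    ext a b
    simp [actM, valM]

/-- All derivatives at the origin of such an eigenfunction vanish. -/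
lemma dirD_pow_eigen {F : SmoothMat n} (hF : Equivariant (valM F)) (h0 : valM F 0 = 0)
    {ξ : ℂ} (hξ : ξ ≠ 0) {j : Fin (n + 1)} (h1 : actM (normP • (1 : PolyMat n)) F = ξ • F)
    (h2 : actM (symbolM n) F = ((-(n : ℂ) + 2 * ((j : ℕ) : ℂ)) * ξ) • F) (d : ℕ) (z : C2)
    (a b : Fin (n + 1)) : (((dirD z ^ d) (F a b) : SmoothFn) : C2 → ℂ) 0 = 0 := by
  -- the trace is a sum of squares of the partial derivatives, with positive weights
  have h3 := congrArg Matrix.trace (actM_fischerM hF h0 hξ h1 h2 d)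
  rw [Matrix.trace_zero, Matrix.trace] at h3
  have h4 : ∀ b, Matrix.diag (valM (actM (fischerM F d) F) 0) b = ((∑ a,
      ∑ k ∈ Finset.piAntidiag Finset.univ d, (Nat.multinomial Finset.univ k : ℝ) *
        ‖(symb (mono k) (F a b) : C2 → ℂ) 0‖ ^ 2 : ℝ) : ℂ) := by
    intro b
    rw [Complex.ofReal_sum]
    simp only [Matrix.diag_apply, valM, actM, fischerM, Matrix.of_apply, Submodule.coe_sum,
      Finset.sum_apply, symb_fischer]
  simp only [h4] at h3
  rw [← Complex.ofReal_sum, Complex.ofReal_eq_zero,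
    Finset.sum_eq_zero_iff_of_nonneg fun b _ => by positivity] at h3
  have h5 := h3 b (Finset.mem_univ _)
  rw [Finset.sum_eq_zero_iff_of_nonneg fun a _ => by positivity] at h5
  exact dirD_pow_eq_zero (h5 a (Finset.mem_univ _)) z

/-- A function of one variable with vanishing Taylor series, whose derivatives grow at most
geometrically, is zero at `1`. -/
lemma eq_zero_of_taylor {g : ℕ → ℝ → ℂ} {K M : ℝ} (hg : ∀ d t, HasDerivAt (g d) (g (d + 1) t) t)
    (h0 : ∀ d, g d 0 = 0) (hb : ∀ d t, ‖g d t‖ ≤ M * K ^ d) : g 0 1 = 0 := by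
  have h : ∀ N d : ℕ, ∀ t ∈ Set.Icc (0 : ℝ) 1, ‖g d t‖ ≤
      M * K ^ (d + N) * t ^ N / N.factorial := by
    intro N
    induction N with
    | zero => intro d t _; simpa using hb d t
    | succ N ih =>
      intro d
      refine image_norm_le_of_norm_deriv_right_le_deriv_boundary
        (f' := g (d + 1)) (B' := fun t => M * K ^ (d + 1 + N) * t ^ N / N.factorial)
        (fun t _ => (hg d t).continuousAt.continuousWithinAt)
        (fun t _ => (hg d t).hasDerivWithinAt) (by simp [h0]) (fun t => ?_)
        (fun t ht => ih (d + 1) t (Set.Ico_subset_Icc_self ht))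
      have h1 := ((hasDerivAt_pow (N + 1) t).const_mul (M * K ^ (d + (N + 1)))).div_const
        ((N + 1).factorial : ℝ)
      refine h1.congr_deriv ?_
      have h2 : (N.factorial : ℝ) ≠ 0 := by positivity
      rw [Nat.factorial_succ, show d + 1 + N = d + (N + 1) by ring]
      push_cast
      field_simp
  have h2 : Filter.Tendsto (fun N : ℕ => M * (K ^ N / N.factorial)) Filter.atTop (nhds (M * 0)) :=
    (FloorSemiring.tendsto_pow_div_factorial_atTop K).const_mul M
  rw [mul_zero] at h2
  refine norm_le_zero_iff.1 (ge_of_tendsto' h2 fun N => ?_)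
  have h3 := h N 0 1 (by simp)
  rw [zero_add, one_pow, mul_one, mul_div_assoc] at h3
  exact h3

/-- A bounded eigenfunction of `Δ_z` with vanishing Taylor series is zero, by Bernstein's
inequality. -/
lemma eigen_eq_zero {u : SmoothFn} {M : ℝ} (hM : ∀ z, ‖(u : C2 → ℂ) z‖ ≤ M) {ξ : ℝ}
    (h : symb normP u = (ξ : ℂ) • u)
    (h0 : ∀ z d, (((dirD z ^ d) u : SmoothFn) : C2 → ℂ) 0 = 0) : u = 0 := by
  obtain ⟨C, -, hC⟩ := exists_bernstein ξ
  apply Subtype.ext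
  funext z
  have he : ∀ d, symb normP ((dirD z ^ d) u) = (ξ : ℂ) • (dirD z ^ d) u := by
    intro d
    rw [← map_smul, ← h, dirD_eq_symb, ← map_pow, ← Module.End.mul_apply, ← Module.End.mul_apply,
      ← map_mul, ← map_mul, mul_comm]
  have hb : ∀ d y, ‖(((dirD z ^ d) u : SmoothFn) : C2 → ℂ) y‖ ≤ M * (C * ‖z‖) ^ d := by
    intro d
    induction d with
    | zero => simpa using hM
    | succ d ih =>
      intro y
      rw [pow_succ', Module.End.mul_apply]
      refine (hC _ _ ih (he d) z y).trans (le_of_eq ?_)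
      ring
  have h1 := eq_zero_of_taylor
    (g := fun d (t : ℝ) => (((dirD z ^ d) u : SmoothFn) : C2 → ℂ) (t • z))
    (K := C * ‖z‖) (M := M) (fun d t => ?_) (fun d => by simpa using h0 z d)
    (fun d t => hb d _)
  · simpa using h1
  · have h2 : HasDerivAt (fun t : ℝ => t • z) z t := by
      simpa using (hasDerivAt_id t).smul_const z
    simp only [pow_succ', Module.End.mul_apply]
    exact (differentiable_coe _ (t • z)).hasFDerivAt.comp_hasDerivAt t h2

/-- A bounded equivariant joint eigenfunction normalized at the origin is determined by its
eigenvalues. -/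
lemma eq_PhiSph {F : SmoothMat n} (hF : Equivariant (valM F)) (h0 : valM F 0 = 1)
    (hb : ∀ a b, ∃ C : ℝ, ∀ z, ‖(F a b : C2 → ℂ) z‖ ≤ C) {ξ : ℝ} (hξ : 0 < ξ) {j : Fin (n + 1)}
    (h1 : actM (normP • (1 : PolyMat n)) F = (ξ : ℂ) • F)
    (h2 : actM (symbolM n) F = ((-(n : ℂ) + 2 * ((j : ℕ) : ℂ)) * ξ) • F) :
    valM F = PhiSph n j ξ := by
  obtain ⟨h3, h4⟩ := PhiS_eigen j hξ.le
  set H := F - PhiS n j ξ with hH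
  have hv : ∀ z, valM H z = valM F z - PhiSph n j ξ z := fun z => by
    rw [hH, valM_sub, valM_PhiS]
  have he1 : actM (normP • (1 : PolyMat n)) H = (ξ : ℂ) • H := by
    rw [hH, actM_sub_right, h1, h3, smul_sub]
  have he2 : actM (symbolM n) H = ((-(n : ℂ) + 2 * ((j : ℕ) : ℂ)) * ξ) • H := by
    rw [hH, actM_sub_right, h2, h4, smul_sub]
  have hz : H = 0 := by
    ext1 a b
    obtain ⟨C, hC⟩ := hb a b
    obtain ⟨C', hC'⟩ := PhiSph_bounded j ξ a b
    refine eigen_eq_zero (M := C + C') (ξ := ξ) (fun z => ?_) ?_ fun z d => ?_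
    · refine (norm_sub_le _ _).trans (add_le_add (hC z) (hC' z))
    · have h5 := congrFun (congrFun he1 a) b
      rwa [actM_smul_one] at h5
    · refine dirD_pow_eigen (fun k z => ?_) ?_ (by exact_mod_cast hξ.ne') he1 he2 d z a b
      · rw [hv, hv, hF, PhiSph_act, mul_sub, sub_mul]
      · rw [hv, h0, PhiSph_zero, sub_self]
  funext z
  have h6 := hv z
  rw [hz] at h6
  exact (sub_eq_zero.1 (h6.symm.trans (by ext a b; rfl)))

end

section
variable {n : ℕ}
/-! ### Smooth functions on `U₂` -/

open scoped Matrix.Norms.Operator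


/-- The coordinates of a skew-Hermitian matrix with respect to the basis `X₁, …, X₄`. -/
def coordU : Matrix (Fin 2) (Fin 2) ℂ →ₗ[ℝ] (Fin 4 → ℝ) where
  toFun A := ![((A 0 0).im - (A 1 1).im) / 2, (A 0 1).re, (A 0 1).im, ((A 0 0).im + (A 1 1).im) / 2]
  map_add' A B := by
    ext i
    fin_cases i <;> simp <;> ring
  map_smul' r A := by
    ext i
    fin_cases i <;> simp <;> ring

lemma lieU_coordU {A : Matrix (Fin 2) (Fin 2) ℂ} (hA : Aᴴ = -A) : lieU (coordU A) = A := by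
  have h : ∀ i j, conj (A j i) = -A i j := fun i j => congrFun (congrFun hA i) j
  have h00 := congrArg Complex.re (h 0 0)
  have h11 := congrArg Complex.re (h 1 1)
  have hr := congrArg Complex.re (h 1 0)
  have hi := congrArg Complex.im (h 1 0)
  simp at h00 h11 hr hi
  ext i j
  fin_cases i <;> fin_cases j <;> apply Complex.ext <;>
    simp [lieU, coordU, basisU, Fin.sum_univ_four] <;> linarith

/-- A smooth logarithm near `1`, with skew-Hermitian values on `U₂`. -/
lemma exists_log : ∃ L : Matrix (Fin 2) (Fin 2) ℂ → Matrix (Fin 2) (Fin 2) ℂ,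
    ContDiffAt ℝ ∞ L 1 ∧ ∀ᶠ k : U2 in nhds 1, expU (coordU (L k)) = k := by
  have hc : ContDiffAt ℝ ∞ (NormedSpace.exp : Matrix (Fin 2) (Fin 2) ℂ → _) 0 :=
    (NormedSpace.exp_analytic (𝕂 := ℝ) (0 : Matrix (Fin 2) (Fin 2) ℂ)).contDiffAt
  have hd : HasFDerivAt (NormedSpace.exp : Matrix (Fin 2) (Fin 2) ℂ → _)
      ((ContinuousLinearEquiv.refl ℝ (Matrix (Fin 2) (Fin 2) ℂ) :
        Matrix (Fin 2) (Fin 2) ℂ →L[ℝ] Matrix (Fin 2) (Fin 2) ℂ)) 0 :=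
    hasFDerivAt_exp_zero (𝕂 := ℝ)
  have hn : (∞ : WithTop ℕ∞) ≠ 0 := by simp
  have hs := hc.hasStrictFDerivAt' hd hn
  -- a local inverse of `exp` at `0`; `L(k)` and `-L(k)^*` have the same exponential for `k` unitary
  set L := hc.localInverse hd hn with hL
  have h1 := hc.to_localInverse hd hn
  have hl := hs.eventually_left_inverse
  have hr := hs.eventually_right_inverse
  have ht := hs.localInverse_tendsto
  rw [NormedSpace.exp_zero] at h1 hr ht
  refine ⟨L, h1, ?_⟩
  have hk : Filter.Tendsto (fun k : U2 => (k : Matrix (Fin 2) (Fin 2) ℂ)) (nhds 1) (nhds 1) :=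
    continuous_subtype_val.tendsto (1 : U2)
  have ht2 : Filter.Tendsto (fun k : U2 => -(L k)ᴴ) (nhds 1) (nhds 0) := by
    have h2 : Filter.Tendsto (fun A : Matrix (Fin 2) (Fin 2) ℂ => -Aᴴ) (nhds 0) (nhds (-0ᴴ)) :=
      (continuous_id.matrix_conjTranspose.neg).tendsto 0
    rw [Matrix.conjTranspose_zero, neg_zero] at h2
    exact h2.comp (ht.comp hk)
  filter_upwards [hk.eventually hr, ht2.eventually hl] with k hk1 hk2
  change NormedSpace.exp (L k) = _ at hk1
  change L (NormedSpace.exp (-(L k)ᴴ)) = _ at hk2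
  have h3 : NormedSpace.exp (-(L k)ᴴ) = (k : Matrix (Fin 2) (Fin 2) ℂ) := by
    rw [Matrix.exp_neg, Matrix.exp_conjTranspose, hk1]
    exact Matrix.inv_eq_left_inv (Matrix.mem_unitaryGroup_iff.1 k.2)
  rw [h3] at hk2
  apply Subtype.ext
  rw [coe_expU, lieU_coordU (by rw [← neg_eq_iff_eq_neg]; exact hk2.symm), hk1]

/-- `f` extends locally to smooth functions of `2 × 2` matrices. -/
def SmoothK (f : U2 → ℂ) : Prop :=
  ∀ k : U2, ∃ F : Matrix (Fin 2) (Fin 2) ℂ → ℂ, ContDiffAt ℝ ∞ F (k : Matrix (Fin 2) (Fin 2) ℂ) ∧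
    ∀ᶠ h : U2 in nhds k, f h = F h

/-- Smoothness in the exponential charts gives smooth extensions, by means of the logarithm. -/
lemma smoothK_of_contDiff {f : U2 → ℂ}
    (hf : ∀ k, ContDiff ℝ ∞ fun x : Fin 4 → ℝ => f (k * expU x)) : SmoothK f := by
  obtain ⟨L, hL, he⟩ := exists_log
  intro k
  refine ⟨fun B => f (k * expU (coordU (L ((k⁻¹ : U2) * B)))), ?_, ?_⟩
  · refine (hf k).contDiffAt.comp _ ((LinearMap.toContinuousLinearMap coordU).contDiff.contDiffAt.comp
      _ (ContDiffAt.comp _ ?_ (contDiff_const.mul contDiff_id).contDiffAt))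
    have : ((k⁻¹ : U2) : Matrix (Fin 2) (Fin 2) ℂ) * (k : Matrix (Fin 2) (Fin 2) ℂ) = 1 :=
      Matrix.mem_unitaryGroup_iff'.1 k.2
    simpa only [id, this] using hL
  · have ht : Filter.Tendsto (fun h : U2 => k⁻¹ * h) (nhds k) (nhds 1) := by
      have := (continuous_const_mul k⁻¹).tendsto k
      rwa [inv_mul_cancel] at this
    filter_upwards [ht.eventually he] with h hh
    rw [Submonoid.coe_mul] at hh
    rw [hh, mul_inv_cancel_left]

/-- The left-invariant vector fields on `U₂`. -/
def fieldK (x : Fin 4 → ℝ) (f : U2 → ℂ) (k : U2) : ℂ :=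
  deriv (fun t : ℝ => f (k * expU (t • x))) 0

lemma hasDerivAt_expU (k : U2) (x : Fin 4 → ℝ) : HasDerivAt
    (fun t : ℝ => ((k * expU (t • x) : U2) : Matrix (Fin 2) (Fin 2) ℂ))
    ((k : Matrix (Fin 2) (Fin 2) ℂ) * lieU x) 0 :=
  hasDerivAt_pi.2 fun a => hasDerivAt_pi.2 fun b => hasDerivAt_mul_expU k x a b

lemma continuous_expU_smul (x : Fin 4 → ℝ) : Continuous fun t : ℝ => expU (t • x) := by
  refine continuous_induced_rng.2 (continuous_matrix fun a b => ?_)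
  exact (contDiff_exp_lieU a b).continuous.comp (continuous_id.smul continuous_const)

lemma hasDerivAt_local {f : U2 → ℂ} {F : Matrix (Fin 2) (Fin 2) ℂ → ℂ} {k : U2}
    (hF : DifferentiableAt ℝ F (k : Matrix (Fin 2) (Fin 2) ℂ)) (h : ∀ᶠ h : U2 in nhds k, f h = F h)
    (x : Fin 4 → ℝ) : HasDerivAt (fun t : ℝ => f (k * expU (t • x)))
      (fderiv ℝ F (k : Matrix (Fin 2) (Fin 2) ℂ) ((k : Matrix (Fin 2) (Fin 2) ℂ) * lieU x)) 0 := by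
  have h0 : k * expU ((0 : ℝ) • x) = k := by rw [zero_smul, expU_zero, mul_one]
  have ht : Filter.Tendsto (fun t : ℝ => k * expU (t • x)) (nhds 0) (nhds k) := by
    have := (continuous_const.mul (continuous_expU_smul x)).tendsto (0 : ℝ) (f := fun t : ℝ => k * expU (t • x))
    rwa [h0] at this
  have h1 : HasFDerivAt F (fderiv ℝ F (k : Matrix (Fin 2) (Fin 2) ℂ))
      (((k * expU ((0 : ℝ) • x) : U2)) : Matrix (Fin 2) (Fin 2) ℂ) := by
    rw [h0]
    exact hF.hasFDerivAt
  exact (h1.comp_hasDerivAt 0 (hasDerivAt_expU k x)).congr_of_eventuallyEq (ht.eventually h)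

lemma SmoothK.hasDerivAt_zero {f : U2 → ℂ} (hf : SmoothK f) (x : Fin 4 → ℝ) (k : U2) :
    HasDerivAt (fun t : ℝ => f (k * expU (t • x))) (fieldK x f k) 0 := by
  obtain ⟨F, hF, he⟩ := hf k
  have h := hasDerivAt_local (hF.differentiableAt (by simp)) he x
  rw [fieldK, h.deriv]
  exact h

lemma SmoothK.hasDerivAt {f : U2 → ℂ} (hf : SmoothK f) (x : Fin 4 → ℝ) (k : U2) (t : ℝ) :
    HasDerivAt (fun t : ℝ => f (k * expU (t • x))) (fieldK x f (k * expU (t • x))) t := by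
  have h := hf.hasDerivAt_zero x (k * expU (t • x))
  rw [← sub_self t] at h
  have h1 := h.comp_sub_const t t
  refine h1.congr_of_eventuallyEq (Filter.Eventually.of_forall fun s => ?_)
  simp only
  rw [mul_assoc, ← expU_add_smul, add_sub_cancel]

lemma SmoothK.continuous {f : U2 → ℂ} (hf : SmoothK f) : Continuous f := by
  refine continuous_iff_continuousAt.2 fun k => ?_
  obtain ⟨F, hF, he⟩ := hf k
  exact ContinuousAt.congr (hF.continuousAt.comp continuous_subtype_val.continuousAt)
    (he.mono fun h hh => hh.symm)

lemma SmoothK.fieldK {f : U2 → ℂ} (hf : SmoothK f) (x : Fin 4 → ℝ) : SmoothK (fieldK x f) := by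
  intro k
  obtain ⟨F, hF, he⟩ := hf k
  refine ⟨fun A => fderiv ℝ F A (A * lieU x), ?_, ?_⟩
  · exact (hF.fderiv_right (m := ∞) (by simp)).clm_apply (contDiffAt_id.mul contDiffAt_const)
  · have h1 : ∀ᶠ A in nhds (k : Matrix (Fin 2) (Fin 2) ℂ), DifferentiableAt ℝ F A :=
      ((hF.of_le (m := 1) (by simp)).eventually (by simp)).mono fun A hA =>
        hA.differentiableAt one_ne_zero
    have h2 : ∀ᶠ h : U2 in nhds k, DifferentiableAt ℝ F (h : Matrix (Fin 2) (Fin 2) ℂ) :=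
      (continuous_subtype_val.tendsto k).eventually h1
    filter_upwards [h2, he.eventually_nhds] with h hd hh
    exact (hasDerivAt_local hd hh x).deriv

lemma SmoothK.mul {f g : U2 → ℂ} (hf : SmoothK f) (hg : SmoothK g) : SmoothK fun k => f k * g k := by
  intro k
  obtain ⟨F, hF, he⟩ := hf k
  obtain ⟨H, hH, he'⟩ := hg k
  exact ⟨fun A => F A * H A, hF.mul hH, (he.and he').mono fun h hh => by
    change f h * g h = F h * H h
    rw [hh.1, hh.2]⟩

lemma smoothK_of_mem_PolK {c : U2 → ℂ} (hc : c ∈ PolK) : SmoothK c :=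
  smoothK_of_contDiff fun k => contDiff_PolK hc k

lemma integral_fieldK {f : U2 → ℂ} (hf : SmoothK f) (x : Fin 4 → ℝ) :
    ∫ k, fieldK x f k ∂haarU2 = 0 := by
  obtain ⟨M, hM⟩ := IsCompact.exists_bound_of_continuousOn isCompact_univ
    (hf.fieldK x).continuous.continuousOn
  have h := hasDerivAt_integral_of_dominated_loc_of_deriv_le (μ := haarU2)
    (F := fun (t : ℝ) k => f (k * expU (t • x)))
    (F' := fun (t : ℝ) k => MotionM2.fieldK x f (k * expU (t • x))) (x₀ := 0) (s := Set.univ)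
    (bound := fun _ => M) Filter.univ_mem
    (Filter.Eventually.of_forall fun t =>
      (hf.continuous.comp (continuous_mul_const _)).aestronglyMeasurable)
    (integrable_haarU2 (hf.continuous.comp (continuous_mul_const _)))
    ((hf.fieldK x).continuous.comp (continuous_mul_const _)).aestronglyMeasurable
    (Filter.Eventually.of_forall fun k t _ => hM _ (Set.mem_univ _)) (integrable_const _)
    (Filter.Eventually.of_forall fun k t _ => hf.hasDerivAt x k t)
  have h1 : (fun t : ℝ => ∫ k, f (k * expU (t • x)) ∂haarU2) = fun _ => ∫ k, f k ∂haarU2 :=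
    funext fun t => integral_mul_right_eq_self f _
  have h2 := h.2
  rw [h1] at h2
  have h3 := h2.unique (hasDerivAt_const (0 : ℝ) _)
  simpa [expU_zero] using h3

/-- Integration by parts on `U₂`. -/
lemma integral_fieldK_mul {f g : U2 → ℂ} (hf : SmoothK f) (hg : SmoothK g) (x : Fin 4 → ℝ) :
    ∫ k, fieldK x f k * g k ∂haarU2 = -∫ k, f k * fieldK x g k ∂haarU2 := by
  have h := integral_fieldK (hf.mul hg) x
  have h1 : fieldK x (fun k => f k * g k) = fun k => fieldK x f k * g k + f k * fieldK x g k := by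
    funext k
    have h2 := ((hf.hasDerivAt_zero x k).mul (hg.hasDerivAt_zero x k)).deriv
    simp only [zero_smul, expU_zero, mul_one] at h2
    exact h2
  have h3 := integral_add (integrable_haarU2 ((hf.fieldK x).continuous.mul hg.continuous))
    (integrable_haarU2 (hf.continuous.mul (hg.fieldK x).continuous))
  rw [h1] at h
  exact eq_neg_of_add_eq_zero_left (h3.symm.trans h)

/-! ### Fourier coefficients on `U₂` -/

/-- The Fourier coefficient `∫_K f(k) τ_{m,n}(k) dk`. -/
def coeffU (m : ℤ) (n : ℕ) (f : U2 → ℂ) : EndV n :=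
  Matrix.of fun i j => ∫ k, f k * tauU m n k i j ∂haarU2

lemma fieldK_tauU (m : ℤ) (x : Fin 4 → ℝ) (i j : Fin (n + 1)) :
    fieldK x (fun k => tauU m n k i j) = fun k => (tauU m n k * dtauU m n x) i j := by
  funext k
  simp only [fieldK, tauU_mul, Matrix.mul_apply]
  exact (HasDerivAt.fun_sum fun l _ => (hasDerivAt_tauU m n x l j).const_mul _).deriv

lemma coeffU_fieldK {f : U2 → ℂ} (hf : SmoothK f) (m : ℤ) (n : ℕ) (x : Fin 4 → ℝ) :
    coeffU m n (fieldK x f) = -(coeffU m n f * dtauU m n x) := by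
  ext i j
  rw [coeffU, Matrix.of_apply, integral_fieldK_mul hf (smoothK_of_mem_PolK (tauU_mem_PolK m n i j)),
    fieldK_tauU, Matrix.neg_apply, neg_inj, Matrix.mul_apply]
  simp only [Matrix.mul_apply, Finset.mul_sum, coeffU, Matrix.of_apply]
  rw [integral_finsetSum]
  · refine Finset.sum_congr rfl fun l _ => ?_
    rw [← integral_mul_const]
    congr 1
    funext k
    ring
  · exact fun l _ => integrable_haarU2
      (hf.continuous.mul ((continuous_tauU_apply m n i l).mul continuous_const))

lemma coeffU_smul (m : ℤ) (n : ℕ) (c : ℂ) (f : U2 → ℂ) :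
    coeffU m n (c • f) = c • coeffU m n f := by
  ext i j
  simp only [coeffU, Matrix.of_apply, Matrix.smul_apply, Pi.smul_apply, smul_eq_mul, mul_assoc,
    integral_const_mul]

lemma coeffU_sub (m : ℤ) (n : ℕ) {f g : U2 → ℂ} (hf : Continuous f) (hg : Continuous g) :
    coeffU m n (f - g) = coeffU m n f - coeffU m n g := by
  ext i j
  simp only [coeffU, Matrix.of_apply, Matrix.sub_apply, Pi.sub_apply, sub_mul]
  exact integral_sub (integrable_haarU2 (hf.mul (continuous_tauU_apply m n i j)))
    (integrable_haarU2 (hg.mul (continuous_tauU_apply m n i j)))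

lemma coeffU_neg (m : ℤ) (n : ℕ) (f : U2 → ℂ) : coeffU m n (-f) = -coeffU m n f := by
  rw [← neg_one_smul ℂ, coeffU_smul, neg_one_smul]

/-- The joint eigenfunctions of the Casimir operator and of the center have only one Fourier
coefficient. -/
lemma coeffU_eq_zero {f : U2 → ℂ} (hf : SmoothK f) {m m' : ℤ} {n' : ℕ}
    (hmn' : Even ((n' : ℤ) - m'))
    (h3 : -fieldK (Pi.single 0 1) (fieldK (Pi.single 0 1) f) -
      fieldK (Pi.single 1 1) (fieldK (Pi.single 1 1) f) -
      fieldK (Pi.single 2 1) (fieldK (Pi.single 2 1) f) = ((n : ℂ) ^ 2 + 2 * n) • f)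
    (h4 : Complex.I • fieldK (Pi.single 3 1) f = (-(m : ℂ)) • f) (hne : ¬(n' = n ∧ m' = m)) :
    coeffU m' n' f = 0 := by
  have hc := fun l : Fin 4 => ((hf.fieldK (Pi.single l 1)).fieldK (Pi.single l 1)).continuous
  have e3 := congrArg (coeffU m' n') h3
  have e4 := congrArg (coeffU m' n') h4
  rw [coeffU_sub _ _ ((hc 0).neg.sub (hc 1)) (hc 2), coeffU_sub _ _ (hc 0).neg (hc 1), coeffU_neg,
    coeffU_smul] at e3
  simp only [coeffU_fieldK (hf.fieldK _), coeffU_fieldK hf, dtauU_single m' n' 0 (by decide),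
    dtauU_single m' n' 1 (by decide), dtauU_single m' n' 2 (by decide), neg_mul, neg_neg,
    mul_assoc] at e3
  have e5 := congrArg (fun B => coeffU m' n' f * B) (casimir_eq n')
  simp only [casimir, mul_add, Matrix.mul_smul, mul_one] at e5
  rw [coeffU_smul, coeffU_smul, coeffU_fieldK hf, dtauU_three hmn', Matrix.mul_smul, mul_one,
    smul_neg, ← neg_smul, smul_smul] at e4
  by_contra hz
  apply hne
  constructor
  · have e6 : (((n' : ℂ) ^ 2 + 2 * n') - ((n : ℂ) ^ 2 + 2 * n)) • coeffU m' n' f = 0 := by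
      rw [sub_smul, ← e3]
      rw [neg_smul] at e5
      rw [← neg_eq_iff_eq_neg.2 e5]
      abel
    have e7 := (smul_eq_zero.1 e6).resolve_right hz
    have e8 : ((n' : ℂ) - n) * (n' + n + 2) = 0 := by linear_combination e7
    have e9 : (n' : ℂ) + n + 2 ≠ 0 := by
      have : ((n' + n + 2 : ℕ) : ℂ) ≠ 0 := Nat.cast_ne_zero.2 (by omega)
      exact_mod_cast this
    exact_mod_cast sub_eq_zero.1 ((mul_eq_zero.1 e8).resolve_right e9)
  · have e6 : ((m : ℂ) - m') • coeffU m' n' f = 0 := by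
      rw [sub_smul, sub_eq_zero, ← neg_inj, ← neg_smul, ← e4, ← neg_smul]
      congr 1
      linear_combination (m' : ℂ) * Complex.I_mul_I
    exact_mod_cast (sub_eq_zero.1 ((smul_eq_zero.1 e6).resolve_right hz)).symm

end

section
variable {n : ℕ}
/-! ### Completeness of the matrix coefficients of the `τ_{m,n}` -/


open Polynomial in
/-- The polynomial `(a X + b)^p (c X + d)^q`, whose coefficients are those of `τ_{p+q}` up to
normalization. -/
def formPoly (A : Matrix (Fin 2) (Fin 2) ℂ) (p q : ℕ) : ℂ[X] :=
  (C (A 0 0) * Polynomial.X + C (A 0 1)) ^ p * (C (A 1 0) * Polynomial.X + C (A 1 1)) ^ q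

open Polynomial in
/-- Multiplication of the coefficients by an entry of `A` produces coefficients of the forms of
degrees `p + q ± 1` (the Clebsch–Gordan rule for `τ_1 ⊗ τ_{p+q}`). -/
lemma formPoly_left (A : Matrix (Fin 2) (Fin 2) ℂ) (p q : ℕ) :
    C (((p : ℂ) + q + 1) * A 0 0) * formPoly A p q =
      derivative (formPoly A (p + 1) q) + C (q * A.det) * formPoly A p (q - 1) := by
  rw [Matrix.det_fin_two]
  rcases q with _ | q
  · simp only [formPoly, derivative_mul, derivative_pow, derivative_X,
      derivative_C, derivative_one, map_mul, map_add, map_sub, map_one, map_natCast, Nat.cast_zero,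
      Nat.add_sub_cancel, Nat.cast_add, Nat.cast_one, pow_zero, map_zero]
    ring
  · simp only [formPoly, derivative_mul, derivative_pow, derivative_X,
      derivative_C, map_mul, map_add, map_sub, map_one, map_natCast,
      Nat.add_sub_cancel, Nat.cast_add, Nat.cast_one]
    ring

open Polynomial in
lemma formPoly_right (A : Matrix (Fin 2) (Fin 2) ℂ) (p q : ℕ) :
    C (((p : ℂ) + q + 1) * A 1 0) * formPoly A p q =
      derivative (formPoly A p (q + 1)) - C (p * A.det) * formPoly A (p - 1) q := by
  rw [Matrix.det_fin_two]
  rcases p with _ | p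
  · simp only [formPoly, derivative_mul, derivative_pow, derivative_X,
      derivative_C, derivative_one, map_mul, map_add, map_sub, map_one, map_natCast, Nat.cast_zero,
      Nat.add_sub_cancel, Nat.cast_add, Nat.cast_one, pow_zero, map_zero]
    ring
  · simp only [formPoly, derivative_mul, derivative_pow, derivative_X,
      derivative_C, map_mul, map_add, map_sub, map_one, map_natCast,
      Nat.add_sub_cancel, Nat.cast_add, Nat.cast_one]
    ring

/-- The functions `det(k)^r c(k)` on `U₂`, with `c` a coefficient of `formPoly`. -/
def formFn (r : ℤ) (p q i : ℕ) (k : U2) : ℂ :=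
  (k : Matrix (Fin 2) (Fin 2) ℂ).det ^ r *
    (formPoly (k : Matrix (Fin 2) (Fin 2) ℂ)ᴴ p q).coeff i

/-- The span of the functions `formFn`. -/
def FormK : Submodule ℂ (U2 → ℂ) :=
  Submodule.span ℂ (Set.range fun s : ℤ × ℕ × ℕ × ℕ => formFn s.1 s.2.1 s.2.2.1 s.2.2.2)

lemma formFn_mem (r : ℤ) (p q i : ℕ) : formFn r p q i ∈ FormK :=
  Submodule.subset_span ⟨(r, p, q, i), rfl⟩

lemma mul_mem_FormK {c f : U2 → ℂ} (h : ∀ r p q i, c * formFn r p q i ∈ FormK) (hf : f ∈ FormK) :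
    c * f ∈ FormK := by
  induction hf using Submodule.span_induction with
  | mem f hf =>
    obtain ⟨s, rfl⟩ := hf
    exact h _ _ _ _
  | zero => rw [mul_zero]; exact FormK.zero_mem
  | add f g _ _ hf hg => rw [mul_add]; exact FormK.add_mem hf hg
  | smul a f _ hf => rw [mul_smul_comm]; exact FormK.smul_mem a hf

lemma det_conjTranspose_U2 (k : U2) : ((k : Matrix (Fin 2) (Fin 2) ℂ)ᴴ).det =
    (k : Matrix (Fin 2) (Fin 2) ℂ).det ^ (-1 : ℤ) := by
  rw [_root_.zpow_neg_one, Matrix.det_conjTranspose]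
  exact eq_inv_of_mul_eq_one_right (det_U2_mul_conj k)

lemma left_mul_mem {f : U2 → ℂ} (hf : f ∈ FormK) :
    (fun k : U2 => (k : Matrix (Fin 2) (Fin 2) ℂ)ᴴ 0 0) * f ∈ FormK := by
  refine mul_mem_FormK (fun r p q i => ?_) hf
  have h0 : (p : ℂ) + q + 1 ≠ 0 := by exact_mod_cast (p + q).succ_ne_zero
  have h : (fun k : U2 => (k : Matrix (Fin 2) (Fin 2) ℂ)ᴴ 0 0) * formFn r p q i =
      ((p : ℂ) + q + 1)⁻¹ • (((i : ℂ) + 1) • formFn r (p + 1) q (i + 1) +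
        (q : ℂ) • formFn (r - 1) p (q - 1) i) := by
    funext k
    have h1 := congrArg (fun P => P.coeff i)
      (formPoly_left (k : Matrix (Fin 2) (Fin 2) ℂ)ᴴ p q)
    simp only [Polynomial.coeff_C_mul, Polynomial.coeff_add, Polynomial.coeff_derivative,
      det_conjTranspose_U2, _root_.zpow_neg_one] at h1
    simp only [Pi.mul_apply, Pi.smul_apply, Pi.add_apply, smul_eq_mul, formFn]
    rw [sub_eq_add_neg r 1, zpow_add₀ (det_U2_ne k), _root_.zpow_neg_one,
      eq_inv_mul_iff_mul_eq₀ h0]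
    linear_combination (k : Matrix (Fin 2) (Fin 2) ℂ).det ^ r * h1
  rw [h]
  exact FormK.smul_mem _ (FormK.add_mem (FormK.smul_mem _ (formFn_mem _ _ _ _))
    (FormK.smul_mem _ (formFn_mem _ _ _ _)))

lemma right_mul_mem {f : U2 → ℂ} (hf : f ∈ FormK) :
    (fun k : U2 => (k : Matrix (Fin 2) (Fin 2) ℂ)ᴴ 1 0) * f ∈ FormK := by
  refine mul_mem_FormK (fun r p q i => ?_) hf
  have h0 : (p : ℂ) + q + 1 ≠ 0 := by exact_mod_cast (p + q).succ_ne_zero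
  have h : (fun k : U2 => (k : Matrix (Fin 2) (Fin 2) ℂ)ᴴ 1 0) * formFn r p q i =
      ((p : ℂ) + q + 1)⁻¹ • (((i : ℂ) + 1) • formFn r p (q + 1) (i + 1) -
        (p : ℂ) • formFn (r - 1) (p - 1) q i) := by
    funext k
    have h1 := congrArg (fun P => P.coeff i)
      (formPoly_right (k : Matrix (Fin 2) (Fin 2) ℂ)ᴴ p q)
    simp only [Polynomial.coeff_C_mul, Polynomial.coeff_sub, Polynomial.coeff_derivative,
      det_conjTranspose_U2, _root_.zpow_neg_one] at h1
    simp only [Pi.mul_apply, Pi.smul_apply, Pi.sub_apply, smul_eq_mul, formFn]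
    rw [sub_eq_add_neg r 1, zpow_add₀ (det_U2_ne k), _root_.zpow_neg_one,
      eq_inv_mul_iff_mul_eq₀ h0]
    linear_combination (k : Matrix (Fin 2) (Fin 2) ℂ).det ^ r * h1
  rw [h]
  exact FormK.smul_mem _ (FormK.sub_mem (FormK.smul_mem _ (formFn_mem _ _ _ _))
    (FormK.smul_mem _ (formFn_mem _ _ _ _)))

lemma left_mul_mem' {f : U2 → ℂ} (hf : f ∈ FormK) :
    (fun k : U2 => (k : Matrix (Fin 2) (Fin 2) ℂ)ᴴ 0 1) * f ∈ FormK := by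
  refine mul_mem_FormK (fun r p q i => ?_) hf
  have h1 : ∀ A : Matrix (Fin 2) (Fin 2) ℂ, formPoly A (p + 1) q =
      Polynomial.C (A 0 0) * (formPoly A p q * Polynomial.X) +
        Polynomial.C (A 0 1) * formPoly A p q := by
    intro A
    simp only [formPoly]
    ring
  rcases i with _ | i
  · have h : (fun k : U2 => (k : Matrix (Fin 2) (Fin 2) ℂ)ᴴ 0 1) * formFn r p q 0 =
        formFn r (p + 1) q 0 := by
      funext k
      simp only [Pi.mul_apply, formFn, h1, Polynomial.coeff_add, Polynomial.coeff_C_mul,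
        Polynomial.coeff_mul_X_zero]
      ring
    rw [h]
    exact formFn_mem _ _ _ _
  · have h : (fun k : U2 => (k : Matrix (Fin 2) (Fin 2) ℂ)ᴴ 0 1) * formFn r p q (i + 1) =
        formFn r (p + 1) q (i + 1) -
          (fun k : U2 => (k : Matrix (Fin 2) (Fin 2) ℂ)ᴴ 0 0) * formFn r p q i := by
      funext k
      simp only [Pi.mul_apply, Pi.sub_apply, formFn, h1, Polynomial.coeff_add,
        Polynomial.coeff_C_mul, Polynomial.coeff_mul_X]
      ring
    rw [h]
    exact FormK.sub_mem (formFn_mem _ _ _ _) (left_mul_mem (formFn_mem _ _ _ _))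

lemma right_mul_mem' {f : U2 → ℂ} (hf : f ∈ FormK) :
    (fun k : U2 => (k : Matrix (Fin 2) (Fin 2) ℂ)ᴴ 1 1) * f ∈ FormK := by
  refine mul_mem_FormK (fun r p q i => ?_) hf
  have h1 : ∀ A : Matrix (Fin 2) (Fin 2) ℂ, formPoly A p (q + 1) =
      Polynomial.C (A 1 0) * (formPoly A p q * Polynomial.X) +
        Polynomial.C (A 1 1) * formPoly A p q := by
    intro A
    simp only [formPoly]
    ring
  rcases i with _ | i
  · have h : (fun k : U2 => (k : Matrix (Fin 2) (Fin 2) ℂ)ᴴ 1 1) * formFn r p q 0 =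
        formFn r p (q + 1) 0 := by
      funext k
      simp only [Pi.mul_apply, formFn, h1, Polynomial.coeff_add, Polynomial.coeff_C_mul,
        Polynomial.coeff_mul_X_zero]
      ring
    rw [h]
    exact formFn_mem _ _ _ _
  · have h : (fun k : U2 => (k : Matrix (Fin 2) (Fin 2) ℂ)ᴴ 1 1) * formFn r p q (i + 1) =
        formFn r p (q + 1) (i + 1) -
          (fun k : U2 => (k : Matrix (Fin 2) (Fin 2) ℂ)ᴴ 1 0) * formFn r p q i := by
      funext k
      simp only [Pi.mul_apply, Pi.sub_apply, formFn, h1, Polynomial.coeff_add,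
        Polynomial.coeff_C_mul, Polynomial.coeff_mul_X]
      ring
    rw [h]
    exact FormK.sub_mem (formFn_mem _ _ _ _) (right_mul_mem (formFn_mem _ _ _ _))

lemma conjTranspose_mul_mem (a b : Fin 2) {f : U2 → ℂ} (hf : f ∈ FormK) :
    (fun k : U2 => (k : Matrix (Fin 2) (Fin 2) ℂ)ᴴ a b) * f ∈ FormK := by
  fin_cases a <;> fin_cases b
  · exact left_mul_mem hf
  · exact left_mul_mem' hf
  · exact right_mul_mem hf
  · exact right_mul_mem' hf

lemma det_mul_mem {f : U2 → ℂ} (hf : f ∈ FormK) :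
    (fun k : U2 => (k : Matrix (Fin 2) (Fin 2) ℂ).det) * f ∈ FormK := by
  refine mul_mem_FormK (fun r p q i => ?_) hf
  have h : (fun k : U2 => (k : Matrix (Fin 2) (Fin 2) ℂ).det) * formFn r p q i =
      formFn (r + 1) p q i := by
    funext k
    simp only [Pi.mul_apply, formFn]
    rw [zpow_add_one₀ (det_U2_ne k)]
    ring
  rw [h]
  exact formFn_mem _ _ _ _

lemma adjugate_U2 (k : U2) : Matrix.adjugate (k : Matrix (Fin 2) (Fin 2) ℂ) =
    (k : Matrix (Fin 2) (Fin 2) ℂ).det • (k : Matrix (Fin 2) (Fin 2) ℂ)ᴴ := by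
  have h := congrArg (fun B => B * (k : Matrix (Fin 2) (Fin 2) ℂ)ᴴ)
    (Matrix.adjugate_mul (k : Matrix (Fin 2) (Fin 2) ℂ))
  simp only [mul_assoc, ← Matrix.star_eq_conjTranspose, Matrix.mem_unitaryGroup_iff.1 k.2, mul_one,
    Matrix.smul_mul, one_mul] at h
  exact h

lemma entry_mul_mem (a b : Fin 2) {f : U2 → ℂ} (hf : f ∈ FormK) :
    (fun k : U2 => (k : Matrix (Fin 2) (Fin 2) ℂ) a b) * f ∈ FormK := by
  have key : ∃ (s : ℂ) (a' b' : Fin 2), ∀ k : U2, (k : Matrix (Fin 2) (Fin 2) ℂ) a b =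
      s * ((k : Matrix (Fin 2) (Fin 2) ℂ).det * (k : Matrix (Fin 2) (Fin 2) ℂ)ᴴ a' b') := by
    have h : ∀ (k : U2) (i j : Fin 2), Matrix.adjugate (k : Matrix (Fin 2) (Fin 2) ℂ) i j =
        (k : Matrix (Fin 2) (Fin 2) ℂ).det * (k : Matrix (Fin 2) (Fin 2) ℂ)ᴴ i j := fun k i j => by
      rw [adjugate_U2]
      rfl
    fin_cases a <;> fin_cases b
    · exact ⟨1, 1, 1, fun k => by rw [← h, Matrix.adjugate_fin_two]; simp⟩
    · exact ⟨-1, 0, 1, fun k => by rw [← h, Matrix.adjugate_fin_two]; simp⟩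
    · exact ⟨-1, 1, 0, fun k => by rw [← h, Matrix.adjugate_fin_two]; simp⟩
    · exact ⟨1, 0, 0, fun k => by rw [← h, Matrix.adjugate_fin_two]; simp⟩
  obtain ⟨s, a', b', hs⟩ := key
  have h : (fun k : U2 => (k : Matrix (Fin 2) (Fin 2) ℂ) a b) * f =
      s • ((fun k : U2 => (k : Matrix (Fin 2) (Fin 2) ℂ).det) *
        ((fun k : U2 => (k : Matrix (Fin 2) (Fin 2) ℂ)ᴴ a' b') * f)) := by
    funext k
    simp only [Pi.mul_apply, Pi.smul_apply, smul_eq_mul, hs k]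
    ring
  rw [h]
  exact FormK.smul_mem _ (det_mul_mem (conjTranspose_mul_mem _ _ hf))

/-- `FormK` is stable under multiplication by polynomial functions, and contains `1`: the entries of
`k*` are covered by the Clebsch–Gordan rule, those of `k` are `±det k` times entries of `k*`. -/
lemma PolK_subset_FormK {c : U2 → ℂ} (hc : c ∈ PolK) : c ∈ FormK := by
  have h : ∀ f ∈ FormK, c * f ∈ FormK := by
    induction hc using Algebra.adjoin_induction with
    | mem c hc =>
      intro f hf
      rcases hc with ⟨p, rfl⟩ | ⟨p, rfl⟩
      · exact entry_mul_mem _ _ hf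
      · exact conjTranspose_mul_mem p.2 p.1 hf
    | algebraMap r =>
      intro f hf
      rw [← Algebra.smul_def]
      exact FormK.smul_mem r hf
    | add x y _ _ hx hy =>
      intro f hf
      rw [add_mul]
      exact FormK.add_mem (hx f hf) (hy f hf)
    | mul x y _ _ hx hy =>
      intro f hf
      rw [mul_assoc]
      exact hx _ (hy f hf)
  have h1 : formFn 0 0 0 0 = 1 := by
    funext k
    simp [formFn, formPoly]
  simpa [h1] using h _ (formFn_mem 0 0 0 0)

lemma formPoly_coeff (A : Matrix (Fin 2) (Fin 2) ℂ) (j : Fin (n + 1)) (i : ℕ) :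
    ((Real.sqrt (n.choose j) : ℝ) : ℂ) * (formPoly A j (n - j)).coeff i =
      if h : i < n + 1 then symPow n A ⟨i, h⟩ j * ((Real.sqrt (n.choose i) : ℝ) : ℂ) else 0 := by
  have h : Polynomial.C ((Real.sqrt (n.choose j) : ℝ) : ℂ) * formPoly A j (n - j) =
      ∑ i : Fin (n + 1), Polynomial.C (symPow n A i j * ((Real.sqrt (n.choose i) : ℝ) : ℂ)) *
        Polynomial.X ^ (i : ℕ) := by
    refine Polynomial.funext fun x => ?_
    have h1 := basisVal_mulVec n A ![x, 1] j
    simp only [basisVal, Matrix.mulVec, dotProduct, Fin.sum_univ_two, Matrix.cons_val_zero,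
      Matrix.cons_val_one, mul_one, one_pow] at h1
    simp only [formPoly, Polynomial.eval_mul, Polynomial.eval_pow, Polynomial.eval_add,
      Polynomial.eval_C, Polynomial.eval_X, Polynomial.eval_finsetSum]
    rw [h1]
    exact Finset.sum_congr rfl fun i _ => by ring
  rw [← Polynomial.coeff_C_mul, h, Polynomial.finsetSum_coeff]
  simp only [Polynomial.coeff_C_mul_X_pow]
  split_ifs with hi
  · rw [Finset.sum_eq_single (⟨i, hi⟩ : Fin (n + 1))]
    · simp
    · intro b _ hb
      rw [if_neg fun h0 => hb (Fin.ext h0.symm)]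
    · simp
  · refine Finset.sum_eq_zero fun b _ => ?_
    rw [if_neg]
    rintro rfl
    exact hi b.2

lemma exists_formFn_eq (r : ℤ) (p q i : ℕ) : ∃ (c : ℂ) (m : ℤ) (a b : Fin (p + q + 1)),
    Even (((p + q : ℕ) : ℤ) - m) ∧ formFn r p q i = fun k => c * tauU m (p + q) k a b := by
  set j : Fin (p + q + 1) := ⟨p, by omega⟩ with hj
  have h1 := fun k : U2 => formPoly_coeff (n := p + q) (k : Matrix (Fin 2) (Fin 2) ℂ)ᴴ j i
  have hs := sqrt_choose_ne (p + q) j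
  have hq : p + q - (j : ℕ) = q := by simp [hj]
  rw [hq] at h1
  by_cases hi : i < p + q + 1
  · simp only [dif_pos hi] at h1
    refine ⟨((Real.sqrt ((p + q).choose j) : ℝ) : ℂ)⁻¹ *
      ((Real.sqrt ((p + q).choose i) : ℝ) : ℂ), ((p + q : ℕ) : ℤ) - 2 * r, ⟨i, hi⟩, j,
      ⟨r, by ring⟩, funext fun k => ?_⟩
    have h3 : (((p + q : ℕ) : ℤ) - (((p + q : ℕ) : ℤ) - 2 * r)) / 2 = r := by omega
    rw [tauU, h3, tau_eq_star, Matrix.smul_apply, smul_eq_mul, formFn]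
    change _ * (formPoly _ (j : ℕ) q).coeff i = _
    have h4 := h1 k
    field_simp
    linear_combination (k : Matrix (Fin 2) (Fin 2) ℂ).det ^ r * h4
  · simp only [dif_neg hi, mul_eq_zero, hs, false_or] at h1
    refine ⟨0, ((p + q : ℕ) : ℤ), 0, 0, by simp, funext fun k => ?_⟩
    rw [formFn]
    change _ * (formPoly _ (j : ℕ) q).coeff i = _
    rw [h1, mul_zero, zero_mul]

/-- A continuous function on `U₂` whose Fourier coefficients all vanish is zero: it is orthogonal
to the polynomial functions, which are dense by the Stone–Weierstrass theorem. -/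
lemma eq_zero_of_coeffU {f : U2 → ℂ} (hf : Continuous f)
    (h : ∀ (m : ℤ) (n : ℕ), Even ((n : ℤ) - m) → coeffU m n f = 0) : f = 0 := by
  have h1 : ∀ c ∈ PolK, ∫ k, f k * c k ∂haarU2 = 0 := by
    intro c hc
    have hW : ∀ c ∈ FormK, Continuous c ∧ ∫ k, f k * c k ∂haarU2 = 0 := by
      intro c hc
      induction hc using Submodule.span_induction with
      | mem c hc =>
        obtain ⟨⟨r, p, q, i⟩, rfl⟩ := hc
        obtain ⟨c, m, a, b, hm, he⟩ := exists_formFn_eq r p q i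
        simp only [he, mul_left_comm (f _), integral_const_mul]
        refine ⟨continuous_const.mul (continuous_tauU_apply m _ a b), ?_⟩
        have h5 := congrFun (congrFun (h m (p + q) hm) a) b
        rw [coeffU, Matrix.of_apply] at h5
        rw [h5]
        simp
      | zero => exact ⟨continuous_const, by simp⟩
      | add c d _ _ hc hd =>
        refine ⟨hc.1.add hd.1, ?_⟩
        simp only [Pi.add_apply, mul_add]
        have h7 := integral_add (integrable_haarU2 (hf.mul hc.1)) (integrable_haarU2 (hf.mul hd.1))
        simp only [Pi.mul_apply] at h7
        rw [h7, hc.2, hd.2, add_zero]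
      | smul a c _ hc =>
        refine ⟨hc.1.const_smul a, ?_⟩
        simp only [Pi.smul_apply, smul_eq_mul, mul_left_comm (f _), integral_const_mul, hc.2,
          mul_zero]
    exact (hW c (PolK_subset_FormK hc)).2
  set S : StarSubalgebra ℂ C(U2, ℂ) :=
    { carrier := {c | (c : U2 → ℂ) ∈ PolK}
      mul_mem' := fun hc hd => PolK.mul_mem hc hd
      add_mem' := fun hc hd => PolK.add_mem hc hd
      algebraMap_mem' := fun a => const_mem_PolK a
      star_mem' := fun hc => conj_mem_PolK hc } with hS
  have hsep : S.SeparatesPoints := by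
    intro k k' hk
    have : ∃ a b, (k : Matrix (Fin 2) (Fin 2) ℂ) a b ≠ (k' : Matrix (Fin 2) (Fin 2) ℂ) a b := by
      by_contra! h0
      exact hk (Subtype.ext (Matrix.ext h0))
    obtain ⟨a, b, hab⟩ := this
    exact ⟨_, ⟨⟨_, continuous_PolK (entry_mem_PolK a b)⟩, entry_mem_PolK a b, rfl⟩, hab⟩
  have hd := ContinuousMap.starSubalgebra_topologicalClosure_eq_top_of_separatesPoints S hsep
  -- by density `f` is orthogonal to its own conjugate, so that `∫ |f|² = 0`
  set F : C(U2, ℂ) := ⟨f, hf⟩ with hF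
  have hcl : IsClosed {c : C(U2, ℂ) | ∫ k, f k * c k ∂haarU2 = 0} := by
    let T : C(U2, ℂ) →ₗ[ℂ] ℂ :=
      { toFun := fun c => ∫ k, f k * c k ∂haarU2
        map_add' := fun c d => by
          simp only [ContinuousMap.add_apply, mul_add]
          exact integral_add (integrable_haarU2 (hf.mul c.continuous))
            (integrable_haarU2 (hf.mul d.continuous))
        map_smul' := fun a c => by
          simp only [ContinuousMap.smul_apply, smul_eq_mul, mul_left_comm (f _),
            integral_const_mul, RingHom.id_apply] }
    refine isClosed_singleton.preimage (T.mkContinuous ‖F‖ fun c => ?_).continuous (t := {0})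
    have h6 := norm_integral_le_of_norm_le_const (μ := haarU2) (f := fun k => f k * c k)
      (C := ‖F‖ * ‖c‖) (Filter.Eventually.of_forall fun k => by
        rw [norm_mul]
        exact mul_le_mul (F.norm_coe_le_norm k) (c.norm_coe_le_norm k) (norm_nonneg _)
          (norm_nonneg _))
    change ‖∫ k, f k * c k ∂haarU2‖ ≤ _
    simpa using h6
  have hstar : star F ∈ {c : C(U2, ℂ) | ∫ k, f k * c k ∂haarU2 = 0} := by
    have hm : star F ∈ S.topologicalClosure := by rw [hd]; trivial
    exact closure_minimal (s := (S : Set C(U2, ℂ))) (t := {c | ∫ k, f k * c k ∂haarU2 = 0})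
      (fun c hc => h1 c hc) hcl hm
  have h2 : ∫ k, ‖f k‖ ^ 2 ∂haarU2 = 0 := by
    have h3 : ∫ k, f k * conj (f k) ∂haarU2 = 0 := hstar
    simp only [← coe_norm_sq] at h3
    rw [integral_complex_ofReal] at h3
    exact_mod_cast h3
  have h4 : (fun k => ‖f k‖ ^ 2) = 0 := by
    have hc : Continuous fun k => ‖f k‖ ^ 2 := hf.norm.pow 2
    refine (hc.ae_eq_iff_eq haarU2 continuous_const).1 ?_
    exact (integral_eq_zero_iff_of_nonneg (fun k => by positivity)
      (hc.integrable_of_hasCompactSupport (HasCompactSupport.of_compactSpace _))).1 h2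
  funext k
  have h5 := congrFun h4 k
  simpa using h5

end

section
variable {n : ℕ}
/-! ### From spherical functions to matrix-valued functions -/


/-- The restriction of a function on `G` to the coset `U₂ × {z}`. -/
def slice (φ : G → ℂ) (z : C2) (k : U2) : ℂ := φ ⟨k, z⟩

lemma fieldU_slice (x : Fin 4 → ℝ) (φ : G → ℂ) (z : C2) :
    slice (fieldU x φ) z = fieldK x (slice φ z) := by
  funext k
  have h : ∀ h : U2, (⟨k, z⟩ : G) * ofK h = ⟨k * h, z⟩ := fun h => by
    ext1
    · rfl
    · simp [ofK, act]
  simp only [slice, fieldU, fieldK, h]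

lemma smoothK_slice {φ : G → ℂ} (hφ : IsSmooth φ) (z : C2) : SmoothK (slice φ z) := by
  refine smoothK_of_contDiff fun k => ?_
  have h : (fun x : Fin 4 → ℝ => slice φ z (k * expU x)) =
      fun x => φ ((⟨k, z⟩ : G) * ⟨expU x, 0⟩) := by
    funext x
    rw [slice]
    congr 1
    ext1
    · rfl
    · simp [act]
  rw [h]
  exact ContDiff.comp (g := fun p : (Fin 4 → ℝ) × C2 => φ ((⟨k, z⟩ : G) * ⟨expU p.1, p.2⟩))
    (f := fun x : Fin 4 → ℝ => (x, (0 : C2))) (hφ ⟨k, z⟩) (contDiff_id.prodMk contDiff_const)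

lemma contDiff_fiber {φ : G → ℂ} (hφ : IsSmooth φ) (k : U2) :
    ContDiff ℝ ∞ fun z => φ ⟨k, z⟩ := by
  have h : (fun z => φ ⟨k, z⟩) = fun z => φ ((⟨k, 0⟩ : G) * ⟨expU 0, actL k⁻¹ z⟩) := by
    funext z
    congr 1
    ext1
    · simp [expU_zero]
    · change z = 0 + act k (actL k⁻¹ z)
      rw [actL_apply, zero_add, ← coe_mul_act, mul_inv_cancel, Submonoid.coe_one, act_one]
  rw [h]
  exact ContDiff.comp (g := fun p : (Fin 4 → ℝ) × C2 => φ ((⟨k, 0⟩ : G) * ⟨expU p.1, p.2⟩))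
    (f := fun z : C2 => ((0 : Fin 4 → ℝ), actL k⁻¹ z)) (hφ ⟨k, 0⟩)
    (contDiff_const.prodMk (actL k⁻¹).contDiff)

/-- A matrix is determined by its pairings with the `τ_{m,n}(k)`. -/
lemma eq_of_trace_tauU (m : ℤ) {B C : EndV n}
    (h : ∀ k : U2, ((tauU m n k)ᴴ * B).trace = ((tauU m n k)ᴴ * C).trace) : B = C := by
  have h1 : ∀ M : EndV n, (M * B).trace = (M * C).trace := by
    intro M
    have hM : M ∈ Submodule.span ℂ (Set.range fun k : U2 => (tauU m n k)ᴴ) := by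
      rw [span_tauU]; trivial
    induction hM using Submodule.span_induction with
    | mem M hM =>
      obtain ⟨k, rfl⟩ := hM
      exact h k
    | zero => simp
    | add M N _ _ hM hN => rw [add_mul, add_mul, Matrix.trace_add, Matrix.trace_add, hM, hN]
    | smul c M _ hM => rw [Matrix.smul_mul, Matrix.smul_mul, Matrix.trace_smul, Matrix.trace_smul, hM]
  ext a b
  simpa [Matrix.trace_single_mul] using h1 (Matrix.single b a 1)

lemma trFn_injective (m : ℤ) {Φ Ψ : C2 → EndV n} (h : trFn m Φ = trFn m Ψ) : Φ = Ψ :=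
  funext fun z => eq_of_trace_tauU m fun k => congrFun h ⟨k, z⟩

lemma coeffU_trFn (m : ℤ) (Φ : C2 → EndV n) (z : C2) :
    coeffU m n (slice (trFn m Φ) z) = ((n : ℂ) + 1)⁻¹ • Φ z := by
  ext i j
  have h : ∀ k, slice (trFn m Φ) z k * tauU m n k i j =
      ∑ p : Fin (n + 1) × Fin (n + 1), Φ z p.1 p.2 *
        (tauU m n k i j * conj (tauU m n k p.1 p.2)) := by
    intro k
    rw [slice, trFn, trace_conjTranspose_mul, Finset.sum_mul]
    exact Finset.sum_congr rfl fun p _ => by ring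
  simp only [coeffU, Matrix.of_apply, h]
  rw [integral_finsetSum]
  · simp only [integral_const_mul, integral_tauU_mul_conj]
    rw [Finset.sum_eq_single (i, j)]
    · simp [mul_comm]
    · rintro ⟨a, b⟩ _ hp
      rw [if_neg, mul_zero]
      rintro ⟨rfl, rfl⟩
      exact hp rfl
    · simp
  · exact fun p _ => integrable_haarU2 (continuous_const.mul ((continuous_tauU_apply m n i j).mul
      (Complex.continuous_conj.comp (continuous_tauU_apply m n p.1 p.2))))

/-- The eigenvalues of `D₃` and `D₄` determine the `K`-type: a joint eigenfunction is given by its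
Fourier coefficient of type `τ_{m,n}` along `U₂`. -/
lemma eq_trFn_of_eigen {φ : G → ℂ} (hφ : IsSmooth φ) {m : ℤ} (hmn : Even ((n : ℤ) - m))
    (h3 : D3 φ = ((n : ℂ) ^ 2 + 2 * n) • φ) (h4 : D4 φ = (-(m : ℂ)) • φ) :
    φ = trFn m fun z => ((n : ℂ) + 1) • coeffU m n (slice φ z) := by
  set B : C2 → EndV n := fun z => ((n : ℂ) + 1) • coeffU m n (slice φ z) with hB
  have hn : (n : ℂ) + 1 ≠ 0 := by exact_mod_cast Nat.succ_ne_zero n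
  have key : ∀ z, slice φ z - slice (trFn m B) z = 0 := by
    intro z
    have hs := smoothK_slice hφ z
    set Ψ : SmoothMat n := liftM (fun _ => B z) fun _ _ => contDiff_const with hΨ
    have hc : slice (trFn m B) z = slice (trFn m (valM Ψ)) z := by
      funext k
      rfl
    have ht : SmoothK (slice (trFn m B) z) := by
      rw [hc]
      exact smoothK_slice (isSmooth_trFn m Ψ) z
    have e3 : ∀ (ψ : G → ℂ), D3 ψ = ((n : ℂ) ^ 2 + 2 * n) • ψ →
        -fieldK (Pi.single 0 1) (fieldK (Pi.single 0 1) (slice ψ z)) -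
        fieldK (Pi.single 1 1) (fieldK (Pi.single 1 1) (slice ψ z)) -
        fieldK (Pi.single 2 1) (fieldK (Pi.single 2 1) (slice ψ z)) =
          ((n : ℂ) ^ 2 + 2 * n) • slice ψ z := by
      intro ψ hψ
      simp only [← fieldU_slice]
      funext k
      exact congrFun hψ ⟨k, z⟩
    have e4 : ∀ (ψ : G → ℂ), D4 ψ = (-(m : ℂ)) • ψ →
        Complex.I • fieldK (Pi.single 3 1) (slice ψ z) = (-(m : ℂ)) • slice ψ z := by
      intro ψ hψ
      simp only [← fieldU_slice]
      funext k
      exact congrFun hψ ⟨k, z⟩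
    -- both functions have their only nonzero Fourier coefficient at `(m, n)`, where they agree
    refine eq_zero_of_coeffU (hs.continuous.sub ht.continuous) fun m' n' hmn' => ?_
    rw [coeffU_sub _ _ hs.continuous ht.continuous]
    by_cases hne : n' = n ∧ m' = m
    · obtain ⟨rfl, rfl⟩ := hne
      rw [coeffU_trFn, hB, smul_smul, inv_mul_cancel₀ hn, one_smul, sub_self]
    · rw [coeffU_eq_zero hs hmn' (e3 φ h3) (e4 φ h4) hne, hc,
        coeffU_eq_zero (smoothK_slice (isSmooth_trFn m Ψ) z) hmn' (e3 _ (D3_trFn m _))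
          (e4 _ (D4_trFn hmn _)) hne, sub_zero]
  funext g
  exact sub_eq_zero.1 (congrFun (key g.z) g.k)

/-- The projection on the `K`-type `τ_{m,n}`. -/
lemma integral_ktype {φ : G → ℂ} (hφ : IsSmooth φ) (m : ℤ) (n : ℕ) (g : G) :
    ∫ h : U2, φ (g * (ofK h)⁻¹) * (((n : ℂ) + 1) * conj (tauU m n h).trace) ∂haarU2 =
      trFn m (fun z => ((n : ℂ) + 1) • A m n φ z) g := by
  have hc := (smoothK_slice hφ g.z).continuous
  obtain ⟨F, hF⟩ : ∃ F : U2 → ℂ, F = fun k : U2 => slice φ g.z k * (((n : ℂ) + 1) *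
        conj (tauU m n (k⁻¹ * g.k)).trace) := ⟨_, rfl⟩
  have h1 : ∀ h : U2, φ (g * (ofK h)⁻¹) * (((n : ℂ) + 1) * conj (tauU m n h).trace) =
      F (g.k / h) := by
    intro h
    have h2 : g * (ofK h)⁻¹ = ⟨g.k / h, g.z⟩ := by
      ext1
      · simp [ofK, div_eq_mul_inv]
      · simp [ofK, act]
    have h3 : (g.k / h)⁻¹ * g.k = h := by rw [inv_div, div_mul_cancel]
    simp only [hF, slice, h2, h3]
  simp only [h1]
  rw [integral_div_left_eq_self, hF]
  have h4 : ∀ k : U2, slice φ g.z k * (((n : ℂ) + 1) * conj (tauU m n (k⁻¹ * g.k)).trace) =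
      ((n : ℂ) + 1) * ((tauU m n g.k)ᴴ * (slice φ g.z k • tauU m n k)).trace := by
    intro k
    have h5 : conj (tauU m n (k⁻¹ * g.k)).trace = ((tauU m n g.k)ᴴ * tauU m n k).trace := by
      rw [starRingEnd_apply, ← Matrix.trace_conjTranspose, tauU_mul, tauU_inv,
        Matrix.conjTranspose_mul, Matrix.conjTranspose_conjTranspose]
    rw [h5, Matrix.mul_smul, Matrix.trace_smul, smul_eq_mul]
    ring
  simp only [h4, integral_const_mul]
  rw [integral_trace (μ := haarU2) (F := fun k : U2 => slice φ g.z k • tauU m n k)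
    (fun i j => integrable_haarU2 (hc.mul (continuous_tauU_apply m n i j))), trFn,
    Matrix.mul_smul, Matrix.trace_smul]
  rfl

lemma HasKType.eq_trFn {φ : G → ℂ} (hφ : IsSmooth φ) {m : ℤ} (h : HasKType m n φ) :
    φ = trFn m fun z => ((n : ℂ) + 1) • A m n φ z :=
  funext fun g => (h g).trans (integral_ktype hφ m n g)

/-- The properties of the matrix-valued function attached to a bounded spherical function. -/
lemma exists_smoothMat {φ : G → ℂ} (hφ : IsBoundedSpherical φ) {m : ℤ} {Φ : C2 → EndV n}
    (h : φ = trFn m fun z => ((n : ℂ) + 1)⁻¹ • Φ z) :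
    ∃ F : SmoothMat n, valM F = Φ ∧ Equivariant Φ ∧ Φ 0 = 1 ∧
      ∀ a b, ∃ C : ℝ, ∀ z, ‖(F a b : C2 → ℂ) z‖ ≤ C := by
  have hn : (n : ℂ) + 1 ≠ 0 := by exact_mod_cast Nat.succ_ne_zero n
  have hk : ∀ k z, ((tauU m n k)ᴴ * Φ z).trace = ((n : ℂ) + 1) * φ ⟨k, z⟩ := by
    intro k z
    rw [h, trFn, Matrix.mul_smul, Matrix.trace_smul, smul_eq_mul, mul_inv_cancel_left₀ hn]
  obtain ⟨C, hC⟩ := hφ.2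
  -- smoothness and boundedness pass from `φ` to the entries of `Φ` since the `τ(k)^*` span `End(V_n)`
  have hsb : ∀ M : EndV n, (ContDiff ℝ ∞ fun z => (M * Φ z).trace) ∧
      ∃ C : ℝ, ∀ z, ‖(M * Φ z).trace‖ ≤ C := by
    intro M
    have hM : M ∈ Submodule.span ℂ (Set.range fun k : U2 => (tauU m n k)ᴴ) := by
      rw [span_tauU]; trivial
    induction hM using Submodule.span_induction with
    | mem M hM =>
      obtain ⟨k, rfl⟩ := hM
      simp only [hk]
      exact ⟨contDiff_const.mul (contDiff_fiber hφ.1.smooth k), ‖(n : ℂ) + 1‖ * C, fun z => by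
        rw [norm_mul]
        exact mul_le_mul_of_nonneg_left (hC _) (norm_nonneg _)⟩
    | zero => exact ⟨by simpa using contDiff_const, 0, by simp⟩
    | add M N _ _ hM hN =>
      obtain ⟨hM1, C1, hM2⟩ := hM
      obtain ⟨hN1, C2, hN2⟩ := hN
      simp only [add_mul, Matrix.trace_add]
      exact ⟨hM1.add hN1, C1 + C2, fun z => (norm_add_le _ _).trans (add_le_add (hM2 z) (hN2 z))⟩
    | smul c M _ hM =>
      obtain ⟨hM1, C1, hM2⟩ := hM
      simp only [Matrix.smul_mul, Matrix.trace_smul, smul_eq_mul]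
      exact ⟨contDiff_const.mul hM1, ‖c‖ * C1, fun z => by
        rw [norm_mul]
        exact mul_le_mul_of_nonneg_left (hM2 z) (norm_nonneg _)⟩
  have he : ∀ a b z, (Matrix.single b a 1 * Φ z).trace = Φ z a b := by
    intro a b z
    simp [Matrix.trace_single_mul]
  have hs : ∀ a b, ContDiff ℝ ∞ fun z => Φ z a b := by
    intro a b
    simpa only [he] using (hsb (Matrix.single b a 1)).1
  have heq : Equivariant Φ := by
    intro k z
    have h1 : (tau n k)ᴴ * Φ (act k z) * tau n k = Φ z := by
      refine eq_of_trace_tauU m fun h => ?_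
      have h2 := hφ.1.central k ⟨h, z⟩
      have h3 : ofK k * (⟨h, z⟩ : G) * (ofK k)⁻¹ = ⟨k * h * k⁻¹, act k z⟩ := by
        ext1
        · exact conj_k k _
        · exact conj_z k _
      rw [h3] at h2
      rw [hk, ← h2, ← hk, tauU_conj_conjTranspose]
      simp only [mul_assoc]
      rw [Matrix.trace_mul_comm (tau n k)]
      simp only [mul_assoc]
    have h4 : tau n k * (tau n k)ᴴ = 1 := by
      rw [← tau_inv, ← tau_mul, mul_inv_cancel, tau_one]
    rw [← h1]
    simp only [mul_assoc]
    rw [h4, mul_one, ← mul_assoc, h4, one_mul]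
  refine ⟨liftM Φ hs, valM_liftM Φ hs, heq, ?_, fun a b => ?_⟩
  · have h1 : ∀ k : U2, tau n k * Φ 0 * (tau n k)ᴴ = Φ 0 := by
      intro k
      rw [← heq]
      simp [act]
    have h2 := hk 1 0
    have h3 : φ ⟨1, 0⟩ = 1 := hφ.1.map_one
    rw [tauU_one, Matrix.conjTranspose_one, one_mul, h3, mul_one] at h2
    rw [schur_of_conj h1, h2, div_self hn, one_smul]
  · obtain ⟨C1, hC1⟩ := (hsb (Matrix.single b a 1)).2
    refine ⟨C1, fun z => ?_⟩
    change ‖Φ z a b‖ ≤ C1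
    simpa only [he] using hC1 z

/-- The classification of the normalized bounded equivariant eigenfunctions. -/
lemma classification {F : SmoothMat n} (hF : Equivariant (valM F)) (h0 : valM F 0 = 1)
    (hb : ∀ a b, ∃ C : ℝ, ∀ z, ‖(F a b : C2 → ℂ) z‖ ≤ C) {ξ η : ℂ}
    (h1 : actM (normP • (1 : PolyMat n)) F = ξ • F) (h2 : actM (symbolM n) F = η • F) :
    ∃ (r : ℝ) (j : Fin (n + 1)), 0 ≤ r ∧ ξ = r ∧ η = (-(n : ℂ) + 2 * ((j : ℕ) : ℂ)) * r ∧
      (0 < r → valM F = PhiSph n j r) ∧ (r = 0 → valM F = fun _ => 1) := by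
  have hF00 : F 0 0 ≠ 0 := by
    intro h3
    have h4 := congrFun (congrFun h0 0) 0
    simp [valM, h3] at h4
  have hF0 : F ≠ 0 := fun h3 => hF00 (by rw [h3]; rfl)
  have he : ∀ a b, symb normP (F a b) = ξ • F a b := by
    intro a b
    rw [← actM_smul_one, h1]
    rfl
  obtain ⟨C, hC⟩ := hb 0 0
  obtain ⟨r, hr, rfl⟩ := eigenvalue_nonneg hC (he 0 0) hF00
  obtain ⟨j, rfl⟩ := exists_line hF0 h1 h2
  refine ⟨r, j, hr, rfl, rfl, fun hr => eq_PhiSph hF h0 hb hr h1 h2, ?_⟩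
  rintro rfl
  funext z
  rw [← h0]
  ext a b
  obtain ⟨C, hC⟩ := hb a b
  exact liouville hC (by simpa using he a b) z

lemma isBoundedEndSpherical_PhiSph (m : ℤ) (j : Fin (n + 1)) (ξ : ℝ) :
    IsBoundedEndSpherical m n (PhiSph n j ξ) := by
  have hn : (n : ℂ) + 1 ≠ 0 := by exact_mod_cast Nat.succ_ne_zero n
  have hφ := isBoundedSpherical_PhiSph m j ξ
  have hA : ∀ z, A m n (trFn m (valM (((n : ℂ) + 1)⁻¹ • PhiS n j ξ))) z =
      ((n : ℂ) + 1)⁻¹ • ((n : ℂ) + 1)⁻¹ • PhiSph n j ξ z := fun z => coeffU_trFn m _ z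
  refine ⟨_, hφ, fun g => ?_, fun z => ?_⟩
  · rw [integral_ktype hφ.1.smooth]
    simp only [hA, smul_smul, mul_inv_cancel_left₀ hn]
    rfl
  · have h1 : ((n : ℂ) + 1) ^ 2 * (((n : ℂ) + 1)⁻¹ * ((n : ℂ) + 1)⁻¹) = 1 := by field_simp
    rw [hA, smul_smul, smul_smul, mul_assoc, h1, one_smul]

lemma IsBoundedEndSpherical.exists_smoothMat {m : ℤ} {Φ : C2 → EndV n}
    (h : IsBoundedEndSpherical m n Φ) : ∃ F : SmoothMat n, valM F = Φ ∧ Equivariant Φ ∧ Φ 0 = 1 ∧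
      ∀ a b, ∃ C : ℝ, ∀ z, ‖(F a b : C2 → ℂ) z‖ ≤ C := by
  have hn : (n : ℂ) + 1 ≠ 0 := by exact_mod_cast Nat.succ_ne_zero n
  obtain ⟨φ, hφ, ht, hA⟩ := h
  refine MotionM2.exists_smoothMat hφ (m := m) ?_
  conv_lhs => rw [ht.eq_trFn hφ.1.smooth]
  congr 1
  funext z
  rw [hA, smul_smul, pow_two, inv_mul_cancel_left₀ hn]

/-- The classification of the bounded matrix-valued spherical functions. -/
lemma IsBoundedEndSpherical.classification {m : ℤ} {Φ : C2 → EndV n}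
    (h : IsBoundedEndSpherical m n Φ) {p : ℂ × ℂ} (hp : HasEigenvalues Φ p) :
    ∃ (r : ℝ) (j : Fin (n + 1)), 0 ≤ r ∧ p.1 = r ∧ p.2 = (-(n : ℂ) + 2 * ((j : ℕ) : ℂ)) * r ∧
      (0 < r → Φ = PhiSph n j r) ∧ (r = 0 → Φ = fun _ => 1) := by
  obtain ⟨F, rfl, hF, h0, hb⟩ := h.exists_smoothMat
  rw [hasEigenvalues_valM] at hp
  exact MotionM2.classification hF h0 hb hp.1 hp.2

/-- The eigenvalue `m` of `D₄` belongs to the `K`-type `τ_{-m,n}`, and `D₂` acts on the functions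
`tr(τ(k)^* Φ(z))` as `-𝐃_n`; the reflection `j ↦ n - j` compensates the sign. -/
lemma spectrumSection_subset {m : ℤ} (hmn : Even ((n : ℤ) - m)) :
    spectrumSection m n ⊆ halfLines n := by
  rintro ⟨ξ, η⟩ ⟨φ, hφ, h1, h2, h3, h4⟩
  simp only at h1 h2 h3 h4
  have hn : (n : ℂ) + 1 ≠ 0 := by exact_mod_cast Nat.succ_ne_zero n
  have hmn' : Even ((n : ℤ) - -m) := by
    have := hmn.add (even_two_mul m)
    rwa [show (n : ℤ) - m + 2 * m = n - -m by ring] at this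
  have ht := eq_trFn_of_eigen hφ.1.smooth hmn' h3 (by rw [h4]; simp)
  obtain ⟨F, hF, he, h0, hb⟩ := exists_smoothMat hφ (m := -m)
    (Φ := fun z => ((n : ℂ) + 1) • ((n : ℂ) + 1) • coeffU (-m) n (slice φ z)) (by
      conv_lhs => rw [ht]
      simp only [smul_smul, inv_mul_cancel_left₀ hn])
  have hφF : φ = trFn (-m) (valM (((n : ℂ) + 1)⁻¹ • F)) := by
    conv_lhs => rw [ht]
    congr 1
    funext z
    rw [valM_smul, hF, smul_smul, inv_mul_cancel₀ hn, one_smul]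
  have hsm : ∀ (c : ℂ) (H : SmoothMat n), c • trFn (-m) (valM H) = trFn (-m) (valM (c • H)) :=
    fun c H => (trFn_smul (-m) c (valM H)).symm
  have hinv : ((n : ℂ) + 1)⁻¹ ≠ 0 := inv_ne_zero hn
  have e1 : actM (normP • (1 : PolyMat n)) F = ξ • F := by
    rw [hφF, D1_trFn, hsm] at h1
    have h5 := valM_injective (trFn_injective _ h1)
    rw [actM_smul_right, smul_comm ξ] at h5
    exact smul_right_injective _ hinv h5
  have e2 : actM (symbolM n) F = (-η) • F := by
    rw [hφF, D2_trFn, neg_eq_iff_eq_neg, ← neg_smul, hsm] at h2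
    have h5 := valM_injective (trFn_injective _ h2)
    rw [actM_smul_right, smul_comm (-η)] at h5
    exact smul_right_injective _ hinv h5
  rw [← hF] at he
  replace h0 : valM F 0 = 1 := by rw [hF]; exact h0
  obtain ⟨r, j, hr, rfl, hη, -, -⟩ := classification he h0 hb e1 e2
  refine ⟨r, Fin.rev j, hr, Prod.ext rfl ?_⟩
  have hj : ((Fin.rev j : ℕ) : ℂ) = n - (j : ℕ) := by
    rw [Fin.val_rev, Nat.cast_sub (by omega)]
    push_cast
    ring
  simp only [hj]
  linear_combination -hη

lemma halfLines_subset {m : ℤ} (hmn : Even ((n : ℤ) - m)) :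
    halfLines n ⊆ spectrumSection m n := by
  rintro _ ⟨ξ, j, hξ, rfl⟩
  have hmn' : Even ((n : ℤ) - -m) := by
    have := hmn.add (even_two_mul m)
    rwa [show (n : ℤ) - m + 2 * m = n - -m by ring] at this
  have hj : ((Fin.rev j : ℕ) : ℂ) = n - (j : ℕ) := by
    rw [Fin.val_rev, Nat.cast_sub (by omega)]
    push_cast
    ring
  obtain ⟨h1, h2⟩ := PhiS_eigen (Fin.rev j) hξ
  have hsm : ∀ (c : ℂ) (H : SmoothMat n), c • trFn (-m) (valM H) = trFn (-m) (valM (c • H)) :=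
    fun c H => (trFn_smul (-m) c (valM H)).symm
  refine ⟨_, isBoundedSpherical_PhiSph (-m) (Fin.rev j) ξ, ?_, ?_, D3_trFn _ _, ?_⟩
  · rw [D1_trFn, hsm, actM_smul_right, h1, smul_comm]
  · rw [D2_trFn, hsm, actM_smul_right, h2, smul_comm, ← hsm, ← neg_smul, hj, hsm]
    congr 3
    simp only
    ring
  · rw [D4_trFn hmn']
    simp

end

end MotionM2

end

theorem mainTheorem6 (n : ℕ) (m : ℤ) (hmn : Even ((n : ℤ) - m)) :
    -- the embedded spectrum
    MotionM2.spectrumSection m n = MotionM2.halfLines n ∧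
    -- the pairs of eigenvalues of the bounded matrix-valued spherical functions
    {p : ℂ × ℂ | ∃ Φ : MotionM2.C2 → MotionM2.EndV n,
      MotionM2.IsBoundedEndSpherical m n Φ ∧ MotionM2.HasEigenvalues Φ p} =
        MotionM2.halfLines n ∧
    -- the case `ξ = 0`
    (MotionM2.IsBoundedEndSpherical m n (fun _ => 1) ∧
      MotionM2.HasEigenvalues (n := n) (fun _ => 1) (0, 0) ∧
      ∀ (Ψ : MotionM2.C2 → MotionM2.EndV n) (ξ₂ : ℂ),
        MotionM2.IsBoundedEndSpherical m n Ψ → MotionM2.HasEigenvalues Ψ (0, ξ₂) →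
          ξ₂ = 0 ∧ Ψ = fun _ => 1) ∧
    -- the case `ξ > 0`
    ∀ j : Fin (n + 1),
      (∀ ξ : ℝ, 0 < ξ →
        MotionM2.IsBoundedEndSpherical m n (MotionM2.PhiSph n j ξ) ∧
        MotionM2.HasEigenvalues (MotionM2.PhiSph n j ξ)
          ((ξ : ℂ), (-(n : ℂ) + 2 * ((j : ℕ) : ℂ)) * (ξ : ℂ)) ∧
        ∀ Ψ : MotionM2.C2 → MotionM2.EndV n,
          MotionM2.IsBoundedEndSpherical m n Ψ →
          MotionM2.HasEigenvalues Ψ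
            ((ξ : ℂ), (-(n : ℂ) + 2 * ((j : ℕ) : ℂ)) * (ξ : ℂ)) →
          Ψ = MotionM2.PhiSph n j ξ) ∧
      -- the expressions as derivatives of the scalar spherical functions
      (∃! P : Matrix (Fin (n + 1)) (Fin (n + 1)) MotionM2.Poly,
        MotionM2.Continues P (MotionM2.Q n (MotionM2.E n j))) ∧
      ∀ P : Matrix (Fin (n + 1)) (Fin (n + 1)) MotionM2.Poly,
        MotionM2.Continues P (MotionM2.Q n (MotionM2.E n j)) →
        ∀ ξ : ℝ, 0 < ξ → ∀ z : MotionM2.C2,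
          MotionM2.PhiSph n j ξ z =
            (((ξ : ℂ) ^ n)⁻¹ * ((n : ℂ) + 1)) •
              MotionM2.polyOpEnd P (MotionM2.phi ξ) z ∧
          MotionM2.PhiSph n j ξ z =
            ((n : ℂ) + 1) •
              MotionM2.polyOpEnd P (MotionM2.phi 1) (Real.sqrt ξ • z) := by
  refine ⟨Set.Subset.antisymm (MotionM2.spectrumSection_subset hmn)
      (MotionM2.halfLines_subset hmn), Set.Subset.antisymm ?_ ?_, ⟨?_, ?_, ?_⟩, ?_⟩
  · rintro ⟨ξ, η⟩ ⟨Φ, hΦ, hp⟩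
    obtain ⟨r, j, hr, h1, h2, -, -⟩ := hΦ.classification hp
    exact ⟨r, j, hr, Prod.ext h1 h2⟩
  · rintro p ⟨r, j, hr, rfl⟩
    exact ⟨_, MotionM2.isBoundedEndSpherical_PhiSph m j r,
      MotionM2.PhiSph_hasEigenvalues j hr⟩
  · have h := MotionM2.isBoundedEndSpherical_PhiSph m (0 : Fin (n + 1)) 0
    rwa [MotionM2.PhiSph_param_zero] at h
  · have h := MotionM2.PhiSph_hasEigenvalues (0 : Fin (n + 1)) le_rfl
    rw [MotionM2.PhiSph_param_zero] at h
    simpa using h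
  · intro Ψ ξ₂ hΨ hp
    obtain ⟨r, j, -, h1, h2, -, h0⟩ := hΨ.classification hp
    have hr : r = 0 := Complex.ofReal_injective h1.symm
    exact ⟨by simpa [hr] using h2, h0 hr⟩
  · intro j
    refine ⟨fun ξ hξ => ⟨MotionM2.isBoundedEndSpherical_PhiSph m j ξ,
      MotionM2.PhiSph_hasEigenvalues j hξ.le, fun Ψ hΨ hp => ?_⟩,
      ⟨_, MotionM2.continues_lagrangeQ j, fun P hP => MotionM2.eq_lagrangeQ hP⟩,
      fun P hP ξ hξ z => ?_⟩
    · obtain ⟨r, i, -, h1, h2, h, -⟩ := hΨ.classification hp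
      obtain rfl : ξ = r := Complex.ofReal_injective h1
      have hξ' : (ξ : ℂ) ≠ 0 := by exact_mod_cast hξ.ne'
      have hij : ((j : ℕ) : ℂ) = ((i : ℕ) : ℂ) := by
        have h3 := mul_right_cancel₀ hξ' h2
        linear_combination h3 / 2
      obtain rfl : j = i := Fin.ext (by exact_mod_cast hij)
      exact h hξ
    · rw [MotionM2.eq_lagrangeQ hP]
      exact ⟨MotionM2.PhiSph_eq_polyOpEnd j hξ z, MotionM2.PhiSph_eq_polyOpEnd_one j ξ z⟩
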